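/- Let $d\ge 2$ and, for $u\in[0,1]^{d-1}$, let $S(u)$ be the point of the unit sphere of $\mathbb R^d$ with angular coordinates $\vartheta_1=2\pi u^{(1)}$, $\vartheta_j=\pi u^{(j)}$ $(2\le j\le d-1)$, that is, $S(u)^{(k)}=\cos\vartheta_k\prod_{j<k}\sin\vartheta_j$ for $1\le k\le d-1$ and $S(u)^{(d)}=\prod_{j\le d-1}\sin\vartheta_j$. Let $Y_i=C^\star+R^\star S(U_i)+\varepsilon_i$, $i\ge1$, where $C^\star\in\mathbb R^d$, $(U_i)_{i\ge1}$ are i.i.d. with a probability density $f^\star$ on $(0,1)^{d-1}$, and $(\varepsilon_i)_{i\ge1}$ are i.i.d., independent of $(U_i)_{i\ge1}$, with law $\mathbb Q^\star=\bigotimes_{j=1}^d\mathbb Q^\star_j$, where the $\mathbb Q^\star_j$ are arbitrary probability measures on $\mathbb R$. If $d>2$, assume that $f^\star>0$ on $(0,\gamma)^{d-1}$ for some $\gamma>0$. Fix $\nu_{\mathrm{est}}>0$, $0<R_{\min}<R_{\max}<\infty$ and a compact set $\mathcal F\subset L^2((0,1)^{d-1})$ of real functions with $\int_{(0,1)^{d-1}}f=1$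 for all $f\in\mathcal F$. For $t=(t_1,t_2)\in\mathbb R\times\mathbb R^{d-1}$ put $$\Psi_{f,R}(t)=\int_{(0,1)^{d-1}}e^{iR\,t^\top S(u)}f(u)\,du,\qquad \tilde\psi_n(t)=\frac1n\sum_{\ell=1}^n e^{it^\top Y_\ell},$$ $$M_n(f,R)=\int_{[-\nu_{\mathrm{est}},\nu_{\mathrm{est}}]^d}\bigl|\Psi_{f,R}(t_1,t_2)\tilde\psi_n(t_1,0)\tilde\psi_n(0,t_2)-\tilde\psi_n(t_1,t_2)\Psi_{f,R}(t_1,0)\Psi_{f,R}(0,t_2)\bigr|^2dt_1\,dt_2.$$ For each $n\ge1$ let $(\widehat f,\widehat R)=(\widehat f_n,\widehat R_n)$ be any measurable random element of $\mathcal F\times[R_{\min},R_{\max}]$ with $M_n(\widehat f,\widehat R)\le\inf_{(f,R)\in\mathcal F\times[R_{\min},R_{\max}]}M_n(f,R)+\frac1n$, and put $\widehat C=\frac1n\sum_{i=1}^nY_i-\widehat R\int_{(0,1)^{d-1}}S(u)\widehat f(u)\,du$. Assume $f^\star\in\mathcal F$ and $R^\star\in(R_{\min},R_{\max})$. Then,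 as $n\to\infty$, $\widehat R\to R^\star$ in probability and $\int_{(0,1)^{d-1}}(\widehat f(u)-f^\star(u))^2\,du\to0$ in probability. If moreover $\mathbb Q^\star$ has a finite first moment and is centered, then also $\widehat C\to C^\star$ in probability. -/

import Mathlib

open MeasureTheory ProbabilityTheory Filter Topology Set

/- Throughout, the ambient dimension is `d = m + 1` and the angles live in dimension
`m = d - 1`. Vectors of `ℝ^d` carry the Euclidean norm; coordinates are numbered from `0`. -/

namespace SphereDeconv

noncomputable section

/-- Lebesgue measure on the open cube `(0,1)^m` of angles. -/
def cubeMeasure (m : ℕ) : Measure (Fin m → ℝ) :=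
  volume.restrict (Set.univ.pi fun _ => Ioo (0 : ℝ) 1)

/-- The `j`-th angle attached to `u`: `2 π u₀` for the first one, `π u_j` for the others. -/
def angle {m : ℕ} (u : Fin m → ℝ) (j : Fin m) : ℝ :=
  if j.val = 0 then 2 * Real.pi * u j else Real.pi * u j

/-- The parametrization of the unit sphere of `ℝ^(m+1)` by angles: the `k`-th coordinate is
`sin(angle 0) ⋯ sin(angle (k-1)) cos(angle k)`, without the cosine for the last one. -/
def sphereMap {m : ℕ} (u : Fin m → ℝ) : EuclideanSpace ℝ (Fin (m + 1)) :=
  WithLp.toLp 2 fun k =>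
    (∏ j : Fin m with j.val < k.val, Real.sin (angle u j)) *
      (if h : k.val < m then Real.cos (angle u ⟨k.val, h⟩) else 1)

/-- The law of the signal `C + R S(U)` when `U` has density `f` on the cube. -/
def signalLaw {m : ℕ} (C : EuclideanSpace ℝ (Fin (m + 1))) (R : ℝ) (f : (Fin m → ℝ) → ℝ) :
    Measure (EuclideanSpace ℝ (Fin (m + 1))) :=
  ((cubeMeasure m).withDensity fun u => ENNReal.ofReal (f u)).map fun u => C + R • sphereMap u

/-- The product law on `ℝ^(m+1)` with the given marginals: noise with independent coordinates. -/
def noiseLaw {m : ℕ} (Q : Fin (m + 1) → Measure ℝ) :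
    Measure (EuclideanSpace ℝ (Fin (m + 1))) :=
  (Measure.pi Q).map (WithLp.toLp 2)

/-- The law of one observation: an independent sum of the signal and of the noise. -/
def observationLaw {m : ℕ} (C : EuclideanSpace ℝ (Fin (m + 1))) (R : ℝ)
    (f : (Fin m → ℝ) → ℝ) (Q : Fin (m + 1) → Measure ℝ) :
    Measure (EuclideanSpace ℝ (Fin (m + 1))) :=
  (signalLaw C R f).conv (noiseLaw Q)

/-- `Ψ_{f,R}(t) = ∫ exp(i R tᵀ S(u)) f(u) du` over the cube. -/
def Psi {m : ℕ} (f : (Fin m → ℝ) → ℝ) (R : ℝ) (t : EuclideanSpace ℝ (Fin (m + 1))) : ℂ :=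
  ∫ u, Complex.exp (Complex.I * ((R * inner ℝ t (sphereMap u) : ℝ) : ℂ)) * (f u : ℂ)
    ∂(cubeMeasure m)

/-- The empirical characteristic function of the first `n` entries of the sample `y`. -/
def empCF {m : ℕ} (n : ℕ) (y : ℕ → EuclideanSpace ℝ (Fin (m + 1)))
    (t : EuclideanSpace ℝ (Fin (m + 1))) : ℂ :=
  (1 / (n : ℂ)) * ∑ l ∈ Finset.range n, Complex.exp (Complex.I * ((inner ℝ t (y l) : ℝ) : ℂ))

/-- `(t₁, t₂) ↦ (t₁, 0)`, where `t₁` is the first coordinate and `t₂` the `m` others. -/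
def fstPart {m : ℕ} (t : EuclideanSpace ℝ (Fin (m + 1))) : EuclideanSpace ℝ (Fin (m + 1)) :=
  WithLp.toLp 2 fun i => if i = 0 then t i else 0

/-- `(t₁, t₂) ↦ (0, t₂)`. -/
def sndPart {m : ℕ} (t : EuclideanSpace ℝ (Fin (m + 1))) : EuclideanSpace ℝ (Fin (m + 1)) :=
  WithLp.toLp 2 fun i => if i = 0 then 0 else t i

/-- The empirical contrast `M_n(f, R)` on `[-ν, ν]^(m+1)` computed from the sample `y`. -/
def contrast {m : ℕ} (ν : ℝ) (n : ℕ) (y : ℕ → EuclideanSpace ℝ (Fin (m + 1)))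
    (f : (Fin m → ℝ) → ℝ) (R : ℝ) : ℝ :=
  ∫ t in {t : EuclideanSpace ℝ (Fin (m + 1)) | ∀ i, t i ∈ Icc (-ν) ν},
    ‖Psi f R t * empCF n y (fstPart t) * empCF n y (sndPart t)
      - empCF n y t * Psi f R (fstPart t) * Psi f R (sndPart t)‖ ^ 2

/-- `(fhat n, Rhat n)`, `n ≥ 1`, are measurable random elements of `F × [Rmin, Rmax]` that
minimize the contrast over `F × [Rmin, Rmax]` up to `1/n`. -/
structure IsMinContrast {m : ℕ} {Ω : Type*} [MeasurableSpace Ω] (P : Measure Ω) (ν : ℝ)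
    (F : Set (Lp ℝ 2 (cubeMeasure m))) (Rmin Rmax : ℝ)
    (Y : ℕ → Ω → EuclideanSpace ℝ (Fin (m + 1)))
    (fhat : ℕ → Ω → Lp ℝ 2 (cubeMeasure m)) (Rhat : ℕ → Ω → ℝ) : Prop where
  measurable_fhat : ∀ n, 1 ≤ n → StronglyMeasurable (fhat n)
  measurable_Rhat : ∀ n, 1 ≤ n → Measurable (Rhat n)
  fhat_mem : ∀ n, 1 ≤ n → ∀ᵐ ω ∂P, fhat n ω ∈ F
  Rhat_mem : ∀ n, 1 ≤ n → ∀ᵐ ω ∂P, Rhat n ω ∈ Icc Rmin Rmax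
  near_min : ∀ n, 1 ≤ n → ∀ᵐ ω ∂P,
    contrast ν n (fun l => Y l ω) (fhat n ω) (Rhat n ω) ≤
      sInf ((fun θ : Lp ℝ 2 (cubeMeasure m) × ℝ =>
        contrast ν n (fun l => Y l ω) θ.1 θ.2) '' (F ×ˢ Icc Rmin Rmax)) + 1 / (n : ℝ)

/-- The estimator of the center:
`Ĉ = n⁻¹ ∑ Y_i - R̂ ∫ S(u) f̂(u) du`. -/
def centerEst {m : ℕ} {Ω : Type*} (Y : ℕ → Ω → EuclideanSpace ℝ (Fin (m + 1)))
    (fhat : ℕ → Ω → Lp ℝ 2 (cubeMeasure m)) (Rhat : ℕ → Ω → ℝ) (n : ℕ) (ω : Ω) :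
    EuclideanSpace ℝ (Fin (m + 1)) :=
  (1 / (n : ℝ)) • ∑ l ∈ Finset.range n, Y l ω
    - Rhat n ω • ∫ u, fhat n ω u • sphereMap u ∂(cubeMeasure m)

end

end SphereDeconv

/-! Consistency reduces to identifiability. The characteristic function of an observation is `N(t)
Ψ(t)`, where `N` comes from the noise and the centre and `Ψ` belongs to the true pair. Since the
noise has independent coordinates, `N(t₁, t₂) = N(t₁, 0) N(0, t₂)`, so `N` factors out of the
integrand of the limit contrast (`discrepancy_observationLaw`) and is nonzero near `0`. The strong
law in the space of continuous functions on the box makes the empirical characteristic functions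
converge uniformly, the contrast is Lipschitz in them uniformly over `F`, and compactness does the
rest, provided that the limit contrast vanishes at the true pair only (`eq_of_contrastOf_eq_zero`).

If the limit contrast vanishes at `(f, R)`, analytic continuation gives, for the real Laplace
transforms `A` of `f` on the sphere of radius `R` and `B` of the true density `g` on the sphere of
radius `r`, the identity `A(t) B(t₁, 0) B(0, t₂) = B(t) A(t₁, 0) A(0, t₂)`. Three ideas turn it into
`R = r` and `f = g`.

Zeros (`exists_affine_mul_exp_ratio`). As a function of complex `t₁ = z`, the ratio of `A` to `B` is
an entire function `q(z)` times a function of `t₂`. A zero of `q` is a zero of `A(·, t₂)` for every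
`t₂`. On the sphere, `X₂` determines `X₀` up to sign, so two such zeros, or a double one, would give
two independent linear relations between the masses at the two points over the same `X₂`, and `f`
would vanish. Hence `q` has at most one zero, which is real and simple, and being of exponential
type `q(z) = (1 - κ z) exp(b z)`.

Growth (`eq_zero_of_expGrowth`, `exists_support_point`). By Phragmén–Lindelöf, the exponential
growth of a Laplace transform in a direction tells how far the support reaches in that direction. In
the plane the first idea applies to both axes, so `A / B` is a product of two affine factors and one
exponential `exp⟨β, t⟩`; the support of `g` translated by `β` lies on the circle of radius `R`,
which forces `β = 0` and `R = r`. In higher dimension a factor `G(t₂)` stays unknown. On an open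
cone of directions charged by `g` its growth rate is an upper semicontinuous function; testing it by
paraboloids touching from above gives again `b = 0` and `R = r` (`touching_point`,
`radius_eq_of_open`).

Helmholtz equation (`trLaplacian_ratio`). On spheres of equal radius `A` and `B` both solve `Δu = r²
u`, which yields a first order relation on their ratio. In the plane it excludes `κ` and `κ'`
directly (`eq_of_product_ratio`). In higher dimension one lets `t₁ → ∞`: the weights concentrate at
the pole `(r, 0)`, and the tilted moments of order one and two give in the limit a transport
equation `dG(y)(a + T y) + r c G(y) = 0` with `T` symmetric nonnegative and `c ≥ 0`. As `G` grows
subexponentially, this forces `G = 1`, then `κ = 0` (`constDirections_eq_top`,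
`laplace_eq_of_ratio`). Laplace transforms determine densities because the angular coordinates are
injective off a null set. -/

namespace SphereDeconv

set_option linter.unusedSectionVars false

/-! ### Entire functions of exponential type -/

/-- Jensen's inequality for the logarithm of the modulus of an entire function. -/
theorem log_norm_le_circleAverage {F : ℂ → ℂ} (hF : Differentiable ℂ F) (h0 : F 0 ≠ 0) {r : ℝ}
    (hr : 0 < r) : Real.log ‖F 0‖ ≤ Real.circleAverage (fun z => Real.log ‖F z‖) 0 r := by
  have hA : AnalyticOnNhd ℂ F (Metric.closedBall 0 |r|) := fun x _ => hF.analyticAt x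
  rw [hA.circleAverage_log_norm hr.ne' h0]
  -- Jensen's formula adds to `log ‖F 0‖` one term per zero `u` of the disc, its multiplicity times
  -- `log (r / ‖u‖) ≥ 0`.
  refine le_add_of_nonneg_left (finsum_nonneg fun u => ?_)
  by_cases hu : u ∈ Metric.closedBall (0 : ℂ) |r|
  · refine mul_nonneg (mod_cast MeromorphicOn.AnalyticOnNhd.divisor_nonneg hA u) ?_
    by_cases hu0 : u = 0
    · simp [hu0]
    · apply Real.log_nonneg
      rw [zero_sub, norm_neg, ← div_eq_mul_inv, one_le_div (norm_pos_iff.2 hu0)]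
      simpa [abs_of_pos hr] using hu
  · rw [Function.locallyFinsuppWithin.apply_eq_zero_of_notMem _ hu]
    simp

theorem circleIntegrable_log_norm_of_entire {F : ℂ → ℂ} (hF : Differentiable ℂ F) (r : ℝ) :
    CircleIntegrable (fun z => Real.log ‖F z‖) 0 r :=
  MeromorphicOn.circleIntegrable_log_norm fun x _ => (hF.analyticAt x).meromorphicAt

/-- If `x ≤ M` and `0 ≤ M` then `|x| ≤ 2 M - x`. Averaging this with `x = log ‖F‖`, Jensen's
inequality bounds the last term. -/
theorem circleAverage_abs_log_norm_le {F : ℂ → ℂ} (hF : Differentiable ℂ F) (h0 : F 0 ≠ 0)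
    {r M : ℝ} (hr : 0 < r) (hM : 0 ≤ M) (hFM : ∀ z, ‖z‖ = r → ‖F z‖ ≤ Real.exp M) :
    Real.circleAverage (fun z => |Real.log ‖F z‖|) 0 r ≤ 2 * M - Real.log ‖F 0‖ := by
  have hI := circleIntegrable_log_norm_of_entire hF r
  have h1 : Real.circleAverage (fun z => |Real.log ‖F z‖|) 0 r ≤
      Real.circleAverage (fun z => 2 * M - Real.log ‖F z‖) 0 r := by
    refine Real.circleAverage_mono hI.abs ((circleIntegrable_const _ _ _).sub hI) fun z hz => ?_
    have hz' : ‖z‖ = r := by simpa [abs_of_pos hr] using hz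
    have : Real.log ‖F z‖ ≤ M := by
      rcases eq_or_ne (F z) 0 with h | h
      · simpa [h] using hM
      · rw [Real.log_le_iff_le_exp (norm_pos_iff.2 h)]
        exact hFM z hz'
    rw [abs_le]
    constructor <;> linarith
  rw [Real.circleAverage_fun_sub (circleIntegrable_const _ _ _) hI,
    Real.circleAverage_const] at h1
  linarith [log_norm_le_circleAverage hF h0 hr]

/-- A zero-free entire function is the exponential of an entire function. -/
theorem exists_entire_log {g : ℂ → ℂ} (hg : Differentiable ℂ g) (h0 : ∀ z, g z ≠ 0) :
    ∃ h : ℂ → ℂ, Differentiable ℂ h ∧ ∀ z, g z = Complex.exp (h z) := by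
  -- A primitive `h` of `g' / g` makes `g exp(-h)` constant.
  have hq : Differentiable ℂ fun z => deriv g z / g z :=
    (hg.contDiff (n := 2)|>.differentiable_deriv_two).div hg h0
  obtain ⟨h, hh0, hh⟩ := hq.isExactOn_univ.with_val_at 0 (Complex.log (g 0))
  have hd : Differentiable ℂ h := fun z => (hh z (mem_univ z)).differentiableAt
  refine ⟨h, hd, fun z => ?_⟩
  have hc : ∀ z, HasDerivAt (fun z => g z * Complex.exp (-h z)) 0 z := fun z => by
    refine ((hg z).hasDerivAt.mul ((hh z (mem_univ z)).fun_neg.cexp)).congr_deriv ?_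
    have := h0 z
    field_simp
    ring
  have := is_const_of_deriv_eq_zero (fun z => (hc z).differentiableAt) (fun z => (hc z).deriv) z 0
  simp only [hh0, Complex.exp_neg, Complex.exp_log (h0 0), mul_inv_cancel₀ (h0 0)] at this
  exact (mul_inv_eq_one₀ (Complex.exp_ne_zero _)).1 this

/-- An entire function whose real part has circle averages of linear growth is affine. -/
theorem affine_of_circleAverage_abs_re_le {h : ℂ → ℂ} (hh : Differentiable ℂ h) {C : ℝ}
    (hC : 0 ≤ C)
    (hav : ∀ r, 0 < r → Real.circleAverage (fun z => |(h z).re|) 0 r ≤ C * (1 + r)) :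
    ∃ b : ℂ, ∀ z, h z = h 0 + b * z := by
  -- Poisson formula on the circle of radius `2 r`: for `‖w‖ < r` the kernel lies between `0` and
  -- `3`.
  have hre : ∀ r, 0 < r → ∀ w, ‖w‖ < r → (h w).re ≤ 3 * (C * (1 + 2 * r)) := by
    intro r hr w hw
    have h2r : 0 < 2 * r := by linarith
    have hwb : w ∈ Metric.ball (0 : ℂ) (2 * r) := by
      rw [mem_ball_zero_iff]; linarith
    have hP := (hh.diffContOnCl (s := Metric.ball (0:ℂ) (2 * r))
      ).circleAverage_re_herglotzRieszKernel_smul' hwb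
    have hci : ∀ {E : Type} [NormedAddCommGroup E] (f : ℂ → E),
        ContinuousOn f (Metric.sphere 0 (2 * r)) → CircleIntegrable f 0 (2 * r) :=
      fun f hf => hf.circleIntegrable h2r.le
    have hden : ∀ z ∈ Metric.sphere (0 : ℂ) (2 * r), z - 0 - (w - 0) ≠ 0 := by
      intro z hz h0
      rw [sub_zero, sub_zero, sub_eq_zero] at h0
      rw [mem_sphere_zero_iff_norm, h0] at hz
      linarith
    have hcont : ContinuousOn (fun z : ℂ => ((z - 0 + (w - 0)) / (z - 0 - (w - 0))).re)
        (Metric.sphere 0 (2 * r)) :=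
      Complex.continuous_re.comp_continuousOn
        (ContinuousOn.div (by fun_prop) (by fun_prop) hden)
    have hP' := congrArg Complex.re hP
    have hcomm := Complex.reCLM.circleAverage_comp_comm
      (hci _ (hcont.smul hh.continuous.continuousOn))
    rw [← Complex.reCLM_apply] at hP'
    have hP' := hcomm.trans hP'
    have hP2 : Real.circleAverage (fun z => ((z - 0 + (w - 0)) / (z - 0 - (w - 0))).re * (h z).re)
        0 (2 * r) = (h w).re := by
      rw [← hP']
      congr 1
      ext z
      simp
    rw [← hP2]
    have hrec : ContinuousOn (fun z => (h z).re) (Metric.sphere 0 (2 * r)) :=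
      (Complex.continuous_re.comp hh.continuous).continuousOn
    calc _ ≤ Real.circleAverage (fun z => 3 * |(h z).re|) 0 (2 * r) := by
          refine Real.circleAverage_mono (hci _ (hcont.mul hrec))
            (hci _ (hrec.abs.const_smul (3 : ℝ))) fun z hz => ?_
          rw [abs_of_pos h2r] at hz
          have k1 := re_herglotzRieszKernel_le hz hwb
          have k2 := le_re_herglotzRieszKernel hz hwb
          have k3 : (2 * r + ‖w - 0‖) / (2 * r - ‖w - 0‖) ≤ 3 := by
            rw [sub_zero, div_le_iff₀ (by linarith)]; linarith
          have k4 : 0 ≤ (2 * r - ‖w - 0‖) / (2 * r + ‖w - 0‖) := by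
            rw [sub_zero]; apply div_nonneg <;> linarith [norm_nonneg w]
          calc _ ≤ |((z - 0 + (w - 0)) / (z - 0 - (w - 0))).re * (h z).re| := le_abs_self _
            _ = ((z - 0 + (w - 0)) / (z - 0 - (w - 0))).re * |(h z).re| := by
              rw [abs_mul, abs_of_nonneg (k4.trans k2)]
            _ ≤ _ := by gcongr; exact k1.trans k3
      _ = 3 * Real.circleAverage (fun z => |(h z).re|) 0 (2 * r) := by
          simpa using Real.circleAverage_fun_smul (a := (3 : ℝ)) (f := fun z => |(h z).re|)
            (c := 0) (R := 2 * r)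
      _ ≤ _ := by gcongr; exact hav _ h2r
  -- Borel–Carathéodory turns the one-sided bound on the real part into linear growth of `h`;
  -- Cauchy's estimate then bounds `deriv h`, which is constant by Liouville.
  have hnorm : ∀ r, 1 ≤ r → ∀ w, ‖w‖ ≤ r → ‖h w‖ ≤ (30 * C + 2 + 3 * ‖h 0‖) * r := by
    intro r hr w hw
    have h2r : 0 < 2 * r := by linarith
    have hM : 0 < 3 * (C * (1 + 2 * (2 * r))) + 1 := by positivity
    have hwb : w ∈ Metric.ball (0 : ℂ) (2 * r) := by
      rw [mem_ball_zero_iff]; linarith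
    have hBC := Complex.borelCaratheodory hM hh.differentiableOn (R := 2 * r)
      (fun z hz => by
        have := hre (2 * r) h2r z (by simpa using hz)
        simp only [Set.mem_ofPred_eq]; linarith) h2r hwb
    have hd : r ≤ 2 * r - ‖w‖ := by linarith
    have hd' : 0 < 2 * r - ‖w‖ := by linarith
    have e1 : 2 * (3 * (C * (1 + 2 * (2 * r))) + 1) * ‖w‖ / (2 * r - ‖w‖) ≤
        2 * (3 * (C * (1 + 2 * (2 * r))) + 1) := by
      rw [div_le_iff₀ hd']
      gcongr; linarith
    have e2 : ‖h 0‖ * (2 * r + ‖w‖) / (2 * r - ‖w‖) ≤ 3 * ‖h 0‖ := by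
      rw [div_le_iff₀ hd']
      nlinarith [norm_nonneg (h 0)]
    nlinarith [norm_nonneg (h 0)]
  have hb : Bornology.IsBounded (range (deriv h)) := by
    set D := 30 * C + 2 + 3 * ‖h 0‖ with hD
    have hD0 : 0 ≤ D := by positivity
    refine isBounded_iff_forall_norm_le.2 ⟨2 * D, ?_⟩
    rintro _ ⟨z, rfl⟩
    have key : ∀ r, 1 + ‖z‖ ≤ r → ‖deriv h z‖ ≤ D * (r + ‖z‖) / r := by
      intro r hr
      have hr0 : 0 < r := by linarith [norm_nonneg z]
      refine Complex.norm_deriv_le_of_forall_mem_sphere_norm_le hr0 hh.diffContOnCl fun w hw => ?_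
      refine hnorm _ (by linarith [norm_nonneg z]) w ?_
      have : ‖w‖ ≤ ‖w - z‖ + ‖z‖ := by simpa using norm_add_le (w - z) z
      rw [mem_sphere_iff_norm] at hw
      linarith
    have := key (1 + ‖z‖) le_rfl
    have h3 : D * (1 + ‖z‖ + ‖z‖) / (1 + ‖z‖) ≤ 2 * D := by
      rw [div_le_iff₀ (by positivity)]
      nlinarith [norm_nonneg z]
    linarith
  have hconst := (hh.contDiff (n := 2)|>.differentiable_deriv_two).apply_eq_apply_of_bounded hb
  refine ⟨deriv h 0, fun z => ?_⟩
  have hc : ∀ z, HasDerivAt (fun z => h z - deriv h 0 * z) 0 z := fun z => by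
    have := (hh z).hasDerivAt.sub ((hasDerivAt_id z).const_mul (deriv h 0))
    rw [mul_one, hconst z 0, sub_self] at this
    exact this
  have := is_const_of_deriv_eq_zero (fun z => (hc z).differentiableAt) (fun z => (hc z).deriv) z 0
  simp only [mul_zero, sub_zero] at this
  rw [← this]; ring

/-- A zero-free entire quotient of functions of exponential type is an exponential. -/
theorem eq_exp_of_mul_eq_of_exponential_type {F g H : ℂ → ℂ} (hF : Differentiable ℂ F)
    (hg : Differentiable ℂ g) (hH : Differentiable ℂ H) (hFg : ∀ z, F z = g z * H z)
    (hg0 : ∀ z, g z ≠ 0) (hH0 : H 0 ≠ 0) {C : ℝ} (hC : 0 ≤ C)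
    (hFC : ∀ z, ‖F z‖ ≤ Real.exp (C * (1 + ‖z‖))) (hHC : ∀ z, ‖H z‖ ≤ Real.exp (C * (1 + ‖z‖))) :
    ∃ b : ℂ, ∀ z, g z = g 0 * Complex.exp (b * z) := by
  obtain ⟨h, hh, hgh⟩ := exists_entire_log hg hg0
  have hF0 : F 0 ≠ 0 := by rw [hFg]; exact mul_ne_zero (hg0 0) hH0
  obtain ⟨b, hb⟩ := affine_of_circleAverage_abs_re_le hh
    (C := 4 * C + |Real.log ‖F 0‖| + |Real.log ‖H 0‖|) (by positivity) fun r hr => by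
    have hIF := circleIntegrable_log_norm_of_entire hF r
    have hIH := circleIntegrable_log_norm_of_entire hH r
    -- On the circle `Re h = log ‖g‖ = log ‖F‖ - log ‖H‖` off the zeros of `H`, which the average
    -- does not see. Both logarithms have averages of linear growth, so `h` is affine.
    have e : Real.circleAverage (fun z => |(h z).re|) 0 r =
        Real.circleAverage (fun z => |Real.log ‖F z‖ - Real.log ‖H z‖|) 0 r := by
      refine Real.circleAverage_congr_codiscreteWithin ?_ hr.ne'
      have hHz : ∀ᶠ z in codiscreteWithin (Metric.sphere (0:ℂ) |r|), H z ≠ 0 := by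
        have := AnalyticOnNhd.preimage_zero_mem_codiscrete (f := H) (x := 0)
          (fun z _ => hH.analyticAt z) hH0
        have := codiscreteWithin_mono (subset_univ (Metric.sphere (0:ℂ) |r|)) this
        filter_upwards [this] with z hz
        simpa using hz
      filter_upwards [hHz] with z hz
      rw [hFg, norm_mul, Real.log_mul (norm_ne_zero_iff.2 (hg0 z)) (norm_ne_zero_iff.2 hz),
        add_sub_cancel_right, hgh, Complex.norm_exp, Real.log_exp]
    rw [e]
    have hM : 0 ≤ C * (1 + r) := by positivity
    calc _ ≤ Real.circleAverage (fun z => |Real.log ‖F z‖| + |Real.log ‖H z‖|) 0 r :=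
          Real.circleAverage_mono (hIF.sub hIH).abs (hIF.abs.add hIH.abs) fun z _ => abs_sub _ _
      _ = _ := Real.circleAverage_fun_add hIF.abs hIH.abs
      _ ≤ (2 * (C * (1 + r)) - Real.log ‖F 0‖) + (2 * (C * (1 + r)) - Real.log ‖H 0‖) :=
          add_le_add
            (circleAverage_abs_log_norm_le hF hF0 hr hM fun z hz => by simpa [hz] using hFC z)
            (circleAverage_abs_log_norm_le hH hH0 hr hM fun z hz => by simpa [hz] using hHC z)
      _ ≤ _ := by
          have a1 := neg_abs_le (Real.log ‖F 0‖)
          have a2 := neg_abs_le (Real.log ‖H 0‖)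
          have a3 : 0 ≤ (|Real.log ‖F 0‖| + |Real.log ‖H 0‖|) * r := by positivity
          nlinarith
  exact ⟨b, fun z => by rw [hgh, hb, Complex.exp_add, ← hgh]⟩

theorem eq_zero_of_entire_of_eventually_real {f : ℂ → ℂ} (hf : Differentiable ℂ f)
    (h0 : ∀ᶠ x : ℝ in 𝓝 0, f x = 0) (z : ℂ) : f z = 0 := by
  have hA : AnalyticOnNhd ℂ f univ := fun z _ => hf.analyticAt z
  have hr : Tendsto (fun n : ℕ => ((n : ℝ) + 1)⁻¹) atTop (𝓝 0) := by
    simpa [one_div] using tendsto_one_div_add_atTop_nhds_zero_nat (𝕜 := ℝ)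
  have hfr : ∃ᶠ w in 𝓝[≠] (0 : ℂ), f w = 0 := by
    have ht : Tendsto (fun n : ℕ => ((((n : ℝ) + 1)⁻¹ : ℝ) : ℂ)) atTop (𝓝[≠] 0) := by
      refine tendsto_nhdsWithin_iff.2 ⟨?_, Eventually.of_forall fun n => ?_⟩
      · rw [← Complex.ofReal_zero]
        exact (Complex.continuous_ofReal.tendsto 0).comp hr
      · simp only [mem_compl_iff, mem_singleton_iff, Complex.ofReal_eq_zero]
        positivity
    exact ht.frequently (hr.eventually h0).frequently
  exact hA.eqOn_zero_of_preconnected_of_frequently_eq_zero isPreconnected_univ (mem_univ 0) hfr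
    (mem_univ z)

theorem eq_zero_of_entire_of_real {f : ℂ → ℂ} (hf : Differentiable ℂ f) (h0 : ∀ x : ℝ, f x = 0)
    (z : ℂ) : f z = 0 :=
  eq_zero_of_entire_of_eventually_real hf (Eventually.of_forall h0) z

theorem eq_zero_or_eq_zero_of_entire_mul {f g : ℂ → ℂ} (hf : Differentiable ℂ f)
    (hg : Differentiable ℂ g) (h : ∀ z, f z * g z = 0) : (∀ z, f z = 0) ∨ ∀ z, g z = 0 := by
  have := AnalyticOnNhd.eq_zero_or_eq_zero_of_mul_eq_zero (U := univ)
    (fun z _ => hf.analyticAt z) (fun z _ => hg.analyticAt z) (fun z _ => h z) isPreconnected_univ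
  simpa using this

/-! ### Laplace transforms: holomorphy and uniqueness -/

section Laplace

variable {U : Type*} [MeasurableSpace U] {μ : Measure U}

/-- The Laplace transform `z ↦ ∫ w exp(z A)`. -/
noncomputable def laplaceC (μ : Measure U) (w A : U → ℂ) (z : ℂ) : ℂ :=
  ∫ u, w u * Complex.exp (z * A u) ∂μ

theorem norm_exp_mul_le {A : ℂ} {B : ℝ} (hA : ‖A‖ ≤ B) (z : ℂ) :
    ‖Complex.exp (z * A)‖ ≤ Real.exp (B * ‖z‖) := by
  rw [Complex.norm_exp]
  refine Real.exp_le_exp.2 ((Complex.re_le_norm _).trans ?_)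
  rw [norm_mul, mul_comm]
  gcongr

theorem integrable_mul_exp {w A : U → ℂ} (hw : Integrable w μ) (hA : AEStronglyMeasurable A μ)
    {B : ℝ} (hB : ∀ u, ‖A u‖ ≤ B) (z : ℂ) :
    Integrable (fun u => w u * Complex.exp (z * A u)) μ :=
  hw.mul_bdd (c := Real.exp (B * ‖z‖))
    (Complex.continuous_exp.comp_aestronglyMeasurable (hA.const_mul z))
    (Eventually.of_forall fun u => norm_exp_mul_le (hB u) z)

theorem norm_laplaceC_le {w A : U → ℂ} (hw : Integrable w μ) {B : ℝ} (hB : ∀ u, ‖A u‖ ≤ B)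
    (z : ℂ) : ‖laplaceC μ w A z‖ ≤ (∫ u, ‖w u‖ ∂μ) * Real.exp (B * ‖z‖) := by
  rw [laplaceC, ← integral_mul_const]
  refine norm_integral_le_of_norm_le (hw.norm.mul_const _) (Eventually.of_forall fun u => ?_)
  rw [norm_mul]
  gcongr
  exact norm_exp_mul_le (hB u) z

theorem hasDerivAt_laplaceC {w A : U → ℂ} (hw : Integrable w μ) (hA : AEStronglyMeasurable A μ)
    {B : ℝ} (hB : ∀ u, ‖A u‖ ≤ B) (z : ℂ) :
    HasDerivAt (laplaceC μ w A) (laplaceC μ (fun u => w u * A u) A z) z := by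
  refine (hasDerivAt_integral_of_dominated_loc_of_deriv_le (Metric.ball_mem_nhds z one_pos)
    (F := fun z u => w u * Complex.exp (z * A u))
    (F' := fun z u => w u * A u * Complex.exp (z * A u))
    (bound := fun u => ‖w u‖ * (B * Real.exp (B * (‖z‖ + 1))))
    (Eventually.of_forall fun z => (integrable_mul_exp hw hA hB z).aestronglyMeasurable)
    (integrable_mul_exp hw hA hB z)
    (integrable_mul_exp (hw.mul_bdd hA (Eventually.of_forall hB)) hA hB z).aestronglyMeasurable
    (Eventually.of_forall fun u x hx => ?_) (hw.norm.mul_const _)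
    (Eventually.of_forall fun u x _ => ?_)).2
  · rw [norm_mul, norm_mul, mul_assoc]
    have hB0 : 0 ≤ B := (norm_nonneg _).trans (hB u)
    have hx' : ‖x‖ ≤ ‖z‖ + 1 := by
      have : ‖x‖ ≤ ‖x - z‖ + ‖z‖ := by simpa using norm_add_le (x - z) z
      rw [mem_ball_iff_norm] at hx
      linarith
    gcongr
    · exact hB u
    · exact (norm_exp_mul_le (hB u) x).trans (by gcongr)
  · refine ((((hasDerivAt_id x).mul_const (A u)).cexp).const_mul (w u)).congr_deriv ?_
    simp only [id]
    ring

theorem differentiable_laplaceC {w A : U → ℂ} (hw : Integrable w μ)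
    (hA : AEStronglyMeasurable A μ) {B : ℝ} (hB : ∀ u, ‖A u‖ ≤ B) :
    Differentiable ℂ (laplaceC μ w A) := fun z => (hasDerivAt_laplaceC hw hA hB z).differentiableAt

variable {E : Type*} [NormedAddCommGroup E] [InnerProductSpace ℝ E] [FiniteDimensional ℝ E]
  [MeasurableSpace E] [BorelSpace E]

/-- The images under `Y` of the positive and of the negative part of `w` are finite measures with
the same characteristic function, so they coincide. -/
theorem integral_mul_comp_eq_zero_of_real {w : U → ℝ} (hw : Integrable w μ)
    {Y : U → E} (hY : Measurable Y)
    (h : ∀ y : E, ∫ u, (w u : ℂ) * Complex.exp ((inner ℝ y (Y u) : ℝ) * Complex.I) ∂μ = 0)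
    {k : E → ℂ} (hk : Measurable k) {B : ℝ} (hkB : ∀ x, ‖k x‖ ≤ B) :
    ∫ u, (w u : ℂ) * k (Y u) ∂μ = 0 := by
  have hp : AEMeasurable (fun u => ENNReal.ofReal (w u)) μ := hw.aemeasurable.ennreal_ofReal
  have hn : AEMeasurable (fun u => ENNReal.ofReal (-w u)) μ := hw.aemeasurable.neg.ennreal_ofReal
  have hfp : IsFiniteMeasure (μ.withDensity fun u => ENNReal.ofReal (w u)) :=
    isFiniteMeasure_withDensity_ofReal hw.2
  have hfn : IsFiniteMeasure (μ.withDensity fun u => ENNReal.ofReal (-w u)) :=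
    isFiniteMeasure_withDensity_ofReal hw.neg.2
  have key : ∀ g : E → ℂ, Measurable g → ∀ C, (∀ x, ‖g x‖ ≤ C) →
      ∫ x, g x ∂((μ.withDensity fun u => ENNReal.ofReal (w u)).map Y) -
        ∫ x, g x ∂((μ.withDensity fun u => ENNReal.ofReal (-w u)).map Y) =
      ∫ u, (w u : ℂ) * g (Y u) ∂μ := by
    intro g hg C hC
    have hgY : AEStronglyMeasurable (fun u => g (Y u)) μ := (hg.comp hY).aestronglyMeasurable
    have hi : ∀ v : U → ℝ, Integrable v μ →
        Integrable (fun u => (ENNReal.ofReal (v u)).toReal • g (Y u)) μ := by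
      intro v hv
      have h1 : Integrable (fun u => (((ENNReal.ofReal (v u)).toReal : ℝ) : ℂ)) μ := by
        simp only [ENNReal.toReal_ofReal']
        exact hv.pos_part.ofReal (𝕜 := ℂ)
      simpa only [Complex.real_smul] using
        h1.mul_bdd hgY (Eventually.of_forall fun u => hC (Y u))
    rw [integral_map hY.aemeasurable hg.aestronglyMeasurable,
      integral_map hY.aemeasurable hg.aestronglyMeasurable,
      integral_withDensity_eq_integral_toReal_smul₀ hp (by simp),
      integral_withDensity_eq_integral_toReal_smul₀ hn (by simp),
      ← integral_sub (hi _ hw) (hi (fun u => -w u) hw.neg)]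
    refine integral_congr_ae (Eventually.of_forall fun u => ?_)
    simp only [ENNReal.toReal_ofReal']
    rw [← sub_smul, max_zero_sub_max_neg_zero_eq_self,
      Complex.real_smul]
  have hμ : (μ.withDensity fun u => ENNReal.ofReal (w u)).map Y =
      (μ.withDensity fun u => ENNReal.ofReal (-w u)).map Y := by
    refine Measure.ext_of_charFun (funext fun y => ?_)
    rw [charFun_apply, charFun_apply, ← sub_eq_zero,
      key (fun x => Complex.exp ((inner ℝ x y : ℝ) * Complex.I)) (by fun_prop) 1
        (fun x => (Complex.norm_exp_ofReal_mul_I _).le)]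
    simpa only [real_inner_comm] using h y
  rw [← key k hk B hkB, hμ, sub_self]

/-- Uniqueness of Laplace transforms of (complex) finite measures of bounded support. -/
theorem integral_mul_comp_eq_zero {w : U → ℂ} (hw : Integrable w μ)
    {Y : U → E} (hY : Measurable Y) {R : ℝ} (hR : ∀ u, ‖Y u‖ ≤ R)
    (h : ∀ y : E, ∫ u, w u * (Real.exp (inner ℝ y (Y u)) : ℂ) ∂μ = 0)
    {k : E → ℂ} (hk : Measurable k) {B : ℝ} (hkB : ∀ x, ‖k x‖ ≤ B) :
    ∫ u, w u * k (Y u) ∂μ = 0 := by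
  -- Along each line the transform is entire and vanishes on the real axis, so it vanishes at `I`:
  -- the Fourier transform is zero.
  have hI : ∀ y : E, ∫ u, w u * Complex.exp ((inner ℝ y (Y u) : ℝ) * Complex.I) ∂μ = 0 := by
    intro y
    have hm : Measurable fun u => ((inner ℝ y (Y u) : ℝ) : ℂ) := by fun_prop
    have hd := differentiable_laplaceC hw hm.aestronglyMeasurable (B := ‖y‖ * R) fun u => by
      rw [Complex.norm_real]
      exact (norm_inner_le_norm _ _).trans (by gcongr; exact hR u)
    have := eq_zero_of_entire_of_real hd (fun x => by
      rw [laplaceC, ← h (x • y)]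
      refine integral_congr_ae (Eventually.of_forall fun u => ?_)
      simp only [inner_smul_left, Complex.ofReal_exp, Complex.ofReal_mul]
      simp) Complex.I
    rw [laplaceC] at this
    simpa only [mul_comm Complex.I] using this
  -- The same holds for the conjugate weight, hence separately for the real and imaginary parts.
  have hw' : ∀ y : E, ∫ u, (starRingEnd ℂ) (w u) *
      Complex.exp ((inner ℝ y (Y u) : ℝ) * Complex.I) ∂μ = 0 := by
    intro y
    have := congrArg (starRingEnd ℂ) (hI (-y))
    rw [← integral_conj, map_zero] at this
    rw [← this]
    refine integral_congr_ae (Eventually.of_forall fun u => ?_)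
    simp [← Complex.exp_conj]
  have hcb : ∀ y : E, Integrable (fun u => w u *
      Complex.exp ((inner ℝ y (Y u) : ℝ) * Complex.I)) μ := fun y =>
    hw.mul_bdd (c := 1) (by fun_prop)
      (Eventually.of_forall fun u => (Complex.norm_exp_ofReal_mul_I _).le)
  have hwc : Integrable (fun u => (starRingEnd ℂ) (w u)) μ :=
    (Complex.conjLIE.toContinuousLinearEquiv.toContinuousLinearMap.integrable_comp hw)
  have hcb' : ∀ y : E, Integrable (fun u => (starRingEnd ℂ) (w u) *
      Complex.exp ((inner ℝ y (Y u) : ℝ) * Complex.I)) μ := fun y =>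
    hwc.mul_bdd (c := 1) (by fun_prop)
      (Eventually.of_forall fun u => (Complex.norm_exp_ofReal_mul_I _).le)
  have hre := integral_mul_comp_eq_zero_of_real (μ := μ) hw.re hY (fun y => by
    have h2 : (2 : ℂ) * ∫ u, ((RCLike.re (w u) : ℝ) : ℂ) *
        Complex.exp ((inner ℝ y (Y u) : ℝ) * Complex.I) ∂μ = 0 := by
      rw [← integral_const_mul, ← add_zero (0 : ℂ)]
      nth_rw 1 [← hI y]
      rw [← hw' y, ← integral_add (hcb y) (hcb' y)]
      refine integral_congr_ae (Eventually.of_forall fun u => ?_)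
      simp only [RCLike.re_eq_complex_re, Complex.re_eq_add_conj]
      ring
    simpa using h2) hk hkB
  have him := integral_mul_comp_eq_zero_of_real (μ := μ) hw.im hY (fun y => by
    have h2 : (2 * Complex.I : ℂ) * ∫ u, ((RCLike.im (w u) : ℝ) : ℂ) *
        Complex.exp ((inner ℝ y (Y u) : ℝ) * Complex.I) ∂μ = 0 := by
      rw [← integral_const_mul, ← sub_zero (0 : ℂ)]
      nth_rw 1 [← hI y]
      rw [← hw' y, ← integral_sub (hcb y) (hcb' y)]
      refine integral_congr_ae (Eventually.of_forall fun u => ?_)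
      simp only [RCLike.im_eq_complex_im, Complex.im_eq_sub_conj]
      field_simp
      try ring
    simpa using h2) hk hkB
  have hkY : AEStronglyMeasurable (fun u => k (Y u)) μ := (hk.comp hY).aestronglyMeasurable
  have e : ∀ u, w u * k (Y u) = ((RCLike.re (w u) : ℝ) : ℂ) * k (Y u) +
      Complex.I * (((RCLike.im (w u) : ℝ) : ℂ) * k (Y u)) := by
    intro u
    nth_rw 1 [← Complex.re_add_im (w u)]
    simp only [RCLike.re_eq_complex_re, RCLike.im_eq_complex_im]
    ring
  simp_rw [e]
  rw [integral_add, hre, integral_const_mul, him, mul_zero, add_zero]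
  · exact hw.re.ofReal.mul_bdd hkY (Eventually.of_forall fun u => hkB (Y u))
  · exact (hw.im.ofReal.mul_bdd hkY (Eventually.of_forall fun u => hkB (Y u))).const_mul _

end Laplace

/-! ### Zeros of Laplace transforms on a sphere -/

section Split

variable {U : Type*} [MeasurableSpace U] {μ : Measure U}
  {E : Type*} [NormedAddCommGroup E] [InnerProductSpace ℝ E] [FiniteDimensional ℝ E]
  [MeasurableSpace E] [BorelSpace E]

/-- A signed density `f` of total mass one, and a map `(X₀, X₂)` to the sphere of radius `R` of
`ℝ × E` whose first coordinate has null level sets. -/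
structure SphereSplit (μ : Measure U) (f : U → ℝ) (X₀ : U → ℝ) (X₂ : U → E) (R : ℝ) : Prop where
  integrable : Integrable f μ
  measurable_fst : Measurable X₀
  measurable_snd : Measurable X₂
  nonneg : 0 ≤ R
  sphere : ∀ u, X₀ u ^ 2 + ‖X₂ u‖ ^ 2 = R ^ 2
  total : ∫ u, f u ∂μ = 1
  level : ∀ c, ∀ᵐ u ∂μ, X₀ u ≠ c

/-- `z ↦ ∫ f exp(z X₀ + ⟨y, X₂⟩)`. -/
noncomputable def mixedLaplace (μ : Measure U) (f : U → ℝ) (X₀ : U → ℝ) (X₂ : U → E) (y : E) :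
    ℂ → ℂ :=
  laplaceC μ (fun u => ((f u * Real.exp (inner ℝ y (X₂ u)) : ℝ) : ℂ)) (fun u => (X₀ u : ℂ))

theorem integral_exp_pos {f : U → ℝ} (hf0 : ∀ᵐ u ∂μ, 0 ≤ f u)
    (h1 : ∫ u, f u ∂μ = 1) {a : U → ℝ} (hfa : Integrable (fun u => f u * Real.exp (a u)) μ) :
    0 < ∫ u, f u * Real.exp (a u) ∂μ := by
  have h0 : 0 ≤ᵐ[μ] fun u => f u * Real.exp (a u) := by
    filter_upwards [hf0] with u hu
    exact mul_nonneg hu (Real.exp_pos _).le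
  refine (integral_nonneg_of_ae h0).lt_of_ne' fun h => ?_
  have := (integral_eq_zero_iff_of_nonneg_ae h0 hfa).1 h
  have hz : f =ᵐ[μ] 0 := by
    filter_upwards [this] with u hu
    simpa [(Real.exp_pos _).ne'] using hu
  rw [integral_congr_ae hz] at h1
  simp at h1

namespace SphereSplit

variable {f : U → ℝ} {X₀ : U → ℝ} {X₂ : U → E} {R : ℝ}

theorem abs_fst_le (S : SphereSplit μ f X₀ X₂ R) (u : U) : |X₀ u| ≤ R :=
  abs_le_of_sq_le_sq (by nlinarith [S.sphere u, sq_nonneg ‖X₂ u‖]) S.nonneg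

theorem norm_fst_le (S : SphereSplit μ f X₀ X₂ R) (u : U) : ‖(X₀ u : ℂ)‖ ≤ R := by
  rw [Complex.norm_real]; exact S.abs_fst_le u

theorem norm_snd_le (S : SphereSplit μ f X₀ X₂ R) (u : U) : ‖X₂ u‖ ≤ R :=
  (pow_le_pow_iff_left₀ (norm_nonneg _) S.nonneg two_ne_zero).1
    (by nlinarith [S.sphere u, sq_nonneg (X₀ u)])

theorem abs_fst_eq (S : SphereSplit μ f X₀ X₂ R) (u : U) :
    Real.sqrt (R ^ 2 - ‖X₂ u‖ ^ 2) = |X₀ u| := by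
  rw [← S.sphere u, add_sub_cancel_right, Real.sqrt_sq_eq_abs]

theorem aestronglyMeasurable_fst (S : SphereSplit μ f X₀ X₂ R) :
    AEStronglyMeasurable (fun u => (X₀ u : ℂ)) μ :=
  (Complex.measurable_ofReal.comp S.measurable_fst).aestronglyMeasurable

theorem integrable_mul_exp_snd (S : SphereSplit μ f X₀ X₂ R) (y : E) :
    Integrable (fun u => f u * Real.exp (inner ℝ y (X₂ u))) μ := by
  have := S.measurable_snd
  refine S.integrable.mul_bdd (c := Real.exp (‖y‖ * R)) (by fun_prop)
    (Eventually.of_forall fun u => ?_)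
  rw [Real.norm_eq_abs, Real.abs_exp]
  exact Real.exp_le_exp.2 ((real_inner_le_norm _ _).trans (by gcongr; exact S.norm_snd_le u))

theorem differentiable_mixedLaplace (S : SphereSplit μ f X₀ X₂ R) (y : E) :
    Differentiable ℂ (mixedLaplace μ f X₀ X₂ y) :=
  differentiable_laplaceC (S.integrable_mul_exp_snd y).ofReal S.aestronglyMeasurable_fst
    S.norm_fst_le

theorem mixedLaplace_zero_zero (S : SphereSplit μ f X₀ X₂ R) :
    mixedLaplace μ f X₀ X₂ 0 0 = 1 := by
  have : ∫ u, (f u : ℂ) ∂μ = 1 := by rw [integral_complex_ofReal, S.total]; simp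
  simpa [mixedLaplace, laplaceC] using this

theorem mixedLaplace_conj (y : E) (z : ℂ) :
    mixedLaplace μ f X₀ X₂ y ((starRingEnd ℂ) z) =
      (starRingEnd ℂ) (mixedLaplace μ f X₀ X₂ y z) := by
  rw [mixedLaplace, laplaceC, laplaceC, ← integral_conj]
  refine integral_congr_ae (Eventually.of_forall fun u => ?_)
  simp [← Complex.exp_conj]

theorem mixedLaplace_at_zero (y : E) :
    mixedLaplace μ f X₀ X₂ y 0 = ((∫ u, f u * Real.exp (inner ℝ y (X₂ u)) ∂μ : ℝ) : ℂ) := by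
  simp [mixedLaplace, laplaceC, ← integral_complex_ofReal]

theorem mixedLaplace_at_zero_ne (S : SphereSplit μ f X₀ X₂ R) (hf : ∀ᵐ u ∂μ, 0 ≤ f u) (y : E) :
    mixedLaplace μ f X₀ X₂ y 0 ≠ 0 := by
  rw [mixedLaplace_at_zero]
  exact_mod_cast (integral_exp_pos hf S.total (S.integrable_mul_exp_snd y)).ne'

theorem mixedLaplace_eq (y : E) (z : ℂ) : mixedLaplace μ f X₀ X₂ y z =
    ∫ u, ((f u : ℂ) * Complex.exp (z * X₀ u)) * (Real.exp (inner ℝ y (X₂ u)) : ℂ) ∂μ := by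
  rw [mixedLaplace, laplaceC]
  refine integral_congr_ae (Eventually.of_forall fun u => ?_)
  push_cast
  ring

theorem integrable_mul_exp_fst (S : SphereSplit μ f X₀ X₂ R) (a : ℂ) :
    Integrable (fun u => (f u : ℂ) * Complex.exp (a * X₀ u)) μ :=
  integrable_mul_exp S.integrable.ofReal S.aestronglyMeasurable_fst S.norm_fst_le a

/-- Along lines in the second variable, the mixed Laplace transform is entire. -/
theorem exists_entire_line (S : SphereSplit μ f X₀ X₂ R) (a : ℂ) (y : E) :
    ∃ L : ℂ → ℂ, Differentiable ℂ L ∧ ∀ t : ℝ, L t = mixedLaplace μ f X₀ X₂ (t • y) a := by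
  have := S.measurable_snd
  refine ⟨laplaceC μ (fun u => (f u : ℂ) * Complex.exp (a * X₀ u))
    (fun u => ((inner ℝ y (X₂ u) : ℝ) : ℂ)),
    differentiable_laplaceC (S.integrable_mul_exp_fst a) (by fun_prop) (B := ‖y‖ * R) fun u => ?_,
    fun t => ?_⟩
  · rw [Complex.norm_real]
    exact (norm_inner_le_norm _ _).trans (by gcongr; exact S.norm_snd_le u)
  · rw [mixedLaplace_eq, laplaceC]
    refine integral_congr_ae (Eventually.of_forall fun u => ?_)
    simp [inner_smul_left]

/-- On the sphere `|X₀| = √(R² - ‖X₂‖²)`, so continuous functions of `|X₀|` are bounded functions of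
`X₂`, and can serve as test functions. -/
theorem exists_bound_comp_sqrt {φ : ℝ → ℂ} (hφ : Continuous φ) (R : ℝ) :
    ∃ B, ∀ x : E, ‖φ (Real.sqrt (R ^ 2 - ‖x‖ ^ 2))‖ ≤ B := by
  obtain ⟨B, hB⟩ := (isCompact_Icc (a := (0 : ℝ)) (b := |R|)).exists_bound_of_continuousOn
    hφ.continuousOn
  refine ⟨B, fun x => hB _ ⟨Real.sqrt_nonneg _, ?_⟩⟩
  rw [← Real.sqrt_sq_eq_abs]
  exact Real.sqrt_le_sqrt (by nlinarith [sq_nonneg ‖x‖])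

/-- Testing a weight whose Laplace transform in the second variable vanishes against functions of
`|X₀|` and `X₂`. -/
theorem integral_test_eq_zero (S : SphereSplit μ f X₀ X₂ R) {w : U → ℂ} (hw : Integrable w μ)
    (h0 : ∀ y : E, ∫ u, w u * (Real.exp (inner ℝ y (X₂ u)) : ℂ) ∂μ = 0)
    {φ : ℝ → ℂ} (hφ : Continuous φ) {k : E → ℂ} (hk : Measurable k) {B : ℝ}
    (hkB : ∀ x, ‖k x‖ ≤ B) : ∫ u, w u * (φ |X₀ u| * k (X₂ u)) ∂μ = 0 := by
  obtain ⟨C, hC⟩ := exists_bound_comp_sqrt (E := E) hφ R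
  have := integral_mul_comp_eq_zero hw S.measurable_snd S.norm_snd_le h0
    (k := fun x => φ (Real.sqrt (R ^ 2 - ‖x‖ ^ 2)) * k x) (B := C * B)
    ((hφ.measurable.comp (by fun_prop)).mul hk)
    (fun x => by
      rw [norm_mul]
      have := hC x
      have := hkB x
      gcongr
      exact (norm_nonneg _).trans (hC x))
  simpa only [S.abs_fst_eq] using this

theorem integrable_test (S : SphereSplit μ f X₀ X₂ R) {w : U → ℂ} (hw : Integrable w μ)
    {φ : ℝ → ℂ} (hφ : Continuous φ) {k : E → ℂ} (hk : Measurable k) {B : ℝ}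
    (hkB : ∀ x, ‖k x‖ ≤ B) : Integrable (fun u => w u * (φ |X₀ u| * k (X₂ u))) μ := by
  obtain ⟨C, hC⟩ := exists_bound_comp_sqrt (E := E) hφ R
  have h1 := S.measurable_fst
  have h2 := S.measurable_snd
  refine hw.mul_bdd (c := C * B) ?_ (Eventually.of_forall fun u => ?_)
  · exact ((hφ.measurable.comp (by fun_prop)).mul (hk.comp h2)).aestronglyMeasurable
  · rw [norm_mul]
    have h3 := hC (X₂ u)
    rw [S.abs_fst_eq] at h3
    have := hkB (X₂ u)
    gcongr
    exact (norm_nonneg _).trans h3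

/-- One can divide by functions of `|X₀|` in test integrals. -/
theorem false_of_forall_integral_eq_zero (S : SphereSplit μ f X₀ X₂ R) {τ : ℝ → ℂ}
    (hτ : Continuous τ) (hne : ∀ᵐ u ∂μ, τ |X₀ u| ≠ 0)
    (h0 : ∀ k : E → ℂ, Measurable k → ∀ B, (∀ x, ‖k x‖ ≤ B) →
      ∫ u, (f u : ℂ) * (τ |X₀ u| * k (X₂ u)) ∂μ = 0) : False := by
  have hτm : Measurable fun x : E => τ (Real.sqrt (R ^ 2 - ‖x‖ ^ 2)) :=
    hτ.measurable.comp (by fun_prop)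
  obtain ⟨C, hC⟩ := exists_bound_comp_sqrt (E := E) hτ R
  have hε : ∀ n : ℕ, (0 : ℝ) < 1 / ((n : ℝ) + 1) := fun n => by positivity
  have hn : ∀ n : ℕ, ∫ u, (f u : ℂ) * (((‖τ |X₀ u|‖ ^ 2 / (‖τ |X₀ u|‖ ^ 2 + 1 / ((n : ℝ) + 1)) :
      ℝ)) : ℂ) ∂μ = 0 := by
    intro n
    -- A bounded substitute for `1 / τ`, namely `conj τ / (|τ|² + 1/(n+1))`. As `n → ∞` only the
    -- total mass of `f` remains, which is `1` and not `0`.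
    have := h0 (fun x => (starRingEnd ℂ) (τ (Real.sqrt (R ^ 2 - ‖x‖ ^ 2))) /
      ((‖τ (Real.sqrt (R ^ 2 - ‖x‖ ^ 2))‖ ^ 2 + 1 / ((n : ℝ) + 1) : ℝ) : ℂ))
      (by fun_prop) (C / (1 / ((n : ℝ) + 1))) (fun x => by
        rw [norm_div, RCLike.norm_conj, Complex.norm_real, Real.norm_eq_abs,
          abs_of_pos (by have := hε n; positivity)]
        have := hC x
        have := hε n
        have h3 := (norm_nonneg _).trans (hC x)
        gcongr
        linarith [sq_nonneg ‖τ (Real.sqrt (R ^ 2 - ‖x‖ ^ 2))‖])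
    rw [← this]
    refine integral_congr_ae (Eventually.of_forall fun u => ?_)
    simp only [S.abs_fst_eq]
    rw [mul_div_assoc', Complex.mul_conj, Complex.normSq_eq_norm_sq, Complex.ofReal_div]
  have hlim : Tendsto (fun n : ℕ => ∫ u, (f u : ℂ) * (((‖τ |X₀ u|‖ ^ 2 /
      (‖τ |X₀ u|‖ ^ 2 + 1 / ((n : ℝ) + 1)) : ℝ)) : ℂ) ∂μ) atTop (𝓝 (∫ u, (f u : ℂ) ∂μ)) := by
    have h1 := S.measurable_fst
    refine tendsto_integral_of_dominated_convergence (fun u => ‖f u‖)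
      (fun n => (S.integrable.ofReal (𝕜 := ℂ)).aestronglyMeasurable.mul
        (Measurable.aestronglyMeasurable ?_)) S.integrable.norm
      (fun n => Eventually.of_forall fun u => ?_) ?_
    · have : Measurable fun u => τ |X₀ u| := hτ.measurable.comp (by fun_prop)
      fun_prop
    · rw [norm_mul, Complex.norm_real, Complex.norm_real]
      refine mul_le_of_le_one_right (norm_nonneg _) ?_
      have := hε n
      rw [Real.norm_eq_abs, abs_of_nonneg (by positivity), div_le_one (by positivity)]
      linarith
    · filter_upwards [hne] with u hu
      have h2 : ‖τ |X₀ u|‖ ^ 2 ≠ 0 := by positivity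
      have h3 : Tendsto (fun n : ℕ => ‖τ |X₀ u|‖ ^ 2 / (‖τ |X₀ u|‖ ^ 2 + 1 / ((n : ℝ) + 1)))
          atTop (𝓝 (‖τ |X₀ u|‖ ^ 2 / (‖τ |X₀ u|‖ ^ 2 + 0))) :=
        tendsto_const_nhds.div (tendsto_const_nhds.add
          (tendsto_one_div_add_atTop_nhds_zero_nat (𝕜 := ℝ))) (by simpa using h2)
      rw [add_zero, div_self h2] at h3
      have h4 := ((Complex.continuous_ofReal.tendsto _).comp h3).const_mul (f u : ℂ)
      simpa using h4
  simp only [hn] at hlim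
  have := tendsto_nhds_unique hlim tendsto_const_nhds
  rw [integral_complex_ofReal, S.total] at this
  simp at this

/-- Given `X₂`, the coordinate `X₀` takes two values `±x`, and the zeros at `a` and `b` impose on
their masses two linear relations of determinant `2 sinh((a - b) x)`, nonzero almost everywhere. The
elimination is the identity `exp(a X₀) sinh(b |X₀|) - exp(b X₀) sinh(a |X₀|) = sinh((b - a) |X₀|)`,
whose right side no longer sees the sign of `X₀`. -/
theorem false_of_two_zeros (S : SphereSplit μ f X₀ X₂ R) {a b : ℂ} (hab : a ≠ b)
    (ha : ∀ y : E, mixedLaplace μ f X₀ X₂ y a = 0) (hb : ∀ y : E, mixedLaplace μ f X₀ X₂ y b = 0) :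
    False := by
  simp_rw [mixedLaplace_eq] at ha hb
  have hc : ∀ c : ℂ, Continuous fun x : ℝ => Complex.sinh (c * x) := fun c => by fun_prop
  refine S.false_of_forall_integral_eq_zero (hc (b - a)) ?_ fun k hk B hkB => ?_
  · have hne : b - a ≠ 0 := sub_ne_zero.2 hab.symm
    -- The zeros of `sinh((b - a) x)` are the countably many `j π I / (b - a)`; each corresponding
    -- level set of `X₀` is null.
    have : ∀ᵐ u ∂μ, ∀ j : ℤ, X₀ u ≠ ((j * Real.pi * Complex.I) / (b - a)).re ∧
        X₀ u ≠ -((j * Real.pi * Complex.I) / (b - a)).re :=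
      ae_all_iff.2 fun j => (S.level _).and (S.level _)
    filter_upwards [this] with u hu h0
    have h1 : Complex.sin ((b - a) * (|X₀ u| : ℝ) * Complex.I) = 0 := by
      rw [Complex.sin_mul_I, h0, zero_mul]
    obtain ⟨j, hj⟩ := Complex.sin_eq_zero_iff.1 h1
    have h2 : ((|X₀ u| : ℝ) : ℂ) = (((-j : ℤ) : ℂ) * Real.pi * Complex.I) / (b - a) := by
      rw [eq_div_iff hne]
      have : (b - a) * (|X₀ u| : ℝ) * Complex.I * Complex.I = j * Real.pi * Complex.I := by rw [hj]
      rw [mul_assoc, Complex.I_mul_I] at this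
      push_cast
      linear_combination -this
    have h3 := congrArg Complex.re h2
    rw [Complex.ofReal_re] at h3
    have h4 := hu (-j)
    rcases abs_cases (X₀ u) with ⟨h, _⟩ | ⟨h, _⟩
    · exact h4.1 (h ▸ h3)
    · exact h4.2 (by rw [← h3, h, neg_neg])
  · have e1 := S.integral_test_eq_zero (S.integrable_mul_exp_fst a) ha (hc b) hk hkB
    have e2 := S.integral_test_eq_zero (S.integrable_mul_exp_fst b) hb (hc a) hk hkB
    have i1 := S.integrable_test (S.integrable_mul_exp_fst a) (hc b) hk hkB
    have i2 := S.integrable_test (S.integrable_mul_exp_fst b) (hc a) hk hkB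
    have := integral_sub i1 i2
    rw [e1, e2, sub_zero] at this
    rw [← this]
    refine integral_congr_ae (Eventually.of_forall fun u => ?_)
    simp only
    have : Complex.sinh ((b - a) * (|X₀ u| : ℝ)) =
        Complex.exp (a * X₀ u) * Complex.sinh (b * (|X₀ u| : ℝ)) -
        Complex.exp (b * X₀ u) * Complex.sinh (a * (|X₀ u| : ℝ)) := by
      rw [← Complex.cosh_add_sinh, ← Complex.cosh_add_sinh, sub_mul, Complex.sinh_sub]
      rcases abs_cases (X₀ u) with ⟨h, _⟩ | ⟨h, _⟩ <;> rw [h]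
      · ring
      · push_cast
        simp only [mul_neg, Complex.sinh_neg, Complex.cosh_neg]
        ring
    rw [this]
    ring

/-- Confluent form of the elimination for two zeros: the derivative supplies the second relation,
and the combination leaves the factor `|X₀|`, which is almost everywhere nonzero. -/
theorem false_of_double_zero (S : SphereSplit μ f X₀ X₂ R) {a : ℂ}
    (ha : ∀ y : E, mixedLaplace μ f X₀ X₂ y a = 0)
    (ha' : ∀ y : E, deriv (mixedLaplace μ f X₀ X₂ y) a = 0) : False := by
  have hw : Integrable (fun u => ((f u : ℂ) * Complex.exp (a * X₀ u)) * X₀ u) μ :=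
    (S.integrable_mul_exp_fst a).mul_bdd S.aestronglyMeasurable_fst
      (Eventually.of_forall S.norm_fst_le)
  have hd : ∀ y : E, ∫ u, ((f u : ℂ) * Complex.exp (a * X₀ u)) * X₀ u *
      (Real.exp (inner ℝ y (X₂ u)) : ℂ) ∂μ = 0 := by
    intro y
    have hfi : Integrable (fun u => ((f u * Real.exp (inner ℝ y (X₂ u)) : ℝ) : ℂ)) μ :=
      (S.integrable_mul_exp_snd y).ofReal
    have hdv := (hasDerivAt_laplaceC hfi S.aestronglyMeasurable_fst S.norm_fst_le a).deriv
    rw [← ha' y]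
    refine Eq.trans ?_ hdv.symm
    rw [laplaceC]
    refine integral_congr_ae (Eventually.of_forall fun u => ?_)
    push_cast
    ring
  simp_rw [mixedLaplace_eq] at ha
  refine S.false_of_forall_integral_eq_zero (τ := fun x => (x : ℂ)) (by fun_prop) ?_
    fun k hk B hkB => ?_
  · filter_upwards [S.level 0] with u hu
    simpa using hu
  · have c1 : Continuous fun x : ℝ => (x : ℂ) * Complex.cosh (a * x) := by fun_prop
    have c2 : Continuous fun x : ℝ => Complex.sinh (a * x) := by fun_prop
    have e1 := S.integral_test_eq_zero (S.integrable_mul_exp_fst a) ha c1 hk hkB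
    have e2 := S.integral_test_eq_zero hw hd c2 hk hkB
    have i1 := S.integrable_test (S.integrable_mul_exp_fst a) c1 hk hkB
    have i2 := S.integrable_test hw c2 hk hkB
    have := integral_sub i1 i2
    rw [e1, e2, sub_zero] at this
    rw [← this]
    refine integral_congr_ae (Eventually.of_forall fun u => ?_)
    simp only
    have : ((|X₀ u| : ℝ) : ℂ) =
        Complex.exp (a * X₀ u) * ((|X₀ u| : ℝ) * Complex.cosh (a * (|X₀ u| : ℝ))) -
        Complex.exp (a * X₀ u) * X₀ u * Complex.sinh (a * (|X₀ u| : ℝ)) := by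
      rw [← Complex.cosh_add_sinh]
      have h2 := Complex.cosh_sq_sub_sinh_sq (a * X₀ u)
      rcases abs_cases (X₀ u) with ⟨h, _⟩ | ⟨h, _⟩ <;> rw [h]
      · linear_combination -(X₀ u : ℂ) * h2
      · push_cast
        simp only [mul_neg, Complex.sinh_neg, Complex.cosh_neg]
        linear_combination (X₀ u : ℂ) * h2
    nth_rw 1 [this]
    ring

/-- This is where positivity enters. Tested against `cos(a.im |X₀|)`, the weight `f exp(a X₀)` has
real part `f exp(a.re X₀) cos²(a.im X₀)`, which is nonnegative and, up to a null set, vanishes only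
with `f`. -/
theorem exists_mixedLaplace_ne_zero (S : SphereSplit μ f X₀ X₂ R) (hf : ∀ᵐ u ∂μ, 0 ≤ f u) (a : ℂ) :
    ∃ y : E, mixedLaplace μ f X₀ X₂ y a ≠ 0 := by
  by_contra! h
  simp_rw [mixedLaplace_eq] at h
  have hc : Continuous fun x : ℝ => Complex.cos (a.im * x) := by fun_prop
  have e := S.integral_test_eq_zero (S.integrable_mul_exp_fst a) h hc (k := fun _ => 1)
    measurable_const (B := 1) (fun _ => by simp)
  have i := S.integrable_test (S.integrable_mul_exp_fst a) hc (k := fun _ => 1)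
    measurable_const (B := 1) (fun _ => by simp)
  have hre := congrArg Complex.re e
  rw [← Complex.reCLM_apply, ← Complex.reCLM.integral_comp_comm i] at hre
  have hfun : ∀ u, Complex.reCLM ((f u : ℂ) * Complex.exp (a * X₀ u) *
      (Complex.cos (a.im * (|X₀ u| : ℝ)) * 1)) =
      f u * (Real.exp (a.re * X₀ u) * Real.cos (a.im * X₀ u) ^ 2) := by
    intro u
    have h1 : Complex.cos (a.im * (|X₀ u| : ℝ)) = ((Real.cos (a.im * X₀ u) : ℝ) : ℂ) := by
      rw [← Complex.ofReal_mul, ← Complex.ofReal_cos]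
      congr 1
      rcases abs_cases (X₀ u) with ⟨h, _⟩ | ⟨h, _⟩ <;> rw [h]
      rw [mul_neg, Real.cos_neg]
    rw [h1, mul_one, mul_assoc, Complex.reCLM_apply, Complex.re_ofReal_mul, Complex.re_mul_ofReal,
      Complex.exp_re]
    simp only [Complex.mul_re, Complex.ofReal_re, Complex.ofReal_im, mul_zero, sub_zero,
      Complex.mul_im, zero_add]
    ring
  simp_rw [hfun] at hre
  have i' := Complex.reCLM.integrable_comp i
  simp_rw [hfun] at i'
  have h0 : 0 ≤ᵐ[μ] fun u => f u * (Real.exp (a.re * X₀ u) * Real.cos (a.im * X₀ u) ^ 2) := by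
    filter_upwards [hf] with u hu
    simp only [Pi.zero_apply]
    positivity
  have hz := (integral_eq_zero_iff_of_nonneg_ae h0 i').1 (by simpa using hre)
  have hcos : ∀ᵐ u ∂μ, Real.cos (a.im * X₀ u) ≠ 0 := by
    have : ∀ᵐ u ∂μ, ∀ j : ℤ, X₀ u ≠ (2 * j + 1) * Real.pi / 2 / a.im :=
      ae_all_iff.2 fun j => S.level _
    filter_upwards [this] with u hu h0
    obtain ⟨j, hj⟩ := Real.cos_eq_zero_iff.1 h0
    rcases eq_or_ne a.im 0 with h | h
    · rw [h] at h0
      simp at h0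
    · exact hu j (by rw [eq_div_iff h, ← hj, mul_comm])
  have hf0 : f =ᵐ[μ] 0 := by
    filter_upwards [hz, hcos] with u hu hu'
    simpa [(Real.exp_pos _).ne', hu'] using hu
  have := S.total
  rw [integral_congr_ae hf0] at this
  simp at this

end SphereSplit

end Split

/-! ### The ratio of two Laplace transforms along an axis -/

section Split

variable {U : Type*} [MeasurableSpace U] {μ : Measure U}
  {E : Type*} [NormedAddCommGroup E] [InnerProductSpace ℝ E] [FiniteDimensional ℝ E]
  [MeasurableSpace E] [BorelSpace E]
  {f g X₀ Z₀ : U → ℝ} {X₂ Z₂ : U → E} {R r : ℝ}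

namespace SphereSplit

theorem norm_mixedLaplace_zero_le (S : SphereSplit μ f X₀ X₂ R) (z : ℂ) :
    ‖mixedLaplace μ f X₀ X₂ 0 z‖ ≤ Real.exp ((∫ u, |f u| ∂μ + R) * (1 + ‖z‖)) := by
  have hfi : Integrable (fun u => ((f u * Real.exp (inner ℝ (0 : E) (X₂ u)) : ℝ) : ℂ)) μ :=
    (S.integrable_mul_exp_snd 0).ofReal
  have h := norm_laplaceC_le hfi S.norm_fst_le z
  have h0 : 0 ≤ ∫ u, |f u| ∂μ := integral_nonneg fun u => abs_nonneg _
  refine h.trans ?_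
  simp only [Complex.norm_real, inner_zero_left, Real.exp_zero, mul_one, Real.norm_eq_abs]
  calc _ ≤ Real.exp (∫ u, |f u| ∂μ) * Real.exp (R * ‖z‖) := by
        gcongr
        linarith [Real.add_one_le_exp (∫ u, |f u| ∂μ)]
    _ ≤ _ := by
        rw [← Real.exp_add]
        refine Real.exp_le_exp.2 ?_
        nlinarith [S.nonneg, norm_nonneg z, mul_nonneg h0 (norm_nonneg z)]

/-- If `Φ(z,y) Φ_g(z,0) Φ_g(0,y) = Φ_g(z,y) Φ(z,0) Φ(0,y)`, the ratio of the Laplace transforms in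
the first variable is entire, and controls the joint ratio. -/
theorem exists_entire_ratio (S : SphereSplit μ f X₀ X₂ R) (T : SphereSplit μ g Z₀ Z₂ r)
    (hg : ∀ᵐ u ∂μ, 0 ≤ g u)
    (hID : ∀ (y : E) (z : ℂ), mixedLaplace μ f X₀ X₂ y z * mixedLaplace μ g Z₀ Z₂ 0 z *
      mixedLaplace μ g Z₀ Z₂ y 0 = mixedLaplace μ g Z₀ Z₂ y z * mixedLaplace μ f X₀ X₂ 0 z *
      mixedLaplace μ f X₀ X₂ y 0) :
    ∃ q : ℂ → ℂ, Differentiable ℂ q ∧ ∀ (y : E) (z : ℂ),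
      mixedLaplace μ f X₀ X₂ y z * mixedLaplace μ g Z₀ Z₂ y 0 =
        q z * (mixedLaplace μ g Z₀ Z₂ y z * mixedLaplace μ f X₀ X₂ y 0) := by
  set P : E → ℂ → ℂ := fun y z => mixedLaplace μ f X₀ X₂ y z * mixedLaplace μ g Z₀ Z₂ y 0 with hP
  set Q : E → ℂ → ℂ := fun y z => mixedLaplace μ g Z₀ Z₂ y z * mixedLaplace μ f X₀ X₂ y 0 with hQ
  have dP : ∀ y, Differentiable ℂ (P y) := fun y =>
    (S.differentiable_mixedLaplace y).mul_const _
  have dQ : ∀ y, Differentiable ℂ (Q y) := fun y =>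
    (T.differentiable_mixedLaplace y).mul_const _
  -- The quotient `P / Q` does not depend on `y`: eliminate between the identities at `y` and `y'`,
  -- then cancel the entire function `Φ_g(z, 0)`, which equals `1` at `0`.
  have hcross : ∀ y y' z, P y z * Q y' z = P y' z * Q y z := by
    intro y y' z
    have := eq_zero_or_eq_zero_of_entire_mul (T.differentiable_mixedLaplace (0 : E))
      (((dP y).mul (dQ y')).sub ((dP y').mul (dQ y))) (fun z => by
        have h1 := hID y z
        have h2 := hID y' z
        simp only [Pi.sub_apply, Pi.mul_apply, hP, hQ]
        linear_combination mixedLaplace μ g Z₀ Z₂ y' z * mixedLaplace μ f X₀ X₂ y' 0 * h1 -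
          mixedLaplace μ g Z₀ Z₂ y z * mixedLaplace μ f X₀ X₂ y 0 * h2)
    rcases this with h | h
    · have := h 0
      rw [T.mixedLaplace_zero_zero] at this
      simp at this
    · exact sub_eq_zero.1 (h z)
  -- If every `Q y a` vanished, then along a line `ℝ y` the product of the entire functions `t ↦
  -- Φ_g(a, t y)` and `t ↦ Φ(0, t y)` would vanish, although neither does for a suitable `y`. So the
  -- quotient has no pole.
  have hex : ∀ a : ℂ, ∃ y, Q y a ≠ 0 := by
    intro a
    by_contra! h
    obtain ⟨y, hy⟩ := T.exists_mixedLaplace_ne_zero hg a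
    obtain ⟨L, hL, hLt⟩ := T.exists_entire_line a y
    obtain ⟨M, hM, hMt⟩ := S.exists_entire_line 0 y
    have h0 := eq_zero_of_entire_of_real (hL.mul hM) fun t => by
      rw [Pi.mul_apply, hLt, hMt]
      exact h (t • y)
    rcases eq_zero_or_eq_zero_of_entire_mul hL hM h0 with h1 | h1
    · have := hLt 1
      rw [h1, one_smul] at this
      exact hy this.symm
    · have := hMt 0
      rw [h1, zero_smul, S.mixedLaplace_zero_zero] at this
      simp at this
  choose Y hY using hex
  have hq : ∀ y z, P y z = P (Y z) z / Q (Y z) z * Q y z := by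
    intro y z
    rw [div_mul_eq_mul_div, eq_div_iff (hY z), hcross]
  refine ⟨fun z => P (Y z) z / Q (Y z) z, fun a => ?_, hq⟩
  have hev : ∀ᶠ z in 𝓝 a, Q (Y a) z ≠ 0 := (dQ (Y a)).continuous.continuousAt.eventually_ne (hY a)
  refine (((dP (Y a)) a).div ((dQ (Y a)) a) (hY a)).congr_of_eventuallyEq ?_
  filter_upwards [hev] with z hz
  rw [Pi.div_apply, eq_div_iff hz, ← hq]

/-- The transform of `g` at `z = 0` is positive, so a zero of the ratio `q` is a zero of the
transform of `f` for every `y`. Hence `q` has at most one zero, a simple one, and conjugation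
symmetry makes it real. Once this zero is removed, what remains is a zero-free quotient of functions
of exponential type. -/
theorem exists_affine_mul_exp_ratio (S : SphereSplit μ f X₀ X₂ R) (T : SphereSplit μ g Z₀ Z₂ r)
    (hg : ∀ᵐ u ∂μ, 0 ≤ g u)
    (hID : ∀ (y : E) (z : ℂ), mixedLaplace μ f X₀ X₂ y z * mixedLaplace μ g Z₀ Z₂ 0 z *
      mixedLaplace μ g Z₀ Z₂ y 0 = mixedLaplace μ g Z₀ Z₂ y z * mixedLaplace μ f X₀ X₂ 0 z *
      mixedLaplace μ f X₀ X₂ y 0) :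
    ∃ κ b : ℝ, ∀ (y : E) (z : ℂ),
      mixedLaplace μ f X₀ X₂ y z * mixedLaplace μ g Z₀ Z₂ y 0 =
        (1 - κ * z) * Complex.exp (b * z) *
          (mixedLaplace μ g Z₀ Z₂ y z * mixedLaplace μ f X₀ X₂ y 0) := by
  obtain ⟨q, hq, hPQ⟩ := S.exists_entire_ratio T hg hID
  have hq0 : ∀ z, mixedLaplace μ f X₀ X₂ 0 z = q z * mixedLaplace μ g Z₀ Z₂ 0 z := by
    intro z
    simpa [T.mixedLaplace_zero_zero, S.mixedLaplace_zero_zero] using hPQ 0 z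
  have hq1 : q 0 = 1 := by
    have := hq0 0
    rw [T.mixedLaplace_zero_zero, S.mixedLaplace_zero_zero, mul_one] at this
    exact this.symm
  have hzero : ∀ a, q a = 0 → ∀ y : E, mixedLaplace μ f X₀ X₂ y a = 0 := by
    intro a ha y
    have := hPQ y a
    rw [ha, zero_mul] at this
    exact (mul_eq_zero.1 this).resolve_right (T.mixedLaplace_at_zero_ne hg y)
  have huniq : ∀ a b, q a = 0 → q b = 0 → a = b := by
    intro a b ha hb
    by_contra hab
    exact S.false_of_two_zeros hab (hzero a ha) (hzero b hb)
  have hconj : ∀ z, q ((starRingEnd ℂ) z) = (starRingEnd ℂ) (q z) := by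
    intro z
    have hd : Differentiable ℂ fun z => (starRingEnd ℂ) (q ((starRingEnd ℂ) z)) := by
      intro z
      have := (hq ((starRingEnd ℂ) z)).hasDerivAt.conj_conj
      simpa [Function.comp_def] using this.differentiableAt
    have h0 := eq_zero_or_eq_zero_of_entire_mul (T.differentiable_mixedLaplace (0 : E))
      (hd.sub hq) (fun z => by
        have h1 := hq0 z
        have h2 := congrArg (starRingEnd ℂ) (hq0 ((starRingEnd ℂ) z))
        rw [mixedLaplace_conj, map_mul, mixedLaplace_conj, Complex.conj_conj,
          Complex.conj_conj] at h2
        simp only [Pi.sub_apply]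
        linear_combination h1 - h2)
    rcases h0 with h | h
    · have := h 0
      rw [T.mixedLaplace_zero_zero] at this
      simp at this
    · have := sub_eq_zero.1 (h z)
      simp only at this
      rw [← this, Complex.conj_conj]
  have hfac : ∃ κ : ℝ, ∃ h : ℂ → ℂ, Differentiable ℂ h ∧ (∀ z, h z ≠ 0) ∧
      ∀ z, q z = (1 - κ * z) * h z := by
    by_cases hz : ∃ a, q a = 0
    · obtain ⟨a, ha⟩ := hz
      have ha0 : a ≠ 0 := by
        rintro rfl
        rw [hq1] at ha
        exact one_ne_zero ha
      have hreal : (starRingEnd ℂ) a = a := huniq _ _ (by rw [hconj, ha, map_zero]) ha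
      have hare : ((a.re : ℝ) : ℂ) = a := Complex.conj_eq_iff_re.1 hreal
      have hqf : ∀ z, q z = (z - a) * dslope q a z := by
        intro z
        have := sub_smul_dslope q a z
        rw [ha, sub_zero, smul_eq_mul] at this
        exact this.symm
      have hds : Differentiable ℂ (dslope q a) := by
        have := (Complex.differentiableOn_dslope (c := a) (s := univ) univ_mem (f := q)).2
          hq.differentiableOn
        exact differentiableOn_univ.1 this
      -- As `q 0 = 1`, the zero `a` is not `0`; the witnesses come from `z - a = -a (1 - a⁻¹ z)`.
      refine ⟨a.re⁻¹, fun z => -a * dslope q a z, hds.const_mul _, fun z hz => ?_, fun z => ?_⟩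
      · have hz' : dslope q a z = 0 := by simpa [ha0] using hz
        have hqz : q z = 0 := by rw [hqf, hz', mul_zero]
        have hza := huniq _ _ hqz ha
        rw [hza, dslope_same] at hz'
        refine S.false_of_double_zero (hzero a ha) fun y => ?_
        have h1 : HasDerivAt (fun z => mixedLaplace μ f X₀ X₂ y z * mixedLaplace μ g Z₀ Z₂ y 0)
            (deriv (mixedLaplace μ f X₀ X₂ y) a * mixedLaplace μ g Z₀ Z₂ y 0) a :=
          ((S.differentiable_mixedLaplace y) a).hasDerivAt.mul_const _
        have h2 := (hq a).hasDerivAt.mul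
          (((T.differentiable_mixedLaplace y) a).hasDerivAt.mul_const
            (mixedLaplace μ f X₀ X₂ y 0))
        have h3 : (fun z => mixedLaplace μ f X₀ X₂ y z * mixedLaplace μ g Z₀ Z₂ y 0) =
          q * fun z => mixedLaplace μ g Z₀ Z₂ y z * mixedLaplace μ f X₀ X₂ y 0 :=
          funext fun z => hPQ y z
        rw [h3] at h1
        have h4 := h1.unique h2
        rw [hz', ha, zero_mul, zero_mul, zero_add] at h4
        exact (mul_eq_zero.1 h4).resolve_right (T.mixedLaplace_at_zero_ne hg y)
      · rw [hqf, Complex.ofReal_inv, hare]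
        field_simp
        ring
    · push Not at hz
      exact ⟨0, q, hq, hz, fun z => by simp⟩
  obtain ⟨κ, h, hh, hne, hqh⟩ := hfac
  have hh0 : h 0 = 1 := by
    have := hqh 0
    rw [hq1] at this
    simpa using this.symm
  have hlin : ∀ z : ℂ, ‖1 - (κ : ℂ) * z‖ ≤ Real.exp (|κ| * (1 + ‖z‖)) := by
    intro z
    calc ‖1 - (κ : ℂ) * z‖ ≤ ‖(1 : ℂ)‖ + ‖(κ : ℂ) * z‖ := norm_sub_le _ _
      _ = |κ| * ‖z‖ + 1 := by rw [norm_one, norm_mul, Complex.norm_real, Real.norm_eq_abs, add_comm]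
      _ ≤ Real.exp (|κ| * ‖z‖) := Real.add_one_le_exp _
      _ ≤ _ := Real.exp_le_exp.2 (by nlinarith [abs_nonneg κ, norm_nonneg z])
  have hS0 : 0 ≤ ∫ u, |f u| ∂μ := integral_nonneg fun u => abs_nonneg _
  have hT0 : 0 ≤ ∫ u, |g u| ∂μ := integral_nonneg fun u => abs_nonneg _
  have hR0 := S.nonneg
  have hr0 := T.nonneg
  obtain ⟨b, hb⟩ := eq_exp_of_mul_eq_of_exponential_type (F := mixedLaplace μ f X₀ X₂ 0) (g := h)
    (H := fun z => (1 - (κ : ℂ) * z) * mixedLaplace μ g Z₀ Z₂ 0 z)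
    (C := |κ| + (∫ u, |f u| ∂μ + R) + (∫ u, |g u| ∂μ + r))
    (S.differentiable_mixedLaplace 0) hh
    (((differentiable_const _).sub (differentiable_id.const_mul _)).mul
      (T.differentiable_mixedLaplace 0))
    (fun z => by rw [hq0, hqh]; ring) hne (by simp [T.mixedLaplace_zero_zero]) (by positivity)
    (fun z => (S.norm_mixedLaplace_zero_le z).trans (Real.exp_le_exp.2
      (mul_le_mul_of_nonneg_right (by linarith [abs_nonneg κ]) (by positivity))))
    (fun z => by
      rw [norm_mul]
      calc _ ≤ Real.exp (|κ| * (1 + ‖z‖)) * Real.exp ((∫ u, |g u| ∂μ + r) * (1 + ‖z‖)) := by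
            gcongr
            · exact hlin z
            · exact T.norm_mixedLaplace_zero_le z
        _ ≤ _ := by
            rw [← Real.exp_add, ← add_mul]
            exact Real.exp_le_exp.2 (mul_le_mul_of_nonneg_right (by linarith) (by positivity)))
  rw [hh0] at hb
  -- Near `0` the function `h` commutes with conjugation, and `b` is its derivative at `0`.
  have hbre : (starRingEnd ℂ) b = b := by
    have hcj : ∀ z : ℂ, κ * z ≠ 1 → h ((starRingEnd ℂ) z) = (starRingEnd ℂ) (h z) := by
      intro z hz
      have h1 := hconj z
      rw [hqh, hqh, map_mul] at h1
      simp only [map_sub, map_one, map_mul, Complex.conj_ofReal] at h1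
      refine mul_left_cancel₀ (fun h0 => hz ?_) h1
      have := congrArg (starRingEnd ℂ) (sub_eq_zero.1 h0)
      simp only [map_one, map_mul, Complex.conj_ofReal, Complex.conj_conj] at this
      exact this.symm
    have hd1 : HasDerivAt h b 0 := by
      have : HasDerivAt (fun z => 1 * Complex.exp (b * z)) b 0 := by
        have := (((hasDerivAt_id (0 : ℂ)).const_mul b).cexp).const_mul 1
        simpa using this
      exact this.congr_of_eventuallyEq (Eventually.of_forall hb)
    have hd2 : HasDerivAt h ((starRingEnd ℂ) b) 0 := by
      have h1 : HasDerivAt h b ((starRingEnd ℂ) 0) := by simpa using hd1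
      have h2 := h1.conj_conj
      have h2' : HasDerivAt ((starRingEnd ℂ) ∘ h ∘ (starRingEnd ℂ)) ((starRingEnd ℂ) b) 0 := by
        simpa using h2
      refine h2'.congr_of_eventuallyEq ?_
      have : ∀ᶠ z : ℂ in 𝓝 0, κ * z ≠ 1 :=
        (continuous_const.mul continuous_id).continuousAt.eventually_ne (by simp)
      filter_upwards [this] with z hz
      rw [Function.comp_apply, Function.comp_apply, hcj z hz, Complex.conj_conj]
    exact hd2.unique hd1
  have hbr : ((b.re : ℝ) : ℂ) = b := Complex.conj_eq_iff_re.1 hbre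
  refine ⟨κ, b.re, fun y z => ?_⟩
  rw [hbr, hPQ, hqh, hb, one_mul]

end SphereSplit

end Split

/-! ### Exponential growth of Laplace transforms and their support -/

section Support

variable {U : Type*} [MeasurableSpace U] {μ : Measure U}
  {W : Type*} [NormedAddCommGroup W] [InnerProductSpace ℝ W] [FiniteDimensional ℝ W]
  [MeasurableSpace W] [BorelSpace W]

/-- The real Laplace transform `t ↦ ∫ f exp⟨t, X⟩`. -/
noncomputable def laplace (μ : Measure U) (f : U → ℝ) (X : U → W) (t : W) : ℝ :=
  ∫ u, f u * Real.exp (inner ℝ t (X u)) ∂μ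

/-- An integrable signed density `f`, and a map `X` to the sphere of radius `R` which is
essentially injective: weights are determined by their Laplace transforms. -/
structure SphereDensity (μ : Measure U) (f : U → ℝ) (X : U → W) (R : ℝ) : Prop where
  integrable : Integrable f μ
  measurable : Measurable X
  nonneg : 0 ≤ R
  norm_eq : ∀ u, ‖X u‖ = R
  det : ∀ w : U → ℝ, Integrable w μ → (∀ y, laplace μ w X y = 0) → w =ᵐ[μ] 0

/-- `|G|` grows at most like `exp(t h)` at `t ζ'`, uniformly for `ζ'` close to `ζ`. -/
def ExpGrowth (G : W → ℝ) (ζ : W) (h : ℝ) : Prop :=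
  ∀ᶠ p : ℝ × W in atTop ×ˢ 𝓝 ζ, |G (p.1 • p.2)| ≤ Real.exp (p.1 * h)

theorem eventually_const_mul_exp_le {α : Type*} {l : Filter α} {C h h' : ℝ} (hh : h < h')
    {T : α → ℝ} (hT : Tendsto T l atTop) :
    ∀ᶠ p in l, C * Real.exp (T p * h) ≤ Real.exp (T p * h') := by
  have h1 : ∀ᶠ t : ℝ in atTop, C * Real.exp (t * h) ≤ Real.exp (t * h') := by
    have h2 : Tendsto (fun t : ℝ => Real.exp (t * (h' - h))) atTop atTop :=
      Real.tendsto_exp_atTop.comp (tendsto_id.atTop_mul_const (sub_pos.2 hh))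
    filter_upwards [h2.eventually_ge_atTop C] with t ht
    calc C * Real.exp (t * h) ≤ Real.exp (t * (h' - h)) * Real.exp (t * h) := by gcongr
      _ = _ := by rw [← Real.exp_add]; congr 1; ring
  exact hT.eventually h1

theorem ExpGrowth.of_eventually_le {G : W → ℝ} {ζ : W} {C h h' : ℝ} (hh : h < h')
    (hG : ∀ᶠ p : ℝ × W in atTop ×ˢ 𝓝 ζ, |G (p.1 • p.2)| ≤ C * Real.exp (p.1 * h)) :
    ExpGrowth G ζ h' := by
  filter_upwards [hG, eventually_const_mul_exp_le (C := C) hh tendsto_fst] with p h1 h2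
  exact h1.trans h2

theorem ExpGrowth.mono {G : W → ℝ} {ζ : W} {h h' : ℝ} (hG : ExpGrowth G ζ h) (hh : h ≤ h') :
    ExpGrowth G ζ h' := by
  filter_upwards [hG, tendsto_fst.eventually (eventually_ge_atTop (0 : ℝ))] with p h1 h2
  exact h1.trans (by gcongr)

theorem ExpGrowth.eventually_nhds {G : W → ℝ} {ζ : W} {h : ℝ} (hG : ExpGrowth G ζ h) :
    ∀ᶠ ζ' in 𝓝 ζ, ExpGrowth G ζ' h := by
  obtain ⟨pa, ha, pb, hb, hab⟩ := eventually_prod_iff.1 hG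
  filter_upwards [hb.eventually_nhds] with ζ' hζ'
  exact eventually_prod_iff.2 ⟨pa, ha, pb, hζ', hab⟩

namespace SphereDensity

variable {f : U → ℝ} {X : U → W} {R : ℝ}

theorem abs_inner_le (S : SphereDensity μ f X R) (t : W) (u : U) : |inner ℝ t (X u)| ≤ R * ‖t‖ := by
  have := abs_real_inner_le_norm t (X u)
  rwa [S.norm_eq, mul_comm] at this

theorem inner_le (S : SphereDensity μ f X R) (t : W) (u : U) : inner ℝ t (X u) ≤ R * ‖t‖ :=
  (le_abs_self _).trans (S.abs_inner_le t u)

theorem integrable_mul_exp (S : SphereDensity μ f X R) {w : U → ℝ} (hw : Integrable w μ) (t : W) :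
    Integrable (fun u => w u * Real.exp (inner ℝ t (X u))) μ := by
  have := S.measurable
  refine hw.mul_bdd (c := Real.exp (R * ‖t‖)) (by fun_prop) (Eventually.of_forall fun u => ?_)
  rw [Real.norm_eq_abs, Real.abs_exp]
  exact Real.exp_le_exp.2 (S.inner_le t u)

theorem abs_laplace_le (S : SphereDensity μ f X R) {w : U → ℝ} (hw : Integrable w μ) (t : W) :
    |laplace μ w X t| ≤ (∫ u, |w u| ∂μ) * Real.exp (R * ‖t‖) := by
  rw [laplace, ← integral_mul_const, ← Real.norm_eq_abs]
  refine norm_integral_le_of_norm_le (hw.abs.mul_const _) (Eventually.of_forall fun u => ?_)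
  rw [norm_mul, Real.norm_eq_abs, Real.norm_eq_abs, Real.abs_exp]
  gcongr
  exact S.inner_le t u

/-- The growth of the Laplace transform in a direction controls the support in this direction. -/
theorem eq_zero_of_expGrowth (S : SphereDensity μ f X R) {ζ : W} {h : ℝ}
    (hG : ExpGrowth (laplace μ f X) ζ h) :
    ∀ᵐ u ∂μ, h < inner ℝ ζ (X u) → f u = 0 := by
  have hXm := S.measurable
  have hset : MeasurableSet {u | h < inner ℝ ζ (X u)} :=
    measurableSet_lt measurable_const (by fun_prop)
  set P := {u | h < inner ℝ ζ (X u)} with hP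
  set a : U → ℂ := fun u => ((inner ℝ ζ (X u) - h : ℝ) : ℂ) with ha
  have ham : AEStronglyMeasurable a μ := by
    have : Measurable a := by fun_prop
    exact this.aestronglyMeasurable
  set B := R * ‖ζ‖ + |h| with hB
  have haB : ∀ u, ‖a u‖ ≤ B := fun u => by
    rw [ha, Complex.norm_real, Real.norm_eq_abs]
    exact (abs_sub _ _).trans (add_le_add (S.abs_inner_le ζ u) le_rfl)
  have hB0 : 0 ≤ B := by have := S.nonneg; positivity
  -- Put `a = ⟨ζ, X⟩ - h`. The part of the transform coming from `P` is bounded on the left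
  -- half-plane, the part coming from its complement on the right one. The growth hypothesis bounds
  -- the sum on the positive axis, hence on the right half-plane by Phragmén–Lindelöf. So the `P`
  -- part is bounded and entire, therefore constant, and it tends to `0` at `-∞`.
  have key : ∀ y, laplace μ (P.indicator f) X y = 0 := by
    intro y
    set w : U → ℂ := fun u => ((f u * Real.exp (inner ℝ y (X u)) : ℝ) : ℂ) with hw
    have hwi : Integrable w μ := (S.integrable_mul_exp S.integrable y).ofReal
    set C := ∫ u, ‖w u‖ ∂μ with hC
    have hip : Integrable (P.indicator w) μ := hwi.indicator hset
    have hin : Integrable (Pᶜ.indicator w) μ := hwi.indicator hset.compl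
    have hsum : ∀ z, laplaceC μ w a z =
        laplaceC μ (P.indicator w) a z + laplaceC μ (Pᶜ.indicator w) a z := by
      intro z
      rw [laplaceC, laplaceC, laplaceC, ← integral_add (SphereDeconv.integrable_mul_exp hip ham haB z)
        (SphereDeconv.integrable_mul_exp hin ham haB z)]
      refine integral_congr_ae (Eventually.of_forall fun u => ?_)
      simp only [← add_mul]
      congr 1
      exact (congrFun (indicator_self_add_compl P w) u).symm
    have hbd : ∀ (v : U → ℂ) (z : ℂ), (∀ u, ‖v u‖ ≤ ‖w u‖) →
        (∀ u, v u ≠ 0 → (z * a u).re ≤ 0) → ‖laplaceC μ v a z‖ ≤ C := by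
      intro v z hv hz
      refine norm_integral_le_of_norm_le hwi.norm (Eventually.of_forall fun u => ?_)
      rw [norm_mul, Complex.norm_exp]
      rcases eq_or_ne (v u) 0 with h0 | h0
      · rw [h0, norm_zero, zero_mul]; exact norm_nonneg _
      · exact (mul_le_mul (hv u) (Real.exp_le_one_iff.2 (hz u h0)) (Real.exp_pos _).le
          (norm_nonneg _)).trans_eq (mul_one _)
    have hre : ∀ z u, (z * a u).re = z.re * (inner ℝ ζ (X u) - h) := fun z u => by
      rw [ha, Complex.re_mul_ofReal]
    have hminus : ∀ z : ℂ, 0 ≤ z.re → ‖laplaceC μ (Pᶜ.indicator w) a z‖ ≤ C := fun z hz =>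
      hbd _ z (fun u => norm_indicator_le_norm_self _ _) fun u hu => by
        have hu' : u ∈ Pᶜ := mem_of_indicator_ne_zero hu
        have : inner ℝ ζ (X u) ≤ h := not_lt.1 hu'
        rw [hre]
        exact mul_nonpos_of_nonneg_of_nonpos hz (sub_nonpos.2 this)
    have hplus : ∀ z : ℂ, z.re ≤ 0 → ‖laplaceC μ (P.indicator w) a z‖ ≤ C := fun z hz =>
      hbd _ z (fun u => norm_indicator_le_norm_self _ _) fun u hu => by
        have hu'' : u ∈ P := mem_of_indicator_ne_zero hu
        have hu' : h < inner ℝ ζ (X u) := hu''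
        rw [hre]
        exact mul_nonpos_of_nonpos_of_nonneg hz (sub_pos.2 hu').le
    have hdiff := differentiable_laplaceC hwi ham haB
    have hPL : ∀ z : ℂ, 0 ≤ z.re → ‖laplaceC μ w a z‖ ≤ C := by
      intro z hz
      refine PhragmenLindelof.right_half_plane_of_bounded_on_real hdiff.diffContOnCl
        ⟨1, one_lt_two, B, ?_⟩ ?_ (fun x => ?_) hz
      · refine Asymptotics.IsBigO.of_bound C (Eventually.of_forall fun z => ?_)
        rw [Real.norm_eq_abs, Real.abs_exp, Real.rpow_one]
        exact norm_laplaceC_le hwi haB z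
      -- Here the uniformity of `ExpGrowth` in the direction is needed: tilting by `y` replaces `ζ`
      -- by `ζ + t⁻¹ y`.
      · have ht : Tendsto (fun t : ℝ => (t, ζ + t⁻¹ • y)) atTop (atTop ×ˢ 𝓝 ζ) := by
          refine tendsto_id.prodMk ?_
          have := (tendsto_inv_atTop_zero (𝕜 := ℝ)).smul_const y
          simpa using this.const_add ζ
        refine ⟨1, eventually_map.2 ?_⟩
        filter_upwards [ht.eventually hG, eventually_gt_atTop (0 : ℝ)] with t h1 h2
        have e : laplaceC μ w a t = ((laplace μ f X (t • (ζ + t⁻¹ • y)) *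
            Real.exp (-(t * h)) : ℝ) : ℂ) := by
          rw [laplace, ← integral_mul_const, laplaceC, ← integral_complex_ofReal]
          refine integral_congr_ae (Eventually.of_forall fun u => ?_)
          simp only [hw, ha, smul_add, smul_inv_smul₀ h2.ne', inner_add_left, inner_smul_left,
            RCLike.conj_to_real]
          rw [mul_assoc (f u), ← Real.exp_add]
          push_cast
          rw [mul_assoc, ← Complex.exp_add]
          congr 2
          ring
        change ‖laplaceC μ w a t‖ ≤ 1
        rw [e, Complex.norm_real, Real.norm_eq_abs, abs_mul, Real.abs_exp, Real.exp_neg,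
          ← div_eq_mul_inv, div_le_one (Real.exp_pos _)]
        exact h1
      · refine hbd w _ (fun u => le_rfl) fun u _ => ?_
        rw [hre]
        simp
    have hbdd : Bornology.IsBounded (range (laplaceC μ (P.indicator w) a)) := by
      refine isBounded_iff_forall_norm_le.2 ⟨2 * C, ?_⟩
      rintro _ ⟨z, rfl⟩
      have hC0 : 0 ≤ C := integral_nonneg fun u => norm_nonneg _
      rcases le_total z.re 0 with hz | hz
      · linarith [hplus z hz]
      · have : laplaceC μ (P.indicator w) a z =
            laplaceC μ w a z - laplaceC μ (Pᶜ.indicator w) a z := by rw [hsum]; ring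
        rw [this]
        refine (norm_sub_le _ _).trans ?_
        linarith [hminus z hz, hPL z hz]
    have hconst := (differentiable_laplaceC hip ham haB).apply_eq_apply_of_bounded hbdd
    have hlim : Tendsto (fun n : ℕ => laplaceC μ (P.indicator w) a (-n)) atTop (𝓝 0) := by
      have : (0 : ℂ) = ∫ u, (0 : ℂ) ∂μ := by simp
      rw [this]
      refine tendsto_integral_of_dominated_convergence (fun u => ‖w u‖)
        (fun n => (SphereDeconv.integrable_mul_exp hip ham haB _).aestronglyMeasurable) hwi.norm
        (fun n => Eventually.of_forall fun u => ?_) (Eventually.of_forall fun u => ?_)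
      · by_cases hu : u ∈ P
        · rw [norm_mul, Complex.norm_exp, hre, indicator_of_mem hu]
          refine mul_le_of_le_one_right (norm_nonneg _) (Real.exp_le_one_iff.2 ?_)
          have hu' : h < inner ℝ ζ (X u) := hu
          simp only [Complex.neg_re, Complex.natCast_re]
          nlinarith [(Nat.cast_nonneg n : (0 : ℝ) ≤ n)]
        · rw [indicator_of_notMem hu, zero_mul, norm_zero]; exact norm_nonneg _
      · by_cases hu : u ∈ P
        · have hu' : h < inner ℝ ζ (X u) := hu
          rw [← mul_zero (P.indicator w u)]
          refine Tendsto.const_mul _ (tendsto_zero_iff_norm_tendsto_zero.2 ?_)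
          simp only [Complex.norm_exp, hre, Complex.neg_re, Complex.natCast_re, neg_mul]
          exact Real.tendsto_exp_neg_atTop_nhds_zero.comp
            (tendsto_natCast_atTop_atTop.atTop_mul_const (sub_pos.2 hu'))
        · simp [indicator_of_notMem hu]
    have h0 : laplaceC μ (P.indicator w) a 0 = 0 := by
      refine tendsto_nhds_unique ?_ hlim
      refine tendsto_const_nhds.congr fun n => hconst _ _
    have e : laplaceC μ (P.indicator w) a 0 = ((laplace μ (P.indicator f) X y : ℝ) : ℂ) := by
      rw [laplace, laplaceC, ← integral_complex_ofReal]
      refine integral_congr_ae (Eventually.of_forall fun u => ?_)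
      by_cases hu : u ∈ P
      · simp [indicator_of_mem hu, hw]
      · simp [indicator_of_notMem hu]
    rw [e] at h0
    exact_mod_cast h0
  filter_upwards [S.det _ (S.integrable.indicator hset) key] with u hu hlt
  have : u ∈ P := hlt
  simpa [indicator_of_mem this] using hu

/-- If the growth function `H` is attained at `ζ`, it is attained through a point of the sphere
which is compatible with the growth in the other directions. -/
theorem exists_support_point (S : SphereDensity μ f X R) {O : Set W} {H : W → ℝ}
    (hH : ∀ ζ ∈ O, ∀ h > H ζ, ExpGrowth (laplace μ f X) ζ h) {ζ : W} (hζ : ζ ∈ O)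
    (hlow : ∀ δ > 0, ¬ ExpGrowth (laplace μ f X) ζ (H ζ - δ)) :
    ∃ p, ‖p‖ = R ∧ inner ℝ ζ p = H ζ ∧ ∀ ζ' ∈ O, inner ℝ ζ' p ≤ H ζ' := by
  -- Otherwise each point of the cap `⟨ζ, p⟩ ≥ H ζ` of the sphere lies in an open half-space where
  -- `f` vanishes, by `eq_zero_of_expGrowth`. By compactness `f` vanishes on a neighbourhood `V` of
  -- the cap, and the growth at `ζ` is then strictly below `H ζ`.
  by_contra! hcon
  have hc : ∀ p, ‖p‖ = R → H ζ ≤ inner ℝ ζ p → ∃ ζ' ∈ O, H ζ' < inner ℝ ζ' p := by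
    intro p hp hle
    rcases hle.eq_or_lt with he | hlt
    · exact hcon p hp he.symm
    · exact ⟨ζ, hζ, hlt⟩
  set A := Metric.sphere (0 : W) R ∩ {p | H ζ ≤ inner ℝ ζ p} with hA
  have hAc : IsCompact A :=
    (isCompact_sphere 0 R).inter_right (isClosed_le continuous_const (by fun_prop))
  obtain ⟨V, hVo, hAV, hV⟩ : ∃ V : Set W, IsOpen V ∧ A ⊆ V ∧ ∀ᵐ u ∂μ, X u ∈ V → f u = 0 := by
    refine hAc.induction_on (p := fun s => ∃ V : Set W, IsOpen V ∧ s ⊆ V ∧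
      ∀ᵐ u ∂μ, X u ∈ V → f u = 0) ⟨∅, isOpen_empty, subset_rfl, by simp⟩
      (fun s t hst ⟨V, h1, h2, h3⟩ => ⟨V, h1, hst.trans h2, h3⟩)
      (fun s t ⟨V, h1, h2, h3⟩ ⟨V', h1', h2', h3'⟩ =>
        ⟨V ∪ V', h1.union h1', union_subset_union h2 h2', ?_⟩) fun p hp => ?_
    · filter_upwards [h3, h3'] with u hu hu' h
      exact h.elim hu hu'
    · obtain ⟨ζ', hζ', hlt⟩ := hc p (by simpa using hp.1) hp.2
      obtain ⟨h, h1, h2⟩ := exists_between hlt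
      have hopen : IsOpen {x : W | h < inner ℝ ζ' x} := isOpen_lt continuous_const (by fun_prop)
      exact ⟨_, mem_nhdsWithin_of_mem_nhds (hopen.mem_nhds h2), _, hopen, subset_rfl,
        S.eq_zero_of_expGrowth (hH ζ' hζ' h h1)⟩
  obtain ⟨δ, hδ, hδV⟩ : ∃ δ > 0, ∀ p ∈ Metric.sphere (0 : W) R \ V, inner ℝ ζ p ≤ H ζ - 2 * δ := by
    have hcK : IsCompact (Metric.sphere (0 : W) R \ V) := (isCompact_sphere 0 R).diff hVo
    rcases (Metric.sphere (0 : W) R \ V).eq_empty_or_nonempty with he | hne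
    · exact ⟨1, one_pos, by simp [he]⟩
    · obtain ⟨q, hq, hmax⟩ := hcK.exists_isMaxOn hne
        (f := fun p => inner ℝ ζ p) (by fun_prop)
      have hlt : inner ℝ ζ q < H ζ := by
        by_contra! hle
        exact hq.2 (hAV ⟨hq.1, hle⟩)
      refine ⟨(H ζ - inner ℝ ζ q) / 2, by linarith, fun p hp => ?_⟩
      have := hmax hp
      simp only [mem_ofPred_eq] at this
      linarith
  -- Of the gap `2 δ`, one half of `δ` pays for moving the direction and another one for the
  -- constant `∫ |f|`.
  refine hlow δ hδ (ExpGrowth.of_eventually_le (C := ∫ u, |f u| ∂μ) (h := H ζ - 3 / 2 * δ)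
    (by linarith) ?_)
  have hnear : ∀ᶠ ζ' in 𝓝 ζ, R * ‖ζ' - ζ‖ < δ / 2 := by
    have : Continuous fun ζ' => R * ‖ζ' - ζ‖ := by fun_prop
    have h2 := this.tendsto ζ
    simp only [sub_self, norm_zero, mul_zero] at h2
    exact h2.eventually_lt_const (by linarith)
  filter_upwards [tendsto_snd.eventually hnear,
    tendsto_fst.eventually (eventually_ge_atTop (0 : ℝ))] with p hp ht
  rw [laplace, ← integral_mul_const, ← Real.norm_eq_abs]
  refine norm_integral_le_of_norm_le (S.integrable.abs.mul_const _) ?_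
  filter_upwards [hV] with u hu
  rw [norm_mul, Real.norm_eq_abs, Real.norm_eq_abs, Real.abs_exp]
  by_cases hXV : X u ∈ V
  · simp [hu hXV]
  · have h1 := hδV (X u) ⟨by simp [S.norm_eq], hXV⟩
    have h2 := S.inner_le (p.2 - ζ) u
    rw [inner_sub_left] at h2
    rw [inner_smul_left, RCLike.conj_to_real]
    gcongr
    linarith

/-- The linear function `⟨·, p⟩` stays below `H ≤ ψ` near `ζ` and meets `ψ` at `ζ`, so its gradient
`p` is that of `ψ`. -/
theorem inner_eq_of_support_point {p ζ v : W} {H ψ : W → ℝ} (hψ : HasFDerivAt ψ (innerSL ℝ v) ζ)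
    (hle : ∀ᶠ ζ' in 𝓝 ζ, inner ℝ ζ' p ≤ H ζ') (hHψ : ∀ᶠ ζ' in 𝓝 ζ, H ζ' ≤ ψ ζ')
    (heq : inner ℝ ζ p = ψ ζ) : p = v := by
  have hmin : IsLocalMin (fun ζ' => ψ ζ' - inner ℝ ζ' p) ζ := by
    filter_upwards [hle, hHψ] with ζ' h1 h2
    rw [heq]
    linarith
  have hd : HasFDerivAt (fun ζ' => ψ ζ' - inner ℝ ζ' p) (innerSL ℝ v - innerSL ℝ p) ζ := by
    refine hψ.sub ?_
    have := (innerSL ℝ p).hasFDerivAt (x := ζ)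
    refine this.congr_of_eventuallyEq (Eventually.of_forall fun x => ?_)
    simp [real_inner_comm]
  have h0 := hmin.hasFDerivAt_eq_zero hd
  rw [← map_sub] at h0
  have h1 := congrArg (fun L => L (v - p)) h0
  simp only [innerSL_apply_apply, zero_apply, inner_self_eq_zero] at h1
  exact (sub_eq_zero.1 h1).symm

end SphereDensity

/-- Every neighbourhood of `p` has positive mass under the law of `X` with density `f`. -/
def IsMassPoint (μ : Measure U) (f : U → ℝ) (X : U → W) (p : W) : Prop :=
  ∀ δ > 0, 0 < ∫ u in {u | ‖X u - p‖ < δ}, f u ∂μ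

/-- A small ball around `p` carries a mass `c > 0`, and there `⟨ζ', X⟩` is close to `⟨ζ, p⟩`. The
factor `c` is absorbed in the loss `δ`. -/
theorem IsMassPoint.eventually_exp_le_laplace {f : U → ℝ} {X : U → W} {R : ℝ} {p ζ : W}
    (hp : IsMassPoint μ f X p) (S : SphereDensity μ f X R) (hf : ∀ᵐ u ∂μ, 0 ≤ f u) {δ : ℝ}
    (hδ : 0 < δ) : ∀ᶠ q : ℝ × W in atTop ×ˢ 𝓝 ζ,
      Real.exp (q.1 * (inner ℝ p ζ - δ)) ≤ laplace μ f X (q.1 • q.2) := by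
  have hXm := S.measurable
  set η := δ / (4 * (‖ζ‖ + 1)) with hη
  have hη0 : 0 < η := by positivity
  have hset : MeasurableSet {u | ‖X u - p‖ < η} := measurableSet_lt (by fun_prop) measurable_const
  set c := ∫ u in {u | ‖X u - p‖ < η}, f u ∂μ with hc
  have hc0 : 0 < c := hp η hη0
  have hnear : ∀ᶠ ζ' in 𝓝 ζ, ‖p‖ * ‖ζ' - ζ‖ < δ / 4 ∧ ‖ζ'‖ < ‖ζ‖ + 1 := by
    have h1 : Continuous fun ζ' => ‖p‖ * ‖ζ' - ζ‖ := by fun_prop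
    have h2 := h1.tendsto ζ
    simp only [sub_self, norm_zero, mul_zero] at h2
    exact (h2.eventually_lt_const (by linarith)).and
      (continuous_norm.continuousAt.eventually_lt_const (by linarith))
  filter_upwards [tendsto_snd.eventually hnear,
    tendsto_fst.eventually (eventually_ge_atTop (0 : ℝ)),
    eventually_const_mul_exp_le (C := c⁻¹) (h := inner ℝ p ζ - δ) (h' := inner ℝ p ζ - δ / 2)
      (by linarith) tendsto_fst] with q hq ht hexp
  have h0 : 0 ≤ᵐ[μ] fun u => f u * Real.exp (inner ℝ (q.1 • q.2) (X u)) := by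
    filter_upwards [hf] with u hu
    simp only [Pi.zero_apply]
    positivity
  calc Real.exp (q.1 * (inner ℝ p ζ - δ))
      ≤ c * Real.exp (q.1 * (inner ℝ p ζ - δ / 2)) := by
        rwa [inv_mul_le_iff₀ hc0] at hexp
    _ = ∫ u in {u | ‖X u - p‖ < η}, f u * Real.exp (q.1 * (inner ℝ p ζ - δ / 2)) ∂μ := by
        rw [integral_mul_const]
    _ ≤ ∫ u in {u | ‖X u - p‖ < η}, f u * Real.exp (inner ℝ (q.1 • q.2) (X u)) ∂μ := by
        refine integral_mono_ae (S.integrable.integrableOn.mul_const _)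
          (S.integrable_mul_exp S.integrable _).integrableOn ?_
        filter_upwards [ae_restrict_of_ae hf, ae_restrict_mem hset] with u hu hmem
        rw [inner_smul_left, RCLike.conj_to_real]
        gcongr
        have hmem' : ‖X u - p‖ < η := hmem
        have e : inner ℝ q.2 (X u) = inner ℝ p ζ + inner ℝ q.2 (X u - p) +
            inner ℝ (q.2 - ζ) p := by
          rw [inner_sub_right, inner_sub_left, real_inner_comm p ζ]; ring
        have e1 := neg_le_of_abs_le (abs_real_inner_le_norm q.2 (X u - p))
        have e2 := neg_le_of_abs_le (abs_real_inner_le_norm (q.2 - ζ) p)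
        have e3 : ‖q.2‖ * ‖X u - p‖ ≤ δ / 4 := by
          calc _ ≤ (‖ζ‖ + 1) * η := by gcongr; exact hq.2.le
            _ = δ / 4 := by rw [hη]; field_simp
        have e4 : ‖q.2 - ζ‖ * ‖p‖ ≤ δ / 4 := by rw [mul_comm]; exact hq.1.le
        linarith
    _ ≤ _ := setIntegral_le_integral (S.integrable_mul_exp S.integrable _) h0

end Support

/-! ### The Helmholtz equation for Laplace transforms on a sphere -/

section Smooth

variable {U : Type*} [MeasurableSpace U] {μ : Measure U}
  {W : Type*} [NormedAddCommGroup W] [InnerProductSpace ℝ W] [FiniteDimensional ℝ W]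
  [MeasurableSpace W] [BorelSpace W]

namespace SphereDensity

variable {f : U → ℝ} {X : U → W} {R : ℝ}

theorem integrable_mul_clm (S : SphereDensity μ f X R) {w : U → ℝ} (hw : Integrable w μ)
    (L : W →L[ℝ] ℝ) : Integrable (fun u => w u * L (X u)) μ := by
  refine hw.mul_bdd (c := ‖L‖ * R) ?_ (Eventually.of_forall fun u => ?_)
  · exact (L.continuous.measurable.comp S.measurable).aestronglyMeasurable
  · rw [← S.norm_eq u]; exact L.le_opNorm _

theorem hasFDerivAt_laplace (S : SphereDensity μ f X R) {w : U → ℝ} (hw : Integrable w μ) (t : W) :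
    HasFDerivAt (laplace μ w X)
      (∫ u, (w u * Real.exp (inner ℝ t (X u))) • innerSL ℝ (X u) ∂μ) t := by
  have hXm := S.measurable
  have hm : ∀ t : W, AEStronglyMeasurable
      (fun u => (w u * Real.exp (inner ℝ t (X u))) • innerSL ℝ (X u)) μ := fun t =>
    (S.integrable_mul_exp hw t).aestronglyMeasurable.smul
      ((innerSL ℝ).continuous.comp_aestronglyMeasurable hXm.aestronglyMeasurable)
  refine hasFDerivAt_integral_of_dominated_of_fderiv_le (Metric.ball_mem_nhds t one_pos)
    (F := fun t u => w u * Real.exp (inner ℝ t (X u)))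
    (F' := fun t u => (w u * Real.exp (inner ℝ t (X u))) • innerSL ℝ (X u))
    (bound := fun u => |w u| * (Real.exp (R * (‖t‖ + 1)) * R))
    (Eventually.of_forall fun t => (S.integrable_mul_exp hw t).aestronglyMeasurable)
    (S.integrable_mul_exp hw t) (hm t) (Eventually.of_forall fun u x hx => ?_)
    (hw.abs.mul_const _) (Eventually.of_forall fun u x _ => ?_)
  · rw [norm_smul, norm_mul, Real.norm_eq_abs, Real.norm_eq_abs, Real.abs_exp, mul_assoc,
      innerSL_apply_norm, S.norm_eq]
    have hx' : ‖x‖ ≤ ‖t‖ + 1 := by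
      have : ‖x‖ ≤ ‖x - t‖ + ‖t‖ := by simpa using norm_add_le (x - t) t
      rw [mem_ball_iff_norm] at hx
      linarith
    have := S.nonneg
    gcongr
    exact (S.inner_le x u).trans (by gcongr)
  · have h1 : HasFDerivAt (fun x : W => (inner ℝ x (X u) : ℝ)) (innerSL ℝ (X u)) x := by
      refine (innerSL ℝ (X u)).hasFDerivAt.congr_of_eventuallyEq (Eventually.of_forall fun x => ?_)
      simp [real_inner_comm]
    have := (h1.exp).const_mul (w u)
    rwa [smul_smul] at this

theorem fderiv_laplace (S : SphereDensity μ f X R) {w : U → ℝ} (hw : Integrable w μ) (t v : W) :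
    fderiv ℝ (laplace μ w X) t v = laplace μ (fun u => w u * inner ℝ v (X u)) X t := by
  have hi : Integrable (fun u => (w u * Real.exp (inner ℝ t (X u))) • innerSL ℝ (X u)) μ := by
    have h1 := (S.integrable_mul_exp hw t)
    refine Integrable.mono' (h1.abs.mul_const R) (h1.aestronglyMeasurable.smul
      ((innerSL ℝ).continuous.comp_aestronglyMeasurable S.measurable.aestronglyMeasurable))
      (Eventually.of_forall fun u => ?_)
    rw [norm_smul, innerSL_apply_norm, S.norm_eq, Real.norm_eq_abs]
  rw [(S.hasFDerivAt_laplace hw t).fderiv, ContinuousLinearMap.integral_apply hi, laplace]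
  refine integral_congr_ae (Eventually.of_forall fun u => ?_)
  simp only [smul_apply, innerSL_apply_apply, smul_eq_mul]
  rw [real_inner_comm v]
  ring

theorem differentiable_laplace (S : SphereDensity μ f X R) {w : U → ℝ} (hw : Integrable w μ) :
    Differentiable ℝ (laplace μ w X) := fun t => (S.hasFDerivAt_laplace hw t).differentiableAt

theorem integrable_mul_inner (S : SphereDensity μ f X R) {w : U → ℝ} (hw : Integrable w μ)
    (v : W) : Integrable (fun u => w u * inner ℝ v (X u)) μ := by
  simpa using S.integrable_mul_clm hw (innerSL ℝ v)

theorem contDiff_laplace (S : SphereDensity μ f X R) (n : ℕ) {w : U → ℝ} (hw : Integrable w μ) :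
    ContDiff ℝ n (laplace μ w X) := by
  induction n generalizing w with
  | zero => exact contDiff_zero.2 (S.differentiable_laplace hw).continuous
  | succ n ih =>
    push_cast
    rw [contDiff_succ_iff_fderiv_apply]
    refine ⟨S.differentiable_laplace hw, by simp, fun v => ?_⟩
    simp_rw [S.fderiv_laplace hw]
    exact ih (S.integrable_mul_inner hw v)

theorem laplace_pos (S : SphereDensity μ f X R) (hf : ∀ᵐ u ∂μ, 0 ≤ f u) (h1 : ∫ u, f u ∂μ = 1)
    (t : W) : 0 < laplace μ f X t :=
  integral_exp_pos hf h1 (S.integrable_mul_exp S.integrable t)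

end SphereDensity

/-- The trace of the second derivative. -/
noncomputable def trLaplacian (F : W → ℝ) (t : W) : ℝ :=
  ∑ i, fderiv ℝ (fun x => fderiv ℝ F x (stdOrthonormalBasis ℝ W i)) t (stdOrthonormalBasis ℝ W i)

theorem sum_inner_mul_inner (v w : W) :
    ∑ i, inner ℝ (stdOrthonormalBasis ℝ W i) v * inner ℝ (stdOrthonormalBasis ℝ W i) w =
      inner ℝ v w := by
  rw [← (stdOrthonormalBasis ℝ W).sum_inner_mul_inner v w]
  refine Finset.sum_congr rfl fun i _ => ?_
  rw [real_inner_comm v]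

/-- Each derivative brings down a coordinate of `X`, and the squares of the coordinates add up to
`R²`. -/
theorem SphereDensity.trLaplacian_laplace {f : U → ℝ} {X : U → W} {R : ℝ}
    (S : SphereDensity μ f X R) (t : W) :
    trLaplacian (laplace μ f X) t = R ^ 2 * laplace μ f X t := by
  rw [trLaplacian]
  simp_rw [S.fderiv_laplace S.integrable, S.fderiv_laplace (S.integrable_mul_inner S.integrable _)]
  simp only [laplace]
  rw [← integral_finsetSum, ← integral_const_mul]
  · refine integral_congr_ae (Eventually.of_forall fun u => ?_)
    have := sum_inner_mul_inner (X u) (X u)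
    rw [real_inner_self_eq_norm_sq, S.norm_eq] at this
    simp only
    rw [← this, Finset.sum_mul]
    refine Finset.sum_congr rfl fun i _ => ?_
    ring
  · intro i _
    exact S.integrable_mul_exp (S.integrable_mul_inner (S.integrable_mul_inner S.integrable _) _) t

theorem contDiff_fderiv_apply_const {F : W → ℝ} {n : ℕ} (hF : ContDiff ℝ (n + 1 : ℕ) F) (v : W) :
    ContDiff ℝ n fun x => fderiv ℝ F x v := by
  push_cast at hF
  exact (contDiff_succ_iff_fderiv_apply.1 hF).2.2 v

theorem trLaplacian_mul {F G : W → ℝ} (hF : ContDiff ℝ (2 : ℕ) F) (hG : ContDiff ℝ (2 : ℕ) G)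
    (t : W) : trLaplacian (fun x => F x * G x) t = trLaplacian F t * G t +
      2 * (∑ i, fderiv ℝ F t (stdOrthonormalBasis ℝ W i) *
        fderiv ℝ G t (stdOrthonormalBasis ℝ W i)) + F t * trLaplacian G t := by
  have dF : Differentiable ℝ F := hF.differentiable (by simp)
  have dG : Differentiable ℝ G := hG.differentiable (by simp)
  have dF' : ∀ v, Differentiable ℝ fun x => fderiv ℝ F x v := fun v =>
    (contDiff_fderiv_apply_const (n := 1) hF v).differentiable (by simp)
  have dG' : ∀ v, Differentiable ℝ fun x => fderiv ℝ G x v := fun v =>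
    (contDiff_fderiv_apply_const (n := 1) hG v).differentiable (by simp)
  have h1 : ∀ x v, fderiv ℝ (fun x => F x * G x) x v = F x * fderiv ℝ G x v +
      G x * fderiv ℝ F x v := by
    intro x v
    rw [fderiv_fun_mul (dF x) (dG x)]
    simp
  simp only [trLaplacian, h1]
  rw [Finset.sum_mul, Finset.mul_sum, Finset.mul_sum, ← Finset.sum_add_distrib,
    ← Finset.sum_add_distrib]
  refine Finset.sum_congr rfl fun i _ => ?_
  rw [fderiv_fun_add ((dF t).fun_mul (dG' _ t)) ((dG t).fun_mul (dF' _ t)), fderiv_fun_mul (dF t) (dG' _ t),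
    fderiv_fun_mul (dG t) (dF' _ t)]
  simp only [add_apply, smul_apply, smul_eq_mul]
  ring

/-- Two Laplace transforms of densities on the same sphere solve the same Helmholtz equation. -/
theorem trLaplacian_ratio {f g : U → ℝ} {X Z : U → W} {R : ℝ} (S : SphereDensity μ f X R)
    (T : SphereDensity μ g Z R) {Γ : W → ℝ} (hΓ : ContDiff ℝ (2 : ℕ) Γ)
    (h : ∀ t, laplace μ f X t = Γ t * laplace μ g Z t) (t : W) :
    trLaplacian Γ t * laplace μ g Z t +
      2 * laplace μ (fun u => g u * fderiv ℝ Γ t (Z u)) Z t = 0 := by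
  have h1 := S.trLaplacian_laplace t
  have h2 : laplace μ f X = fun t => Γ t * laplace μ g Z t := funext h
  rw [h2] at h1
  -- The terms `R² Γ` times the transform of `g` cancel. The cross term, a product of gradients, is
  -- itself the Laplace transform of the weight `g dΓ(Z)`.
  rw [trLaplacian_mul hΓ (T.contDiff_laplace 2 T.integrable), T.trLaplacian_laplace] at h1
  have h3 : ∑ i, fderiv ℝ Γ t (stdOrthonormalBasis ℝ W i) *
      fderiv ℝ (laplace μ g Z) t (stdOrthonormalBasis ℝ W i) =
      laplace μ (fun u => g u * fderiv ℝ Γ t (Z u)) Z t := by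
    simp_rw [T.fderiv_laplace T.integrable, laplace]
    simp_rw [← integral_const_mul]
    rw [← integral_finsetSum]
    · refine integral_congr_ae (Eventually.of_forall fun u => ?_)
      simp only
      have hz : fderiv ℝ Γ t (Z u) = ∑ i, inner ℝ (stdOrthonormalBasis ℝ W i) (Z u) *
          fderiv ℝ Γ t (stdOrthonormalBasis ℝ W i) := by
        nth_rw 1 [← (stdOrthonormalBasis ℝ W).sum_repr' (Z u)]
        rw [map_sum]
        simp only [map_smul, smul_eq_mul]
      rw [hz, Finset.mul_sum, Finset.sum_mul]
      refine Finset.sum_congr rfl fun i _ => ?_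
      ring
    · intro i _
      exact (T.integrable_mul_exp (T.integrable_mul_inner T.integrable _) t).const_mul _
  rw [h3] at h1
  linarith

end Smooth

/-! ### Growth of the elementary factors -/

section Growth

variable {U : Type*} [MeasurableSpace U] {μ : Measure U}
  {W : Type*} [NormedAddCommGroup W] [InnerProductSpace ℝ W] [FiniteDimensional ℝ W]
  [MeasurableSpace W] [BorelSpace W]

/-- A point which is not a mass point has a ball in which `f` vanishes almost everywhere, and a
locally null set is null. -/
theorem ae_isMassPoint {f : U → ℝ} {X : U → W} {R : ℝ} (S : SphereDensity μ f X R)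
    (hf : ∀ᵐ u ∂μ, 0 ≤ f u) : ∀ᵐ u ∂μ, f u ≠ 0 → IsMassPoint μ f X (X u) := by
  have hXm := S.measurable
  have hms : NullMeasurableSet {u | f u ≠ 0} μ :=
    (S.integrable.aemeasurable.nullMeasurable (measurableSet_singleton 0)).compl
  set ν := (μ.restrict {u | f u ≠ 0}).map X with hν
  have hnull : ν {p | ¬ IsMassPoint μ f X p} = 0 := by
    refine measure_null_of_locally_null _ fun p hp => ?_
    simp only [IsMassPoint, mem_ofPred_eq] at hp
    push Not at hp
    obtain ⟨δ, hδ, hle⟩ := hp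
    refine ⟨Metric.ball p δ, mem_nhdsWithin_of_mem_nhds (Metric.ball_mem_nhds p hδ), ?_⟩
    rw [hν, Measure.map_apply hXm measurableSet_ball]
    have hset : {u | ‖X u - p‖ < δ} = X ⁻¹' Metric.ball p δ := by
      ext u; simp [dist_eq_norm]
    rw [hset] at hle
    have hmB : MeasurableSet (X ⁻¹' Metric.ball p δ) := hXm measurableSet_ball
    have h0 : ∀ᵐ u ∂μ.restrict (X ⁻¹' Metric.ball p δ), f u = 0 := by
      have hnn := ae_restrict_of_ae (s := X ⁻¹' Metric.ball p δ) hf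
      have := (integral_eq_zero_iff_of_nonneg_ae hnn S.integrable.integrableOn).1
        (le_antisymm hle (integral_nonneg_of_ae hnn))
      exact this
    rw [ae_restrict_iff' hmB] at h0
    rw [Measure.restrict_apply hmB]
    refine measure_mono_null (fun u hu => ?_) h0
    exact fun h => hu.2 (h hu.1)
  have h1 : ∀ᵐ p ∂ν, IsMassPoint μ f X p := hnull
  have h2 := ae_of_ae_map hXm.aemeasurable h1
  rwa [ae_restrict_iff'₀ hms] at h2

/-- Affine factors are invisible at the exponential scale. -/
theorem eventually_affine_le (κ : ℝ) (e ζ : W) {δ : ℝ} (hδ : 0 < δ) :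
    ∀ᶠ q : ℝ × W in atTop ×ˢ 𝓝 ζ, |1 - κ * inner ℝ e (q.1 • q.2)| ≤ Real.exp (q.1 * δ) := by
  have hb : ∀ᶠ ζ' in 𝓝 ζ, |κ * inner ℝ e ζ'| < |κ * inner ℝ e ζ| + 1 := by
    have h : Continuous fun ζ' : W => |κ * inner ℝ e ζ'| := by fun_prop
    exact (h.tendsto ζ).eventually_lt_const (by linarith)
  set A := |κ * inner ℝ e ζ| + 1 with hA
  have hA0 : 0 < A := by positivity
  filter_upwards [tendsto_snd.eventually hb, tendsto_fst.eventually (eventually_ge_atTop (0 : ℝ)),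
    eventually_const_mul_exp_le (C := 1 + 2 * A / δ) (h := δ / 2) (h' := δ) (by linarith)
      tendsto_fst] with q h1 h2 h3
  refine le_trans ?_ h3
  have h4 : |1 - κ * inner ℝ e (q.1 • q.2)| ≤ 1 + q.1 * A := by
    rw [inner_smul_right, mul_left_comm]
    refine (abs_sub _ _).trans ?_
    rw [abs_one, abs_mul, abs_of_nonneg h2]
    gcongr
  refine h4.trans ?_
  have h5 := Real.add_one_le_exp (q.1 * (δ / 2))
  have h6 : q.1 * A = (2 * A / δ) * (q.1 * (δ / 2)) := by field_simp
  have h7 : 1 ≤ Real.exp (q.1 * (δ / 2)) := Real.one_le_exp (by positivity)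
  have h8 : 0 ≤ 2 * A / δ := by positivity
  rw [h6]
  nlinarith

/-- Off the hyperplane orthogonal to `e` the affine factor is eventually unbounded, unless `κ = 0`
and it is `1`; it can therefore be divided out of growth estimates. -/
theorem eventually_le_affine {κ : ℝ} {e ζ : W} (hκ : inner ℝ e ζ ≠ 0) :
    ∃ c > 0, ∀ᶠ q : ℝ × W in atTop ×ˢ 𝓝 ζ, c ≤ |1 - κ * inner ℝ e (q.1 • q.2)| := by
  rcases eq_or_ne κ 0 with h0 | h0
  · exact ⟨1, one_pos, by simp [h0]⟩
  refine ⟨1, one_pos, ?_⟩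
  have hA0 : 0 < |κ * inner ℝ e ζ| := by positivity
  have hb : ∀ᶠ ζ' in 𝓝 ζ, |κ * inner ℝ e ζ| / 2 < |κ * inner ℝ e ζ'| := by
    have h : Continuous fun ζ' : W => |κ * inner ℝ e ζ'| := by fun_prop
    exact (h.tendsto ζ).eventually_const_lt (by linarith)
  filter_upwards [tendsto_snd.eventually hb, tendsto_fst.eventually (eventually_ge_atTop (0 : ℝ)),
    tendsto_fst.eventually (eventually_ge_atTop (4 / |κ * inner ℝ e ζ|))] with q h1 h2 h3
  have h4 : 2 ≤ |κ * inner ℝ e (q.1 • q.2)| := by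
    rw [inner_smul_right, mul_left_comm, abs_mul, abs_of_nonneg h2]
    rw [div_le_iff₀ hA0] at h3
    nlinarith
  have h5 := abs_sub_abs_le_abs_sub (κ * inner ℝ e (q.1 • q.2)) 1
  rw [abs_one, abs_sub_comm] at h5
  linarith

theorem tendsto_inner_eventually_le (β ζ : W) {δ : ℝ} (hδ : 0 < δ) :
    ∀ᶠ q : ℝ × W in atTop ×ˢ 𝓝 ζ, |inner ℝ β (q.1 • q.2) - q.1 * inner ℝ β ζ| ≤ q.1 * δ := by
  have hb : ∀ᶠ ζ' in 𝓝 ζ, |inner ℝ β ζ' - inner ℝ β ζ| < δ := by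
    have h : Continuous fun ζ' : W => |inner ℝ β ζ' - inner ℝ β ζ| := by fun_prop
    exact (h.tendsto ζ).eventually_lt_const (by simpa using hδ)
  filter_upwards [tendsto_snd.eventually hb, tendsto_fst.eventually (eventually_ge_atTop (0 : ℝ))]
    with q h1 h2
  rw [inner_smul_right, ← mul_sub, abs_mul, abs_of_nonneg h2]
  gcongr

theorem SphereDensity.expGrowth_laplace {f : U → ℝ} {X : U → W} {R : ℝ} (S : SphereDensity μ f X R)
    (ζ : W) {h : ℝ} (hh : R * ‖ζ‖ < h) : ExpGrowth (laplace μ f X) ζ h := by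
  refine ExpGrowth.of_eventually_le (C := ∫ u, |f u| ∂μ) (h := (R * ‖ζ‖ + h) / 2) (by linarith) ?_
  have hb : ∀ᶠ ζ' in 𝓝 ζ, R * ‖ζ'‖ < (R * ‖ζ‖ + h) / 2 := by
    have h : Continuous fun ζ' : W => R * ‖ζ'‖ := by fun_prop
    exact (h.tendsto ζ).eventually_lt_const (by linarith)
  filter_upwards [tendsto_snd.eventually hb, tendsto_fst.eventually (eventually_ge_atTop (0 : ℝ))]
    with q h1 h2
  refine (S.abs_laplace_le S.integrable _).trans ?_
  have h0 : 0 ≤ ∫ u, |f u| ∂μ := integral_nonneg fun u => abs_nonneg _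
  refine mul_le_mul_of_nonneg_left (Real.exp_le_exp.2 ?_) h0
  rw [norm_smul, Real.norm_eq_abs, abs_of_nonneg h2]
  nlinarith

end Growth

/-! ### Derivatives of affine functions -/

section Affine

variable {W : Type*} [NormedAddCommGroup W] [InnerProductSpace ℝ W] [FiniteDimensional ℝ W]

theorem fderiv_affine (κ : ℝ) (e t v : W) :
    fderiv ℝ (fun t : W => 1 - κ * inner ℝ e t) t v = -(κ * inner ℝ e v) := by
  have h : HasFDerivAt (fun t : W => 1 - κ * inner ℝ e t) (-(κ • innerSL ℝ e)) t := by
    have := (((innerSL ℝ e).hasFDerivAt (x := t)).const_mul κ).const_sub 1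
    simpa using this
  rw [h.fderiv]
  simp

theorem contDiff_affine (κ : ℝ) (e : W) {n : WithTop ℕ∞} :
    ContDiff ℝ n fun t : W => 1 - κ * inner ℝ e t :=
  contDiff_const.sub (contDiff_const.mul (contDiff_const.inner ℝ contDiff_id))

theorem trLaplacian_affine (κ : ℝ) (e t : W) :
    trLaplacian (fun t : W => 1 - κ * inner ℝ e t) t = 0 := by
  simp [trLaplacian, fderiv_affine]

end Affine

/-! ### Identification in the plane -/

section Two

variable {U : Type*} [MeasurableSpace U] {μ : Measure U}
  {W : Type*} [NormedAddCommGroup W] [InnerProductSpace ℝ W] [FiniteDimensional ℝ W]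
  [MeasurableSpace W] [BorelSpace W]

namespace SphereDensity

variable {f g : U → ℝ} {X Z : U → W} {R r : ℝ}

/-- The transform of `f` grows at most like `⟨β, ζ⟩ + r ‖ζ‖` in every direction, and exactly so in
the direction `p`. The support point `q` of norm `R` obtained there satisfies `‖q - β‖ ≤ r` and `⟨p,
q - β⟩ = r²`, so `q = β + p`. -/
theorem norm_add_eq_of_isMassPoint (S : SphereDensity μ f X R) (T : SphereDensity μ g Z r)
    (hg : ∀ᵐ u ∂μ, 0 ≤ g u) (hr : 0 < r) {e e' β : W} {κ κ' : ℝ}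
    (hratio : ∀ t, laplace μ f X t = (1 - κ * inner ℝ e t) * (1 - κ' * inner ℝ e' t) *
      Real.exp (inner ℝ β t) * laplace μ g Z t) {p : W} (hp : IsMassPoint μ g Z p)
    (hpr : ‖p‖ = r) (h0 : inner ℝ e p ≠ 0) (h1 : inner ℝ e' p ≠ 0) : ‖β + p‖ = R := by
  have habs : ∀ t, |laplace μ f X t| = |1 - κ * inner ℝ e t| * |1 - κ' * inner ℝ e' t| *
      Real.exp (inner ℝ β t) * |laplace μ g Z t| := by
    intro t
    rw [hratio, abs_mul, abs_mul, abs_mul, Real.abs_exp]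
  obtain ⟨q, hqR, hqp, hq⟩ := S.exists_support_point (O := univ)
    (H := fun ζ => inner ℝ β ζ + r * ‖ζ‖) (fun ζ _ h hh => by
      set δ := (h - (inner ℝ β ζ + r * ‖ζ‖)) / 5 with hδ
      have hδ0 : 0 < δ := by
        have : inner ℝ β ζ + r * ‖ζ‖ < h := hh
        rw [hδ]; linarith
      filter_upwards [eventually_affine_le κ e ζ hδ0, eventually_affine_le κ' e' ζ hδ0,
        tendsto_inner_eventually_le β ζ hδ0, T.expGrowth_laplace ζ (h := r * ‖ζ‖ + δ)
        (by linarith), tendsto_fst.eventually (eventually_ge_atTop (0 : ℝ))] with t h1 h2 h3 h4 h5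
      rw [habs]
      calc _ ≤ Real.exp (t.1 * δ) * Real.exp (t.1 * δ) *
            Real.exp (t.1 * (inner ℝ β ζ + δ)) * Real.exp (t.1 * (r * ‖ζ‖ + δ)) := by
            gcongr
            linarith [(abs_le.1 h3).2]
        _ ≤ _ := by
            rw [← Real.exp_add, ← Real.exp_add, ← Real.exp_add]
            refine Real.exp_le_exp.2 ?_
            have : h = inner ℝ β ζ + r * ‖ζ‖ + 5 * δ := by rw [hδ]; ring
            rw [this]
            nlinarith) (mem_univ p) (fun δ hδ hG => by
      obtain ⟨c, hc, h2⟩ := eventually_le_affine (κ := κ) h0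
      obtain ⟨c', hc', h3⟩ := eventually_le_affine (κ := κ') h1
      have hδ4 : 0 < δ / 4 := by linarith
      have hall := (((hG.and h2).and h3).and (tendsto_inner_eventually_le β p hδ4)).and
        ((hp.eventually_exp_le_laplace T hg (ζ := p) hδ4).and
        ((eventually_const_mul_exp_le (C := (c * c')⁻¹) (h := inner ℝ β p + r * ‖p‖ - δ)
          (h' := inner ℝ β p + r * ‖p‖ - 3 / 4 * δ) (by linarith) tendsto_fst).and
          (tendsto_fst.eventually (eventually_gt_atTop (0 : ℝ)))))
      obtain ⟨t, ⟨⟨⟨⟨k1, k2⟩, k3⟩, k4⟩, k5, k6, k7⟩⟩ := hall.exists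
      rw [habs] at k1
      have k8 : c * c' * Real.exp (t.1 * (inner ℝ β p - δ / 4)) *
          Real.exp (t.1 * (inner ℝ p p - δ / 4)) ≤ Real.exp (t.1 *
            (inner ℝ β p + r * ‖p‖ - δ)) := by
        refine le_trans ?_ k1
        gcongr
        · linarith [(abs_le.1 k4).1]
        · exact k5.trans (le_abs_self _)
      rw [inv_mul_le_iff₀ (by positivity)] at k6
      rw [mul_assoc, ← Real.exp_add] at k8
      have k9 := k8.trans k6
      rw [mul_le_mul_iff_right₀ (by positivity), Real.exp_le_exp, real_inner_self_eq_norm_sq,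
        hpr] at k9
      nlinarith)
  have hβ : ∀ ζ, inner ℝ ζ (q - β) ≤ r * ‖ζ‖ := fun ζ => by
    have := hq ζ (mem_univ _)
    rw [inner_sub_right, real_inner_comm β ζ]
    linarith
  have hn : ‖q - β‖ ≤ r := by
    have := hβ (q - β)
    rw [real_inner_self_eq_norm_sq] at this
    nlinarith [norm_nonneg (q - β)]
  have hip : inner ℝ p (q - β) = r * r := by
    rw [inner_sub_right, real_inner_comm β p, hqp, hpr]
    ring
  have : q - β = p := by
    have h2 : ‖q - β - p‖ ^ 2 ≤ 0 := by
      rw [norm_sub_sq_real, real_inner_comm, hip, hpr]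
      nlinarith [norm_nonneg (q - β)]
    have h3 : ‖q - β - p‖ = 0 := by nlinarith [norm_nonneg (q - β - p)]
    exact sub_eq_zero.1 (norm_eq_zero.1 h3)
  rw [← this, add_sub_cancel, hqR]

/-- On a circle, the equation `⟨v, Z⟩ = c` leaves at most two values for the coordinate `⟨e, Z⟩`,
whose level sets are null. -/
theorem ae_inner_ne (T : SphereDensity μ g Z r) {e e' : W}
    (hbasis : ∀ t, t = (inner ℝ e t : ℝ) • e + (inner ℝ e' t : ℝ) • e')
    (he : ‖e‖ = 1) (he' : ‖e'‖ = 1) (hee : inner ℝ e e' = (0 : ℝ))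
    (hlev : ∀ c, ∀ᵐ u ∂μ, inner ℝ e (Z u) ≠ c) {v : W} (hve : inner ℝ e' v ≠ (0 : ℝ)) (c : ℝ) :
    ∀ᵐ u ∂μ, inner ℝ v (Z u) ≠ c := by
  set a := (inner ℝ e v : ℝ)
  set b := (inner ℝ e' v : ℝ)
  set N := a ^ 2 + b ^ 2 with hN
  have hN0 : 0 < N := by positivity
  set D := Real.sqrt (N * r ^ 2 - c ^ 2) with hD
  filter_upwards [hlev ((a * c - b * D) / N), hlev ((a * c + b * D) / N)] with u h1 h2 hc
  set x := (inner ℝ e (Z u) : ℝ)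
  set y := (inner ℝ e' (Z u) : ℝ)
  have hZ : Z u = x • e + y • e' := hbasis (Z u)
  have hvv : v = a • e + b • e' := hbasis v
  have hee' : inner ℝ e' e = (0 : ℝ) := by rw [real_inner_comm]; exact hee
  have hxy : x ^ 2 + y ^ 2 = r ^ 2 := by
    have : inner ℝ (Z u) (Z u) = r ^ 2 := by rw [real_inner_self_eq_norm_sq, T.norm_eq]
    rw [hZ] at this
    simp only [inner_add_left, inner_add_right, inner_smul_left, inner_smul_right,
      RCLike.conj_to_real, hee, hee', real_inner_self_eq_norm_sq, he, he'] at this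
    linarith
  have hcc : a * x + b * y = c := by
    rw [← hc, hZ, hvv]
    simp only [inner_add_left, inner_add_right, inner_smul_left, inner_smul_right,
      RCLike.conj_to_real, hee, hee', real_inner_self_eq_norm_sq, he, he']
    ring
  have hd : (-b * x + a * y) ^ 2 = N * r ^ 2 - c ^ 2 := by
    rw [← hxy, ← hcc, hN]; ring
  have hD2 : D ^ 2 = (-b * x + a * y) ^ 2 := by
    rw [hD, Real.sq_sqrt (by rw [← hd]; positivity), hd]
  rcases sq_eq_sq_iff_eq_or_eq_neg.1 hD2 with h | h
  · apply h1
    rw [eq_div_iff hN0.ne', h, ← hcc, hN]; ring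
  · apply h2
    rw [eq_div_iff hN0.ne', h, ← hcc, hN]; ring

/-- Almost all the mass of `g` lies at points `Z` with `‖β + Z‖ = R`. If `β ≠ 0` these points are on
a line, which is not charged; so `β = 0` and `R = r`. The remaining ratio `Γ` is a product of affine
functions of orthogonal coordinates, hence harmonic, and the Helmholtz relation says that the
transform of `g dΓ_t(Z)` vanishes at `t` for every `t`. This is impossible unless both `κ` and `κ'`
are zero. -/
theorem eq_of_product_ratio (S : SphereDensity μ f X R) (T : SphereDensity μ g Z r)
    (hg : ∀ᵐ u ∂μ, 0 ≤ g u) (hg1 : ∫ u, g u ∂μ = 1) (hr : 0 < r) {e e' : W}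
    (hbasis : ∀ t, t = (inner ℝ e t : ℝ) • e + (inner ℝ e' t : ℝ) • e')
    (he : ‖e‖ = 1) (he' : ‖e'‖ = 1) (hee : inner ℝ e e' = (0 : ℝ))
    (hlev : ∀ c, ∀ᵐ u ∂μ, inner ℝ e (Z u) ≠ c) (hlev' : ∀ c, ∀ᵐ u ∂μ, inner ℝ e' (Z u) ≠ c)
    {κ κ' b b' : ℝ}
    (hratio : ∀ t, laplace μ f X t = (1 - κ * inner ℝ e t) * (1 - κ' * inner ℝ e' t) *
      Real.exp (b * inner ℝ e t + b' * inner ℝ e' t) * laplace μ g Z t) :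
    R = r ∧ ∀ t, laplace μ f X t = laplace μ g Z t := by
  have hee' : inner ℝ e' e = (0 : ℝ) := by rw [real_inner_comm]; exact hee
  have hgne : ¬ ∀ᵐ u ∂μ, g u = 0 := by
    intro h
    have h' : g =ᵐ[μ] 0 := h
    rw [integral_congr_ae h'] at hg1
    simp at hg1
  have hlin : ∀ v : W, v ≠ 0 → ∀ c, ∀ᵐ u ∂μ, inner ℝ v (Z u) ≠ c := by
    intro v hv c
    by_cases h : inner ℝ e' v = (0 : ℝ)
    · refine T.ae_inner_ne (e := e') (e' := e) (fun t => by rw [add_comm]; exact hbasis t) he' he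
        hee' hlev' (fun h0 => hv ?_) c
      rw [hbasis v, h, h0]; simp
    · exact T.ae_inner_ne hbasis he he' hee hlev h c
  set β : W := b • e + b' • e' with hβ
  have hβt : ∀ t, (inner ℝ β t : ℝ) = b * inner ℝ e t + b' * inner ℝ e' t := fun t => by
    rw [hβ, inner_add_left, inner_smul_left, inner_smul_left]; simp
  simp_rw [← hβt] at hratio
  have hmass : ∀ᵐ u ∂μ, g u ≠ 0 → ‖β + Z u‖ = R := by
    filter_upwards [ae_isMassPoint T hg, hlev 0, hlev' 0] with u h1 h2 h3 h4
    exact S.norm_add_eq_of_isMassPoint T hg hr hratio (h1 h4) (T.norm_eq u) h2 h3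
  have hβ0 : β = 0 := by
    by_contra hne
    refine hgne ?_
    filter_upwards [hmass, hlin β hne ((R ^ 2 - r ^ 2 - ‖β‖ ^ 2) / 2)] with u h1 h2
    by_contra h3
    have h4 := norm_add_sq_real β (Z u)
    rw [h1 h3, T.norm_eq] at h4
    exact h2 (by linarith)
  have hRr : R = r := by
    by_contra hne
    refine hgne ?_
    filter_upwards [hmass] with u h1
    by_contra h3
    have := h1 h3
    rw [hβ0, zero_add, T.norm_eq] at this
    exact hne this.symm
  subst hRr
  refine ⟨rfl, ?_⟩
  simp only [hβ0, inner_zero_left, Real.exp_zero, mul_one] at hratio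
  have hcF := contDiff_affine κ e (n := (2 : ℕ))
  have hcG := contDiff_affine κ' e' (n := (2 : ℕ))
  have hHE : ∀ t, laplace μ (fun u => g u * ((1 - κ * inner ℝ e t) * -(κ' * inner ℝ e' (Z u)) +
      (1 - κ' * inner ℝ e' t) * -(κ * inner ℝ e (Z u)))) Z t = 0 := by
    intro t
    have h := trLaplacian_ratio S T (hcF.mul hcG) hratio t
    have htr : trLaplacian (fun t : W => (1 - κ * inner ℝ e t) * (1 - κ' * inner ℝ e' t)) t = 0 := by
      rw [trLaplacian_mul hcF hcG, trLaplacian_affine, trLaplacian_affine]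
      simp_rw [fderiv_affine]
      have := sum_inner_mul_inner e e'
      simp_rw [real_inner_comm e, real_inner_comm e'] at this
      have h2 : ∑ i, -(κ * inner ℝ e (stdOrthonormalBasis ℝ W i)) *
          -(κ' * inner ℝ e' (stdOrthonormalBasis ℝ W i)) = κ * κ' * inner ℝ e e' := by
        rw [← sum_inner_mul_inner e e', Finset.mul_sum]
        refine Finset.sum_congr rfl fun i _ => ?_
        rw [real_inner_comm e, real_inner_comm e']
        ring
      rw [h2, hee]
      ring
    rw [htr, zero_mul, zero_add] at h
    have h3 := (mul_eq_zero.1 h).resolve_left two_ne_zero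
    rw [← h3]
    congr 1
    funext u
    have hd : fderiv ℝ (fun t : W => (1 - κ * inner ℝ e t) * (1 - κ' * inner ℝ e' t)) t (Z u) =
        (1 - κ * inner ℝ e t) * -(κ' * inner ℝ e' (Z u)) +
        (1 - κ' * inner ℝ e' t) * -(κ * inner ℝ e (Z u)) := by
      rw [fderiv_fun_mul (hcF.differentiable (by simp) t) (hcG.differentiable (by simp) t)]
      simp only [add_apply, smul_apply, smul_eq_mul, fderiv_affine]
    rw [hd]
  have hcon : ∀ v : W, v ≠ 0 → (∀ t, laplace μ (fun u => g u * inner ℝ v (Z u)) Z t = 0) →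
      False := by
    intro v hv h
    refine hgne ?_
    filter_upwards [T.det _ (T.integrable_mul_inner T.integrable v) h, hlin v hv 0] with u h1 h2
    simpa [h2] using h1
  have he0 : e ≠ 0 := fun h => by simp [h] at he
  have he0' : e' ≠ 0 := fun h => by simp [h] at he'
  have hκ0 : κ = 0 ∧ κ' = 0 := by
    by_cases hκ : κ = 0 <;> by_cases hκ' : κ' = 0
    · exact ⟨hκ, hκ'⟩
    · refine (hcon e' he0' fun t => ?_).elim
      have := hHE t
      simp only [hκ, zero_mul, sub_zero, one_mul, neg_zero, mul_zero, add_zero] at this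
      have h2 : laplace μ (fun u => g u * -(κ' * inner ℝ e' (Z u))) Z t =
          -κ' * laplace μ (fun u => g u * inner ℝ e' (Z u)) Z t := by
        simp only [laplace]
        rw [← integral_const_mul]
        exact integral_congr_ae (Eventually.of_forall fun u => by ring)
      rw [h2] at this
      exact (mul_eq_zero.1 this).resolve_left (neg_ne_zero.2 hκ')
    · refine (hcon e he0 fun t => ?_).elim
      have := hHE t
      simp only [hκ', zero_mul, sub_zero, one_mul, neg_zero, mul_zero, zero_add] at this
      have h2 : laplace μ (fun u => g u * -(κ * inner ℝ e (Z u))) Z t =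
          -κ * laplace μ (fun u => g u * inner ℝ e (Z u)) Z t := by
        simp only [laplace]
        rw [← integral_const_mul]
        exact integral_congr_ae (Eventually.of_forall fun u => by ring)
      rw [h2] at this
      exact (mul_eq_zero.1 this).resolve_left (neg_ne_zero.2 hκ)
    · exfalso
      set v := e + e' with hv
      have hv0 : v ≠ 0 := by
        intro h
        have : (inner ℝ e v : ℝ) = 1 := by
          rw [hv, inner_add_right, hee, real_inner_self_eq_norm_sq, he]; norm_num
        rw [h] at this; simp at this
      -- Both affine factors vanish at `p`, and at `p + x v` the differential of their product is `κ
      -- κ' x ⟨v, ·⟩`. So the transform of `g ⟨v, Z⟩` vanishes on this line for `x ≠ 0`, at `x = 0`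
      -- by continuity, and its derivative there is `∫ g ⟨v, Z⟩² exp⟨p, Z⟩ > 0`, a contradiction.
      set p : W := κ⁻¹ • e + κ'⁻¹ • e' with hp
      have hep : (inner ℝ e p : ℝ) = κ⁻¹ := by
        rw [hp, inner_add_right, inner_smul_right, inner_smul_right, hee,
          real_inner_self_eq_norm_sq, he]; norm_num
      have hep' : (inner ℝ e' p : ℝ) = κ'⁻¹ := by
        rw [hp, inner_add_right, inner_smul_right, inner_smul_right, hee',
          real_inner_self_eq_norm_sq, he']; norm_num
      have hev : (inner ℝ e v : ℝ) = 1 := by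
        rw [hv, inner_add_right, hee, real_inner_self_eq_norm_sq, he]; norm_num
      have hev' : (inner ℝ e' v : ℝ) = 1 := by
        rw [hv, inner_add_right, hee', real_inner_self_eq_norm_sq, he']; norm_num
      have hgv := T.integrable_mul_inner T.integrable v
      set A := laplace μ (fun u => g u * inner ℝ v (Z u)) Z with hA
      have hne : ∀ x : ℝ, x ≠ 0 → A (p + x • v) = 0 := by
        intro x hx
        have := hHE (p + x • v)
        have k1 : (inner ℝ e (p + x • v) : ℝ) = κ⁻¹ + x * 1 := by
          rw [inner_add_right e p, inner_smul_right e v, hep, hev]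
        have k2 : (inner ℝ e' (p + x • v) : ℝ) = κ'⁻¹ + x * 1 := by
          rw [inner_add_right e' p, inner_smul_right e' v, hep', hev']
        rw [k1, k2] at this
        have h2 : laplace μ (fun u => g u * ((1 - κ * (κ⁻¹ + x * 1)) * -(κ' * inner ℝ e' (Z u)) +
            (1 - κ' * (κ'⁻¹ + x * 1)) * -(κ * inner ℝ e (Z u)))) Z (p + x • v) =
            (κ * κ' * x) * A (p + x • v) := by
          simp only [hA, laplace]
          rw [← integral_const_mul]
          refine integral_congr_ae (Eventually.of_forall fun u => ?_)
          simp only [hv, inner_add_left]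
          field_simp
          ring
        rw [h2] at this
        exact (mul_eq_zero.1 this).resolve_left (by positivity)
      have hdA : HasDerivAt (fun x : ℝ => A (p + x • v))
          (laplace μ (fun u => g u * inner ℝ v (Z u) * inner ℝ v (Z u)) Z p) 0 := by
        have h1 : HasFDerivAt A (fderiv ℝ A p) (p + (0 : ℝ) • v) := by
          rw [zero_smul, add_zero]
          exact (T.differentiable_laplace hgv p).hasFDerivAt
        have h2 : HasDerivAt (fun x : ℝ => p + x • v) v 0 := by
          simpa using ((hasDerivAt_id (0 : ℝ)).smul_const v).const_add p
        have h3 := h1.comp_hasDerivAt (0 : ℝ) h2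
        rw [T.fderiv_laplace hgv] at h3
        exact h3
      have h0 : A p = 0 := by
        have hc : Continuous fun x : ℝ => A (p + x • v) :=
          (T.differentiable_laplace hgv).continuous.comp (by fun_prop)
        have h1 : Tendsto (fun x : ℝ => A (p + x • v)) (𝓝[≠] 0) (𝓝 (A (p + (0 : ℝ) • v))) :=
          (hc.tendsto 0).mono_left nhdsWithin_le_nhds
        have h2 : Tendsto (fun x : ℝ => A (p + x • v)) (𝓝[≠] 0) (𝓝 0) :=
          tendsto_const_nhds.congr' (by
            filter_upwards [self_mem_nhdsWithin] with x hx
            exact (hne x hx).symm)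
        have := tendsto_nhds_unique h1 h2
        simpa using this
      have hzero : (fun x : ℝ => A (p + x • v)) = fun _ => 0 := by
        funext x
        rcases eq_or_ne x 0 with rfl | hx
        · simpa using h0
        · exact hne x hx
      rw [hzero] at hdA
      have hint : laplace μ (fun u => g u * inner ℝ v (Z u) * inner ℝ v (Z u)) Z p = 0 :=
        hdA.unique (hasDerivAt_const _ _)
      rw [laplace] at hint
      have hnn : 0 ≤ᵐ[μ] fun u => g u * inner ℝ v (Z u) * inner ℝ v (Z u) *
          Real.exp (inner ℝ p (Z u)) := by
        filter_upwards [hg] with u hu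
        have := mul_nonneg hu (mul_self_nonneg (inner ℝ v (Z u) : ℝ))
        simp only [Pi.zero_apply]
        rw [mul_assoc (g u)]
        positivity
      have hz := (integral_eq_zero_iff_of_nonneg_ae hnn
        (T.integrable_mul_exp (T.integrable_mul_inner hgv v) p)).1 hint
      refine hgne ?_
      filter_upwards [hz, hlin v hv0 0] with u h1 h2
      simpa [h2, (Real.exp_pos _).ne'] using h1
  intro t
  rw [hratio, hκ0.1, hκ0.2]
  ring

end SphereDensity

end Two

/-! ### Growth rates and the radius in higher dimension -/

section Rate

variable {U : Type*} [MeasurableSpace U] {μ : Measure U}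
  {W : Type*} [NormedAddCommGroup W] [InnerProductSpace ℝ W] [FiniteDimensional ℝ W]
  [MeasurableSpace W] [BorelSpace W]

/-- The exponential growth rate of `G` around the direction `ζ`. -/
noncomputable def growthRate (G : W → ℝ) (ζ : W) : ℝ := sInf {h | ExpGrowth G ζ h}

theorem expGrowth_of_growthRate_lt {G : W → ℝ} {ζ : W} (hne : ∃ h, ExpGrowth G ζ h) {h : ℝ}
    (hh : growthRate G ζ < h) : ExpGrowth G ζ h := by
  obtain ⟨h', h1, h2⟩ := exists_lt_of_csInf_lt hne hh
  exact ExpGrowth.mono h1 h2.le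

theorem growthRate_add_smul {G : W → ℝ} {e : W} (hG : ∀ t (σ : ℝ), G (t + σ • e) = G t) (ζ : W)
    (σ : ℝ) : growthRate G (ζ + σ • e) = growthRate G ζ := by
  have key : ∀ (ζ : W) (σ : ℝ) h, ExpGrowth G ζ h → ExpGrowth G (ζ + σ • e) h := by
    intro ζ σ h hg
    have ht : Tendsto (fun q : ℝ × W => (q.1, q.2 - σ • e)) (atTop ×ˢ 𝓝 (ζ + σ • e))
        (atTop ×ˢ 𝓝 ζ) := by
      refine tendsto_fst.prodMk ?_
      have : Tendsto (fun x : W => x - σ • e) (𝓝 (ζ + σ • e)) (𝓝 (ζ + σ • e - σ • e)) :=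
        (continuous_id.sub continuous_const).tendsto _
      rw [add_sub_cancel_right] at this
      exact this.comp tendsto_snd
    filter_upwards [ht.eventually hg] with q hq
    have e1 : q.1 • q.2 = q.1 • (q.2 - σ • e) + (q.1 * σ) • e := by
      rw [smul_sub, smul_smul, sub_add_cancel]
    rw [e1, hG]
    exact hq
  rw [growthRate, growthRate]
  congr 1
  ext h
  refine ⟨fun hg => ?_, key ζ σ h⟩
  have := key _ (-σ) h hg
  simpa using this

namespace SphereDensity

variable {f g G : U → ℝ} {X Z : U → W} {R r κ b : ℝ} {e : W} {G : W → ℝ}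

/-- The rates of the factors add up: `b ⟨e, ζ⟩` for the exponential, `h` for `G`, `r ‖ζ‖` for the
transform of `g`, and nothing for the affine factor. -/
theorem expGrowth_of_factor (T : SphereDensity μ g Z r)
    (hratio : ∀ t, laplace μ f X t =
      (1 - κ * inner ℝ e t) * Real.exp (b * inner ℝ e t) * G t * laplace μ g Z t) {ζ : W} {h h' : ℝ}
    (hG : ExpGrowth G ζ h) (hh : b * inner ℝ e ζ + h + r * ‖ζ‖ < h') :
    ExpGrowth (laplace μ f X) ζ h' := by
  set δ := (h' - (b * inner ℝ e ζ + h + r * ‖ζ‖)) / 3 with hδ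
  have hδ0 : 0 < δ := by rw [hδ]; linarith
  filter_upwards [eventually_affine_le κ e ζ hδ0, tendsto_inner_eventually_le (b • e) ζ hδ0,
    T.expGrowth_laplace ζ (h := r * ‖ζ‖ + δ) (by linarith), hG] with t h1 h2 h3 h4
  rw [hratio, abs_mul, abs_mul, abs_mul, Real.abs_exp]
  rw [inner_smul_left, inner_smul_left, RCLike.conj_to_real] at h2
  have h5 : Real.exp (b * inner ℝ e (t.1 • t.2)) ≤ Real.exp (t.1 * (b * inner ℝ e ζ + δ)) :=
    Real.exp_le_exp.2 (by linarith [(abs_le.1 h2).2])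
  calc _ ≤ Real.exp (t.1 * δ) * Real.exp (t.1 * (b * inner ℝ e ζ + δ)) * Real.exp (t.1 * h) *
        Real.exp (t.1 * (r * ‖ζ‖ + δ)) := mul_le_mul (mul_le_mul (mul_le_mul h1 h5
          (Real.exp_pos _).le (Real.exp_pos _).le) h4 (abs_nonneg _) (by positivity)) h3
          (abs_nonneg _) (by positivity)
    _ ≤ _ := by
        rw [← Real.exp_add, ← Real.exp_add, ← Real.exp_add]
        refine Real.exp_le_exp.2 (le_of_eq ?_)
        have : h' = b * inner ℝ e ζ + h + r * ‖ζ‖ + 3 * δ := by rw [hδ]; ring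
        rw [this]
        ring

/-- A converse by division: in a direction charged by `g` its transform attains the full rate `r
‖ζ‖`, and `⟨e, ζ⟩ ≠ 0` keeps the affine factor away from `0`. -/
theorem expGrowth_factor (T : SphereDensity μ g Z r) (hg : ∀ᵐ u ∂μ, 0 ≤ g u)
    (hratio : ∀ t, laplace μ f X t =
      (1 - κ * inner ℝ e t) * Real.exp (b * inner ℝ e t) * G t * laplace μ g Z t) {ζ : W} {h h' : ℝ}
    (heζ : inner ℝ e ζ ≠ 0) (hζ0 : ζ ≠ 0) (hmass : IsMassPoint μ g Z ((r / ‖ζ‖) • ζ))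
    (hf : ExpGrowth (laplace μ f X) ζ h) (hh : h < b * inner ℝ e ζ + h' + r * ‖ζ‖) :
    ExpGrowth G ζ h' := by
  set δ := (b * inner ℝ e ζ + h' + r * ‖ζ‖ - h) / 3 with hδ
  have hδ0 : 0 < δ := by rw [hδ]; linarith
  obtain ⟨c, hc, hcb⟩ := eventually_le_affine (κ := κ) heζ
  refine ExpGrowth.of_eventually_le (C := c⁻¹) (h := h' - δ) (by linarith) ?_
  filter_upwards [hcb, tendsto_inner_eventually_le (b • e) ζ hδ0,
    hmass.eventually_exp_le_laplace T hg (ζ := ζ) hδ0, hf,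
    tendsto_fst.eventually (eventually_ge_atTop (0 : ℝ))] with t h1 h2 h3 h4 h5
  rw [hratio, abs_mul, abs_mul, abs_mul, Real.abs_exp] at h4
  rw [inner_smul_left, inner_smul_left, RCLike.conj_to_real] at h2
  have hin : (inner ℝ ((r / ‖ζ‖) • ζ) ζ : ℝ) = r * ‖ζ‖ := by
    rw [inner_smul_left, RCLike.conj_to_real, real_inner_self_eq_norm_sq]
    have := norm_ne_zero_iff.2 hζ0
    field_simp
  rw [hin] at h3
  have h6 : c * Real.exp (t.1 * (b * inner ℝ e ζ - δ)) * |G (t.1 • t.2)| *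
      Real.exp (t.1 * (r * ‖ζ‖ - δ)) ≤ Real.exp (t.1 * h) := by
    have h8 : Real.exp (t.1 * (b * inner ℝ e ζ - δ)) ≤ Real.exp (b * inner ℝ e (t.1 • t.2)) :=
      Real.exp_le_exp.2 (by linarith [(abs_le.1 h2).1])
    refine le_trans ?_ h4
    exact mul_le_mul (mul_le_mul_of_nonneg_right (mul_le_mul h1 h8 (Real.exp_pos _).le
      (abs_nonneg _)) (abs_nonneg _)) (h3.trans (le_abs_self _)) (Real.exp_pos _).le
      (by positivity)
  have h7 : c * |G (t.1 • t.2)| * Real.exp (t.1 * (b * inner ℝ e ζ + r * ‖ζ‖ - 2 * δ)) ≤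
      Real.exp (t.1 * h) := by
    refine le_trans (le_of_eq ?_) h6
    have : t.1 * (b * inner ℝ e ζ + r * ‖ζ‖ - 2 * δ) =
      t.1 * (b * inner ℝ e ζ - δ) + t.1 * (r * ‖ζ‖ - δ) := by ring
    rw [this, Real.exp_add]
    ring
  rw [← le_div_iff₀ (Real.exp_pos _), ← Real.exp_sub] at h7
  rw [← div_eq_inv_mul, le_div_iff₀' hc]
  refine h7.trans (Real.exp_le_exp.2 (le_of_eq ?_))
  have : h = b * inner ℝ e ζ + h' + r * ‖ζ‖ - 3 * δ := by rw [hδ]; ring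
  rw [this]
  ring

/-- A very negative rate for `G` would bring the rate of the transform of `f` below `-R ‖ζ‖`, and
`f` would vanish. This makes the infimum in `growthRate` a true one: for a set unbounded below,
`sInf` would return `0`. -/
theorem bddBelow_expGrowth (S : SphereDensity μ f X R) (T : SphereDensity μ g Z r)
    (hf1 : ∫ u, f u ∂μ = 1)
    (hratio : ∀ t, laplace μ f X t =
      (1 - κ * inner ℝ e t) * Real.exp (b * inner ℝ e t) * G t * laplace μ g Z t) (ζ : W) :
    BddBelow {h | ExpGrowth G ζ h} := by
  refine ⟨-(R * ‖ζ‖) - 2 - b * inner ℝ e ζ - r * ‖ζ‖, fun h hh => ?_⟩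
  by_contra! hlt
  have h1 := S.eq_zero_of_expGrowth (expGrowth_of_factor T hratio hh
    (h' := b * inner ℝ e ζ + h + r * ‖ζ‖ + 1) (by linarith))
  have h2 : f =ᵐ[μ] 0 := by
    filter_upwards [h1] with u hu
    refine hu ?_
    have := neg_le_of_abs_le (S.abs_inner_le ζ u)
    linarith
  rw [integral_congr_ae h2] at hf1
  simp at hf1

/-- The values `σ = 0` and `σ = ±ε/2` give the coefficients: `b² = K²` and `b H = 0`, then `H² = b²
(n - s²)` with `n - s² > 0`. Geometrically, along a line missing the origin an affine function
agrees with a multiple of the norm only if it is zero. -/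
theorem eq_zero_of_quadratic {b s H K n : ℝ} (hn : s ^ 2 < n)
    (h : ∀ᶠ σ in 𝓝 (0 : ℝ), (b * (s + σ) + H) ^ 2 = K ^ 2 * (n + 2 * s * σ + σ ^ 2)) :
    b = 0 ∧ H = 0 := by
  obtain ⟨ε, hε, hε'⟩ := Metric.eventually_nhds_iff.1 h
  have e1 := hε' (y := 0) (by simpa using hε)
  have e2 := hε' (y := ε / 2) (by
    rw [Real.dist_eq, sub_zero, abs_of_pos (by linarith)]; linarith)
  have e3 := hε' (y := -(ε / 2)) (by
    rw [Real.dist_eq, sub_zero, abs_neg, abs_of_pos (by linarith)]; linarith)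
  have k1 : (b ^ 2 - K ^ 2) * ε ^ 2 = 0 := by linear_combination 2 * e2 + 2 * e3 - 4 * e1
  have k2 : (b * (b * s + H) - K ^ 2 * s) * ε = 0 := by linear_combination (e2 - e3) / 2
  have hb : b ^ 2 = K ^ 2 := by
    have := (mul_eq_zero.1 k1).resolve_right (by positivity)
    linarith
  have hbH : b * H = 0 := by
    have := (mul_eq_zero.1 k2).resolve_right hε.ne'
    rw [← hb] at this
    linarith
  have k3 : H ^ 2 = b ^ 2 * (n - s ^ 2) := by
    rw [← hb] at e1
    linear_combination e1 - 2 * s * hbH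
  have hn' : 0 < n - s ^ 2 := by linarith
  rcases mul_eq_zero.1 hbH with h0 | h0
  · refine ⟨h0, ?_⟩
    rw [h0] at k3
    simpa using k3
  · refine ⟨?_, h0⟩
    rw [h0] at k3
    have : b ^ 2 = 0 := by
      have := mul_eq_zero.1 (k3.symm.trans (by norm_num : (0:ℝ)^2 = 0))
      exact this.resolve_right hn'.ne'
    simpa using this

theorem hasFDerivAt_norm {ζ : W} (hζ : ζ ≠ 0) (r : ℝ) :
    HasFDerivAt (fun x : W => r * ‖x‖) (innerSL ℝ ((r / ‖ζ‖) • ζ)) ζ := by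
  have h1 : HasFDerivAt (fun x : W => ‖x‖ ^ 2) (2 • innerSL ℝ ζ) ζ :=
    (hasStrictFDerivAt_norm_sq ζ).hasFDerivAt
  have hn : ‖ζ‖ ^ 2 ≠ 0 := by have := norm_ne_zero_iff.2 hζ; positivity
  have h2 := (h1.sqrt hn).const_mul r
  simp only [Real.sqrt_sq (norm_nonneg _)] at h2
  refine h2.congr_fderiv ?_
  ext v
  simp
  have := norm_ne_zero_iff.2 hζ
  field_simp

/-- At a point where the growth rate is touched from above by a differentiable function. -/
theorem touching_point (S : SphereDensity μ f X R) (T : SphereDensity μ g Z r)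
    (hg : ∀ᵐ u ∂μ, 0 ≤ g u) (hr : 0 < r) (he : ‖e‖ = 1)
    (hratio : ∀ t, laplace μ f X t =
      (1 - κ * inner ℝ e t) * Real.exp (b * inner ℝ e t) * G t * laplace μ g Z t)
    (hGe : ∀ t (σ : ℝ), G (t + σ • e) = G t) (hGub : ∀ ζ, ∃ h, ExpGrowth G ζ h)
    (hf1 : ∫ u, f u ∂μ = 1)
    {O : Set W} (hO : IsOpen O) (hOe : ∀ ζ ∈ O, inner ℝ e ζ ≠ (0 : ℝ))
    (hOm : ∀ ζ ∈ O, IsMassPoint μ g Z ((r / ‖ζ‖) • ζ))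
    {ζ : W} (hζ : ζ ∈ O) (hζe : (inner ℝ e ζ : ℝ) ^ 2 < ‖ζ‖ ^ 2)
    {ψ : W → ℝ} {q : W} (hψ : HasFDerivAt ψ (innerSL ℝ q) ζ)
    (hle : ∀ᶠ ζ' in 𝓝 ζ, growthRate G ζ' ≤ ψ ζ') (heq : growthRate G ζ = ψ ζ) :
    b = 0 ∧ growthRate G ζ = 0 ∧ ‖q‖ ^ 2 + r ^ 2 = R ^ 2 := by
  have hshift : Tendsto (fun σ : ℝ => ζ + σ • e) (𝓝 0) (𝓝 ζ) := by
    have : Continuous fun σ : ℝ => ζ + σ • e := by fun_prop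
    simpa using this.tendsto 0
  have hO0 : ∀ ζ ∈ O, ζ ≠ 0 := fun ζ h h0 => hOe ζ h (by simp [h0])
  -- The rate of `G` is invariant along `e`, so a translate of `ψ` touches it at each `ζ + σ e`. The
  -- rate of the transform of `f` is attained there, and its support point, which has norm `R`, must
  -- be the gradient of the touching function.
  have main : ∀ᶠ σ : ℝ in 𝓝 0, ‖b • e + q + (r / ‖ζ + σ • e‖) • (ζ + σ • e)‖ = R ∧
      inner ℝ q (ζ + σ • e) = growthRate G ζ := by
    filter_upwards [hshift.eventually (hO.mem_nhds hζ)] with σ hσ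
    have hne := hO0 _ hσ
    obtain ⟨p, hpR, hpζ, hp⟩ := S.exists_support_point (O := O)
      (H := fun ζ => b * inner ℝ e ζ + growthRate G ζ + r * ‖ζ‖) (fun ζ' _ h hh => by
        obtain ⟨k, h1, h2⟩ := exists_between (show growthRate G ζ' <
          h - b * inner ℝ e ζ' - r * ‖ζ'‖ by
            have : b * inner ℝ e ζ' + growthRate G ζ' + r * ‖ζ'‖ < h := hh
            linarith)
        exact expGrowth_of_factor T hratio (expGrowth_of_growthRate_lt (hGub ζ') h1) (by linarith))
      hσ (fun δ hδ hG => by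
        have h1 := expGrowth_factor T hg hratio (hOe _ hσ) hne (hOm _ hσ) hG
          (h' := growthRate G (ζ + σ • e) - δ / 2) (by linarith)
        have h2 := csInf_le (S.bddBelow_expGrowth T hf1 hratio (ζ + σ • e)) h1
        rw [← growthRate] at h2
        linarith)
    have hback : Tendsto (fun x : W => x - σ • e) (𝓝 (ζ + σ • e)) (𝓝 ζ) := by
      have : Tendsto (fun x : W => x - σ • e) (𝓝 (ζ + σ • e)) (𝓝 (ζ + σ • e - σ • e)) :=
        (continuous_id.sub continuous_const).tendsto _
      rwa [add_sub_cancel_right] at this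
    have hψ' : HasFDerivAt (fun x => b * inner ℝ e x + ψ (x - σ • e) + r * ‖x‖)
        (innerSL ℝ (b • e + q + (r / ‖ζ + σ • e‖) • (ζ + σ • e))) (ζ + σ • e) := by
      have h1 : HasFDerivAt (fun x : W => b * inner ℝ e x) (innerSL ℝ (b • e)) (ζ + σ • e) := by
        have := ((innerSL ℝ e).hasFDerivAt (x := ζ + σ • e)).const_mul b
        rw [map_smul]
        exact this
      have h2 : HasFDerivAt (fun x => ψ (x - σ • e)) (innerSL ℝ q) (ζ + σ • e) := by
        have h3 : HasFDerivAt ψ (innerSL ℝ q) (ζ + σ • e - σ • e) := by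
          rwa [add_sub_cancel_right]
        have h4 : HasFDerivAt (fun x : W => x - σ • e) (ContinuousLinearMap.id ℝ W) (ζ + σ • e) :=
          (hasFDerivAt_id _).sub_const _
        exact h3.comp (ζ + σ • e) h4
      have := (h1.add h2).add (hasFDerivAt_norm hne r)
      rw [← map_add, ← map_add] at this
      exact this
    have hgr : growthRate G (ζ + σ • e) = ψ (ζ + σ • e - σ • e) := by
      rw [growthRate_add_smul hGe, add_sub_cancel_right, heq]
    have hpe := inner_eq_of_support_point hψ'
      (H := fun ζ => b * inner ℝ e ζ + growthRate G ζ + r * ‖ζ‖)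
      (by filter_upwards [hO.mem_nhds hσ] with x hx using hp x hx)
      (by
        filter_upwards [hback.eventually hle] with x hx
        have h1 := growthRate_add_smul hGe (x - σ • e) σ
        rw [sub_add_cancel] at h1
        rw [h1]
        linarith) (by rw [hpζ, hgr])
    refine ⟨by rw [← hpe, hpR], ?_⟩
    have hin : inner ℝ (ζ + σ • e) ((r / ‖ζ + σ • e‖) • (ζ + σ • e)) = r * ‖ζ + σ • e‖ := by
      rw [inner_smul_right, real_inner_self_eq_norm_sq]
      have := norm_ne_zero_iff.2 hne
      field_simp
    rw [hpe, inner_add_right, inner_add_right, hin, inner_smul_right, growthRate_add_smul hGe,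
      real_inner_comm e, real_inner_comm q] at hpζ
    linarith
  have h0 := main.self_of_nhds
  obtain ⟨ε, hε, hε'⟩ := Metric.eventually_nhds_iff.1 main
  have h1 := (hε' (y := ε / 2) (by
    rw [Real.dist_eq, sub_zero, abs_of_pos (by linarith)]; linarith)).2
  have hqe : (inner ℝ q e : ℝ) = 0 := by
    have h2 := h0.2
    rw [zero_smul, add_zero] at h2
    rw [inner_add_right, inner_smul_right, h2] at h1
    have : ε / 2 * inner ℝ q e = 0 := by linarith
    exact (mul_eq_zero.1 this).resolve_left (by positivity)
  have hqζ : (inner ℝ q ζ : ℝ) = growthRate G ζ := by simpa using h0.2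
  -- Expanding `‖b e + q + r ω‖² = R²`, with `ω` the unit vector of `ζ + σ e`, gives `b (⟨e, ζ⟩ + σ)
  -- + growthRate G ζ = K ‖ζ + σ e‖` with `K` independent of `σ`.
  have hbH := eq_zero_of_quadratic (b := b) (s := inner ℝ e ζ) (H := growthRate G ζ)
    (K := (R ^ 2 - r ^ 2 - ‖b • e + q‖ ^ 2) / (2 * r)) hζe (by
      filter_upwards [main, hshift.eventually (hO.mem_nhds hζ)] with σ hσ hσO
      have hne := norm_ne_zero_iff.2 (hO0 _ hσO)
      have e1 := norm_add_sq_real (b • e + q) ((r / ‖ζ + σ • e‖) • (ζ + σ • e))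
      rw [hσ.1, norm_smul, inner_smul_right, Real.norm_eq_abs, abs_div, abs_norm, abs_of_pos hr,
        div_mul_cancel₀ _ hne, inner_add_left, inner_smul_left, RCLike.conj_to_real, hσ.2,
        inner_add_right e ζ, inner_smul_right, real_inner_self_eq_norm_sq, he] at e1
      have e2 : ‖ζ + σ • e‖ ^ 2 = ‖ζ‖ ^ 2 + 2 * inner ℝ e ζ * σ + σ ^ 2 := by
        rw [norm_add_sq_real, inner_smul_right, norm_smul, he, real_inner_comm e ζ, mul_one,
          Real.norm_eq_abs, sq_abs]
        ring
      have e3 : b * (inner ℝ e ζ + σ) + growthRate G ζ =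
          (R ^ 2 - r ^ 2 - ‖b • e + q‖ ^ 2) / (2 * r) * ‖ζ + σ • e‖ := by
        field_simp
        field_simp at e1
        linarith
      rw [e3, mul_pow, e2])
  refine ⟨hbH.1, hbH.2, ?_⟩
  have h2 := h0.1
  have hne := norm_ne_zero_iff.2 (hO0 _ hζ)
  simp only [hbH.1, zero_smul, zero_add, add_zero] at h2
  have e1 := norm_add_sq_real q ((r / ‖ζ‖) • ζ)
  rw [h2, norm_smul, inner_smul_right, hqζ, hbH.2, Real.norm_eq_abs, abs_div, abs_norm,
    abs_of_pos hr, div_mul_cancel₀ _ hne] at e1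
  linarith

/-- An open set of directions charged by `g` determines the radius and kills the drift. -/
theorem radius_eq_of_open (S : SphereDensity μ f X R) (T : SphereDensity μ g Z r)
    (hg : ∀ᵐ u ∂μ, 0 ≤ g u) (hr : 0 < r) (he : ‖e‖ = 1)
    (hratio : ∀ t, laplace μ f X t =
      (1 - κ * inner ℝ e t) * Real.exp (b * inner ℝ e t) * G t * laplace μ g Z t)
    (hGe : ∀ t (σ : ℝ), G (t + σ • e) = G t) (hGub : ∀ ζ, ∃ h, ExpGrowth G ζ h)
    (hf1 : ∫ u, f u ∂μ = 1)
    {O : Set W} (hO : IsOpen O) (hOne : O.Nonempty) (hOe : ∀ ζ ∈ O, inner ℝ e ζ ≠ (0 : ℝ))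
    (hOm : ∀ ζ ∈ O, IsMassPoint μ g Z ((r / ‖ζ‖) • ζ))
    (hOd : ∀ ζ ∈ O, (inner ℝ e ζ : ℝ) ^ 2 < ‖ζ‖ ^ 2) :
    b = 0 ∧ R = r := by
  have husc : UpperSemicontinuous (growthRate G) := by
    intro ζ c hc
    obtain ⟨h, h1, h2⟩ := exists_between hc
    filter_upwards [(expGrowth_of_growthRate_lt (hGub ζ) h1).eventually_nhds] with ζ' hζ'
    exact (csInf_le (S.bddBelow_expGrowth T hf1 hratio ζ') hζ').trans_lt h2
  -- A steep paraboloid: `N` is so large that `growthRate G - N ‖· - ζ₀‖²` attains its maximum over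
  -- the ball at an interior point `ζ`. There the rate is touched from above, hence is `0`, and
  -- maximality gives `growthRate G ζ₀ ≤ 0`.
  have key : ∀ ζ₀ ∈ O, ∃ ζ ∈ O, b = 0 ∧ growthRate G ζ = 0 ∧ growthRate G ζ₀ ≤ 0 := by
    intro ζ₀ hζ₀
    obtain ⟨ρ, hρ, hball⟩ := Metric.nhds_basis_closedBall.mem_iff.1 (hO.mem_nhds hζ₀)
    have hc := isCompact_closedBall ζ₀ ρ
    have hne : (Metric.closedBall ζ₀ ρ).Nonempty := ⟨ζ₀, Metric.mem_closedBall_self hρ.le⟩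
    obtain ⟨ζM, -, hM⟩ := (husc.upperSemicontinuousOn (Metric.closedBall ζ₀ ρ)).exists_isMaxOn hne hc
    set N := (|growthRate G ζM - growthRate G ζ₀| + 1) / ρ ^ 2 with hN
    have hN0 : 0 < N := by positivity
    have husc' : UpperSemicontinuousOn (fun ζ => growthRate G ζ + -(N * ‖ζ - ζ₀‖ ^ 2))
        (Metric.closedBall ζ₀ ρ) := by
      refine (husc.upperSemicontinuousOn _).add ?_
      have : Continuous fun ζ : W => -(N * ‖ζ - ζ₀‖ ^ 2) := by fun_prop
      exact this.upperSemicontinuous.upperSemicontinuousOn _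
    obtain ⟨ζ, hζ, hmax⟩ := husc'.exists_isMaxOn hne hc
    have h0 : growthRate G ζ₀ ≤ growthRate G ζ + -(N * ‖ζ - ζ₀‖ ^ 2) := by
      have := hmax (Metric.mem_closedBall_self hρ.le)
      simpa using this
    have hint : ζ ∈ Metric.ball ζ₀ ρ := by
      rw [mem_ball_iff_norm]
      by_contra! hge
      have h1 : growthRate G ζ ≤ growthRate G ζM := hM hζ
      have h2 : N * ρ ^ 2 ≤ N * ‖ζ - ζ₀‖ ^ 2 := by gcongr
      have h3 : N * ρ ^ 2 = |growthRate G ζM - growthRate G ζ₀| + 1 := by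
        rw [hN]; field_simp
      linarith [le_abs_self (growthRate G ζM - growthRate G ζ₀)]
    have hζO := hball hζ
    have hd : HasFDerivAt (fun x => growthRate G ζ - N * ‖ζ - ζ₀‖ ^ 2 + N * ‖x - ζ₀‖ ^ 2)
        (innerSL ℝ ((2 * N) • (ζ - ζ₀))) ζ := by
      have h1 : HasFDerivAt (fun x : W => ‖x - ζ₀‖ ^ 2) (2 • innerSL ℝ (ζ - ζ₀)) ζ := by
        have h2 : HasFDerivAt (fun x : W => ‖x‖ ^ 2) (2 • innerSL ℝ (ζ - ζ₀)) (ζ - ζ₀) :=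
          (hasStrictFDerivAt_norm_sq (ζ - ζ₀)).hasFDerivAt
        exact h2.comp ζ ((hasFDerivAt_id _).sub_const _)
      refine ((h1.const_mul N).const_add _).congr_fderiv ?_
      ext v
      simp
      ring
    have := S.touching_point T hg hr he hratio hGe hGub hf1 hO hOe hOm hζO (hOd ζ hζO) hd (by
      filter_upwards [Metric.isOpen_ball.mem_nhds hint] with x hx
      have : growthRate G x + -(N * ‖x - ζ₀‖ ^ 2) ≤ growthRate G ζ + -(N * ‖ζ - ζ₀‖ ^ 2) :=
        hmax (Metric.ball_subset_closedBall hx)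
      linarith) (by ring)
    refine ⟨ζ, hζO, this.1, this.2.1, ?_⟩
    rw [this.2.1] at h0
    have : 0 ≤ N * ‖ζ - ζ₀‖ ^ 2 := by positivity
    linarith
  obtain ⟨ζ₀, hζ₀⟩ := hOne
  obtain ⟨ζ, hζ, hb, hz, -⟩ := key ζ₀ hζ₀
  refine ⟨hb, ?_⟩
  -- The rate is nonpositive on `O` and zero at `ζ`, so the zero function touches it from above; its
  -- gradient `q = 0` leaves `r² = R²`.
  have := S.touching_point T hg hr he hratio hGe hGub hf1 hO hOe hOm hζ (hOd ζ hζ)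
    (ψ := fun _ => 0) (q := 0) (by simpa using hasFDerivAt_const (0 : ℝ) ζ)
    (by filter_upwards [hO.mem_nhds hζ] with x hx using (key x hx).choose_spec.2.2.2) hz
  have h2 := this.2.2
  rw [norm_zero] at h2
  have := S.nonneg
  nlinarith

end SphereDensity

end Rate

/-! ### Concentration of exponential weights -/

section Concentration

variable {U : Type*} [MeasurableSpace U] {μ : Measure U}

/-- A lower bound for an integral of a nonnegative function by its integral over a set. -/
theorem setIntegral_mul_const_le_integral {q k : U → ℝ} {s : Set U} {c : ℝ} (hs : MeasurableSet s)
    (hq : Integrable q μ) (hq0 : ∀ᵐ u ∂μ, 0 ≤ q u) (hk0 : ∀ u, 0 ≤ k u)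
    (hk : Integrable (fun u => q u * k u) μ) (hck : ∀ u ∈ s, c ≤ k u) :
    (∫ u in s, q u ∂μ) * c ≤ ∫ u, q u * k u ∂μ := by
  rw [← integral_mul_const]
  refine (setIntegral_mono_on_ae (hq.mul_const _).integrableOn hk.integrableOn hs ?_).trans
    (setIntegral_le_integral hk ?_)
  · filter_upwards [hq0] with u hu hus
    exact mul_le_mul_of_nonneg_left (hck u hus) hu
  · filter_upwards [hq0] with u hu using mul_nonneg hu (hk0 u)

/-- The exponential weights `exp(s A)` concentrate, as `s → ∞`, where `A` is maximal. -/
theorem eventually_abs_integral_exp_le {q A h : U → ℝ} {r C η : ℝ} (hq : Integrable q μ)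
    (hq0 : ∀ᵐ u ∂μ, 0 ≤ q u) (hA : Measurable A) (hAr : ∀ u, |A u| ≤ r)
    (hmass : ∀ δ > 0, 0 < ∫ u in {u | r - δ < A u}, q u ∂μ)
    (hC : ∀ u, |h u| ≤ C) (hsmall : ∀ η > 0, ∃ δ > 0, ∀ u, r - δ < A u → |h u| ≤ η) (hη : 0 < η) :
    ∀ᶠ s in atTop, |∫ u, q u * h u * Real.exp (s * A u) ∂μ| ≤
      η * ∫ u, q u * Real.exp (s * A u) ∂μ := by
  -- Where `A > r - δ` the factor `h` is at most `η / 2`. The rest is of order `exp(s (r - δ))`,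
  -- negligible against the mass of `{A > r - δ / 2}`, which contributes at least `c exp(s (r - δ /
  -- 2))`.
  obtain ⟨δ, hδ, hδh⟩ := hsmall (η / 2) (by linarith)
  have hset : MeasurableSet {u | r - δ / 2 < A u} := measurableSet_lt measurable_const hA
  set c := ∫ u in {u | r - δ / 2 < A u}, q u ∂μ with hc
  have hc0 : 0 < c := hmass (δ / 2) (by linarith)
  have hexp : ∀ s : ℝ, Integrable (fun u => q u * Real.exp (s * A u)) μ := fun s => by
    refine hq.mul_bdd (c := Real.exp (|s| * r)) (by fun_prop) (Eventually.of_forall fun u => ?_)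
    rw [Real.norm_eq_abs, Real.abs_exp]
    refine Real.exp_le_exp.2 ((le_abs_self _).trans ?_)
    rw [abs_mul]
    gcongr
    exact hAr u
  filter_upwards [eventually_ge_atTop (0 : ℝ), eventually_const_mul_exp_le
    (C := (C * ∫ u, q u ∂μ) / (η / 2 * c)) (h := r - δ) (h' := r - δ / 2) (by linarith)
    (tendsto_id (α := ℝ) (x := atTop))] with s hs hs2
  simp only [id] at hs2
  have hlow : c * Real.exp (s * (r - δ / 2)) ≤ ∫ u, q u * Real.exp (s * A u) ∂μ :=
    setIntegral_mul_const_le_integral hset hq hq0 (fun u => (Real.exp_pos _).le) (hexp s)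
      fun u hu => Real.exp_le_exp.2 (mul_le_mul_of_nonneg_left (le_of_lt hu) hs)
  have hup : |∫ u, q u * h u * Real.exp (s * A u) ∂μ| ≤
      ∫ u, (η / 2 * (q u * Real.exp (s * A u)) + C * Real.exp (s * (r - δ)) * q u) ∂μ := by
    rw [← Real.norm_eq_abs]
    refine norm_integral_le_of_norm_le (((hexp s).const_mul _).add (hq.const_mul _)) ?_
    filter_upwards [hq0] with u hu
    rw [norm_mul, norm_mul, Real.norm_eq_abs, Real.norm_eq_abs, Real.norm_eq_abs, Real.abs_exp,
      abs_of_nonneg hu]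
    have hC0 : 0 ≤ C := (abs_nonneg _).trans (hC u)
    have e0 := Real.exp_pos (s * A u)
    have e1 := Real.exp_pos (s * (r - δ))
    rcases lt_or_ge (r - δ) (A u) with h1 | h1
    · have h2 : q u * |h u| * Real.exp (s * A u) ≤ q u * (η / 2) * Real.exp (s * A u) := by
        gcongr
        exact hδh u h1
      have : 0 ≤ C * Real.exp (s * (r - δ)) * q u := by positivity
      linarith
    · have h2 : q u * |h u| * Real.exp (s * A u) ≤ q u * C * Real.exp (s * (r - δ)) := by
        gcongr
        exact hC u
      have : 0 ≤ η / 2 * (q u * Real.exp (s * A u)) := by positivity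
      linarith
  rw [integral_add ((hexp s).const_mul _) (hq.const_mul _), integral_const_mul,
    integral_const_mul] at hup
  have hlast : C * Real.exp (s * (r - δ)) * ∫ u, q u ∂μ ≤
      η / 2 * ∫ u, q u * Real.exp (s * A u) ∂μ := by
    have h3 : C * Real.exp (s * (r - δ)) * ∫ u, q u ∂μ =
        (η / 2) * (c * ((C * ∫ u, q u ∂μ) / (η / 2 * c) * Real.exp (s * (r - δ)))) := by
      field_simp
    rw [h3]
    have : c * ((C * ∫ u, q u ∂μ) / (η / 2 * c) * Real.exp (s * (r - δ))) ≤
        ∫ u, q u * Real.exp (s * A u) ∂μ :=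
      (mul_le_mul_of_nonneg_left hs2 hc0.le).trans hlow
    exact mul_le_mul_of_nonneg_left this (by linarith)
  linarith

end Concentration

/-! ### Transport along expanding affine fields -/

section Transport

variable {W : Type*} [NormedAddCommGroup W] [InnerProductSpace ℝ W] [FiniteDimensional ℝ W]

/-- A function of subexponential growth which decays along an expanding affine vector field
vanishes. -/
theorem eq_zero_of_transport {h : W → ℝ} (hd : Differentiable ℝ h)
    (hs : ∀ ε > 0, ∃ C, ∀ t, |h t| ≤ C * Real.exp (ε * ‖t‖)) {a : W} {T : W →L[ℝ] W}
    (hT : ∀ v, 0 ≤ inner ℝ v (T v)) {c : ℝ} (hc : c < 0)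
    (heq : ∀ y, fderiv ℝ h y (a + T y) = c * h y) (y : W) : h y = 0 := by
  by_contra hy
  set ε := -c / (2 * (‖a‖ + 1)) with hε
  have hε0 : 0 < ε := by have : 0 < -c := by linarith
                         positivity
  have hεa : ε * ‖a‖ < -c := by
    have h1 : ε * (2 * (‖a‖ + 1)) = -c := by rw [hε]; field_simp
    nlinarith [norm_nonneg a]
  -- `√(1 + ‖x‖²)` is a smooth version of `‖x‖`, so `φ` tends to `0` at infinity and has a maximum
  -- with `h x ≠ 0`. Differentiating there along `v = a + T x` gives `c = ε ⟨x, v⟩ / √(1 + ‖x‖²) ≥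
  -- -ε ‖a‖`, because `⟨x, T x⟩ ≥ 0`, while `ε` was chosen with `ε ‖a‖ < -c`.
  set φ : W → ℝ := fun x => h x ^ 2 * Real.exp (-2 * ε * √(1 + ‖x‖ ^ 2)) with hφ
  have hφc : Continuous φ := by
    have := hd.continuous
    fun_prop
  have hpos : 0 < φ y := by positivity
  obtain ⟨C, hC⟩ := hs (ε / 2) (by linarith)
  have hbd : ∀ x, φ x ≤ C ^ 2 * Real.exp (-(ε * ‖x‖)) := by
    intro x
    have h1 : h x ^ 2 ≤ (C * Real.exp (ε / 2 * ‖x‖)) ^ 2 := by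
      rw [← sq_abs (h x)]
      gcongr
      exact hC x
    have h2 : ‖x‖ ≤ √(1 + ‖x‖ ^ 2) := Real.le_sqrt_of_sq_le (by linarith)
    calc φ x ≤ (C * Real.exp (ε / 2 * ‖x‖)) ^ 2 * Real.exp (-2 * ε * ‖x‖) :=
          mul_le_mul h1 (Real.exp_le_exp.2 (by nlinarith)) (Real.exp_pos _).le (sq_nonneg _)
      _ = _ := by
          rw [mul_pow, ← Real.exp_nat_mul, mul_assoc, ← Real.exp_add]
          congr 2
          push_cast
          ring
  have hlim : Tendsto (fun x : W => C ^ 2 * Real.exp (-(ε * ‖x‖))) (cocompact W) (𝓝 0) := by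
    have h1 : Tendsto (fun x : W => ε * ‖x‖) (cocompact W) atTop :=
      (tendsto_norm_cocompact_atTop).const_mul_atTop hε0
    simpa using (Real.tendsto_exp_neg_atTop_nhds_zero.comp h1).const_mul (C ^ 2)
  obtain ⟨x, hx⟩ := hφc.exists_forall_ge' y (by
    filter_upwards [hlim.eventually_le_const hpos] with z hz using (hbd z).trans hz)
  have hhx : h x ≠ 0 := by
    intro h0
    have := hx y
    rw [show φ x = 0 by simp [hφ, h0]] at this
    linarith
  set v := a + T x with hv
  have hline : HasDerivAt (fun t : ℝ => x + t • v) v 0 := by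
    simpa using ((hasDerivAt_id (0 : ℝ)).smul_const v).const_add x
  have hN : (0 : ℝ) < 1 + ‖x‖ ^ 2 := by positivity
  have h1 : HasDerivAt (fun t : ℝ => h (x + t • v)) (c * h x) 0 := by
    have h2 : HasFDerivAt h (fderiv ℝ h x) (x + (0 : ℝ) • v) := by
      rw [zero_smul, add_zero]; exact (hd x).hasFDerivAt
    exact (h2.comp_hasDerivAt (0 : ℝ) hline).congr_deriv (heq x)
  have h2 : HasDerivAt (fun t : ℝ => √(1 + ‖x + t • v‖ ^ 2))
      (2 * inner ℝ x v / (2 * √(1 + ‖x‖ ^ 2))) 0 := by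
    have h3 := (hline.norm_sq.const_add 1).sqrt (by simpa using hN.ne')
    simpa using h3
  have h3 := (h1.fun_pow 2).fun_mul ((h2.const_mul (-2 * ε)).exp)
  have hloc : IsLocalMax (fun t : ℝ => h (x + t • v) ^ 2 *
      Real.exp (-2 * ε * √(1 + ‖x + t • v‖ ^ 2))) 0 :=
    Eventually.of_forall fun t => by simpa [hφ] using hx (x + t • v)
  have h4 := hloc.hasDerivAt_eq_zero h3
  set ρ := √(1 + ‖x‖ ^ 2) with hρ
  have hρ1 : ‖x‖ ≤ ρ := Real.le_sqrt_of_sq_le (by linarith)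
  have hρ0 : 0 < ρ := Real.sqrt_pos.2 hN
  simp only [zero_smul, add_zero, ← hρ] at h4
  have h5 : h x ^ 2 * Real.exp (-2 * ε * ρ) * (2 * (c - ε * (inner ℝ x v / ρ))) = 0 := by
    rw [← h4]
    field_simp
    ring
  have h6 : c = ε * (inner ℝ x v / ρ) := by
    have := (mul_eq_zero.1 h5).resolve_left (by positivity)
    linarith
  have h7 : -‖a‖ ≤ inner ℝ x v / ρ := by
    rw [le_div_iff₀ hρ0, hv, inner_add_right]
    have k1 := neg_le_of_abs_le (abs_real_inner_le_norm x a)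
    have k2 := hT x
    have k3 : ‖x‖ * ‖a‖ ≤ ρ * ‖a‖ := by gcongr
    linarith
  nlinarith

/-- Normalise `x s` and extract a limit on the unit sphere: a closed cone keeps it, and relations
valid up to `o(‖x s‖)` become exact. -/
theorem exists_limit_direction {E : Type*} [NormedAddCommGroup E] [NormedSpace ℝ E]
    [FiniteDimensional ℝ E] {ι : Type*} {x : ℝ → E} {C : Set E} (hC : IsClosed C)
    (hCs : ∀ v ∈ C, ∀ c : ℝ, 0 ≤ c → c • v ∈ C) (hxC : ∀ᶠ s in atTop, x s ∈ C)
    (hx0 : ∀ᶠ s in atTop, x s ≠ 0) (L : ι → E →L[ℝ] ℝ)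
    (hL : ∀ i, ∀ η > 0, ∀ᶠ s in atTop, |L i (x s)| ≤ η * ‖x s‖) :
    ∃ v ∈ C, ‖v‖ = 1 ∧ ∀ i, L i v = 0 := by
  obtain ⟨s₀, hs₀⟩ := (hxC.and hx0).exists_forall_of_atTop
  have hseq : Tendsto (fun n : ℕ => s₀ + (n : ℝ)) atTop atTop :=
    tendsto_atTop_add_const_left _ _ tendsto_natCast_atTop_atTop
  have hge : ∀ n : ℕ, s₀ ≤ s₀ + (n : ℝ) := fun n => by simp
  have : ProperSpace E := FiniteDimensional.proper ℝ E
  set w : ℕ → E := fun n => ‖x (s₀ + n)‖⁻¹ • x (s₀ + n) with hw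
  have hwn : ∀ n, w n ∈ Metric.sphere (0 : E) 1 := fun n => by
    have := norm_ne_zero_iff.2 (hs₀ _ (hge n)).2
    rw [mem_sphere_zero_iff_norm, hw, norm_smul, norm_inv, norm_norm, inv_mul_cancel₀ this]
  obtain ⟨v, hv, φ, hφ, hlim⟩ := (isCompact_sphere (0 : E) 1).tendsto_subseq hwn
  refine ⟨v, ?_, mem_sphere_zero_iff_norm.1 hv, fun i => ?_⟩
  · exact hC.mem_of_tendsto hlim (Eventually.of_forall fun n =>
      hCs _ (hs₀ _ (hge _)).1 _ (by positivity))
  · have h1 : Tendsto (fun n => |L i ((w ∘ φ) n)|) atTop (𝓝 |L i v|) :=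
      (((L i).continuous.tendsto v).comp hlim).abs
    have h2 : |L i v| ≤ 0 := by
      refine le_of_forall_pos_le_add fun η hη => ?_
      rw [zero_add]
      refine le_of_tendsto h1 ?_
      have h3 := (hseq.comp hφ.tendsto_atTop).eventually (hL i η hη)
      filter_upwards [h3] with n hn
      have h0 := norm_pos_iff.2 (hs₀ _ (hge (φ n))).2
      simp only [Function.comp_apply, hw, map_smul, smul_eq_mul, abs_mul, abs_inv, abs_norm] at hn ⊢
      rw [inv_mul_le_iff₀ h0, mul_comm]
      exact hn
    exact abs_nonpos_iff.1 h2

end Transport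

/-! ### Subexponential growth of the transverse factor -/

section Subexp

variable {U : Type*} [MeasurableSpace U] {μ : Measure U}
  {W : Type*} [NormedAddCommGroup W] [InnerProductSpace ℝ W] [FiniteDimensional ℝ W]
  [MeasurableSpace W] [BorelSpace W]

namespace SphereDensity

variable {g : U → ℝ} {Z : U → W} {r κ : ℝ} {e : W}

/-- A function which is invariant in the direction `e` of a mass point, and becomes of exponential
type `r` when multiplied by a Laplace transform on the sphere of radius `r`, grows
subexponentially. -/
theorem subexponential_of_mul_laplace (T : SphereDensity μ g Z r) (hg : ∀ᵐ u ∂μ, 0 ≤ g u)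
    (hm : IsMassPoint μ g Z (r • e)) (he : ‖e‖ = 1) (hr : 0 < r) {h : W → ℝ}
    (hinv : ∀ t (σ : ℝ), h (t + σ • e) = h t) {C : ℝ}
    (hb : ∀ t, |(1 - κ * inner ℝ e t) * h t * laplace μ g Z t| ≤ C * Real.exp (r * ‖t‖))
    {ε : ℝ} (hε : 0 < ε) : ∃ C', ∀ t, |h t| ≤ C' * Real.exp (ε * ‖t‖) := by
  have hZm := T.measurable
  -- As `h` does not vary along `e`, it may be evaluated at `p + s e` with `p ⟂ e` and `s` about `K
  -- ‖t‖`. The norm of this point exceeds `s` by at most `‖t‖ / (2 K)`, and the mass at the pole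
  -- makes the transform of `g` at least `c exp(s (r - δ) - δ ‖t‖)`. With these `K` and `δ` the two
  -- losses are `ε/2 ‖t‖` each.
  set K := r / ε with hK
  have hK0 : 0 < K := by positivity
  set δ := ε / (2 * (K + 1)) with hδ
  have hδ0 : 0 < δ := by positivity
  have hset : MeasurableSet {u | ‖Z u - r • e‖ < δ} := measurableSet_lt (by fun_prop) measurable_const
  set c := ∫ u in {u | ‖Z u - r • e‖ < δ}, g u ∂μ with hc
  have hc0 : 0 < c := hm δ hδ0
  -- This keeps `|1 - κ s| ≥ 1`. For `κ = 0` the quotient is `0` and the factor is `1`.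
  set s₀ := 2 / |κ| with hs₀
  have hs₀0 : 0 ≤ s₀ := by positivity
  refine ⟨C / c * Real.exp (δ * s₀), fun t => ?_⟩
  set p := t - (inner ℝ e t : ℝ) • e with hp
  have hep : (inner ℝ e p : ℝ) = 0 := by
    rw [hp, inner_sub_right, inner_smul_right, real_inner_self_eq_norm_sq, he]; ring
  have hpt : ‖p‖ ≤ ‖t‖ := by
    have h1 : ‖t‖ ^ 2 = ‖p‖ ^ 2 + (inner ℝ e t) ^ 2 := by
      have h2 : t = p + (inner ℝ e t : ℝ) • e := by rw [hp]; abel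
      conv_lhs => rw [h2]
      rw [norm_add_sq_real, inner_smul_right, real_inner_comm e p, hep, norm_smul, he,
        Real.norm_eq_abs, mul_one, sq_abs]
      ring
    refine le_of_sq_le_sq ?_ (norm_nonneg _)
    nlinarith [sq_nonneg (inner ℝ e t : ℝ)]
  set s := s₀ + K * ‖t‖ with hs
  have hs0 : 0 ≤ s := by positivity
  have hht : h t = h (p + s • e) := by
    rw [hinv, hp, sub_eq_add_neg, ← neg_smul, hinv]
  have hes : (inner ℝ e (p + s • e) : ℝ) = s := by
    rw [inner_add_right, hep, inner_smul_right, real_inner_self_eq_norm_sq, he]; ring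
  have hone : 1 ≤ |1 - κ * s| := by
    rcases eq_or_ne κ 0 with h0 | h0
    · simp [h0]
    · have hκ : 0 < |κ| := abs_pos.2 h0
      have h1 : 2 ≤ |κ| * s := by
        have : |κ| * s₀ = 2 := by rw [hs₀]; field_simp
        rw [hs, mul_add, this]
        have : 0 ≤ |κ| * (K * ‖t‖) := by positivity
        linarith
      have h2 := abs_sub_abs_le_abs_sub (κ * s) 1
      rw [abs_one, abs_sub_comm, abs_mul, abs_of_nonneg hs0] at h2
      linarith
  have hnorm : ‖p + s • e‖ ≤ s + ‖t‖ / (2 * K) := by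
    refine le_of_sq_le_sq ?_ (by positivity)
    rw [norm_add_sq_real, inner_smul_right, real_inner_comm e p, hep, norm_smul, he,
      Real.norm_eq_abs, abs_of_nonneg hs0]
    have h1 : 2 * s * (‖t‖ / (2 * K)) ≥ ‖t‖ ^ 2 := by
      have h2 : 2 * (K * ‖t‖) * (‖t‖ / (2 * K)) = ‖t‖ ^ 2 := by field_simp
      rw [ge_iff_le, ← h2]
      gcongr
      rw [hs]; linarith
    have h2 : ‖p‖ ^ 2 ≤ ‖t‖ ^ 2 := by gcongr
    have h3 := sq_nonneg (‖t‖ / (2 * K))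
    nlinarith
  have hlow : c * Real.exp (s * (r - δ) - δ * ‖t‖) ≤ laplace μ g Z (p + s • e) := by
    refine setIntegral_mul_const_le_integral hset T.integrable hg (fun u => (Real.exp_pos _).le)
      (T.integrable_mul_exp T.integrable _) fun u hu => Real.exp_le_exp.2 ?_
    have hu' : ‖Z u - r • e‖ < δ := hu
    have h1 := neg_le_of_abs_le (abs_real_inner_le_norm (p + s • e) (Z u - r • e))
    have h2 : ‖p + s • e‖ ≤ ‖t‖ + s := by
      refine (norm_add_le _ _).trans (add_le_add hpt ?_)
      rw [norm_smul, he, Real.norm_eq_abs, abs_of_nonneg hs0, mul_one]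
    have h3 : ‖p + s • e‖ * ‖Z u - r • e‖ ≤ (‖t‖ + s) * δ := by gcongr
    have h4 : (inner ℝ (p + s • e) (r • e) : ℝ) = s * r := by
      rw [inner_smul_right, real_inner_comm e, hes]; ring
    rw [inner_sub_right, h4] at h1
    linarith
  have hbt := hb (p + s • e)
  rw [hes, abs_mul, abs_mul, ← hht] at hbt
  have hC0 : 0 ≤ C := by
    have := (abs_nonneg _).trans (hb 0)
    exact nonneg_of_mul_nonneg_left this (Real.exp_pos _)
  have h1 : |h t| * (c * Real.exp (s * (r - δ) - δ * ‖t‖)) ≤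
      C * Real.exp (r * (s + ‖t‖ / (2 * K))) := by
    calc _ ≤ |1 - κ * s| * |h t| * |laplace μ g Z (p + s • e)| := by
          refine mul_le_mul ?_ (hlow.trans (le_abs_self _)) (by positivity) (by positivity)
          nlinarith [abs_nonneg (h t)]
      _ ≤ _ := hbt
      _ ≤ _ := mul_le_mul_of_nonneg_left (Real.exp_le_exp.2 (by gcongr)) hC0
  have h2 : |h t| ≤ C * Real.exp (r * (s + ‖t‖ / (2 * K))) /
      (c * Real.exp (s * (r - δ) - δ * ‖t‖)) := (le_div_iff₀ (by positivity)).2 h1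
  refine h2.trans (le_of_eq ?_)
  rw [mul_div_mul_comm, ← Real.exp_sub, mul_assoc, ← Real.exp_add]
  congr 2
  have hδe : δ * (K + 1) = ε / 2 := by rw [hδ]; field_simp
  have hKe : r / (2 * K) = ε / 2 := by rw [hK]; field_simp
  have : r * (s + ‖t‖ / (2 * K)) - (s * (r - δ) - δ * ‖t‖) =
      (r / (2 * K)) * ‖t‖ + δ * s + δ * ‖t‖ := by ring
  rw [this, hKe, hs]
  linear_combination ‖t‖ * hδe

end SphereDensity

end Subexp

/-! ### Limits of tilted moments -/

section Moments

variable {U : Type*} [MeasurableSpace U] {μ : Measure U}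
  {W : Type*} [NormedAddCommGroup W] [InnerProductSpace ℝ W] [FiniteDimensional ℝ W]
  [MeasurableSpace W] [BorelSpace W]

/-- The rank one operator `v ↦ ⟨y, v⟩ y`. -/
noncomputable def selfOuter (y : W) : W →L[ℝ] W := (innerSL ℝ y).smulRight y

@[simp] theorem selfOuter_apply (y v : W) : selfOuter y v = (inner ℝ y v : ℝ) • y := rfl

theorem continuous_selfOuter : Continuous (selfOuter : W → W →L[ℝ] W) := by
  have h : (selfOuter : W → W →L[ℝ] W) =
      fun y => ContinuousLinearMap.smulRightL ℝ W W (innerSL ℝ y) y := rfl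
  rw [h]
  fun_prop

theorem norm_selfOuter_le (y : W) : ‖selfOuter y‖ ≤ ‖y‖ * ‖y‖ := by
  rw [selfOuter, ContinuousLinearMap.norm_smulRight_apply, innerSL_apply_norm]

/-- The left side is the trace of the second moment operator. Errors of order `∫ w ‖Y‖²` are thus
controlled by the norm of that operator, which also cannot vanish when this integral is positive. -/
theorem integral_norm_sq_le {w : U → ℝ} {Y : U → W} (hi : Integrable (fun u => w u • selfOuter (Y u)) μ) :
    ∫ u, w u * ‖Y u‖ ^ 2 ∂μ ≤ (Module.finrank ℝ W : ℝ) * ‖∫ u, w u • selfOuter (Y u) ∂μ‖ := by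
  set T := ∫ u, w u • selfOuter (Y u) ∂μ with hT
  set b := stdOrthonormalBasis ℝ W
  have hv : ∀ v : W, T v = ∫ u, (w u • selfOuter (Y u)) v ∂μ := fun v =>
    ContinuousLinearMap.integral_apply hi v
  have hiv : ∀ v : W, Integrable (fun u => (w u • selfOuter (Y u)) v) μ := fun v =>
    (ContinuousLinearMap.apply ℝ W v).integrable_comp hi
  have h1 : ∑ i, inner ℝ (b i) (T (b i)) = ∫ u, w u * ‖Y u‖ ^ 2 ∂μ := by
    have : ∀ i, inner ℝ (b i) (T (b i)) = ∫ u, inner ℝ (b i) ((w u • selfOuter (Y u)) (b i)) ∂μ := by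
      intro i
      rw [hv]
      exact ((innerSL ℝ (b i)).integral_comp_comm (hiv _)).symm
    simp_rw [this]
    rw [← integral_finsetSum]
    · refine integral_congr_ae (Eventually.of_forall fun u => ?_)
      have h2 := sum_inner_mul_inner (Y u) (Y u)
      rw [real_inner_self_eq_norm_sq] at h2
      simp only [smul_apply, selfOuter_apply, inner_smul_right]
      rw [← h2, Finset.mul_sum]
      refine Finset.sum_congr rfl fun i _ => ?_
      rw [real_inner_comm (b i)]
    · exact fun i _ => (innerSL ℝ (b i)).integrable_comp (hiv _)
  rw [← h1]
  calc ∑ i, inner ℝ (b i) (T (b i)) ≤ ∑ _i : Fin (Module.finrank ℝ W), ‖T‖ := by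
        refine Finset.sum_le_sum fun i _ => ?_
        refine (real_inner_le_norm _ _).trans ?_
        have := T.le_opNorm (b i)
        rw [b.norm_eq_one, mul_one] at this
        rwa [b.norm_eq_one, one_mul]
    _ = _ := by simp

theorem abs_exp_sub_one_sub_le (x : ℝ) : |Real.exp x - 1 - x| ≤ x ^ 2 * Real.exp |x| := by
  have h := Complex.norm_exp_sub_sum_le_norm_mul_exp (x : ℂ) 2
  simp only [Finset.sum_range_succ, Finset.sum_range_zero, Nat.factorial, zero_add, pow_zero,
    pow_one, Nat.cast_one, div_one, mul_one, Complex.norm_real, Real.norm_eq_abs] at h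
  rw [show Complex.exp (x : ℂ) - (1 + (x : ℂ)) = ((Real.exp x - 1 - x : ℝ) : ℂ) by push_cast; ring,
    Complex.norm_real, Real.norm_eq_abs, sq_abs] at h
  exact h

/-- The second order expansion, at a pole, of a family of tilted transport identities. -/
theorem exists_transport_limit {g A : U → ℝ} {Y : U → W} {ε : ℝ → ℝ} {G : W → ℝ} {r B : ℝ}
    {D : W → W →L[ℝ] ℝ} (K : Submodule ℝ W) (hgi : Integrable g μ) (hg : ∀ᵐ u ∂μ, 0 ≤ g u)
    (hA : Measurable A) (hAr : ∀ u, |A u| ≤ r) (hY : Measurable Y) (hYB : ∀ u, ‖Y u‖ ≤ B)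
    (hYK : ∀ k ∈ K, ∀ u, inner ℝ k (Y u) = (0 : ℝ))
    (hmass : ∀ δ > 0, 0 < ∫ u in {u | r - δ < A u}, g u ∂μ)
    (hmassY : ∀ δ > 0, 0 < ∫ u in {u | r - δ < A u}, g u * ‖Y u‖ ^ 2 ∂μ)
    (hYs : ∀ η > 0, ∃ δ > 0, ∀ u, r - δ < A u → ‖Y u‖ ≤ η)
    (hε : ∀ᶠ s in atTop, 0 ≤ ε s)
    (hid : ∀ y, ∀ᶠ s in atTop, ∫ u, g u * ((D y (Y u) + ε s * A u * G y) *
      Real.exp (inner ℝ y (Y u))) * Real.exp (s * A u) ∂μ = 0) :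
    ∃ (a : W) (T : W →L[ℝ] W) (c : ℝ), (a, T, c) ≠ 0 ∧ 0 ≤ c ∧ (∀ v, 0 ≤ inner ℝ v (T v)) ∧
      (∀ v w, inner ℝ (T v) w = inner ℝ v (T w)) ∧ (∀ k ∈ K, inner ℝ k a = (0 : ℝ)) ∧
      (∀ k ∈ K, ∀ v, inner ℝ k (T v) = (0 : ℝ)) ∧ ∀ y, D y (a + T y) + r * G y * c = 0 := by
  have hr0 : ∀ u, 0 ≤ r := fun u => (abs_nonneg _).trans (hAr u)
  have hB0 : ∀ u, 0 ≤ B := fun u => (norm_nonneg _).trans (hYB u)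
  have hexp : ∀ s : ℝ, ∀ {q : U → ℝ}, Integrable q μ →
      Integrable (fun u => q u * Real.exp (s * A u)) μ := fun s q hq => by
    refine hq.mul_bdd (c := Real.exp (|s| * r)) (by fun_prop) (Eventually.of_forall fun u => ?_)
    rw [Real.norm_eq_abs, Real.abs_exp]
    refine Real.exp_le_exp.2 ((le_abs_self _).trans ?_)
    rw [abs_mul]
    gcongr
    exact hAr u
  set w : ℝ → U → ℝ := fun s u => g u * Real.exp (s * A u) with hw
  have hwi : ∀ s, Integrable (w s) μ := fun s => hexp s hgi
  have hw0 : ∀ s, ∀ᵐ u ∂μ, 0 ≤ w s u := fun s => by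
    filter_upwards [hg] with u hu using mul_nonneg hu (Real.exp_pos _).le
  have hYi : ∀ s, Integrable (fun u => w s u • Y u) μ := fun s =>
    (hwi s).smul_bdd B hY.aestronglyMeasurable (Eventually.of_forall hYB)
  have hTi : ∀ s, Integrable (fun u => w s u • selfOuter (Y u)) μ := fun s =>
    (hwi s).smul_bdd (B * B)
      (continuous_selfOuter.comp_aestronglyMeasurable hY.aestronglyMeasurable)
      (Eventually.of_forall fun u => (norm_selfOuter_le _).trans
        (mul_le_mul (hYB u) (hYB u) (norm_nonneg _) (hB0 u)))
  have hY2i : Integrable (fun u => g u * ‖Y u‖ ^ 2) μ := by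
    refine hgi.mul_bdd (c := B ^ 2) (by fun_prop) (Eventually.of_forall fun u => ?_)
    rw [Real.norm_eq_abs, abs_of_nonneg (sq_nonneg _)]
    have := hYB u
    gcongr
  have hY20 : ∀ᵐ u ∂μ, 0 ≤ g u * ‖Y u‖ ^ 2 := by
    filter_upwards [hg] with u hu using mul_nonneg hu (sq_nonneg _)
  -- First moment, second moment and rescaled mass of the tilted weight. Expanding `exp⟨y, Y⟩`, the
  -- hypothesis says that the linear form `L y` below is `o(‖x s‖)` at `x s`; a normalised limit of
  -- `x s` is the required triple.
  set x : ℝ → W × (W →L[ℝ] W) × ℝ := fun s =>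
    (∫ u, w s u • Y u ∂μ, ∫ u, w s u • selfOuter (Y u) ∂μ, ε s * ∫ u, w s u ∂μ) with hx
  have hTv : ∀ s v, (x s).2.1 v = ∫ u, w s u • ((inner ℝ (Y u) v : ℝ) • Y u) ∂μ := fun s v =>
    ContinuousLinearMap.integral_apply (hTi s) v
  have hTvi : ∀ s v, Integrable (fun u => w s u • ((inner ℝ (Y u) v : ℝ) • Y u)) μ := fun s v =>
    (ContinuousLinearMap.apply ℝ W v).integrable_comp (hTi s)
  have hin : ∀ s v v', inner ℝ v' ((x s).2.1 v) =
      ∫ u, w s u * (inner ℝ (Y u) v * inner ℝ v' (Y u)) ∂μ := fun s v v' => by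
    rw [hTv]
    refine ((innerSL ℝ v').integral_comp_comm (hTvi s v)).symm.trans
      (integral_congr_ae (Eventually.of_forall fun u => ?_))
    simp
  set C : Set (W × (W →L[ℝ] W) × ℝ) := {x | 0 ≤ x.2.2 ∧ (∀ v, 0 ≤ inner ℝ v (x.2.1 v)) ∧
    (∀ v w, inner ℝ (x.2.1 v) w = inner ℝ v (x.2.1 w)) ∧ (∀ k ∈ K, inner ℝ k x.1 = (0 : ℝ)) ∧
    (∀ k ∈ K, ∀ v, inner ℝ k (x.2.1 v) = (0 : ℝ))} with hCdef
  have hC : IsClosed C := by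
    have hap : ∀ v : W, Continuous fun x : W × (W →L[ℝ] W) × ℝ => x.2.1 v := fun v => by fun_prop
    have hc2 : Continuous fun x : W × (W →L[ℝ] W) × ℝ => x.2.2 := by fun_prop
    have q1 : IsClosed {x : W × (W →L[ℝ] W) × ℝ | ∀ v, 0 ≤ inner ℝ v (x.2.1 v)} := by
      simp only [Set.ofPred_forall]
      exact isClosed_iInter fun v => isClosed_le continuous_const (continuous_const.inner (hap v))
    have q2 : IsClosed {x : W × (W →L[ℝ] W) × ℝ |
        ∀ v w, inner ℝ (x.2.1 v) w = inner ℝ v (x.2.1 w)} := by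
      simp only [Set.ofPred_forall]
      exact isClosed_iInter fun v => isClosed_iInter fun v' =>
        isClosed_eq ((hap v).inner continuous_const) (continuous_const.inner (hap v'))
    have q3 : IsClosed {x : W × (W →L[ℝ] W) × ℝ | ∀ k ∈ K, inner ℝ k x.1 = (0 : ℝ)} := by
      simp only [Set.ofPred_forall]
      exact isClosed_iInter fun v => isClosed_iInter fun _ =>
        isClosed_eq (continuous_const.inner continuous_fst) continuous_const
    have q4 : IsClosed {x : W × (W →L[ℝ] W) × ℝ |
        ∀ k ∈ K, ∀ v, inner ℝ k (x.2.1 v) = (0 : ℝ)} := by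
      simp only [Set.ofPred_forall]
      exact isClosed_iInter fun v => isClosed_iInter fun _ => isClosed_iInter fun v' =>
        isClosed_eq (continuous_const.inner (hap v')) continuous_const
    exact (isClosed_le continuous_const hc2).inter (q1.inter (q2.inter (q3.inter q4)))
  have hCs : ∀ v ∈ C, ∀ c : ℝ, 0 ≤ c → c • v ∈ C := by
    rintro ⟨a, T, d⟩ ⟨h1, h2, h3, h4, h5⟩ c hc
    refine ⟨mul_nonneg hc h1, fun v => ?_, fun v v' => ?_, fun k hk => ?_, fun k hk v => ?_⟩
    · simpa [inner_smul_right] using mul_nonneg hc (h2 v)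
    · have := h3 v v'
      simp only at this
      simp [inner_smul_right, inner_smul_left, this]
    · have := h4 k hk
      simp only at this
      simp [inner_smul_right, this]
    · have := h5 k hk v
      simp only at this
      simp [inner_smul_right, this]
  have hxC : ∀ᶠ s in atTop, x s ∈ C := by
    filter_upwards [hε] with s hs
    refine ⟨mul_nonneg hs (integral_nonneg_of_ae (hw0 s)), fun v => ?_, fun v v' => ?_,
      fun k hk => ?_, fun k hk v => ?_⟩
    · rw [hin]
      refine integral_nonneg_of_ae ?_
      filter_upwards [hw0 s] with u hu
      rw [real_inner_comm v]
      exact mul_nonneg hu (mul_self_nonneg _)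
    · rw [real_inner_comm, hin, hin]
      refine integral_congr_ae (Eventually.of_forall fun u => ?_)
      simp only
      rw [real_inner_comm v, real_inner_comm v']
      ring
    · refine ((innerSL ℝ k).integral_comp_comm (hYi s)).symm.trans ?_
      simp [hYK k hk]
    · rw [hin]
      simp [hYK k hk]
  have hpos : ∀ᶠ s in atTop, 0 < ∫ u, w s u * ‖Y u‖ ^ 2 ∂μ := by
    filter_upwards [eventually_ge_atTop (0 : ℝ)] with s hs
    have h1 := setIntegral_mul_const_le_integral (c := Real.exp (s * (r - 1)))
      (measurableSet_lt measurable_const hA) hY2i hY20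
      (fun u => (Real.exp_pos _).le) (hexp s hY2i) (s := {u | r - 1 < A u})
      fun u hu => Real.exp_le_exp.2 (mul_le_mul_of_nonneg_left (le_of_lt hu) hs)
    have h2 := mul_pos (hmassY 1 one_pos) (Real.exp_pos (s * (r - 1)))
    refine (h2.trans_le h1).trans_le (le_of_eq ?_)
    refine integral_congr_ae (Eventually.of_forall fun u => ?_)
    simp only [hw]
    ring
  have hnn : (0 : ℝ) ≤ (Module.finrank ℝ W : ℝ) := Nat.cast_nonneg _
  have htr : ∀ s, ∫ u, w s u * ‖Y u‖ ^ 2 ∂μ ≤ (Module.finrank ℝ W : ℝ) * ‖x s‖ := fun s =>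
    (integral_norm_sq_le (hTi s)).trans (mul_le_mul_of_nonneg_left
      ((norm_fst_le (x s).2).trans (norm_snd_le (x s))) hnn)
  have hx0 : ∀ᶠ s in atTop, x s ≠ 0 := by
    filter_upwards [hpos] with s hs h0
    have := htr s
    rw [h0, norm_zero, mul_zero] at this
    linarith
  set L : W → (W × (W →L[ℝ] W) × ℝ) →L[ℝ] ℝ := fun y =>
    (D y).comp (ContinuousLinearMap.fst ℝ W _) +
    (D y).comp ((ContinuousLinearMap.apply ℝ W y).comp ((ContinuousLinearMap.fst ℝ _ ℝ).comp
      (ContinuousLinearMap.snd ℝ W _))) +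
    (r * G y) • ((ContinuousLinearMap.snd ℝ _ ℝ).comp (ContinuousLinearMap.snd ℝ W _)) with hLdef
  have hLv : ∀ y v, L y v = D y (v.1 + v.2.1 y) + r * G y * v.2.2 := fun y v => by
    simp [hLdef, map_add]
  obtain ⟨v, hv, hv1, hvL⟩ := exists_limit_direction hC hCs hxC hx0 L (by
    intro y η hη
    set N : ℝ := (Module.finrank ℝ W : ℝ) + 1 with hN
    have hN0 : 0 < N := by positivity
    set M : ℝ := ‖D y‖ * (‖y‖ ^ 2 * Real.exp (‖y‖ * B)) with hM
    have hM0 : 0 ≤ M := by positivity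
    -- The two errors: `h₁` is the remainder `D y (Y) (exp⟨y, Y⟩ - 1 - ⟨y, Y⟩)` divided by `‖Y‖²`,
    -- of order `‖Y‖`, and `h₂` comes from replacing `A exp⟨y, Y⟩` by its value `r` at the pole.
    -- Both are small where `A` is close to `r`.
    set h₁ : U → ℝ := fun u => D y (Y u) *
      (Real.exp (inner ℝ y (Y u)) - 1 - inner ℝ y (Y u)) / ‖Y u‖ ^ 2 with hh₁
    set h₂ : U → ℝ := fun u => G y * (A u * Real.exp (inner ℝ y (Y u)) - r) with hh₂
    have hinner : ∀ u, |inner ℝ y (Y u)| ≤ ‖y‖ * B := fun u =>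
      (abs_real_inner_le_norm _ _).trans (mul_le_mul_of_nonneg_left (hYB u) (norm_nonneg _))
    have h₁b : ∀ u, |h₁ u| ≤ M * ‖Y u‖ := by
      intro u
      rcases eq_or_ne (Y u) 0 with h0 | h0
      · simp [hh₁, h0]
      have h0' := norm_pos_iff.2 h0
      rw [hh₁, abs_div, abs_mul, abs_of_nonneg (sq_nonneg ‖Y u‖), div_le_iff₀ (by positivity)]
      calc _ ≤ (‖D y‖ * ‖Y u‖) * ((‖y‖ * ‖Y u‖) ^ 2 * Real.exp (‖y‖ * B)) := by
            refine mul_le_mul ((D y).le_opNorm _) ((abs_exp_sub_one_sub_le _).trans ?_)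
              (abs_nonneg _) (by positivity)
            rw [← sq_abs (inner ℝ y (Y u))]
            have := abs_real_inner_le_norm y (Y u)
            have := hinner u
            gcongr
        _ = _ := by rw [hM]; ring
    have c₁ := eventually_abs_integral_exp_le (h := h₁) (C := M * B) hY2i hY20 hA hAr hmassY
      (fun u => (h₁b u).trans (mul_le_mul_of_nonneg_left (hYB u) hM0)) (fun η hη => by
        obtain ⟨δ, hδ, hδY⟩ := hYs (η / (M + 1)) (by positivity)
        refine ⟨δ, hδ, fun u hu => (h₁b u).trans ?_⟩
        have := hδY u hu
        rw [le_div_iff₀ (by positivity)] at this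
        nlinarith [norm_nonneg (Y u)]) (η := η / N) (by positivity)
    have c₂ := eventually_abs_integral_exp_le (h := h₂)
      (C := |G y| * (r * Real.exp (‖y‖ * B) + r)) hgi hg hA hAr hmass (fun u => by
        rw [hh₂, abs_mul]
        refine mul_le_mul_of_nonneg_left ((abs_sub _ _).trans ?_) (abs_nonneg _)
        rw [abs_mul, Real.abs_exp, abs_of_nonneg (hr0 u)]
        have h1 := hr0 u
        have h2 := hAr u
        have h3 := (le_abs_self _).trans (hinner u)
        gcongr) (fun η hη => by
        have hcont : Continuous fun p : ℝ × ℝ => |G y * (p.1 * Real.exp p.2 - r)| := by fun_prop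
        have h0 : |G y * ((r, (0 : ℝ)).1 * Real.exp (r, (0 : ℝ)).2 - r)| < η := by simpa using hη
        obtain ⟨ρ, hρ, hρ'⟩ := Metric.eventually_nhds_iff.1
          ((hcont.tendsto (r, (0 : ℝ))).eventually_lt_const h0)
        obtain ⟨δ, hδ, hδY⟩ := hYs (ρ / (2 * (‖y‖ + 1))) (by positivity)
        refine ⟨min δ ρ, lt_min hδ hρ, fun u hu => ?_⟩
        refine (hρ' (y := (A u, inner ℝ y (Y u))) ?_).le
        rw [Prod.dist_eq, max_lt_iff]
        constructor
        · rw [Real.dist_eq, abs_lt]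
          have := (abs_le.1 (hAr u)).2
          have := min_le_right δ ρ
          constructor <;> linarith
        · rw [Real.dist_eq, sub_zero]
          refine (abs_real_inner_le_norm _ _).trans_lt ?_
          have h1 := hδY u (by have := min_le_left δ ρ; linarith)
          rw [le_div_iff₀ (by positivity)] at h1
          nlinarith [norm_nonneg (Y u), norm_nonneg y]) (η := η / N) (by positivity)
    filter_upwards [c₁, c₂, hid y, hε] with s k₁ k₂ k₃ k₄
    have hi₁ : Integrable (fun u => g u * ‖Y u‖ ^ 2 * h₁ u * Real.exp (s * A u)) μ := by
      refine hexp s (hY2i.mul_bdd (c := M * B) ?_ (Eventually.of_forall fun u =>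
        (h₁b u).trans (mul_le_mul_of_nonneg_left (hYB u) hM0)))
      have := (D y).continuous.measurable.comp hY
      have h5 : Measurable h₁ := by
        refine ((this.mul ?_).div ?_) <;> fun_prop
      exact h5.aestronglyMeasurable
    have hDi : Integrable (fun u => w s u * D y (Y u)) μ := by
      refine ((D y).integrable_comp (hYi s)).congr (Eventually.of_forall fun u => ?_)
      simp
    have hDi2 : Integrable (fun u => w s u * (inner ℝ (Y u) y * D y (Y u))) μ := by
      refine ((D y).integrable_comp (hTvi s y)).congr (Eventually.of_forall fun u => ?_)
      simp
    have hi₂ : Integrable (fun u => g u * h₂ u * Real.exp (s * A u)) μ := by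
      refine hexp s (hgi.mul_bdd (c := |G y| * (r * Real.exp (‖y‖ * B) + r)) (by fun_prop)
        (Eventually.of_forall fun u => ?_))
      rw [Real.norm_eq_abs, hh₂, abs_mul]
      refine mul_le_mul_of_nonneg_left ((abs_sub _ _).trans ?_) (abs_nonneg _)
      rw [abs_mul, Real.abs_exp, abs_of_nonneg (hr0 u)]
      have h1 := hr0 u
      have h2 := hAr u
      have h3 := (le_abs_self _).trans (hinner u)
      gcongr
    have e1 : D y ((x s).1 + (x s).2.1 y) =
        ∫ u, (w s u * D y (Y u) + w s u * (inner ℝ (Y u) y * D y (Y u))) ∂μ := by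
      rw [integral_add hDi hDi2, map_add, hTv, hx]
      congr 1
      · refine ((D y).integral_comp_comm (hYi s)).symm.trans
          (integral_congr_ae (Eventually.of_forall fun u => ?_))
        simp
      · refine ((D y).integral_comp_comm (hTvi s y)).symm.trans
          (integral_congr_ae (Eventually.of_forall fun u => ?_))
        simp
    have e2 : L y (x s) = -(∫ u, g u * ‖Y u‖ ^ 2 * h₁ u * Real.exp (s * A u) ∂μ) -
        ε s * ∫ u, g u * h₂ u * Real.exp (s * A u) ∂μ := by
      rw [hLv, e1, hx]
      simp only
      have h6 : ∀ u, g u * ((D y (Y u) + ε s * A u * G y) * Real.exp (inner ℝ y (Y u))) *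
          Real.exp (s * A u) = g u * ‖Y u‖ ^ 2 * h₁ u * Real.exp (s * A u) +
          ε s * (g u * h₂ u * Real.exp (s * A u)) + (w s u * D y (Y u) +
          w s u * (inner ℝ (Y u) y * D y (Y u)) + r * G y * (ε s * w s u)) := by
        intro u
        have h6 : ‖Y u‖ ^ 2 * h₁ u = D y (Y u) *
            (Real.exp (inner ℝ y (Y u)) - 1 - inner ℝ y (Y u)) := by
          rcases eq_or_ne (Y u) 0 with h0 | h0
          · simp [h0]
          · have h0' := norm_ne_zero_iff.2 h0
            rw [hh₁]
            field_simp
        have h7 : g u * ‖Y u‖ ^ 2 * h₁ u = g u * (D y (Y u) *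
            (Real.exp (inner ℝ y (Y u)) - 1 - inner ℝ y (Y u))) := by rw [mul_assoc, h6]
        rw [h7, real_inner_comm y]
        simp only [hh₂, hw]
        ring
      have p1 : Integrable (fun u => g u * ‖Y u‖ ^ 2 * h₁ u * Real.exp (s * A u) +
          ε s * (g u * h₂ u * Real.exp (s * A u))) μ := hi₁.add (hi₂.const_mul _)
      have p2 : Integrable (fun u => w s u * D y (Y u) + w s u * (inner ℝ (Y u) y * D y (Y u))) μ :=
        hDi.add hDi2
      have p3 : Integrable (fun u => r * G y * (ε s * w s u)) μ :=
        ((hwi s).const_mul _).const_mul _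
      have p4 : Integrable (fun u => w s u * D y (Y u) + w s u * (inner ℝ (Y u) y * D y (Y u)) +
          r * G y * (ε s * w s u)) μ := p2.add p3
      rw [integral_congr_ae (Eventually.of_forall h6), integral_add p1 p4,
        integral_add hi₁ (hi₂.const_mul _), integral_add p2 p3, integral_const_mul,
        integral_const_mul, integral_const_mul] at k₃
      linarith
    have h7 : ∫ u, g u * ‖Y u‖ ^ 2 * Real.exp (s * A u) ∂μ = ∫ u, w s u * ‖Y u‖ ^ 2 ∂μ :=
      integral_congr_ae (Eventually.of_forall fun u => by simp only [hw]; ring)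
    rw [h7] at k₁
    have h8 : |ε s * ∫ u, w s u ∂μ| ≤ ‖x s‖ := (norm_snd_le (x s).2).trans (norm_snd_le (x s))
    have h9 := htr s
    rw [e2]
    calc _ ≤ |∫ u, g u * ‖Y u‖ ^ 2 * h₁ u * Real.exp (s * A u) ∂μ| +
          ε s * |∫ u, g u * h₂ u * Real.exp (s * A u) ∂μ| := by
          refine (abs_sub _ _).trans ?_
          rw [abs_neg, abs_mul, abs_of_nonneg k₄]
      _ ≤ η / N * ((Module.finrank ℝ W : ℝ) * ‖x s‖) + ε s * (η / N * ∫ u, w s u ∂μ) :=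
          add_le_add (k₁.trans (mul_le_mul_of_nonneg_left h9 (by positivity)))
            (mul_le_mul_of_nonneg_left k₂ k₄)
      _ ≤ η / N * ((Module.finrank ℝ W : ℝ) * ‖x s‖) + η / N * ‖x s‖ := by
          have h10 := (le_abs_self _).trans h8
          have : 0 < η / N := by positivity
          nlinarith
      _ = η * ‖x s‖ := by
          rw [← mul_assoc, ← add_mul, ← mul_add_one, ← hN]
          field_simp)
  obtain ⟨a, T, c⟩ := v
  obtain ⟨h1, h2, h3, h4, h5⟩ := hv
  refine ⟨a, T, c, fun h0 => ?_, h1, h2, h3, h4, h5, fun y => ?_⟩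
  · rw [h0, norm_zero] at hv1
    exact zero_ne_one hv1
  · rw [← hvL y, hLv]

end Moments

/-! ### The Helmholtz relation near the pole -/

section Pole

variable {U : Type*} [MeasurableSpace U] {μ : Measure U}
  {W : Type*} [NormedAddCommGroup W] [InnerProductSpace ℝ W] [FiniteDimensional ℝ W]
  [MeasurableSpace W] [BorelSpace W]

namespace SphereDensity

variable {f g : U → ℝ} {X Z : U → W} {r κ : ℝ} {e : W}

theorem norm_sub_pole_sq (T : SphereDensity μ g Z r) (he : ‖e‖ = 1) (u : U) :
    ‖Z u - r • e‖ ^ 2 = 2 * r * (r - inner ℝ e (Z u)) := by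
  rw [norm_sub_sq_real, T.norm_eq, norm_smul, he, inner_smul_right, real_inner_comm e,
    Real.norm_eq_abs, mul_one, sq_abs]
  ring

/-- `‖Z - r e‖² = 2 r (r - ⟨e, Z⟩)`: the height alone controls the distance to the pole. -/
theorem exists_pole_small (T : SphereDensity μ g Z r) (hr : 0 < r) (he : ‖e‖ = 1) {k : W → ℝ}
    (hk : Continuous k) (hk0 : k (r • e) = 0) {η : ℝ} (hη : 0 < η) :
    ∃ δ > 0, ∀ u, r - δ < inner ℝ e (Z u) → |k (Z u)| ≤ η := by
  have h0 : |k (r • e)| < η := by rwa [hk0, abs_zero]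
  obtain ⟨ρ, hρ, hρ'⟩ := Metric.eventually_nhds_iff.1
    ((hk.abs.tendsto (r • e)).eventually_lt_const h0)
  refine ⟨ρ ^ 2 / (2 * r), by positivity, fun u hu => (hρ' ?_).le⟩
  rw [dist_eq_norm]
  refine lt_of_pow_lt_pow_left₀ 2 hρ.le ?_
  rw [T.norm_sub_pole_sq he]
  have h1 : r - inner ℝ e (Z u) < ρ ^ 2 / (2 * r) := by linarith
  rw [lt_div_iff₀ (by positivity)] at h1
  linarith

/-- The direction of `ζ + σ e` tends to `e` as `σ → ∞`, and `O` is stable under these translations.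
The mass points found this way have the same component transverse to `e` as `ζ`, up to a positive
factor. -/
theorem exists_isMassPoint_near_pole (hr : 0 < r) (he : ‖e‖ = 1) {O : Set W}
    (hOsh : ∀ ζ ∈ O, ∀ σ : ℝ, 0 ≤ σ → ζ + σ • e ∈ O)
    (hOm : ∀ ζ ∈ O, IsMassPoint μ g Z ((r / ‖ζ‖) • ζ)) (hO0 : ∀ ζ ∈ O, ζ ≠ 0) {ζ : W}
    (hζ : ζ ∈ O) {δ : ℝ} (hδ : 0 < δ) :
    ∃ c : ℝ, 0 < c ∧ ∃ σ : ℝ, IsMassPoint μ g Z (c • (ζ + σ • e)) ∧ ‖c • (ζ + σ • e) - r • e‖ < δ := by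
  have hc : ContinuousAt (fun x : ℝ => (r / ‖x • ζ + e‖) • (x • ζ + e)) 0 := by
    have h1 : Continuous fun x : ℝ => x • ζ + e := by fun_prop
    refine (continuousAt_const.div h1.norm.continuousAt ?_).smul h1.continuousAt
    simp [he]
  have ht : Tendsto (fun σ : ℝ => (r / ‖σ⁻¹ • ζ + e‖) • (σ⁻¹ • ζ + e)) atTop (𝓝 (r • e)) := by
    have := hc.tendsto.comp tendsto_inv_atTop_zero
    simpa [he, Function.comp_def] using this
  obtain ⟨σ, hσ, hσ0⟩ := ((ht.eventually (Metric.ball_mem_nhds _ hδ)).and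
    (eventually_gt_atTop 0)).exists
  have hmem := hOsh ζ hζ σ hσ0.le
  have hn := norm_pos_iff.2 (hO0 _ hmem)
  have heq : σ⁻¹ • ζ + e = σ⁻¹ • (ζ + σ • e) := by
    rw [smul_add, smul_smul, inv_mul_cancel₀ hσ0.ne', one_smul]
  refine ⟨r / ‖ζ + σ • e‖, by positivity, σ, hOm _ hmem, ?_⟩
  rw [heq, norm_smul, smul_smul, norm_inv, Real.norm_eq_abs, abs_of_pos hσ0,
    show r / (σ⁻¹ * ‖ζ + σ • e‖) * σ⁻¹ = r / ‖ζ + σ • e‖ by field_simp] at hσ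
  exact mem_ball_iff_norm.1 hσ

theorem setIntegral_pos_of_isMassPoint (T : SphereDensity μ g Z r) (hg : ∀ᵐ u ∂μ, 0 ≤ g u)
    {k : W → ℝ} (hk : Continuous k) (hk0 : ∀ z, 0 ≤ k z)
    (hki : Integrable (fun u => g u * k (Z u)) μ) {p : W} (hp : IsMassPoint μ g Z p)
    (hkp : 0 < k p) {s : Set W} (hs : s ∈ 𝓝 p) :
    0 < ∫ u in {u | Z u ∈ s}, g u * k (Z u) ∂μ := by
  have hZm := T.measurable
  obtain ⟨ρ, hρ, hρ'⟩ := Metric.eventually_nhds_iff.1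
    ((eventually_mem_set.2 hs).and ((hk.tendsto p).eventually_const_lt (half_lt_self hkp)))
  have hset : MeasurableSet {u | ‖Z u - p‖ < ρ} := measurableSet_lt (by fun_prop) measurable_const
  have hsub : {u | ‖Z u - p‖ < ρ} ⊆ {u | Z u ∈ s} := fun u hu =>
    (hρ' (y := Z u) (by rw [dist_eq_norm]; exact hu)).1
  have hnn : ∀ᵐ u ∂μ, 0 ≤ g u * k (Z u) := by
    filter_upwards [hg] with u hu using mul_nonneg hu (hk0 _)
  calc 0 < (∫ u in {u | ‖Z u - p‖ < ρ}, g u ∂μ) * (k p / 2) := mul_pos (hp ρ hρ) (by linarith)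
    _ = ∫ u in {u | ‖Z u - p‖ < ρ}, g u * (k p / 2) ∂μ := (integral_mul_const _ _).symm
    _ ≤ ∫ u in {u | ‖Z u - p‖ < ρ}, g u * k (Z u) ∂μ := by
        refine setIntegral_mono_on_ae (T.integrable.mul_const _).integrableOn hki.integrableOn hset ?_
        filter_upwards [hg] with u hu hus
        exact mul_le_mul_of_nonneg_left
          (hρ' (y := Z u) (by rw [dist_eq_norm]; exact hus)).2.le hu
    _ ≤ _ := setIntegral_mono_set hki.integrableOn (ae_restrict_of_ae hnn)
        (Eventually.of_forall hsub)

/-- The transport identity satisfied by the angular part of the ratio of two Laplace transforms. -/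
theorem transport_identity (S : SphereDensity μ f X r) (T : SphereDensity μ g Z r)
    (hg : ∀ᵐ u ∂μ, 0 ≤ g u) (hr : 0 < r) (he : ‖e‖ = 1) (hm : IsMassPoint μ g Z (r • e))
    {G : W → ℝ} (hG2 : ContDiff ℝ (2 : ℕ) G) (hGe : ∀ t (σ : ℝ), G (t + σ • e) = G t)
    (hGd : ∀ t, fderiv ℝ G t e = 0)
    (hratio : ∀ t, laplace μ f X t = (1 - κ * inner ℝ e t) * G t * laplace μ g Z t)
    {y : W} (hy : inner ℝ e y = (0 : ℝ)) :
    ∀ᶠ s in atTop, ∫ u, g u * ((fderiv ℝ G y (Z u) + κ / (κ * s - 1) * inner ℝ e (Z u) * G y) *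
      Real.exp (inner ℝ y (Z u))) * Real.exp (s * inner ℝ e (Z u)) ∂μ = 0 := by
  have hZm := T.measurable
  set D := fderiv ℝ G y with hD
  set A : U → ℝ := fun u => inner ℝ e (Z u) with hAdef
  have hA : Measurable A := by fun_prop
  have hAr : ∀ u, |A u| ≤ r := fun u => by simpa [he] using T.abs_inner_le e u
  have hfd : ∀ t (σ : ℝ), fderiv ℝ G (t + σ • e) = fderiv ℝ G t := by
    intro t σ
    rw [← fderiv_comp_add_right]
    congr 1
    funext x
    exact hGe x σ
  set Q : ℝ → ℝ := fun s => ∫ u, g u * Real.exp (inner ℝ y (Z u)) * Real.exp (s * A u) ∂μ with hQ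
  have hqi := T.integrable_mul_exp T.integrable y
  have hexp : ∀ s : ℝ, ∀ {q : U → ℝ}, Integrable q μ →
      Integrable (fun u => q u * Real.exp (s * A u)) μ := fun s q hq => by
    refine (T.integrable_mul_exp hq (s • e)).congr (Eventually.of_forall fun u => ?_)
    simp [hAdef, inner_smul_left]
  have hexpt : ∀ (s : ℝ) u, Real.exp (inner ℝ (y + s • e) (Z u)) =
      Real.exp (inner ℝ y (Z u)) * Real.exp (s * A u) := fun s u => by
    rw [inner_add_left, inner_smul_left, RCLike.conj_to_real, Real.exp_add]
  have hGdiff : Differentiable ℝ G := hG2.differentiable (by simp)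
  have hΓ2 : ContDiff ℝ (2 : ℕ) fun t => (1 - κ * inner ℝ e t) * G t := (contDiff_affine κ e).mul hG2
  have hDi := T.integrable_mul_clm T.integrable D
  have hDi' : ∀ s, Integrable (fun u => g u * D (Z u) * Real.exp (inner ℝ y (Z u)) *
      Real.exp (s * A u)) μ := fun s => hexp s (T.integrable_mul_exp hDi y)
  have hAi := T.integrable_mul_inner T.integrable e
  have hAi' : ∀ s, Integrable (fun u => g u * A u * Real.exp (inner ℝ y (Z u)) *
      Real.exp (s * A u)) μ := fun s => hexp s (T.integrable_mul_exp hAi y)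
  set I₁ : ℝ → ℝ := fun s => ∫ u, g u * D (Z u) * Real.exp (inner ℝ y (Z u)) *
    Real.exp (s * A u) ∂μ with hI₁
  set I₂ : ℝ → ℝ := fun s => ∫ u, g u * A u * Real.exp (inner ℝ y (Z u)) *
    Real.exp (s * A u) ∂μ with hI₂
  have hes : ∀ s : ℝ, inner ℝ e (y + s • e) = s := fun s => by
    rw [inner_add_right, hy, inner_smul_right, real_inner_self_eq_norm_sq, he]; ring
  -- The Helmholtz relation at `y + s e`. Neither `G` nor its derivatives see `s`, and the gradients
  -- of the affine factor and of `G` are orthogonal.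
  have hHE : ∀ s, (1 - κ * s) * trLaplacian G y * Q s +
      2 * ((1 - κ * s) * I₁ s - κ * G y * I₂ s) = 0 := by
    intro s
    have h1 := trLaplacian_ratio S T hΓ2 hratio (y + s • e)
    have h2 : trLaplacian (fun t => (1 - κ * inner ℝ e t) * G t) (y + s • e) =
        (1 - κ * s) * trLaplacian G y := by
      rw [trLaplacian_mul (contDiff_affine κ e) hG2, trLaplacian_affine, hes]
      have h3 : ∑ i, fderiv ℝ (fun t : W => 1 - κ * inner ℝ e t) (y + s • e)
          (stdOrthonormalBasis ℝ W i) * fderiv ℝ G (y + s • e) (stdOrthonormalBasis ℝ W i) = 0 := by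
        simp_rw [fderiv_affine]
        have h4 := hGd (y + s • e)
        have h5 : fderiv ℝ G (y + s • e) e = ∑ i, inner ℝ (stdOrthonormalBasis ℝ W i) e *
            fderiv ℝ G (y + s • e) (stdOrthonormalBasis ℝ W i) := by
          nth_rw 2 [← (stdOrthonormalBasis ℝ W).sum_repr' e]
          rw [map_sum]
          simp only [map_smul, smul_eq_mul]
        rw [h4] at h5
        calc _ = -κ * ∑ i, inner ℝ (stdOrthonormalBasis ℝ W i) e *
              fderiv ℝ G (y + s • e) (stdOrthonormalBasis ℝ W i) := by
              rw [Finset.mul_sum]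
              refine Finset.sum_congr rfl fun i _ => ?_
              rw [real_inner_comm e]
              ring
          _ = 0 := by rw [← h5, mul_zero]
      have h6 : trLaplacian G (y + s • e) = trLaplacian G y := by
        rw [trLaplacian, trLaplacian]
        refine Finset.sum_congr rfl fun i _ => ?_
        rw [← fderiv_comp_add_right]
        simp_rw [hfd]
      rw [h3, h6]
      ring
    have h3 : laplace μ (fun u => g u * fderiv ℝ (fun t => (1 - κ * inner ℝ e t) * G t)
        (y + s • e) (Z u)) Z (y + s • e) = (1 - κ * s) * I₁ s - κ * G y * I₂ s := by
      simp only [hI₁, hI₂]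
      rw [laplace, ← integral_const_mul, ← integral_const_mul,
        ← integral_sub ((hDi' s).const_mul _) ((hAi' s).const_mul _)]
      refine integral_congr_ae (Eventually.of_forall fun u => ?_)
      have h4 : fderiv ℝ (fun t => (1 - κ * inner ℝ e t) * G t) (y + s • e) (Z u) =
          (1 - κ * s) * D (Z u) - κ * G y * A u := by
        rw [fderiv_fun_mul ((contDiff_affine κ e (n := 1)).differentiable (by simp) _) (hGdiff _)]
        simp only [add_apply, smul_apply, smul_eq_mul, fderiv_affine, hfd, hes, hGe, ← hD]
        ring
      simp only [h4, hexpt]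
      ring
    have h7 : laplace μ g Z (y + s • e) = Q s := by
      rw [laplace, hQ]
      refine integral_congr_ae (Eventually.of_forall fun u => ?_)
      simp only [hexpt]
      ring
    rw [h2, h3, h7] at h1
    exact h1
  have hden : ∀ᶠ s : ℝ in atTop, κ * s - 1 ≠ 0 := by
    rcases eq_or_ne κ 0 with h0 | h0
    · simp [h0]
    · filter_upwards [eventually_gt_atTop κ⁻¹] with s hs h1
      have : s = κ⁻¹ := by field_simp; linarith
      exact hs.ne' this
  have hεlim : Tendsto (fun s : ℝ => κ / (κ * s - 1)) atTop (𝓝 0) := by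
    rcases lt_trichotomy κ 0 with h0 | h0 | h0
    · exact Tendsto.const_div_atBot
        (tendsto_atBot_add_const_right _ (-1) (tendsto_id.const_mul_atTop_of_neg h0)) _
    · simp [h0]
    · exact Tendsto.const_div_atTop
        (tendsto_atTop_add_const_right _ (-1) (tendsto_id.const_mul_atTop h0)) _
  have hqmass : ∀ δ > 0, 0 < ∫ u in {u | r - δ < A u}, g u * Real.exp (inner ℝ y (Z u)) ∂μ := by
    intro δ hδ
    refine T.setIntegral_pos_of_isMassPoint hg (k := fun z => Real.exp (inner ℝ y z))
      (s := {z | r - δ < inner ℝ e z}) (by fun_prop) (fun z => (Real.exp_pos _).le) hqi hm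
      (Real.exp_pos _) ?_
    refine (isOpen_lt continuous_const (by fun_prop)).mem_nhds ?_
    rw [mem_ofPred_eq, inner_smul_right, real_inner_self_eq_norm_sq, he]
    linarith
  have hq0 : ∀ᵐ u ∂μ, 0 ≤ g u * Real.exp (inner ℝ y (Z u)) := by
    filter_upwards [hg] with u hu using mul_nonneg hu (Real.exp_pos _).le
  have hQ0 : ∀ s, 0 ≤ s → 0 < Q s := by
    intro s hs
    have h1 := setIntegral_mul_const_le_integral (c := Real.exp (s * (r - 1)))
      (measurableSet_lt measurable_const hA) hqi hq0
      (fun u => (Real.exp_pos _).le) (hexp s hqi) (s := {u | r - 1 < A u})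
      fun u hu => Real.exp_le_exp.2 (mul_le_mul_of_nonneg_left (le_of_lt hu) hs)
    exact (mul_pos (hqmass 1 one_pos) (Real.exp_pos (s * (r - 1)))).trans_le h1
  have hI₂b : ∀ s, |I₂ s| ≤ r * Q s := by
    intro s
    simp only [hI₂, hQ]
    rw [← integral_const_mul, ← Real.norm_eq_abs]
    refine norm_integral_le_of_norm_le ((hexp s hqi).const_mul r) ?_
    filter_upwards [hg] with u hu
    rw [norm_mul, norm_mul, norm_mul, Real.norm_eq_abs, Real.norm_eq_abs, Real.norm_eq_abs,
      Real.norm_eq_abs, Real.abs_exp, Real.abs_exp, abs_of_nonneg hu]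
    have := hAr u
    have e1 := Real.exp_pos (inner ℝ y (Z u))
    have e2 := Real.exp_pos (s * A u)
    calc _ ≤ g u * r * Real.exp (inner ℝ y (Z u)) * Real.exp (s * A u) := by gcongr
      _ = _ := by ring
  -- Divide by `1 - κ s` and let `s → ∞`: the weights concentrate at `r e`, where the linear form
  -- `dG(y)` vanishes, so the second order term must vanish. The first order identity remains.
  have hlap : trLaplacian G y = 0 := by
    refine abs_nonpos_iff.1 (le_of_forall_pos_le_add fun η hη => ?_)
    rw [zero_add]
    have c₁ := eventually_abs_integral_exp_le (h := fun u => D (Z u)) (C := ‖D‖ * r) hqi hq0 hA hAr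
      hqmass (fun u => by rw [← T.norm_eq u]; exact D.le_opNorm _)
      (fun η hη => T.exists_pole_small hr he D.continuous (by rw [map_smul, hGd, smul_zero]) hη)
      (η := η / 4) (by linarith)
    have c₂ : ∀ᶠ s in atTop, |κ / (κ * s - 1)| * (2 * |G y| * r) < η / 2 := by
      have := (hεlim.abs.mul_const (2 * |G y| * r))
      rw [abs_zero, zero_mul] at this
      exact this.eventually_lt_const (by linarith)
    obtain ⟨s, k₁, k₂, k₃, k₄⟩ := (c₁.and (c₂.and (hden.and (eventually_ge_atTop (0 : ℝ))))).exists
    have hQs := hQ0 s k₄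
    have h1 : trLaplacian G y * Q s = -2 * (I₁ s + κ / (κ * s - 1) * (G y * I₂ s)) := by
      have := hHE s
      field_simp
      linear_combination -this
    have h2 : |I₁ s| ≤ η / 4 * Q s := by
      refine le_trans (le_of_eq ?_) k₁
      congr 1
      refine integral_congr_ae (Eventually.of_forall fun u => ?_)
      simp only
      ring
    have h3 : |trLaplacian G y| * Q s ≤ η * Q s := by
      calc |trLaplacian G y| * Q s = |trLaplacian G y * Q s| := by rw [abs_mul, abs_of_pos hQs]
        _ = 2 * |I₁ s + κ / (κ * s - 1) * (G y * I₂ s)| := by rw [h1, abs_mul]; norm_num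
        _ ≤ 2 * (η / 4 * Q s + |κ / (κ * s - 1)| * (|G y| * (r * Q s))) := by
            refine mul_le_mul_of_nonneg_left ((abs_add_le _ _).trans (add_le_add h2 ?_)) (by norm_num)
            rw [abs_mul, abs_mul]
            have := hI₂b s
            gcongr
        _ = (η / 2 + |κ / (κ * s - 1)| * (2 * |G y| * r)) * Q s := by ring
        _ ≤ _ := by
            refine mul_le_mul_of_nonneg_right ?_ hQs.le
            linarith
    exact le_of_mul_le_mul_right h3 hQs
  filter_upwards [hden] with s hs
  have h1 := hHE s
  rw [hlap] at h1
  have h2 : I₁ s + κ / (κ * s - 1) * G y * I₂ s = 0 := by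
    field_simp
    linear_combination -h1 / 2
  rw [← h2]
  simp only [hI₁, hI₂]
  rw [← integral_const_mul, ← integral_add (hDi' s) ((hAi' s).const_mul _)]
  refine integral_congr_ae (Eventually.of_forall fun u => ?_)
  simp only [hAdef]
  ring

end SphereDensity

end Pole

/-! ### Rigidity of the transverse factor -/

section Rigidity

variable {U : Type*} [MeasurableSpace U] {μ : Measure U}
  {W : Type*} [NormedAddCommGroup W] [InnerProductSpace ℝ W] [FiniteDimensional ℝ W]
  [MeasurableSpace W] [BorelSpace W]

/-- The directions along which `G` does not vary. -/
noncomputable def constDirections (G : W → ℝ) : Submodule ℝ W where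
  carrier := {v | ∀ y, fderiv ℝ G y v = 0}
  add_mem' hv hw y := by rw [map_add, hv y, hw y, add_zero]
  zero_mem' y := map_zero _
  smul_mem' c v hv y := by rw [map_smul, hv y, smul_zero]

theorem mem_constDirections {G : W → ℝ} {v : W} :
    v ∈ constDirections G ↔ ∀ y, fderiv ℝ G y v = 0 := Iff.rfl

theorem apply_add_of_mem_constDirections {G : W → ℝ} (hG : Differentiable ℝ G) {k : W}
    (hk : k ∈ constDirections G) (y : W) : G (y + k) = G y := by
  have hline : ∀ t : ℝ, HasDerivAt (fun t : ℝ => G (y + t • k)) 0 t := fun t => by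
    have h1 : HasDerivAt (fun t : ℝ => y + t • k) k t := by
      simpa using ((hasDerivAt_id t).smul_const k).const_add y
    have h2 := (hG (y + t • k)).hasFDerivAt.comp_hasDerivAt t h1
    rwa [hk (y + t • k)] at h2
  have := is_const_of_deriv_eq_zero (fun t => (hline t).differentiableAt)
    (fun t => (hline t).deriv) 1 0
  simpa using this

theorem fderiv_add_of_mem_constDirections {G : W → ℝ} (hG : Differentiable ℝ G) {k : W}
    (hk : k ∈ constDirections G) (y : W) : fderiv ℝ G (y + k) = fderiv ℝ G y := by
  rw [← fderiv_comp_add_right]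
  congr 1
  funext x
  exact apply_add_of_mem_constDirections hG hk x

theorem exists_pos_eigenvector {T : W →L[ℝ] W} (hT : ∀ v, 0 ≤ inner ℝ v (T v))
    (hTs : ∀ v w, inner ℝ (T v) w = inner ℝ v (T w)) (hT0 : T ≠ 0) :
    ∃ u : W, u ≠ 0 ∧ ∃ β : ℝ, 0 < β ∧ T u = β • u := by
  have hsym : (T : W →ₗ[ℝ] W).IsSymmetric := fun v w => hTs v w
  by_contra! hcon
  refine hT0 ?_
  set b := hsym.eigenvectorBasis rfl with hb
  have hz : ∀ i, T (b i) = 0 := by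
    intro i
    have h1 : T (b i) = (hsym.eigenvalues rfl i : ℝ) • b i := hsym.apply_eigenvectorBasis rfl i
    have h2 := hT (b i)
    rw [h1, inner_smul_right, real_inner_self_eq_norm_sq, b.norm_eq_one, one_pow, mul_one] at h2
    have h3 : b i ≠ 0 := b.orthonormal.ne_zero i
    rcases h2.eq_or_lt with h4 | h4
    · rw [h1, ← h4, zero_smul]
    · exact absurd h1 (hcon _ h3 _ h4)
  have : (T : W →ₗ[ℝ] W) = 0 := b.toBasis.ext fun i => by simpa using hz i
  ext v
  exact LinearMap.congr_fun this v

namespace SphereDensity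

variable {f g : U → ℝ} {X Z : U → W} {r κ : ℝ} {e : W}

/-- Let `K` be the space of constant directions. If `Kᗮ ≠ 0`, the moments near the pole of the
component of `Z` in `Kᗮ` produce a nonzero `(a, T, c)` with `dG(y)(a + T y) + r c G(y) = 0`. If `c >
0`, the transport lemma gives `G = 0`, against `G 0 = 1`. If `c = 0` and `T = 0`, then `a` is a
constant direction orthogonal to `K`, so `a = 0`. If `c = 0` and `T ≠ 0`, take `T u = β u` with `β >
0` and differentiate along `u`: the derivative `∂_u G` is transported with rate `-β`, so it vanishes
and `u ∈ K ∩ Kᗮ`. -/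
theorem constDirections_eq_top (S : SphereDensity μ f X r) (T : SphereDensity μ g Z r)
    (hg : ∀ᵐ u ∂μ, 0 ≤ g u) (hr : 0 < r) (he : ‖e‖ = 1) {G : W → ℝ}
    (hG2 : ContDiff ℝ (2 : ℕ) G) (hG0 : G 0 = 1) (hGe : ∀ t (σ : ℝ), G (t + σ • e) = G t)
    (hGd : e ∈ constDirections G)
    (hratio : ∀ t, laplace μ f X t = (1 - κ * inner ℝ e t) * G t * laplace μ g Z t)
    (hm : IsMassPoint μ g Z (r • e))
    {O : Set W} (hO : IsOpen O) (hOne : O.Nonempty)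
    (hOsh : ∀ ζ ∈ O, ∀ σ : ℝ, 0 ≤ σ → ζ + σ • e ∈ O)
    (hOm : ∀ ζ ∈ O, IsMassPoint μ g Z ((r / ‖ζ‖) • ζ)) (hO0 : ∀ ζ ∈ O, ζ ≠ 0) :
    (constDirections G)ᗮ = ⊥ := by
  by_contra hK
  have hZm := T.measurable
  have hGdiff : Differentiable ℝ G := hG2.differentiable (by simp)
  set K := constDirections G with hKdef
  set p := Kᗮ.starProjection with hp
  have hpmem : ∀ v, p v ∈ Kᗮ := fun v => Submodule.starProjection_apply_mem _ _
  have hpe : p e = 0 := by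
    rw [hp, Submodule.starProjection_apply_eq_zero_iff, Submodule.orthogonal_orthogonal]
    exact hGd
  have hpid : ∀ v ∈ Kᗮ, p v = v := fun v hv => Submodule.starProjection_eq_self_iff.2 hv
  have hpinner : ∀ v w, inner ℝ (p v) w = inner ℝ v (p w) := fun v w =>
    Submodule.inner_starProjection_left_eq_right _ _ _
  have hsubK : ∀ v, v - p v ∈ K := fun v => by
    have := Submodule.sub_starProjection_mem_orthogonal (K := Kᗮ) v
    rwa [Submodule.orthogonal_orthogonal] at this
  have hpG : ∀ y, G (p y) = G y := fun y => by
    have := apply_add_of_mem_constDirections hGdiff (hsubK y) (p y)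
    rw [add_sub_cancel] at this
    exact this.symm
  have hpD : ∀ y, fderiv ℝ G (p y) = fderiv ℝ G y := fun y => by
    have := fderiv_add_of_mem_constDirections hGdiff (hsubK y) (p y)
    rw [add_sub_cancel] at this
    exact this.symm
  have hDp : ∀ y v, fderiv ℝ G y (p v) = fderiv ℝ G y v := fun y v => by
    have := mem_constDirections.1 (hsubK v) y
    rw [map_sub, sub_eq_zero] at this
    exact this.symm
  obtain ⟨v, hv, hv0⟩ := (Submodule.ne_bot_iff _).1 hK
  -- Openness of `O` provides a charged direction with a nonzero component in `Kᗮ`; moved towards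
  -- the pole, it makes the second moments positive.
  obtain ⟨ζ, hζO, hζp⟩ : ∃ ζ ∈ O, p ζ ≠ 0 := by
    obtain ⟨ζ₀, hζ₀⟩ := hOne
    rcases eq_or_ne (p ζ₀) 0 with h0 | h0
    · have hc : Continuous fun τ : ℝ => ζ₀ + τ • v := by fun_prop
      have h1 : ∀ᶠ τ : ℝ in 𝓝 0, ζ₀ + τ • v ∈ O :=
        (hc.tendsto 0).eventually (hO.mem_nhds (by simpa using hζ₀))
      obtain ⟨τ, hτ, hτ0⟩ := ((h1.filter_mono nhdsWithin_le_nhds).and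
        (self_mem_nhdsWithin (s := Ioi (0 : ℝ)))).exists
      refine ⟨_, hτ, ?_⟩
      rw [map_add, map_smul, h0, zero_add, hpid v hv]
      exact smul_ne_zero (ne_of_gt hτ0) hv0
    · exact ⟨ζ₀, hζ₀, h0⟩
  set A : U → ℝ := fun u => inner ℝ e (Z u) with hAdef
  have hA : Measurable A := by fun_prop
  have hAr : ∀ u, |A u| ≤ r := fun u => by simpa [he] using T.abs_inner_le e u
  have hpn : ∀ v, ‖p v‖ ≤ ‖v‖ := fun v => Submodule.norm_starProjection_apply_le _ _
  have hnear : ∀ δ, ∀ q : W, ‖q - r • e‖ < δ → {z : W | r - δ < inner ℝ e z} ∈ 𝓝 q := by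
    intro δ q hq
    refine (isOpen_lt continuous_const (by fun_prop)).mem_nhds ?_
    have h1 := neg_le_of_abs_le (abs_real_inner_le_norm e (q - r • e))
    rw [inner_sub_right, inner_smul_right, real_inner_self_eq_norm_sq, he] at h1
    rw [mem_ofPred_eq]
    linarith
  have hgb : Integrable (fun u => g u * ‖p (Z u)‖ ^ 2) μ := by
    refine T.integrable.mul_bdd (c := r ^ 2) ?_ (Eventually.of_forall fun u => ?_)
    · exact ((p.continuous.norm.pow 2).measurable.comp hZm).aestronglyMeasurable
    · rw [Real.norm_eq_abs, abs_of_nonneg (sq_nonneg _)]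
      have := hpn (Z u)
      rw [T.norm_eq] at this
      gcongr
  obtain ⟨a, L, c, hne, hc, hLpos, hLsym, haK, hLK, heq⟩ := exists_transport_limit
    (μ := μ) (g := g) (A := A) (Y := fun u => p (Z u)) (ε := fun s => κ / (κ * s - 1)) (G := G)
    (r := r) (B := r) (D := fderiv ℝ G) K T.integrable hg hA hAr (p.continuous.measurable.comp hZm)
    (fun u => by rw [← T.norm_eq u]; exact hpn _)
    (fun k hk u => Submodule.inner_right_of_mem_orthogonal hk (hpmem _))
    (fun δ hδ => by
      have := T.setIntegral_pos_of_isMassPoint hg (k := fun _ => 1) continuous_const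
        (fun _ => zero_le_one) (by simpa using T.integrable) hm one_pos
        (hnear δ _ (by simpa using hδ))
      simpa using this)
    (fun δ hδ => by
      obtain ⟨b, hb, σ, hmp, hlt⟩ := exists_isMassPoint_near_pole hr he hOsh hOm hO0 hζO hδ
      refine T.setIntegral_pos_of_isMassPoint hg (k := fun z => ‖p z‖ ^ 2) (by fun_prop)
        (fun _ => sq_nonneg _) hgb hmp ?_ (hnear δ _ hlt)
      have : p (b • (ζ + σ • e)) ≠ 0 := by
        rw [map_smul, map_add, map_smul, hpe, smul_zero, add_zero]
        exact smul_ne_zero hb.ne' hζp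
      have := norm_pos_iff.2 this
      positivity)
    (fun η hη => by
      obtain ⟨δ, hδ, h⟩ := T.exists_pole_small hr he (k := fun z => ‖p z‖) (by fun_prop)
        (by rw [map_smul, hpe, smul_zero, norm_zero]) hη
      exact ⟨δ, hδ, fun u hu => (le_abs_self _).trans (h u hu)⟩)
    (by
      rcases lt_trichotomy κ 0 with h0 | h0 | h0
      · filter_upwards [eventually_ge_atTop (0 : ℝ)] with s hs
        exact div_nonneg_of_nonpos h0.le (by nlinarith)
      · simp [h0]
      · filter_upwards [eventually_ge_atTop κ⁻¹] with s hs
        have : 1 ≤ κ * s := by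
          have := mul_le_mul_of_nonneg_left hs h0.le
          rwa [mul_inv_cancel₀ h0.ne'] at this
        exact div_nonneg h0.le (by linarith))
    (fun y => by
      have hy : (inner ℝ e (p y) : ℝ) = 0 := by rw [← hpinner, hpe, inner_zero_left]
      filter_upwards [S.transport_identity T hg hr he hm hG2 hGe (mem_constDirections.1 hGd) hratio hy]
        with s hs
      rw [← hs]
      refine integral_congr_ae (Eventually.of_forall fun u => ?_)
      simp only [hpD, hpG, hDp, hpinner, hAdef])
  have hF : ∀ t, |laplace μ f X t| ≤ (∫ u, |f u| ∂μ) * Real.exp (r * ‖t‖) :=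
    S.abs_laplace_le S.integrable
  have hsub : ∀ ε > 0, ∃ C, ∀ t, |G t| ≤ C * Real.exp (ε * ‖t‖) := fun ε hε =>
    T.subexponential_of_mul_laplace hg hm he hr hGe (κ := κ)
      (fun t => by rw [← hratio]; exact hF t) hε
  -- For `u ⟂ e`, differentiating the ratio identity does not touch the affine factor, so `∂_u G`
  -- times this factor and the transform of `g` is again of exponential type `r`.
  have hsub' : ∀ u, inner ℝ e u = (0 : ℝ) → ∀ ε > 0, ∃ C, ∀ t,
      |fderiv ℝ G t u| ≤ C * Real.exp (ε * ‖t‖) := by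
    intro u hu ε hε
    refine T.subexponential_of_mul_laplace hg hm he hr (h := fun t => fderiv ℝ G t u) (fun t σ => ?_)
      (κ := κ) (C := (∫ x, |f x * inner ℝ u (X x)| ∂μ) + r * ‖u‖ * ∫ u, |f u| ∂μ) (fun t => ?_) hε
    · rw [fderiv_add_of_mem_constDirections hGdiff (K.smul_mem σ hGd)]
    · have h1 : fderiv ℝ (laplace μ f X) t u = (1 - κ * inner ℝ e t) * fderiv ℝ G t u *
          laplace μ g Z t + (1 - κ * inner ℝ e t) * G t *
          laplace μ (fun x => g x * inner ℝ u (Z x)) Z t := by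
        have h2 : laplace μ f X = fun t => (1 - κ * inner ℝ e t) * G t * laplace μ g Z t :=
          funext hratio
        rw [h2, fderiv_fun_mul (((contDiff_affine κ e (n := 1)).differentiable (by simp) t).fun_mul
          (hGdiff t)) (T.differentiable_laplace T.integrable t),
          fderiv_fun_mul ((contDiff_affine κ e (n := 1)).differentiable (by simp) t) (hGdiff t)]
        simp only [add_apply, smul_apply, smul_eq_mul, fderiv_affine, hu,
          T.fderiv_laplace T.integrable]
        ring
      rw [S.fderiv_laplace S.integrable] at h1
      have h2 := S.abs_laplace_le (S.integrable_mul_inner S.integrable u) t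
      have h3 : |laplace μ (fun x => g x * inner ℝ u (Z x)) Z t| ≤ r * ‖u‖ * laplace μ g Z t := by
        rw [laplace, laplace, ← integral_const_mul, ← Real.norm_eq_abs]
        refine norm_integral_le_of_norm_le ((T.integrable_mul_exp T.integrable t).const_mul _) ?_
        filter_upwards [hg] with x hx
        rw [norm_mul, norm_mul, Real.norm_eq_abs, Real.norm_eq_abs, Real.norm_eq_abs, Real.abs_exp,
          abs_of_nonneg hx]
        have := T.abs_inner_le u x
        calc _ ≤ g x * (r * ‖u‖) * Real.exp (inner ℝ t (Z x)) := by
              have := Real.exp_pos (inner ℝ t (Z x))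
              gcongr
          _ = _ := by ring
      have h4 : |(1 - κ * inner ℝ e t) * G t * laplace μ (fun x => g x * inner ℝ u (Z x)) Z t| ≤
          r * ‖u‖ * ((∫ u, |f u| ∂μ) * Real.exp (r * ‖t‖)) := by
        have h5 := hF t
        rw [hratio, abs_mul] at h5
        have h6 := le_abs_self (laplace μ g Z t)
        rw [abs_mul]
        calc _ ≤ |(1 - κ * inner ℝ e t) * G t| * (r * ‖u‖ * |laplace μ g Z t|) := by
              refine mul_le_mul_of_nonneg_left (h3.trans ?_) (abs_nonneg _)
              gcongr
          _ = r * ‖u‖ * (|(1 - κ * inner ℝ e t) * G t| * |laplace μ g Z t|) := by ring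
          _ ≤ _ := mul_le_mul_of_nonneg_left h5 (by positivity)
      have h7 : (1 - κ * inner ℝ e t) * fderiv ℝ G t u * laplace μ g Z t =
          laplace μ (fun x => f x * inner ℝ u (X x)) X t -
          (1 - κ * inner ℝ e t) * G t * laplace μ (fun x => g x * inner ℝ u (Z x)) Z t := by
        rw [h1]; ring
      rw [h7]
      refine (abs_sub _ _).trans ((add_le_add h2 h4).trans (le_of_eq ?_))
      ring
  have heK : ∀ v, (∀ k ∈ K, inner ℝ k v = (0 : ℝ)) → v ∈ Kᗮ := fun v hv =>
    (Submodule.mem_orthogonal _ _).2 hv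
  have hdisj : ∀ v, v ∈ K → v ∈ Kᗮ → v = 0 := fun v h1 h2 =>
    inner_self_eq_zero.1 (Submodule.inner_right_of_mem_orthogonal (𝕜 := ℝ) h1 h2)
  rcases hc.eq_or_lt with hc0 | hc0
  · subst hc0
    simp only [mul_zero, add_zero] at heq
    rcases eq_or_ne L 0 with hL0 | hL0
    · subst hL0
      simp only [zero_apply, add_zero] at heq
      exact hne (by rw [hdisj a heq (heK a haK)]; rfl)
    · obtain ⟨u, hu0, β, hβ, hLu⟩ := exists_pos_eigenvector hLpos hLsym hL0
      have huK : ∀ k ∈ K, inner ℝ k u = (0 : ℝ) := fun k hk => by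
        have := hLK k hk u
        rw [hLu, inner_smul_right] at this
        exact (mul_eq_zero.1 this).resolve_left hβ.ne'
      refine hu0 (hdisj u (fun y => ?_) (heK u huK))
      have hD1 : ContDiff ℝ (1 : ℕ) (fderiv ℝ G) := hG2.fderiv_right (by norm_num)
      have hDd : Differentiable ℝ (fderiv ℝ G) := hD1.differentiable (by simp)
      have hap : ∀ y v, fderiv ℝ (fun y => fderiv ℝ G y u) y v = fderiv ℝ (fderiv ℝ G) y v u := by
        intro y v
        rw [fderiv_clm_apply (hDd y) (differentiableAt_const u)]
        simp
      refine eq_zero_of_transport (h := fun y => fderiv ℝ G y u) (fun y => ?_)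
        (hsub' u (huK e hGd)) hLpos (c := -β) (by linarith) (a := a) (fun y => ?_) y
      · exact (hDd y).clm_apply (differentiableAt_const u)
      · have h1 : HasFDerivAt (fun y => fderiv ℝ G y (a + L y)) (0 : W →L[ℝ] ℝ) y := by
          have : (fun y => fderiv ℝ G y (a + L y)) = fun _ => 0 := funext heq
          rw [this]
          exact hasFDerivAt_const _ _
        have h2 := (hDd y).hasFDerivAt.clm_apply ((L.hasFDerivAt (x := y)).const_add a)
        have h3 := DFunLike.congr_fun (h2.unique h1) u
        have hsym : IsSymmSndFDerivAt ℝ G y := by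
          refine (hG2.contDiffAt (x := y)).isSymmSndFDerivAt ?_
          simp
        have h4 := hsym.eq u (a + L y)
        simp [hLu] at h3
        rw [hap, ← h4, map_add]
        linarith
  · have h0 := eq_zero_of_transport hGdiff hsub hLpos (c := -(r * c)) (by nlinarith) (a := a)
      (fun y => by linarith [heq y]) 0
    rw [hG0] at h0
    exact one_ne_zero h0

/-- If two Laplace transforms on the same sphere differ by an affine factor and a factor which does
not depend on the direction `e`, then they coincide. -/
theorem laplace_eq_of_ratio (S : SphereDensity μ f X r) (T : SphereDensity μ g Z r)
    (hg : ∀ᵐ u ∂μ, 0 ≤ g u) (hr : 0 < r) (he : ‖e‖ = 1) {G : W → ℝ}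
    (hG2 : ContDiff ℝ (2 : ℕ) G) (hG0 : G 0 = 1) (hGe : ∀ t (σ : ℝ), G (t + σ • e) = G t)
    (hratio : ∀ t, laplace μ f X t = (1 - κ * inner ℝ e t) * G t * laplace μ g Z t)
    {O : Set W} (hO : IsOpen O) (hOne : O.Nonempty)
    (hOsh : ∀ ζ ∈ O, ∀ σ : ℝ, 0 ≤ σ → ζ + σ • e ∈ O)
    (hOm : ∀ ζ ∈ O, IsMassPoint μ g Z ((r / ‖ζ‖) • ζ)) (hO0 : ∀ ζ ∈ O, ζ ≠ 0) (t : W) :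
    laplace μ f X t = laplace μ g Z t := by
  have hZm := T.measurable
  have hGdiff : Differentiable ℝ G := hG2.differentiable (by simp)
  have hGd : e ∈ constDirections G := fun y => by
    have h1 : HasDerivAt (fun t : ℝ => y + t • e) e 0 := by
      simpa using ((hasDerivAt_id (0 : ℝ)).smul_const e).const_add y
    have h2 : HasFDerivAt G (fderiv ℝ G y) (y + (0 : ℝ) • e) := by
      rw [zero_smul, add_zero]; exact (hGdiff y).hasFDerivAt
    have h3 := h2.comp_hasDerivAt (0 : ℝ) h1
    have h4 : G ∘ (fun t : ℝ => y + t • e) = fun _ => G y := funext fun σ => hGe y σ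
    rw [h4] at h3
    exact h3.unique (hasDerivAt_const _ _)
  have hm : IsMassPoint μ g Z (r • e) := by
    intro δ hδ
    obtain ⟨ζ, hζ⟩ := hOne
    obtain ⟨b, -, σ, hmp, hlt⟩ := exists_isMassPoint_near_pole hr he hOsh hOm hO0 hζ hδ
    have := T.setIntegral_pos_of_isMassPoint hg (k := fun _ => 1) continuous_const
      (fun _ => zero_le_one) (by simpa using T.integrable) hmp one_pos
      (s := Metric.ball (r • e) δ) (Metric.isOpen_ball.mem_nhds (mem_ball_iff_norm.2 hlt))
    simpa [dist_eq_norm] using this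
  have htop := S.constDirections_eq_top T hg hr he hG2 hG0 hGe hGd hratio hm hO hOne hOsh hOm hO0
  rw [Submodule.orthogonal_eq_bot_iff] at htop
  have hfd : ∀ y, fderiv ℝ G y = 0 := fun y => by
    ext v
    have : v ∈ constDirections G := by rw [htop]; trivial
    exact this y
  have hG1 : ∀ y, G y = 1 := fun y => by
    rw [is_const_of_fderiv_eq_zero hGdiff hfd y 0, hG0]
  -- With `G = 1` the identity at `y = 0` reads `∫ g ⟨e, Z⟩ exp(s ⟨e, Z⟩) = 0` for large `s` if `κ ≠
  -- 0`, whereas these weights concentrate where `⟨e, Z⟩` is close to `r > 0`.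
  have hκ : κ = 0 := by
    by_contra hκ
    have h1 := S.transport_identity T hg hr he hm hG2 hGe (mem_constDirections.1 hGd) hratio
      (y := 0) (inner_zero_right _)
    set A : U → ℝ := fun u => inner ℝ e (Z u) with hAdef
    have hA : Measurable A := by fun_prop
    have hAr : ∀ u, |A u| ≤ r := fun u => by simpa [he] using T.abs_inner_le e u
    have hmass : ∀ δ > 0, 0 < ∫ u in {u | r - δ < A u}, g u ∂μ := by
      intro δ hδ
      have := T.setIntegral_pos_of_isMassPoint hg (k := fun _ => 1) continuous_const
        (fun _ => zero_le_one) (by simpa using T.integrable) hm one_pos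
        (s := {z | r - δ < inner ℝ e z}) ((isOpen_lt continuous_const (by fun_prop)).mem_nhds (by
          rw [mem_ofPred_eq, inner_smul_right, real_inner_self_eq_norm_sq, he]
          linarith))
      simpa using this
    have hexp : ∀ s : ℝ, ∀ {q : U → ℝ}, Integrable q μ →
        Integrable (fun u => q u * Real.exp (s * A u)) μ := fun s q hq => by
      refine (T.integrable_mul_exp hq (s • e)).congr (Eventually.of_forall fun u => ?_)
      simp [hAdef, inner_smul_left]
    have h2 := eventually_abs_integral_exp_le (h := fun u => A u - r) (C := r + r) T.integrable hg
      hA hAr hmass (fun u => (abs_sub _ _).trans (by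
        rw [abs_of_pos hr]; exact add_le_add (hAr u) le_rfl))
      (fun η hη => T.exists_pole_small hr he (k := fun z => inner ℝ e z - r) (by fun_prop)
        (by simp [inner_smul_right, he]) hη) (η := r / 2) (by linarith)
    obtain ⟨s, k1, k2, k3, k4⟩ := (h1.and (h2.and ((eventually_ge_atTop (0 : ℝ)).and
      (eventually_gt_atTop κ⁻¹)))).exists
    have hden : κ * s - 1 ≠ 0 := fun h => k4.ne' (by field_simp; linarith)
    have hAe := hexp s (T.integrable_mul_inner T.integrable e)
    have hpos : 0 < ∫ u, g u * Real.exp (s * A u) ∂μ := by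
      have h1 := setIntegral_mul_const_le_integral (c := Real.exp (s * (r - 1)))
        (measurableSet_lt measurable_const hA) T.integrable hg
        (fun u => (Real.exp_pos _).le) (hexp s T.integrable) (s := {u | r - 1 < A u})
        fun u hu => Real.exp_le_exp.2 (mul_le_mul_of_nonneg_left (le_of_lt hu) k3)
      exact (mul_pos (hmass 1 one_pos) (Real.exp_pos (s * (r - 1)))).trans_le h1
    have h3 : ∫ u, g u * inner ℝ e (Z u) * Real.exp (s * A u) ∂μ = 0 := by
      have h4 : κ / (κ * s - 1) * ∫ u, g u * inner ℝ e (Z u) * Real.exp (s * A u) ∂μ = 0 := by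
        rw [← k1, ← integral_const_mul]
        refine integral_congr_ae (Eventually.of_forall fun u => ?_)
        simp [hfd, hG1, hAdef]
        ring
      exact (mul_eq_zero.1 h4).resolve_left (div_ne_zero hκ hden)
    have h5 : ∫ u, g u * (A u - r) * Real.exp (s * A u) ∂μ =
        (∫ u, g u * inner ℝ e (Z u) * Real.exp (s * A u) ∂μ) -
        r * ∫ u, g u * Real.exp (s * A u) ∂μ := by
      rw [← integral_const_mul, ← integral_sub hAe ((hexp s T.integrable).const_mul _)]
      refine integral_congr_ae (Eventually.of_forall fun u => ?_)
      simp only [hAdef]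
      ring
    rw [h5, h3, zero_sub, abs_neg, abs_mul, abs_of_pos hr, abs_of_pos hpos] at k2
    nlinarith
  rw [hratio, hκ, hG1]
  ring

end SphereDensity

end Rigidity

/-! ### From the factorisation identity to equality of Laplace transforms -/

section Identifiability

variable {U : Type*} [MeasurableSpace U] {μ : Measure U}
  {W : Type*} [NormedAddCommGroup W] [InnerProductSpace ℝ W] [FiniteDimensional ℝ W]
  [MeasurableSpace W] [BorelSpace W]

theorem inner_sub_smul_right (e y x : W) :
    (inner ℝ y (x - (inner ℝ e x : ℝ) • e) : ℝ) = inner ℝ (y - (inner ℝ e y : ℝ) • e) x := by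
  rw [inner_sub_right, inner_sub_left, inner_smul_left, inner_smul_right, RCLike.conj_to_real,
    real_inner_comm e y]
  ring

theorem inner_sub_smul_self {e : W} (he : ‖e‖ = 1) (x : W) :
    (inner ℝ e (x - (inner ℝ e x : ℝ) • e) : ℝ) = 0 := by
  rw [inner_sub_right, inner_smul_right, real_inner_self_eq_norm_sq, he]
  ring

theorem mixedLaplace_ofReal (f : U → ℝ) (X : U → W) (e y : W) (s : ℝ) :
    mixedLaplace μ f (fun u => inner ℝ e (X u)) (fun u => X u - (inner ℝ e (X u) : ℝ) • e) y s =
      (laplace μ f X (y - (inner ℝ e y : ℝ) • e + s • e) : ℂ) := by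
  rw [mixedLaplace, laplaceC, laplace, ← integral_complex_ofReal]
  refine integral_congr_ae (Eventually.of_forall fun u => ?_)
  simp only
  rw [inner_sub_smul_right, inner_add_left, inner_smul_left, RCLike.conj_to_real, Real.exp_add]
  push_cast
  ring

theorem mixedLaplace_zero_right (f : U → ℝ) (X : U → W) (e y : W) :
    mixedLaplace μ f (fun u => inner ℝ e (X u)) (fun u => X u - (inner ℝ e (X u) : ℝ) • e) y 0 =
      (laplace μ f X (y - (inner ℝ e y : ℝ) • e) : ℂ) := by
  have := mixedLaplace_ofReal (μ := μ) f X e y 0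
  simpa using this

theorem laplace_zero (f : U → ℝ) (X : U → W) : laplace μ f X 0 = ∫ u, f u ∂μ := by
  simp [laplace]

namespace SphereDensity

variable {f g : U → ℝ} {X Z : U → W} {R r κ : ℝ} {e : W}

theorem sphereSplit (S : SphereDensity μ f X R) (he : ‖e‖ = 1) (hf1 : ∫ u, f u ∂μ = 1)
    (hlev : ∀ c, ∀ᵐ u ∂μ, inner ℝ e (X u) ≠ c) :
    SphereSplit μ f (fun u => inner ℝ e (X u)) (fun u => X u - (inner ℝ e (X u) : ℝ) • e) R where
  integrable := S.integrable
  measurable_fst := by have := S.measurable; fun_prop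
  measurable_snd := by have := S.measurable; fun_prop
  nonneg := S.nonneg
  sphere u := by
    rw [norm_sub_sq_real, norm_smul, he, S.norm_eq, inner_smul_right, real_inner_comm e,
      Real.norm_eq_abs, mul_one, sq_abs]
    ring
  total := hf1
  level := hlev

/-- The factorisation identity along the direction `e` determines the ratio of the Laplace
transforms up to an affine and an exponential factor. -/
theorem exists_ratio (S : SphereDensity μ f X R) (T : SphereDensity μ g Z r)
    (hg : ∀ᵐ u ∂μ, 0 ≤ g u) (hg1 : ∫ u, g u ∂μ = 1) (hf1 : ∫ u, f u ∂μ = 1) (he : ‖e‖ = 1)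
    (hlev : ∀ c, ∀ᵐ u ∂μ, inner ℝ e (X u) ≠ c) (hlev' : ∀ c, ∀ᵐ u ∂μ, inner ℝ e (Z u) ≠ c)
    (hID : ∀ t : W, laplace μ f X t * laplace μ g Z ((inner ℝ e t : ℝ) • e) *
      laplace μ g Z (t - (inner ℝ e t : ℝ) • e) = laplace μ g Z t *
      laplace μ f X ((inner ℝ e t : ℝ) • e) * laplace μ f X (t - (inner ℝ e t : ℝ) • e)) :
    ∃ κ b : ℝ, ∀ t, laplace μ f X t * laplace μ g Z (t - (inner ℝ e t : ℝ) • e) =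
      (1 - κ * inner ℝ e t) * Real.exp (b * inner ℝ e t) *
        (laplace μ g Z t * laplace μ f X (t - (inner ℝ e t : ℝ) • e)) := by
  have S' := S.sphereSplit he hf1 hlev
  have T' := T.sphereSplit he hg1 hlev'
  obtain ⟨κ, b, h⟩ := S'.exists_affine_mul_exp_ratio T' hg (fun y z => by
    have hd : Differentiable ℂ fun z =>
        mixedLaplace μ f (fun u => inner ℝ e (X u)) (fun u => X u - (inner ℝ e (X u) : ℝ) • e) y z *
        mixedLaplace μ g (fun u => inner ℝ e (Z u)) (fun u => Z u - (inner ℝ e (Z u) : ℝ) • e) 0 z *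
        mixedLaplace μ g (fun u => inner ℝ e (Z u)) (fun u => Z u - (inner ℝ e (Z u) : ℝ) • e) y 0 -
        mixedLaplace μ g (fun u => inner ℝ e (Z u)) (fun u => Z u - (inner ℝ e (Z u) : ℝ) • e) y z *
        mixedLaplace μ f (fun u => inner ℝ e (X u)) (fun u => X u - (inner ℝ e (X u) : ℝ) • e) 0 z *
        mixedLaplace μ f (fun u => inner ℝ e (X u)) (fun u => X u - (inner ℝ e (X u) : ℝ) • e) y 0 :=
      (((S'.differentiable_mixedLaplace y).mul (T'.differentiable_mixedLaplace 0)).mul_const _).sub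
      (((T'.differentiable_mixedLaplace y).mul (S'.differentiable_mixedLaplace 0)).mul_const _)
    refine sub_eq_zero.1 (eq_zero_of_entire_of_real hd (fun s => ?_) z)
    have h1 := hID (y - (inner ℝ e y : ℝ) • e + s • e)
    have h2 : (inner ℝ e (y - (inner ℝ e y : ℝ) • e + s • e) : ℝ) = s := by
      rw [inner_add_right, inner_sub_smul_self he, inner_smul_right, real_inner_self_eq_norm_sq, he]
      ring
    rw [h2, add_sub_cancel_right] at h1
    simp only [mixedLaplace_ofReal, mixedLaplace_zero_right, inner_zero_right, zero_smul, sub_zero,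
      zero_add]
    rw [sub_eq_zero]
    exact_mod_cast h1)
  refine ⟨κ, b, fun t => ?_⟩
  have h1 := h t ((inner ℝ e t : ℝ) : ℂ)
  rw [mixedLaplace_ofReal, mixedLaplace_ofReal, mixedLaplace_zero_right, mixedLaplace_zero_right,
    sub_add_cancel] at h1
  exact_mod_cast h1

theorem exp_le_laplace (T : SphereDensity μ g Z r) (hg : ∀ᵐ u ∂μ, 0 ≤ g u)
    (hg1 : ∫ u, g u ∂μ = 1) (t : W) : Real.exp (-(r * ‖t‖)) ≤ laplace μ g Z t := by
  have h : ∫ u, g u * Real.exp (-(r * ‖t‖)) ∂μ ≤ laplace μ g Z t := by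
    refine integral_mono_ae (T.integrable.mul_const _) (T.integrable_mul_exp T.integrable t) ?_
    filter_upwards [hg] with u hu
    exact mul_le_mul_of_nonneg_left
      (Real.exp_le_exp.2 (neg_le_of_abs_le (T.abs_inner_le t u))) hu
  rwa [integral_mul_const, hg1, one_mul] at h

/-- The transverse factor `G` is the ratio of the transforms at the projection orthogonal to `e`.
The growth argument gives `b = 0` and `R = r`; the rigidity argument then applies. -/
theorem eq_of_factorisation (S : SphereDensity μ f X R) (T : SphereDensity μ g Z r)
    (hg : ∀ᵐ u ∂μ, 0 ≤ g u) (hg1 : ∫ u, g u ∂μ = 1) (hf1 : ∫ u, f u ∂μ = 1) (hr : 0 < r)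
    (he : ‖e‖ = 1)
    (hlev : ∀ c, ∀ᵐ u ∂μ, inner ℝ e (X u) ≠ c) (hlev' : ∀ c, ∀ᵐ u ∂μ, inner ℝ e (Z u) ≠ c)
    (hID : ∀ t : W, laplace μ f X t * laplace μ g Z ((inner ℝ e t : ℝ) • e) *
      laplace μ g Z (t - (inner ℝ e t : ℝ) • e) = laplace μ g Z t *
      laplace μ f X ((inner ℝ e t : ℝ) • e) * laplace μ f X (t - (inner ℝ e t : ℝ) • e))
    {O : Set W} (hO : IsOpen O) (hOne : O.Nonempty)
    (hOsh : ∀ ζ ∈ O, ∀ σ : ℝ, 0 ≤ σ → ζ + σ • e ∈ O) (hOe : ∀ ζ ∈ O, inner ℝ e ζ ≠ (0 : ℝ))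
    (hOm : ∀ ζ ∈ O, IsMassPoint μ g Z ((r / ‖ζ‖) • ζ))
    (hOd : ∀ ζ ∈ O, (inner ℝ e ζ : ℝ) ^ 2 < ‖ζ‖ ^ 2) :
    R = r ∧ ∀ t, laplace μ f X t = laplace μ g Z t := by
  obtain ⟨κ, b, h⟩ := S.exists_ratio T hg hg1 hf1 he hlev hlev' hID
  set G : W → ℝ := fun t => laplace μ f X (t - (inner ℝ e t : ℝ) • e) /
    laplace μ g Z (t - (inner ℝ e t : ℝ) • e) with hG
  have hpos : ∀ t, 0 < laplace μ g Z t := T.laplace_pos hg hg1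
  have hratio : ∀ t, laplace μ f X t =
      (1 - κ * inner ℝ e t) * Real.exp (b * inner ℝ e t) * G t * laplace μ g Z t := fun t => by
    have := (hpos (t - (inner ℝ e t : ℝ) • e)).ne'
    refine mul_right_cancel₀ this ((h t).trans ?_)
    have h1 := div_mul_cancel₀ (laplace μ f X (t - (inner ℝ e t : ℝ) • e)) this
    simp only [hG]
    linear_combination -((1 - κ * inner ℝ e t) * Real.exp (b * inner ℝ e t) * laplace μ g Z t) * h1
  have hproj : ∀ t (σ : ℝ), t + σ • e - (inner ℝ e (t + σ • e) : ℝ) • e =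
      t - (inner ℝ e t : ℝ) • e := fun t σ => by
    rw [inner_add_right, inner_smul_right, real_inner_self_eq_norm_sq, he, add_smul]
    simp
  have hGe : ∀ t (σ : ℝ), G (t + σ • e) = G t := fun t σ => by
    simp only [hG, hproj]
  have hpn : ∀ t : W, ‖t - (inner ℝ e t : ℝ) • e‖ ≤ 2 * ‖t‖ := fun t => by
    refine (norm_sub_le _ _).trans ?_
    rw [norm_smul, he, mul_one, Real.norm_eq_abs]
    have := abs_real_inner_le_norm e t
    rw [he, one_mul] at this
    linarith
  have hGub : ∀ ζ, ∃ h, ExpGrowth G ζ h := by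
    intro ζ
    set B := (R + r) * (2 * (‖ζ‖ + 1)) with hB
    refine ⟨B + 1, ExpGrowth.of_eventually_le (C := ∫ u, |f u| ∂μ) (h := B) (by linarith) ?_⟩
    have hb : ∀ᶠ ζ' in 𝓝 ζ, ‖ζ'‖ < ‖ζ‖ + 1 :=
      (continuous_norm.tendsto ζ).eventually_lt_const (by linarith)
    filter_upwards [tendsto_snd.eventually hb, tendsto_fst.eventually (eventually_ge_atTop (0 : ℝ))]
      with q h1 h2
    set t := q.1 • q.2 - (inner ℝ e (q.1 • q.2) : ℝ) • e with ht
    have htn : ‖t‖ ≤ q.1 * (2 * (‖ζ‖ + 1)) := by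
      refine (hpn _).trans ?_
      rw [norm_smul, Real.norm_eq_abs, abs_of_nonneg h2]
      nlinarith
    have h3 := S.abs_laplace_le S.integrable t
    have h4 := T.exp_le_laplace hg hg1 t
    have h0 : 0 ≤ ∫ u, |f u| ∂μ := integral_nonneg fun u => abs_nonneg _
    simp only [hG]
    rw [← ht, abs_div, abs_of_pos (hpos t), div_le_iff₀ (hpos t)]
    have hRr : 0 ≤ R + r := add_nonneg S.nonneg hr.le
    have h5 : Real.exp (R * ‖t‖) ≤ Real.exp (q.1 * B) * Real.exp (-(r * ‖t‖)) := by
      rw [← Real.exp_add]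
      refine Real.exp_le_exp.2 ?_
      have := mul_le_mul_of_nonneg_left htn hRr
      rw [hB]
      linarith
    calc _ ≤ (∫ u, |f u| ∂μ) * Real.exp (R * ‖t‖) := h3
      _ ≤ (∫ u, |f u| ∂μ) * (Real.exp (q.1 * B) * Real.exp (-(r * ‖t‖))) := by gcongr
      _ = (∫ u, |f u| ∂μ) * Real.exp (q.1 * B) * Real.exp (-(r * ‖t‖)) := by ring
      _ ≤ _ := by gcongr
  obtain ⟨hb, hRr⟩ := S.radius_eq_of_open T hg hr he hratio hGe hGub hf1 hO hOne hOe hOm hOd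
  refine ⟨hRr, ?_⟩
  subst hRr
  have hG2 : ContDiff ℝ (2 : ℕ) G := by
    have h1 : ContDiff ℝ (2 : ℕ) fun t : W => t - (inner ℝ e t : ℝ) • e :=
      contDiff_id.sub ((contDiff_const.inner ℝ contDiff_id).smul contDiff_const)
    exact ((S.contDiff_laplace 2 S.integrable).comp h1).div
      ((T.contDiff_laplace 2 T.integrable).comp h1) fun t => (hpos _).ne'
  refine S.laplace_eq_of_ratio T hg hr he hG2 ?_ hGe (κ := κ) (fun t => ?_) hO hOne hOsh hOm
    fun ζ hζ h0 => hOe ζ hζ (by rw [h0, inner_zero_right])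
  · simp [hG, laplace_zero, hf1, hg1]
  · have := hratio t
    rwa [hb, zero_mul, Real.exp_zero, mul_one] at this

/-- In the plane the identity is symmetric in the two axes, so the ratio is known along both and no
transverse factor is left undetermined. -/
theorem eq_of_factorisation_two (S : SphereDensity μ f X R) (T : SphereDensity μ g Z r)
    (hg : ∀ᵐ u ∂μ, 0 ≤ g u) (hg1 : ∫ u, g u ∂μ = 1) (hf1 : ∫ u, f u ∂μ = 1) (hr : 0 < r)
    {e' : W} (hbasis : ∀ t, t = (inner ℝ e t : ℝ) • e + (inner ℝ e' t : ℝ) • e')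
    (he : ‖e‖ = 1) (he' : ‖e'‖ = 1) (hee : inner ℝ e e' = (0 : ℝ))
    (hlev : ∀ c, ∀ᵐ u ∂μ, inner ℝ e (X u) ≠ c) (hlevZ : ∀ c, ∀ᵐ u ∂μ, inner ℝ e (Z u) ≠ c)
    (hlev' : ∀ c, ∀ᵐ u ∂μ, inner ℝ e' (X u) ≠ c) (hlevZ' : ∀ c, ∀ᵐ u ∂μ, inner ℝ e' (Z u) ≠ c)
    (hID : ∀ t : W, laplace μ f X t * laplace μ g Z ((inner ℝ e t : ℝ) • e) *
      laplace μ g Z (t - (inner ℝ e t : ℝ) • e) = laplace μ g Z t *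
      laplace μ f X ((inner ℝ e t : ℝ) • e) * laplace μ f X (t - (inner ℝ e t : ℝ) • e)) :
    R = r ∧ ∀ t, laplace μ f X t = laplace μ g Z t := by
  have hsub : ∀ t, t - (inner ℝ e t : ℝ) • e = (inner ℝ e' t : ℝ) • e' := fun t => by
    conv_lhs => lhs; rw [hbasis t]
    rw [add_sub_cancel_left]
  have hsub' : ∀ t, t - (inner ℝ e' t : ℝ) • e' = (inner ℝ e t : ℝ) • e := fun t => by
    conv_lhs => lhs; rw [hbasis t]
    rw [add_sub_cancel_right]
  obtain ⟨κ, b, h⟩ := S.exists_ratio T hg hg1 hf1 he hlev hlevZ hID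
  obtain ⟨κ', b', h'⟩ := S.exists_ratio T hg hg1 hf1 he' hlev' hlevZ' (fun t => by
    have := hID t
    rw [hsub] at this
    rw [hsub']
    linear_combination this)
  have hpos : ∀ t, 0 < laplace μ g Z t := T.laplace_pos hg hg1
  refine S.eq_of_product_ratio T hg hg1 hr hbasis he he' hee hlevZ hlevZ' (κ := κ) (κ' := κ')
    (b := b) (b' := b') fun t => ?_
  have h1 := h t
  have h2 := h' ((inner ℝ e' t : ℝ) • e')
  have h3 : (inner ℝ e' ((inner ℝ e' t : ℝ) • e') : ℝ) = inner ℝ e' t := by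
    rw [inner_smul_right, real_inner_self_eq_norm_sq, he']; ring
  rw [h3, sub_self, laplace_zero, laplace_zero, hf1, hg1, mul_one, mul_one] at h2
  rw [hsub, h2] at h1
  have h4 := (hpos ((inner ℝ e' t : ℝ) • e')).ne'
  rw [Real.exp_add]
  refine mul_right_cancel₀ h4 (h1.trans ?_)
  ring

end SphereDensity

end Identifiability

/-! ### Injectivity of the angular coordinates -/

section Angles

variable {m : ℕ}

theorem prod_filter_lt (F : ℕ → ℝ) {k : ℕ} (hk : k ≤ m) :
    ∏ j : Fin m with j.val < k, F j = ∏ j ∈ Finset.range k, F j := by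
  rw [Finset.prod_filter, Fin.prod_univ_eq_prod_range (fun j => if j < k then F j else 1) m,
    ← Finset.prod_filter]
  congr 1
  ext j
  simp
  omega

/-- The sine of the `j`-th angle, extended by one. -/
noncomputable def sinAngle (u : Fin m → ℝ) (j : ℕ) : ℝ :=
  if h : j < m then Real.sin (angle u ⟨j, h⟩) else 1

theorem sinAngle_val (u : Fin m → ℝ) (j : Fin m) : sinAngle u j = Real.sin (angle u j) := by
  simp [sinAngle]

/-- The product of the sines of the first `k` angles. -/
noncomputable def sinProd (u : Fin m → ℝ) (k : ℕ) : ℝ := ∏ j ∈ Finset.range k, sinAngle u j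

theorem sinProd_succ (u : Fin m → ℝ) (k : Fin m) :
    sinProd u (k + 1) = sinProd u k * Real.sin (angle u k) := by
  rw [sinProd, Finset.prod_range_succ, sinAngle_val, sinProd]

theorem sphereMap_castSucc (u : Fin m → ℝ) (k : Fin m) :
    sphereMap u k.castSucc = sinProd u k * Real.cos (angle u k) := by
  simp only [sphereMap, Fin.val_castSucc, k.isLt, dite_true, sinProd]
  rw [← prod_filter_lt _ k.isLt.le]
  simp only [sinAngle_val, Fin.eta]

theorem sphereMap_last (u : Fin m → ℝ) : sphereMap u (Fin.last m) = sinProd u m := by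
  simp only [sphereMap, Fin.val_last, lt_irrefl, dite_false, mul_one, sinProd]
  rw [← prod_filter_lt _ le_rfl]
  simp only [sinAngle_val]

/-- The squares of the coordinates telescope, each being a difference of squares of consecutive
products of sines. -/
theorem norm_sphereMap (u : Fin m → ℝ) : ‖sphereMap u‖ = 1 := by
  have h : ‖sphereMap u‖ ^ 2 = 1 := by
    rw [EuclideanSpace.norm_sq_eq, Fin.sum_univ_castSucc]
    simp only [Real.norm_eq_abs, sq_abs, sphereMap_castSucc, sphereMap_last]
    have h1 : ∀ k : Fin m, (sinProd u k * Real.cos (angle u k)) ^ 2 =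
        sinProd u (k : ℕ) ^ 2 - sinProd u ((k : ℕ) + 1) ^ 2 := fun k => by
      rw [sinProd_succ, mul_pow, Real.cos_sq']
      ring
    simp_rw [h1]
    rw [Fin.sum_univ_eq_sum_range (fun k => sinProd u k ^ 2 - sinProd u (k + 1) ^ 2) m,
      Finset.sum_range_sub']
    simp [sinProd]
  nlinarith [norm_nonneg (sphereMap u)]

theorem continuous_angle (j : Fin m) : Continuous fun u : Fin m → ℝ => angle u j := by
  unfold angle
  split_ifs <;> fun_prop

theorem continuous_sphereMap : Continuous (sphereMap : (Fin m → ℝ) → _) := by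
  refine (PiLp.continuous_toLp 2 _).comp (continuous_pi fun k => ?_)
  have := continuous_angle (m := m)
  refine (continuous_finsetProd _ fun j _ => Real.continuous_sin.comp (this j)).mul ?_
  split_ifs
  · exact Real.continuous_cos.comp (this _)
  · exact continuous_const

/-- The part of the cube where the angular coordinates are injective. -/
def injCube (m : ℕ) : Set (Fin m → ℝ) :=
  (Set.univ.pi fun _ => Ioo (0 : ℝ) 1) ∩ {u | ∀ j : Fin m, j.val = 0 → u j ≠ 1 / 2}

/-- The coordinates yield the cosines one after the other, as all sines are nonzero once `u 0 = 1/2`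
is removed. The sines follow: they are positive for all angles but the first, and the sign of the
first one is that of the last coordinate. -/
theorem injOn_sphereMap : InjOn sphereMap (injCube m) := by
  intro u hu v hv huv
  have hpi := Real.pi_pos
  have hcoord : ∀ k : Fin (m + 1), sphereMap u k = sphereMap v k := fun k => by rw [huv]
  have hpos : ∀ w ∈ injCube m, ∀ j : Fin m, j.val ≠ 0 → 0 < Real.sin (angle w j) := by
    intro w hw j hj
    have := hw.1 j (mem_univ j)
    rw [angle, if_neg hj]
    exact Real.sin_pos_of_pos_of_lt_pi (mul_pos hpi this.1) (by nlinarith [this.2])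
  have hrange : ∀ w ∈ injCube m, ∀ j : Fin m, 0 < angle w j ∧ angle w j < 2 * Real.pi := by
    intro w hw j
    have := hw.1 j (mem_univ j)
    rw [angle]
    split_ifs
    · exact ⟨by have := this.1; positivity, by nlinarith [this.2]⟩
    · exact ⟨mul_pos hpi this.1, by nlinarith [this.2]⟩
  have hne : ∀ w ∈ injCube m, ∀ j : Fin m, Real.sin (angle w j) ≠ 0 := by
    intro w hw j
    rcases eq_or_ne j.val 0 with hj | hj
    · intro h0
      have h1 := hw.2 j hj
      have h2 := hrange w hw j
      have h3 : angle w j = 2 * Real.pi * w j := by rw [angle, if_pos hj]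
      have h4 : Real.sin (angle w j - Real.pi) = 0 := by rw [Real.sin_sub_pi, h0, neg_zero]
      have h5 := (Real.sin_eq_zero_iff_of_lt_of_lt (by linarith) (by linarith)).1 h4
      rw [h3] at h5
      apply h1
      have : Real.pi * (2 * w j - 1) = 0 := by linarith
      have := (mul_eq_zero.1 this).resolve_left hpi.ne'
      linarith
    · exact (hpos w hw j hj).ne'
  have hA : ∀ w ∈ injCube m, ∀ k ≤ m, sinProd w k ≠ 0 := by
    intro w hw k hk
    rw [sinProd, Finset.prod_ne_zero_iff]
    intro j hj
    have hjm : j < m := (Finset.mem_range.1 hj).trans_le hk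
    rw [sinAngle, dif_pos hjm]
    exact hne w hw _
  have hsign : ∀ w ∈ injCube m, ∀ j : Fin m, j.val = 0 →
      0 < sinProd w m * Real.sin (angle w j) := by
    intro w hw j hj
    obtain ⟨n, rfl⟩ : ∃ n, m = n + 1 := ⟨m - 1, by have := j.isLt; omega⟩
    have hj0 : j = 0 := Fin.ext hj
    subst hj0
    rw [sinProd, Finset.prod_range_succ']
    have h0 : sinAngle w 0 = Real.sin (angle w 0) := sinAngle_val w 0
    rw [h0, mul_assoc]
    refine mul_pos (Finset.prod_pos fun i hi => ?_) (mul_self_pos.2 (hne w hw 0))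
    have hi' : i + 1 < n + 1 := by have := Finset.mem_range.1 hi; omega
    rw [sinAngle, dif_pos hi']
    exact hpos w hw _ (by simp)
  have key : ∀ n : ℕ, ∀ h : n < m, sinProd u n = sinProd v n →
      Real.cos (angle u ⟨n, h⟩) = Real.cos (angle v ⟨n, h⟩) ∧
      Real.sin (angle u ⟨n, h⟩) = Real.sin (angle v ⟨n, h⟩) := by
    intro n h hp
    have h1 := hcoord (Fin.castSucc ⟨n, h⟩)
    rw [sphereMap_castSucc, sphereMap_castSucc] at h1
    simp only at h1
    rw [hp] at h1
    have hc := mul_left_cancel₀ (hA v hv n h.le) h1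
    refine ⟨hc, ?_⟩
    have hsq : Real.sin (angle u ⟨n, h⟩) ^ 2 = Real.sin (angle v ⟨n, h⟩) ^ 2 := by
      rw [Real.sin_sq, Real.sin_sq, hc]
    rcases sq_eq_sq_iff_eq_or_eq_neg.1 hsq with h2 | h2
    · exact h2
    · exfalso
      rcases eq_or_ne n 0 with h0 | h0
      · have h3 := hsign u hu ⟨n, h⟩ h0
        have h4 := hsign v hv ⟨n, h⟩ h0
        have h5 := hcoord (Fin.last m)
        rw [sphereMap_last, sphereMap_last] at h5
        rw [h5, h2] at h3
        linarith
      · have h3 := hpos u hu ⟨n, h⟩ h0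
        have h4 := hpos v hv ⟨n, h⟩ h0
        linarith
  have hprod : ∀ n ≤ m, sinProd u n = sinProd v n := by
    intro n
    induction n with
    | zero => simp [sinProd]
    | succ n ih =>
      intro hn
      have h1 := sinProd_succ u ⟨n, hn⟩
      have h2 := sinProd_succ v ⟨n, hn⟩
      simp only at h1 h2
      rw [h1, h2, ih (by omega), (key n hn (ih (by omega))).2]
  funext j
  have h1 := key j j.isLt (hprod j j.isLt.le)
  simp only [Fin.eta] at h1
  have h2 := hrange u hu j
  have h3 := hrange v hv j
  have h4 : Real.cos (angle u j - angle v j) = 1 := by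
    rw [Real.cos_sub, h1.1, h1.2]
    linarith [Real.sin_sq_add_cos_sq (angle v j)]
  have h5 := (Real.cos_eq_one_iff_of_lt_of_lt (by linarith) (by linarith)).1 h4
  have h6 : angle u j = angle v j := by linarith
  unfold angle at h6
  split_ifs at h6
  · exact mul_left_cancel₀ (by positivity) h6
  · exact mul_left_cancel₀ (by positivity) h6

theorem ae_cube_of_null {j : Fin m} {s : Set ℝ} (hs : volume s = 0) :
    ∀ᵐ u ∂(cubeMeasure m), u j ∉ s := by
  have h1 : ∀ᵐ x : ℝ, x ∉ s := by rwa [ae_iff, show {a | ¬ a ∉ s} = s by ext; simp]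
  have h2 : ∀ᵐ u : Fin m → ℝ, u j ∉ s :=
    (Measure.quasiMeasurePreserving_eval (fun _ : Fin m => (volume : Measure ℝ)) j).ae h1
  exact ae_restrict_of_ae h2

theorem measurableSet_cube : MeasurableSet (Set.univ.pi fun _ : Fin m => Ioo (0 : ℝ) 1) :=
  MeasurableSet.univ_pi fun _ => measurableSet_Ioo

theorem measurableSet_injCube : MeasurableSet (injCube m) := by
  refine measurableSet_cube.inter ?_
  rw [Set.ofPred_forall]
  refine MeasurableSet.iInter fun j => ?_
  rw [Set.ofPred_forall]
  exact MeasurableSet.iInter fun _ => (measurable_pi_apply j) (measurableSet_singleton _).compl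

theorem ae_mem_injCube : ∀ᵐ u ∂(cubeMeasure m), u ∈ injCube m := by
  have h1 : ∀ᵐ u ∂(cubeMeasure m), u ∈ Set.univ.pi fun _ : Fin m => Ioo (0 : ℝ) 1 :=
    ae_restrict_mem measurableSet_cube
  have h2 : ∀ᵐ u ∂(cubeMeasure m), ∀ j : Fin m, u j ∉ ({1 / 2} : Set ℝ) :=
    ae_all_iff.2 fun j => ae_cube_of_null (by simp)
  filter_upwards [h1, h2] with u hu hu2
  exact ⟨hu, fun j _ => hu2 j⟩

theorem countable_cos_eq (c : ℝ) : {x : ℝ | Real.cos x = c}.Countable := by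
  rcases Set.eq_empty_or_nonempty {x : ℝ | Real.cos x = c} with h | ⟨y, hy⟩
  · rw [h]; exact countable_empty
  have hsub : {x : ℝ | Real.cos x = c} ⊆ range (fun k : ℤ => 2 * k * Real.pi + y) ∪
      range (fun k : ℤ => 2 * k * Real.pi - y) := by
    intro x hx
    have h1 : Real.cos y = Real.cos x := by
      have e1 : Real.cos x = c := hx
      have e2 : Real.cos y = c := hy
      rw [e1, e2]
    obtain ⟨k, hk⟩ := Real.cos_eq_cos_iff.1 h1
    rcases hk with hk | hk
    · exact Or.inl ⟨k, hk.symm⟩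
    · exact Or.inr ⟨k, hk.symm⟩
  exact ((countable_range _).union (countable_range _)).mono hsub

theorem ae_cos_angle_ne (φ : ℝ) (j : Fin m) (c : ℝ) :
    ∀ᵐ u ∂(cubeMeasure m), Real.cos (angle u j + φ) ≠ c := by
  have hpi := Real.pi_pos
  obtain ⟨a, ha, hau⟩ : ∃ a : ℝ, a ≠ 0 ∧ ∀ u : Fin m → ℝ, angle u j = a * u j := by
    by_cases hj : j.val = 0
    · exact ⟨2 * Real.pi, by positivity, fun u => by rw [angle, if_pos hj]⟩
    · exact ⟨Real.pi, hpi.ne', fun u => by rw [angle, if_neg hj]⟩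
  have hc : {x : ℝ | Real.cos (a * x + φ) = c}.Countable :=
    (countable_cos_eq c).preimage_of_injOn (f := fun x => a * x + φ) (fun x _ y _ h => by
      simp only [add_left_inj] at h
      exact mul_left_cancel₀ ha h)
  filter_upwards [ae_cube_of_null (j := j) (hc.measure_zero volume)] with u hu h
  exact hu (by rw [hau] at h; exact h)

end Angles

/-! ### Weights are determined by their Laplace transforms -/

section Determination

variable {U : Type*} [MeasurableSpace U] [StandardBorelSpace U] {μ : Measure U}
  {W : Type*} [NormedAddCommGroup W] [InnerProductSpace ℝ W] [FiniteDimensional ℝ W]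
  [MeasurableSpace W] [BorelSpace W]

/-- A weight is determined by its Laplace transform along an essentially injective map. -/
theorem ae_eq_zero_of_laplace_eq_zero {X : U → W} {R : ℝ} {C : Set U} (hX : Measurable X)
    (hR : ∀ u, ‖X u‖ ≤ R) (hC : MeasurableSet C) (hinj : InjOn X C) (hae : ∀ᵐ u ∂μ, u ∈ C)
    {w : U → ℝ} (hw : Integrable w μ) (h : ∀ y, laplace μ w X y = 0) : w =ᵐ[μ] 0 := by
  refine hw.ae_eq_zero_of_forall_setIntegral_eq_zero fun s hs _ => ?_
  -- By the Lusin–Souslin theorem the image of a Borel set under an injective measurable map is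
  -- Borel, so the indicator of `s` is almost everywhere a bounded measurable function of `X`.
  have hB : MeasurableSet (X '' (s ∩ C)) :=
    (hs.inter hC).image_of_measurable_injOn hX (hinj.mono inter_subset_right)
  have h1 := integral_mul_comp_eq_zero (μ := μ) (w := fun u => (w u : ℂ)) hw.ofReal hX hR
    (fun y => by
      have : ∫ u, ((w u * Real.exp (inner ℝ y (X u)) : ℝ) : ℂ) ∂μ = 0 := by
        rw [integral_complex_ofReal]
        have := h y
        rw [laplace] at this
        rw [this, Complex.ofReal_zero]
      simpa using this)
    (k := (X '' (s ∩ C)).indicator fun _ => 1) (measurable_const.indicator hB) (B := 1)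
    (fun x => by
      by_cases hx : x ∈ X '' (s ∩ C) <;> simp [hx])
  have h2 : ∫ u, (w u : ℂ) * (X '' (s ∩ C)).indicator (fun _ => (1 : ℂ)) (X u) ∂μ =
      ∫ u, ((s.indicator w u : ℝ) : ℂ) ∂μ := by
    refine integral_congr_ae ?_
    filter_upwards [hae] with u hu
    by_cases hus : u ∈ s
    · have : X u ∈ X '' (s ∩ C) := ⟨u, ⟨hus, hu⟩, rfl⟩
      simp [this, hus]
    · have : X u ∉ X '' (s ∩ C) := by
        rintro ⟨v, ⟨hv, hvC⟩, hvu⟩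
        rw [hinj hvC hu hvu] at hv
        exact hus hv
      simp [this, hus]
  rw [h2, integral_complex_ofReal] at h1
  rw [← integral_indicator hs]
  exact_mod_cast h1

end Determination

/-! ### The sphere, its pole and the cone of small angles -/

section Sphere

variable {m : ℕ}

theorem sphereDensity {R : ℝ} (hR : 0 < R) {f : (Fin m → ℝ) → ℝ}
    (hf : Integrable f (cubeMeasure m)) :
    SphereDensity (cubeMeasure m) f (fun u => R • sphereMap u) R := by
  have hXm : Measurable fun u : Fin m → ℝ => R • sphereMap u :=
    (continuous_sphereMap.const_smul R).measurable
  have hn : ∀ u : Fin m → ℝ, ‖R • sphereMap u‖ = R := fun u => by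
    rw [norm_smul, norm_sphereMap, mul_one, Real.norm_eq_abs, abs_of_pos hR]
  refine ⟨hf, hXm, hR.le, hn, fun w hw h => ?_⟩
  refine ae_eq_zero_of_laplace_eq_zero hXm (fun u => (hn u).le) measurableSet_injCube ?_
    ae_mem_injCube hw h
  intro u hu v hv huv
  exact injOn_sphereMap hu hv (smul_right_injective _ hR.ne' huv)

/-- The norm of the vector of the coordinates of index at least `j`. -/
noncomputable def tailNorm (y : EuclideanSpace ℝ (Fin (m + 1))) (j : ℕ) : ℝ :=
  √(∑ k : Fin (m + 1), if j ≤ k.val then y k ^ 2 else 0)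

theorem tailNorm_sq (y : EuclideanSpace ℝ (Fin (m + 1))) (j : ℕ) :
    tailNorm y j ^ 2 = ∑ k : Fin (m + 1), if j ≤ k.val then y k ^ 2 else 0 :=
  Real.sq_sqrt (Finset.sum_nonneg fun k _ => by split_ifs <;> positivity)

theorem tailNorm_zero (y : EuclideanSpace ℝ (Fin (m + 1))) : tailNorm y 0 = ‖y‖ := by
  rw [EuclideanSpace.norm_eq, tailNorm]
  simp

theorem tailNorm_succ (y : EuclideanSpace ℝ (Fin (m + 1))) (j : Fin m) :
    tailNorm y j ^ 2 = y j.castSucc ^ 2 + tailNorm y (j + 1) ^ 2 := by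
  have h : y j.castSucc ^ 2 = ∑ k, if k = j.castSucc then y k ^ 2 else 0 := by simp
  rw [tailNorm_sq, tailNorm_sq, h, ← Finset.sum_add_distrib]
  refine Finset.sum_congr rfl fun k _ => ?_
  rcases eq_or_ne k j.castSucc with rfl | hk
  · simp
  · have : k.val ≠ j.val := fun h => hk (Fin.ext h)
    by_cases h : j.val ≤ k.val
    · have : j.val + 1 ≤ k.val := by omega
      simp [hk, h, this]
    · have : ¬ j.val + 1 ≤ k.val := by omega
      simp [hk, h, this]

theorem tailNorm_last {y : EuclideanSpace ℝ (Fin (m + 1))} (hy : 0 ≤ y (Fin.last m)) :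
    tailNorm y m = y (Fin.last m) := by
  rw [tailNorm, Finset.sum_eq_single (Fin.last m)]
  · simp [Real.sqrt_sq hy]
  · intro k _ hk
    have : ¬ m ≤ k.val := by
      have h1 := k.isLt
      have h2 : k.val ≠ m := fun h => hk (Fin.ext h)
      omega
    simp [this]
  · simp

theorem continuous_tailNorm (j : ℕ) :
    Continuous fun y : EuclideanSpace ℝ (Fin (m + 1)) => tailNorm y j := by
  unfold tailNorm
  refine Real.continuous_sqrt.comp (continuous_finsetSum _ fun k _ => ?_)
  split_ifs <;> fun_prop

/-- The cube coordinates of the direction of a vector with positive coordinates. -/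
noncomputable def anglesOf (y : EuclideanSpace ℝ (Fin (m + 1))) (j : Fin m) : ℝ :=
  Real.arctan (tailNorm y (j + 1) / y j.castSucc) /
    (if j.val = 0 then 2 * Real.pi else Real.pi)

theorem angle_anglesOf (y : EuclideanSpace ℝ (Fin (m + 1))) (j : Fin m) :
    angle (anglesOf y) j = Real.arctan (tailNorm y (j + 1) / y j.castSucc) := by
  have := Real.pi_ne_zero
  rw [angle, anglesOf]
  split_ifs <;> field_simp

theorem tailNorm_pos {y : EuclideanSpace ℝ (Fin (m + 1))} (hy : ∀ k, 0 < y k) {j : ℕ} (hj : j ≤ m) :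
    0 < tailNorm y j := by
  refine Real.sqrt_pos.2 ?_
  refine Finset.sum_pos' (fun k _ => by split_ifs <;> positivity) ⟨Fin.last m, Finset.mem_univ _, ?_⟩
  have := hy (Fin.last m)
  simp [hj]
  positivity

theorem cos_sin_anglesOf {y : EuclideanSpace ℝ (Fin (m + 1))} (hy : ∀ k, 0 < y k) (j : Fin m) :
    Real.cos (angle (anglesOf y) j) = y j.castSucc / tailNorm y j ∧
    Real.sin (angle (anglesOf y) j) = tailNorm y (j + 1) / tailNorm y j := by
  have h0 := hy j.castSucc
  have h1 := tailNorm_pos hy j.isLt.le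
  have h2 : √(1 + (tailNorm y (j + 1) / y j.castSucc) ^ 2) = tailNorm y j / y j.castSucc := by
    have h3 : 1 + (tailNorm y (j + 1) / y j.castSucc) ^ 2 = (tailNorm y j / y j.castSucc) ^ 2 := by
      have := tailNorm_succ y j
      field_simp
      linarith
    rw [h3, Real.sqrt_sq (by positivity)]
  rw [angle_anglesOf, Real.cos_arctan, Real.sin_arctan, h2]
  constructor <;> field_simp

theorem sinProd_anglesOf {y : EuclideanSpace ℝ (Fin (m + 1))} (hy : ∀ k, 0 < y k) {k : ℕ}
    (hk : k ≤ m) : sinProd (anglesOf y) k = tailNorm y k / ‖y‖ := by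
  have hn : 0 < ‖y‖ := by rw [← tailNorm_zero]; exact tailNorm_pos hy (Nat.zero_le _)
  induction k with
  | zero => rw [tailNorm_zero, div_self hn.ne']; simp [sinProd]
  | succ k ih =>
    have h1 := sinProd_succ (anglesOf y) ⟨k, hk⟩
    simp only at h1
    have h2 := tailNorm_pos hy (j := k) (by omega)
    rw [h1, ih (by omega), (cos_sin_anglesOf hy ⟨k, hk⟩).2]
    field_simp

/-- The `j`-th angle of `y` has cosine `y j` and sine the norm of the following coordinates, both
over the norm of the coordinates from `j` on; so the products of sines telescope. -/
theorem sphereMap_anglesOf {y : EuclideanSpace ℝ (Fin (m + 1))} (hy : ∀ k, 0 < y k) :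
    sphereMap (anglesOf y) = (1 / ‖y‖) • y := by
  ext k
  rw [PiLp.smul_apply, smul_eq_mul]
  induction k using Fin.lastCases with
  | last => rw [sphereMap_last, sinProd_anglesOf hy le_rfl, tailNorm_last (hy _).le]; ring
  | cast k =>
    have h2 := tailNorm_pos hy k.isLt.le
    rw [sphereMap_castSucc, sinProd_anglesOf hy k.isLt.le, (cos_sin_anglesOf hy k).1]
    field_simp

/-- The open cone of the directions with small angles. -/
def smallAngleCone (m : ℕ) (ε : ℝ) : Set (EuclideanSpace ℝ (Fin (m + 1))) :=
  {y | (∀ k, 0 < y k) ∧ ∀ j : Fin m, tailNorm y (j + 1) < ε * y j.castSucc}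

theorem isOpen_smallAngleCone (ε : ℝ) : IsOpen (smallAngleCone m ε) := by
  have h1 : IsOpen {y : EuclideanSpace ℝ (Fin (m + 1)) | ∀ k, 0 < y k} := by
    rw [Set.ofPred_forall]
    exact isOpen_iInter_of_finite fun k => isOpen_lt continuous_const (by fun_prop)
  have h2 : IsOpen {y : EuclideanSpace ℝ (Fin (m + 1)) |
      ∀ j : Fin m, tailNorm y (j + 1) < ε * y j.castSucc} := by
    rw [Set.ofPred_forall]
    exact isOpen_iInter_of_finite fun k => isOpen_lt (continuous_tailNorm _) (by fun_prop)
  exact h1.inter h2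

theorem smallAngleCone_nonempty {ε : ℝ} (hε : 0 < ε) : (smallAngleCone m ε).Nonempty := by
  -- For the coordinates `η ^ k`, the tail after index `j` is at most `(m + 1) η η ^ j`, and `(m +
  -- 1) η < ε`.
  set η := min 1 (ε / (m + 2)) with hη
  have hη0 : 0 < η := lt_min one_pos (by positivity)
  have hη1 : η ≤ 1 := min_le_left _ _
  refine ⟨WithLp.toLp 2 fun k => η ^ k.val, fun k => pow_pos hη0 _, fun j => ?_⟩
  have hlt : (m + 1) * η < ε := by
    have h1 : η ≤ ε / (m + 2) := min_le_right _ _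
    rw [le_div_iff₀ (by positivity)] at h1
    nlinarith
  refine lt_of_le_of_lt (b := (m + 1) * η * η ^ j.val) ?_
    (mul_lt_mul_of_pos_right hlt (pow_pos hη0 _))
  refine Real.sqrt_le_iff.2 ⟨by positivity, ?_⟩
  calc _ ≤ ∑ k : Fin (m + 1), (η * η ^ j.val) ^ 2 := by
        refine Finset.sum_le_sum fun k _ => ?_
        split_ifs with h
        · simp only
          have : η ^ k.val ≤ η ^ (j.val + 1) := pow_le_pow_of_le_one hη0.le hη1 h
          rw [pow_succ'] at this
          gcongr
        · positivity
    _ = (m + 1) * (η * η ^ j.val) ^ 2 := by simp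
    _ ≤ _ := by
        have h1 : (1 : ℝ) ≤ m + 1 := by linarith [(Nat.cast_nonneg m : (0 : ℝ) ≤ m)]
        have h2 : 0 ≤ (η * η ^ j.val) ^ 2 := sq_nonneg _
        nlinarith [mul_nonneg (mul_nonneg (by linarith : (0:ℝ) ≤ (m:ℝ) + 1) (by linarith : (0:ℝ) ≤ (m:ℝ))) h2]

theorem anglesOf_mem {ε : ℝ} {y : EuclideanSpace ℝ (Fin (m + 1))} (hy : y ∈ smallAngleCone m ε)
    (j : Fin m) : anglesOf y j ∈ Ioo 0 ε := by
  have h0 := hy.1 j.castSucc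
  have h1 := tailNorm_pos hy.1 (j := j + 1) j.isLt
  have h2 : 0 < tailNorm y (j + 1) / y j.castSucc := by positivity
  have h3 : tailNorm y (j + 1) / y j.castSucc < ε := (div_lt_iff₀ h0).2 (hy.2 j)
  have h4 : 0 < Real.arctan (tailNorm y (j + 1) / y j.castSucc) := Real.arctan_pos.2 h2
  have h5 : Real.arctan (tailNorm y (j + 1) / y j.castSucc) < ε :=
    (Real.lt_tan h4 (Real.arctan_lt_pi_div_two _)).trans (by rwa [Real.tan_arctan])
  have hpi := Real.pi_gt_three
  have h6 : (1 : ℝ) ≤ if j.val = 0 then 2 * Real.pi else Real.pi := by split_ifs <;> linarith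
  refine ⟨div_pos h4 (by linarith), (div_le_self h4.le h6).trans_lt h5⟩

/-- Near `v` the preimage of a ball contains a nonempty open subset of the cube on which `f > 0`
almost everywhere. -/
theorem isMassPoint_sphereMap {R γ : ℝ} {f : (Fin m → ℝ) → ℝ}
    (hf : Integrable f (cubeMeasure m)) (hf0 : ∀ᵐ u ∂(cubeMeasure m), 0 ≤ f u)
    (hpos : ∀ᵐ u ∂(cubeMeasure m), (∀ j, u j ∈ Ioo 0 γ) → 0 < f u)
    {v : Fin m → ℝ} (hv : ∀ j, v j ∈ Ioo 0 (min γ 1)) :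
    IsMassPoint (cubeMeasure m) f (fun u => R • sphereMap u) (R • sphereMap v) := by
  intro δ hδ
  have hc : Continuous fun u : Fin m → ℝ => ‖R • sphereMap u - R • sphereMap v‖ := by
    have := continuous_sphereMap (m := m)
    fun_prop
  set A := {u : Fin m → ℝ | ‖R • sphereMap u - R • sphereMap v‖ < δ} with hA
  have hAo : IsOpen A := isOpen_lt hc continuous_const
  have hnn := ae_restrict_of_ae (s := A) hf0
  by_contra! hle
  have h0 := (integral_eq_zero_iff_of_nonneg_ae hnn hf.integrableOn).1
    (le_antisymm hle (integral_nonneg_of_ae hnn))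
  have h1 : ∀ᵐ u ∂(cubeMeasure m), u ∈ A → f u = 0 :=
    (ae_restrict_iff' hAo.measurableSet).1 h0
  set N := A ∩ Set.univ.pi fun _ : Fin m => Ioo (0 : ℝ) (min γ 1) with hN
  have hNo : IsOpen N := hAo.inter (isOpen_set_pi finite_univ fun _ _ => isOpen_Ioo)
  have hNne : N.Nonempty := ⟨v, by simpa [hA] using hδ, fun j _ => hv j⟩
  have hN0 : cubeMeasure m N = 0 := by
    refine measure_mono_null (fun u hu => ?_) (ae_iff.1 (h1.and hpos))
    rintro ⟨k1, k2⟩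
    have := k2 fun j => ⟨(hu.2 j (mem_univ j)).1, (hu.2 j (mem_univ j)).2.trans_le (min_le_left _ _)⟩
    rw [k1 hu.1] at this
    exact lt_irrefl _ this
  rw [cubeMeasure, Measure.restrict_apply hNo.measurableSet, inter_eq_left.2] at hN0
  · exact (hNo.measure_pos volume hNne).ne' hN0
  · exact fun u hu j hj => ⟨(hu.2 j hj).1, (hu.2 j hj).2.trans_le (min_le_right _ _)⟩

/-- The first basis vector. -/
noncomputable def pole (m : ℕ) : EuclideanSpace ℝ (Fin (m + 1)) := EuclideanSpace.single 0 1

theorem inner_pole (t : EuclideanSpace ℝ (Fin (m + 1))) : (inner ℝ (pole m) t : ℝ) = t 0 := by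
  simp [pole, EuclideanSpace.inner_single_left]

theorem norm_pole : ‖pole m‖ = 1 := by simp [pole]

theorem fstPart_eq (t : EuclideanSpace ℝ (Fin (m + 1))) :
    fstPart t = (inner ℝ (pole m) t : ℝ) • pole m := by
  rw [inner_pole]
  ext i
  by_cases hi : i = 0
  · subst hi; simp [fstPart, pole]
  · simp [fstPart, pole, hi]

theorem sndPart_eq (t : EuclideanSpace ℝ (Fin (m + 1))) :
    sndPart t = t - (inner ℝ (pole m) t : ℝ) • pole m := by
  rw [inner_pole]
  ext i
  by_cases hi : i = 0
  · subst hi; simp [sndPart, pole]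
  · simp [sndPart, pole, hi]

/-- The translation increases the coordinate `0`, which enters none of the tails that the cone
bounds from above. -/
theorem smallAngleCone_add {ε σ : ℝ} (hε : 0 < ε) (hσ : 0 ≤ σ) {y : EuclideanSpace ℝ (Fin (m + 1))}
    (hy : y ∈ smallAngleCone m ε) : y + σ • pole m ∈ smallAngleCone m ε := by
  have hval : ∀ k, y k ≤ (y + σ • pole m) k := fun k => by
    by_cases hk : k = 0
    · subst hk; simp [pole, hσ]
    · simp [pole, hk]
  refine ⟨fun k => (hy.1 k).trans_le (hval k), fun j => ?_⟩
  have : tailNorm (y + σ • pole m) (j + 1) = tailNorm y (j + 1) := by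
    unfold tailNorm
    congr 1
    refine Finset.sum_congr rfl fun k _ => ?_
    by_cases hk : k = 0
    · subst hk; simp
    · simp [pole, hk]
  rw [this]
  exact (hy.2 j).trans_le (mul_le_mul_of_nonneg_left (hval _) hε.le)

theorem ae_inner_pole_ne (hm : 1 ≤ m) {R : ℝ} (hR : 0 < R) (c : ℝ) :
    ∀ᵐ u ∂(cubeMeasure m), inner ℝ (pole m) (R • sphereMap u) ≠ c := by
  filter_upwards [ae_cos_angle_ne 0 ⟨0, hm⟩ (c / R)] with u hu h
  apply hu
  rw [inner_pole, PiLp.smul_apply, smul_eq_mul] at h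
  have h1 := sphereMap_castSucc u ⟨0, hm⟩
  have h2 : (Fin.castSucc ⟨0, hm⟩ : Fin (m + 1)) = 0 := rfl
  rw [h2] at h1
  rw [h1] at h
  simp [sinProd] at h
  rw [add_zero, ← h]
  field_simp

/-- The factorisation identity determines the radius and the density. -/
theorem eq_of_laplace_factorisation (hm : 1 ≤ m) {f g : (Fin m → ℝ) → ℝ} {R r : ℝ} (hR : 0 < R)
    (hr : 0 < r) (hf : Integrable f (cubeMeasure m)) (hg : Integrable g (cubeMeasure m))
    (hf1 : ∫ u, f u ∂(cubeMeasure m) = 1) (hg1 : ∫ u, g u ∂(cubeMeasure m) = 1)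
    (hg0 : ∀ᵐ u ∂(cubeMeasure m), 0 ≤ g u)
    (hgpos : 2 ≤ m → ∃ γ : ℝ, 0 < γ ∧
      ∀ᵐ u ∂(cubeMeasure m), (∀ j, u j ∈ Ioo 0 γ) → 0 < g u)
    (hID : ∀ t, laplace (cubeMeasure m) f (fun u => R • sphereMap u) t *
      laplace (cubeMeasure m) g (fun u => r • sphereMap u) (fstPart t) *
      laplace (cubeMeasure m) g (fun u => r • sphereMap u) (sndPart t) =
      laplace (cubeMeasure m) g (fun u => r • sphereMap u) t *
      laplace (cubeMeasure m) f (fun u => R • sphereMap u) (fstPart t) *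
      laplace (cubeMeasure m) f (fun u => R • sphereMap u) (sndPart t)) :
    R = r ∧ f =ᵐ[cubeMeasure m] g := by
  have S := sphereDensity hR hf
  have T := sphereDensity hr hg
  simp_rw [fstPart_eq, sndPart_eq] at hID
  suffices h : R = r ∧ ∀ t, laplace (cubeMeasure m) f (fun u => R • sphereMap u) t =
      laplace (cubeMeasure m) g (fun u => r • sphereMap u) t by
    obtain ⟨hRr, h⟩ := h
    refine ⟨hRr, ?_⟩
    subst hRr
    have h1 := T.det (fun u => f u - g u) (hf.sub hg) (fun y => by
      have h2 := h y
      rw [laplace, laplace, ← sub_eq_zero, ← integral_sub (S.integrable_mul_exp hf y)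
        (T.integrable_mul_exp hg y)] at h2
      rw [laplace, ← h2]
      refine integral_congr_ae (Eventually.of_forall fun u => ?_)
      simp only
      ring)
    filter_upwards [h1] with u hu
    exact sub_eq_zero.1 hu
  rcases hm.eq_or_lt with hm1 | hm2
  -- On the circle both axes are used, and no positivity near the pole is required.
  · subst hm1
    set e' : EuclideanSpace ℝ (Fin 2) := EuclideanSpace.single 1 1 with he'
    have hin : ∀ t : EuclideanSpace ℝ (Fin 2), (inner ℝ e' t : ℝ) = t 1 := fun t => by
      simp [he', EuclideanSpace.inner_single_left]
    have hlev : ∀ {R : ℝ}, 0 < R → ∀ c, ∀ᵐ u ∂(cubeMeasure 1),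
        inner ℝ e' (R • sphereMap u) ≠ c := by
      intro R hR c
      -- The second coordinate is `R sin θ = R cos(θ - π/2)`.
      filter_upwards [ae_cos_angle_ne (-(Real.pi / 2)) (0 : Fin 1) (c / R)] with u hu h
      apply hu
      rw [hin, PiLp.smul_apply, smul_eq_mul] at h
      have h1 := sphereMap_last u
      have h2 : (Fin.last 1 : Fin 2) = 1 := rfl
      rw [h2] at h1
      rw [h1] at h
      have h3 := sinProd_succ u 0
      simp [sinProd] at h3
      simp [sinProd, h3] at h
      rw [← sub_eq_add_neg, Real.cos_sub_pi_div_two, ← h]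
      field_simp
    refine S.eq_of_factorisation_two T hg0 hg1 hf1 hr (e := pole 1) (e' := e') (fun t => ?_)
      norm_pole (by simp [he']) (by rw [inner_pole]; simp [he']) (ae_inner_pole_ne le_rfl hR)
      (ae_inner_pole_ne le_rfl hr) (hlev hR) (hlev hr) hID
    rw [inner_pole, hin]
    ext i
    fin_cases i <;> simp [pole, he']
  -- Positivity of the density at small angles makes every direction of the small angle cone a mass
  -- point.
  · obtain ⟨γ, hγ, hpos⟩ := hgpos hm2
    have hε : 0 < min γ 1 := lt_min hγ one_pos
    refine S.eq_of_factorisation T hg0 hg1 hf1 hr norm_pole (ae_inner_pole_ne hm hR)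
      (ae_inner_pole_ne hm hr) hID (isOpen_smallAngleCone (min γ 1)) (smallAngleCone_nonempty hε)
      (fun ζ hζ σ hσ => smallAngleCone_add hε hσ hζ) (fun ζ hζ => ?_) (fun ζ hζ => ?_)
      (fun ζ hζ => ?_)
    · rw [inner_pole]
      exact (hζ.1 0).ne'
    · have h1 := isMassPoint_sphereMap (R := r) hg hg0 hpos (fun j => anglesOf_mem hζ j)
      rwa [sphereMap_anglesOf hζ.1, smul_smul, mul_one_div] at h1
    · rw [inner_pole, EuclideanSpace.norm_sq_eq, Fin.sum_univ_succ]
      simp only [Real.norm_eq_abs, sq_abs]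
      have : 0 < ∑ i : Fin m, ζ i.succ ^ 2 := by
        refine Finset.sum_pos (fun i _ => pow_pos (hζ.1 _) 2) ⟨⟨0, hm⟩, Finset.mem_univ _⟩
      linarith

end Sphere

/-! ### Continuity of the contrast -/

section Contrast

variable {m : ℕ}

instance isProbabilityMeasure_cubeMeasure : IsProbabilityMeasure (cubeMeasure m) := by
  refine ⟨?_⟩
  rw [cubeMeasure, Measure.restrict_apply_univ, Real.volume_pi_Ioo]
  simp

theorem norm_cexp_I_mul_ofReal_mul (x : ℝ) (z : ℂ) :
    ‖Complex.exp (Complex.I * (x : ℂ)) * z‖ = ‖z‖ := by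
  rw [norm_mul, mul_comm Complex.I, Complex.norm_exp_ofReal_mul_I, one_mul]

theorem continuous_Psi_kernel (R : ℝ) (t : EuclideanSpace ℝ (Fin (m + 1))) :
    Continuous fun u : Fin m → ℝ =>
      Complex.exp (Complex.I * ((R * inner ℝ t (sphereMap u) : ℝ) : ℂ)) := by
  have := continuous_sphereMap (m := m)
  fun_prop

theorem integrable_Psi {f : (Fin m → ℝ) → ℝ} (hf : Integrable f (cubeMeasure m)) (R : ℝ)
    (t : EuclideanSpace ℝ (Fin (m + 1))) :
    Integrable (fun u => Complex.exp (Complex.I * ((R * inner ℝ t (sphereMap u) : ℝ) : ℂ)) *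
      (f u : ℂ)) (cubeMeasure m) := by
  have hfc : Integrable (fun u => (f u : ℂ)) (cubeMeasure m) := hf.ofReal
  refine hfc.norm.mono' ((continuous_Psi_kernel R t).aestronglyMeasurable.mul
    hfc.aestronglyMeasurable) (Eventually.of_forall fun u => ?_)
  rw [norm_cexp_I_mul_ofReal_mul]

theorem norm_Psi_le (f : (Fin m → ℝ) → ℝ) (R : ℝ) (t : EuclideanSpace ℝ (Fin (m + 1))) :
    ‖Psi f R t‖ ≤ ∫ u, ‖f u‖ ∂(cubeMeasure m) := by
  refine (norm_integral_le_integral_norm _).trans (le_of_eq (integral_congr_ae ?_))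
  refine Eventually.of_forall fun u => ?_
  simp only [norm_cexp_I_mul_ofReal_mul, Complex.norm_real]

theorem integrable_Lp (f : Lp ℝ 2 (cubeMeasure m)) : Integrable f (cubeMeasure m) :=
  (Lp.memLp f).integrable (by norm_num)

theorem integral_norm_Lp_le (f : Lp ℝ 2 (cubeMeasure m)) :
    ∫ u, ‖f u‖ ∂(cubeMeasure m) ≤ ‖f‖ := by
  rw [integral_norm_eq_lintegral_enorm (Lp.aestronglyMeasurable f),
    ← eLpNorm_one_eq_lintegral_enorm, Lp.norm_def]
  refine ENNReal.toReal_mono (Lp.eLpNorm_ne_top f) ?_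
  exact eLpNorm_le_eLpNorm_of_exponent_le (by norm_num) (Lp.aestronglyMeasurable f)

theorem Psi_sub (f g : Lp ℝ 2 (cubeMeasure m)) (R : ℝ) (t : EuclideanSpace ℝ (Fin (m + 1))) :
    Psi f R t - Psi g R t = Psi (f - g : Lp ℝ 2 (cubeMeasure m)) R t := by
  rw [Psi, Psi, Psi, ← integral_sub (integrable_Psi (integrable_Lp f) R t)
    (integrable_Psi (integrable_Lp g) R t)]
  refine integral_congr_ae ?_
  filter_upwards [Lp.coeFn_sub f g] with u hu
  rw [hu, Pi.sub_apply, Complex.ofReal_sub, mul_sub]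

theorem continuous_Psi_param {f : (Fin m → ℝ) → ℝ} (hf : Integrable f (cubeMeasure m)) :
    Continuous fun p : ℝ × EuclideanSpace ℝ (Fin (m + 1)) => Psi f p.1 p.2 := by
  refine continuous_of_dominated (bound := fun u => ‖f u‖)
    (fun p => (integrable_Psi hf p.1 p.2).aestronglyMeasurable)
    (fun p => Eventually.of_forall fun u => ?_) hf.norm (Eventually.of_forall fun u => ?_)
  · rw [norm_cexp_I_mul_ofReal_mul, Complex.norm_real]
  · fun_prop

theorem norm_Psi_sub_le (f g : Lp ℝ 2 (cubeMeasure m)) (R : ℝ)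
    (t : EuclideanSpace ℝ (Fin (m + 1))) : ‖Psi f R t - Psi g R t‖ ≤ ‖f - g‖ := by
  rw [Psi_sub]
  exact (norm_Psi_le _ _ _).trans (integral_norm_Lp_le _)

/-- `Psi` is 1-Lipschitz in `f`, uniformly in the other arguments, and for fixed `f` it is
continuous in them by dominated convergence. -/
theorem continuous_Psi : Continuous fun p : (Lp ℝ 2 (cubeMeasure m) × ℝ) ×
    EuclideanSpace ℝ (Fin (m + 1)) => Psi p.1.1 p.1.2 p.2 := by
  refine continuous_iff_continuousAt.2 ?_
  rintro ⟨⟨f, R⟩, t⟩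
  have h0 : Tendsto (fun q : (Lp ℝ 2 (cubeMeasure m) × ℝ) × EuclideanSpace ℝ (Fin (m + 1)) =>
      ‖q.1.1 - f‖) (𝓝 ((f, R), t)) (𝓝 0) :=
    tendsto_iff_norm_sub_tendsto_zero.1
      ((continuous_fst.comp continuous_fst).tendsto ((f, R), t))
  have h1 : Tendsto (fun q : (Lp ℝ 2 (cubeMeasure m) × ℝ) × EuclideanSpace ℝ (Fin (m + 1)) =>
      Psi q.1.1 q.1.2 q.2 - Psi f q.1.2 q.2) (𝓝 ((f, R), t)) (𝓝 0) :=
    squeeze_zero_norm (fun q => norm_Psi_sub_le q.1.1 f q.1.2 q.2) h0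
  have hr : Tendsto (fun q : (Lp ℝ 2 (cubeMeasure m) × ℝ) × EuclideanSpace ℝ (Fin (m + 1)) =>
      (q.1.2, q.2)) (𝓝 ((f, R), t)) (𝓝 (R, t)) :=
    ((continuous_snd.comp continuous_fst).prodMk continuous_snd).tendsto ((f, R), t)
  have h2 := ((continuous_Psi_param (integrable_Lp f)).tendsto (R, t)).comp hr
  have h3 := h1.add h2
  rw [zero_add] at h3
  refine h3.congr fun q => ?_
  simp only [Function.comp_apply, sub_add_cancel]

theorem continuous_fstPart : Continuous (fstPart (m := m)) := by
  have : fstPart (m := m) = fun t => (inner ℝ (pole m) t : ℝ) • pole m := funext fstPart_eq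
  rw [this]
  fun_prop

theorem continuous_sndPart : Continuous (sndPart (m := m)) := by
  have : sndPart (m := m) = fun t => t - (inner ℝ (pole m) t : ℝ) • pole m := funext sndPart_eq
  rw [this]
  fun_prop

/-- The cube over which the contrast is integrated. -/
def box (m : ℕ) (ν : ℝ) : Set (EuclideanSpace ℝ (Fin (m + 1))) := {t | ∀ i, t i ∈ Icc (-ν) ν}

theorem isCompact_box (ν : ℝ) : IsCompact (box m ν) := by
  have h : IsCompact (Set.univ.pi fun _ : Fin (m + 1) => Icc (-ν) ν) :=
    isCompact_univ_pi fun _ => isCompact_Icc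
  convert h.image (PiLp.continuous_toLp 2 fun _ : Fin (m + 1) => ℝ) using 1
  ext t
  constructor
  · intro ht
    exact ⟨WithLp.ofLp t, fun i _ => ht i, rfl⟩
  · rintro ⟨x, hx, rfl⟩ i
    exact hx i trivial

theorem fstPart_mem_box {ν : ℝ} (hν : 0 < ν) {t : EuclideanSpace ℝ (Fin (m + 1))}
    (ht : t ∈ box m ν) : fstPart t ∈ box m ν := by
  intro i
  by_cases hi : i = 0
  · simpa [fstPart, hi] using ht 0
  · simp [fstPart, hi, hν.le]

theorem sndPart_mem_box {ν : ℝ} (hν : 0 < ν) {t : EuclideanSpace ℝ (Fin (m + 1))}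
    (ht : t ∈ box m ν) : sndPart t ∈ box m ν := by
  intro i
  by_cases hi : i = 0
  · simp [sndPart, hi, hν.le]
  · simpa [sndPart, hi] using ht i

/-- The function whose squared modulus is integrated in the contrast, for a general function
`φ` in place of the empirical characteristic function. -/
noncomputable def discrepancy (φ : EuclideanSpace ℝ (Fin (m + 1)) → ℂ) (f : (Fin m → ℝ) → ℝ)
    (R : ℝ) (t : EuclideanSpace ℝ (Fin (m + 1))) : ℂ :=
  Psi f R t * φ (fstPart t) * φ (sndPart t) - φ t * Psi f R (fstPart t) * Psi f R (sndPart t)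

/-- The contrast attached to a general function `φ`. -/
noncomputable def contrastOf (ν : ℝ) (φ : EuclideanSpace ℝ (Fin (m + 1)) → ℂ)
    (f : (Fin m → ℝ) → ℝ) (R : ℝ) : ℝ :=
  ∫ t in box m ν, ‖discrepancy φ f R t‖ ^ 2

theorem contrast_eq (ν : ℝ) (n : ℕ) (y : ℕ → EuclideanSpace ℝ (Fin (m + 1)))
    (f : (Fin m → ℝ) → ℝ) (R : ℝ) : contrast ν n y f R = contrastOf ν (empCF n y) f R := rfl

theorem continuous_discrepancy {φ : EuclideanSpace ℝ (Fin (m + 1)) → ℂ} (hφ : Continuous φ) :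
    Continuous fun p : (Lp ℝ 2 (cubeMeasure m) × ℝ) × EuclideanSpace ℝ (Fin (m + 1)) =>
      discrepancy φ p.1.1 p.1.2 p.2 := by
  have h1 := continuous_Psi (m := m)
  have hf := continuous_fstPart (m := m)
  have hs := continuous_sndPart (m := m)
  have h2 : Continuous fun p : (Lp ℝ 2 (cubeMeasure m) × ℝ) × EuclideanSpace ℝ (Fin (m + 1)) =>
      Psi p.1.1 p.1.2 (fstPart p.2) :=
    h1.comp (by fun_prop : Continuous fun p : (Lp ℝ 2 (cubeMeasure m) × ℝ) ×
      EuclideanSpace ℝ (Fin (m + 1)) => (p.1, fstPart p.2))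
  have h3 : Continuous fun p : (Lp ℝ 2 (cubeMeasure m) × ℝ) × EuclideanSpace ℝ (Fin (m + 1)) =>
      Psi p.1.1 p.1.2 (sndPart p.2) :=
    h1.comp (by fun_prop : Continuous fun p : (Lp ℝ 2 (cubeMeasure m) × ℝ) ×
      EuclideanSpace ℝ (Fin (m + 1)) => (p.1, sndPart p.2))
  unfold discrepancy
  fun_prop

theorem continuousOn_contrastOf (ν : ℝ) {φ : EuclideanSpace ℝ (Fin (m + 1)) → ℂ}
    (hφ : Continuous φ) {K : Set (Lp ℝ 2 (cubeMeasure m) × ℝ)} (hK : IsCompact K) :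
    ContinuousOn (fun θ : Lp ℝ 2 (cubeMeasure m) × ℝ => contrastOf ν φ θ.1 θ.2) K := by
  rw [continuousOn_iff_continuous_domRestrict]
  have : CompactSpace K := isCompact_iff_compactSpace.1 hK
  refine continuous_parametric_integral_of_continuous (X := K)
    (f := fun θ t => ‖discrepancy φ θ.1.1 θ.1.2 t‖ ^ 2) ?_ (isCompact_box ν)
  exact ((continuous_discrepancy hφ).comp (by fun_prop : Continuous fun p : K ×
    EuclideanSpace ℝ (Fin (m + 1)) => (p.1.1, p.2))).norm.pow 2

theorem norm_discrepancy_le {φ : EuclideanSpace ℝ (Fin (m + 1)) → ℂ} (h1 : ∀ t, ‖φ t‖ ≤ 1)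
    {f : (Fin m → ℝ) → ℝ} {R B : ℝ} (hB : ∀ t, ‖Psi f R t‖ ≤ B)
    (t : EuclideanSpace ℝ (Fin (m + 1))) : ‖discrepancy φ f R t‖ ≤ B + B ^ 2 := by
  have hB0 : 0 ≤ B := (norm_nonneg _).trans (hB 0)
  refine (norm_sub_le _ _).trans ?_
  simp only [norm_mul]
  calc _ ≤ B * 1 * 1 + 1 * B * B := by
        gcongr <;> first | exact hB _ | exact h1 _
    _ = B + B ^ 2 := by ring

theorem norm_discrepancy_sub_le {φ ψ : EuclideanSpace ℝ (Fin (m + 1)) → ℂ}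
    (h1 : ∀ t, ‖φ t‖ ≤ 1) (h2 : ∀ t, ‖ψ t‖ ≤ 1) {ν δ : ℝ} (hν : 0 < ν)
    (hd : ∀ t ∈ box m ν, ‖φ t - ψ t‖ ≤ δ) {f : (Fin m → ℝ) → ℝ} {R B : ℝ}
    (hB : ∀ t, ‖Psi f R t‖ ≤ B) {t : EuclideanSpace ℝ (Fin (m + 1))} (ht : t ∈ box m ν) :
    ‖discrepancy φ f R t - discrepancy ψ f R t‖ ≤ (2 * B + B ^ 2) * δ := by
  have hB0 : 0 ≤ B := (norm_nonneg _).trans (hB 0)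
  have hδ0 : 0 ≤ δ := (norm_nonneg _).trans (hd t ht)
  have e : discrepancy φ f R t - discrepancy ψ f R t =
      Psi f R t * (φ (fstPart t) - ψ (fstPart t)) * φ (sndPart t)
      + Psi f R t * ψ (fstPart t) * (φ (sndPart t) - ψ (sndPart t))
      - (φ t - ψ t) * Psi f R (fstPart t) * Psi f R (sndPart t) := by
    unfold discrepancy
    ring
  rw [e]
  refine (norm_sub_le _ _).trans ((add_le_add_left (norm_add_le _ _) _).trans ?_)
  simp only [norm_mul]
  have hd1 := hd _ (fstPart_mem_box hν ht)
  have hd2 := hd _ (sndPart_mem_box hν ht)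
  calc _ ≤ B * δ * 1 + B * 1 * δ + δ * B * B := by
        gcongr <;> first | exact hB _ | exact h1 _ | exact h2 _ | exact hd _ ht
    _ = (2 * B + B ^ 2) * δ := by ring

/-- A difference of squares of bounded functions. The constant depends on `f` only through a bound
on its norm and not on `R`, hence is uniform over the parameter set. -/
theorem abs_contrastOf_sub_le {φ ψ : EuclideanSpace ℝ (Fin (m + 1)) → ℂ}
    (hφ : Continuous φ) (hψ : Continuous ψ)
    (h1 : ∀ t, ‖φ t‖ ≤ 1) (h2 : ∀ t, ‖ψ t‖ ≤ 1) {ν δ : ℝ} (hν : 0 < ν)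
    (hd : ∀ t ∈ box m ν, ‖φ t - ψ t‖ ≤ δ) {f : Lp ℝ 2 (cubeMeasure m)} {R B : ℝ}
    (hB : ‖f‖ ≤ B) :
    |contrastOf ν φ f R - contrastOf ν ψ f R| ≤
      2 * (B + B ^ 2) * (2 * B + B ^ 2) * volume.real (box m ν) * δ := by
  have hB' : ∀ t, ‖Psi f R t‖ ≤ B := fun t =>
    ((norm_Psi_le _ _ _).trans (integral_norm_Lp_le f)).trans hB
  have hcont : ∀ {χ : EuclideanSpace ℝ (Fin (m + 1)) → ℂ}, Continuous χ →
      IntegrableOn (fun t => ‖discrepancy χ f R t‖ ^ 2) (box m ν) := fun {χ} hχ =>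
    (((continuous_discrepancy hχ).comp (by fun_prop : Continuous fun t :
      EuclideanSpace ℝ (Fin (m + 1)) => ((f, R), t))).norm.pow 2).continuousOn.integrableOn_compact
      (isCompact_box ν)
  rw [contrastOf, contrastOf, ← integral_sub (hcont hφ) (hcont hψ), ← Real.norm_eq_abs]
  refine (norm_setIntegral_le_of_norm_le_const
    (C := 2 * (B + B ^ 2) * ((2 * B + B ^ 2) * δ)) (isCompact_box ν).measure_lt_top
    fun t ht => ?_).trans (le_of_eq (by ring))
  have a1 := norm_discrepancy_le h1 hB' t
  have a2 := norm_discrepancy_le h2 hB' t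
  have a3 := norm_discrepancy_sub_le h1 h2 hν hd hB' ht
  rw [Real.norm_eq_abs, sq_sub_sq, abs_mul, abs_of_nonneg (by positivity)]
  refine mul_le_mul (by linarith) ((abs_norm_sub_norm_le _ _).trans a3) (abs_nonneg _) ?_
  linarith [norm_nonneg (discrepancy φ f R t)]

end Contrast

/-! ### Uniform law of large numbers -/

section EmpiricalCharFun

/-- The law of large numbers, uniform over a compact set of arguments, for empirical
characteristic functions. -/
theorem tendstoUniformlyOn_empirical_charFun {W Ω : Type*} [NormedAddCommGroup W]
    [InnerProductSpace ℝ W] [FiniteDimensional ℝ W] [MeasurableSpace W] [BorelSpace W]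
    [MeasurableSpace Ω] {P : Measure Ω} [IsProbabilityMeasure P] {Y : ℕ → Ω → W}
    (hY : ∀ i, Measurable (Y i)) (hind : iIndepFun Y P) {ρ : Measure W}
    (hlaw : ∀ i, P.map (Y i) = ρ) {K : Set W} (hK : IsCompact K) :
    ∀ᵐ ω ∂P, TendstoUniformlyOn (fun (n : ℕ) t => (1 / (n : ℂ)) * ∑ l ∈ Finset.range n,
      Complex.exp (Complex.I * ((inner ℝ t (Y l ω) : ℝ) : ℂ))) (charFun ρ) atTop K := by
  have : CompactSpace K := isCompact_iff_compactSpace.1 hK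
  borelize C(K, ℂ)
  -- The exponentials `t ↦ exp(i ⟨t, y⟩)` are viewed as bounded random elements of the Banach space
  -- `C(K, ℂ)`; the strong law there is the uniform statement.
  let e : W → C(K, ℂ) := fun y =>
    ⟨fun t => Complex.exp (Complex.I * ((inner ℝ (t : W) y : ℝ) : ℂ)), by fun_prop⟩
  have he : Continuous e := by
    refine ContinuousMap.continuous_of_continuous_uncurry _ ?_
    show Continuous fun p : W × K => Complex.exp (Complex.I * ((inner ℝ (p.2 : W) p.1 : ℝ) : ℂ))
    fun_prop
  have heb : ∀ y, ‖e y‖ ≤ 1 := fun y => by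
    refine (ContinuousMap.norm_le _ zero_le_one).2 fun t => le_of_eq ?_
    show ‖Complex.exp (Complex.I * ((inner ℝ (t : W) y : ℝ) : ℂ))‖ = 1
    rw [mul_comm, Complex.norm_exp_ofReal_mul_I]
  have hint : Integrable (fun ω => e (Y 0 ω)) P :=
    Integrable.of_bound (he.comp_aestronglyMeasurable (hY 0).aestronglyMeasurable) 1
      (Eventually.of_forall fun ω => heb _)
  have hslln := strong_law_ae (fun i ω => e (Y i ω)) hint
    (fun i j hij => (hind.indepFun hij).comp he.measurable he.measurable)
    (fun i => (⟨(hY i).aemeasurable, (hY 0).aemeasurable, by rw [hlaw, hlaw]⟩ :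
      IdentDistrib (Y i) (Y 0) P P).comp he.measurable)
  have hmean : ∀ t : K, (∫ ω, e (Y 0 ω) ∂P) t = charFun ρ (t : W) := fun t => by
    have h := (ContinuousMap.evalCLM ℂ t).integral_comp_comm hint
    rw [charFun_apply, ← hlaw 0, integral_map (hY 0).aemeasurable
      (Continuous.aestronglyMeasurable (by fun_prop))]
    refine h.symm.trans (integral_congr_ae (Eventually.of_forall fun ω => ?_))
    show Complex.exp (Complex.I * ((inner ℝ (t : W) (Y 0 ω) : ℝ) : ℂ)) = _
    rw [real_inner_comm, mul_comm]
  filter_upwards [hslln] with ω hω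
  rw [ContinuousMap.tendsto_iff_tendstoUniformly, Metric.tendstoUniformly_iff] at hω
  rw [Metric.tendstoUniformlyOn_iff]
  intro ε hε
  filter_upwards [hω ε hε] with n hn t ht
  have h := hn ⟨t, ht⟩
  rw [hmean, ContinuousMap.smul_apply, ContinuousMap.sum_apply] at h
  convert h using 2
  rw [Complex.real_smul, one_div, Complex.ofReal_inv, Complex.ofReal_natCast]
  rfl

end EmpiricalCharFun

/-! ### Compactness argument for minimisers -/

section Argmin

/-- A sequence in a compact set along which a continuous function tends to its value at
the only zero converges to this zero. -/
theorem tendsto_of_tendsto_zero_of_unique_zero {X : Type*} [TopologicalSpace X] {K : Set X}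
    (hK : IsCompact K) {M : X → ℝ} (hM : ContinuousOn M K) {θ₀ : X}
    (huniq : ∀ θ ∈ K, M θ = 0 → θ = θ₀) {θ : ℕ → X} (hθ : ∀ᶠ n in atTop, θ n ∈ K)
    (hlim : Tendsto (fun n => M (θ n)) atTop (𝓝 0)) : Tendsto θ atTop (𝓝 θ₀) := by
  rw [tendsto_nhds]
  intro O hO h0
  have hc : IsCompact (K \ O) := hK.diff hO
  -- Otherwise the sequence is frequently in the compact set `K \ O` and has a cluster point there,
  -- at which `M` must vanish.
  by_contra hcon
  have hfr : ∃ᶠ n in atTop, θ n ∈ K \ O :=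
    ((not_eventually.1 hcon).and_eventually hθ).mono fun n h => ⟨h.2, h.1⟩
  obtain ⟨x, hx, hxc⟩ := hc.exists_mapClusterPt_of_frequently hfr
  have hle : map θ atTop ≤ 𝓟 K := le_principal_iff.2 hθ
  have hMx : MapClusterPt (M x) atTop (M ∘ θ) :=
    hxc.tendsto_comp' ((hM x hx.1).mono_left (inf_le_inf_left _ hle))
  have : M x = 0 := by
    have hne : (𝓝 (M x) ⊓ map (M ∘ θ) atTop).NeBot := hMx
    have := hne.mono (inf_le_inf_left _ hlim)
    exact eq_of_nhds_neBot this
  exact hx.2 (huniq x hx.1 this ▸ h0)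

end Argmin

/-! ### Characteristic functions of the model -/

section CharFun

variable {m : ℕ}

theorem fstPart_add_sndPart (t : EuclideanSpace ℝ (Fin (m + 1))) :
    fstPart t + sndPart t = t := by
  rw [fstPart_eq, sndPart_eq, add_sub_cancel]

theorem fstPart_smul (x : ℝ) (t : EuclideanSpace ℝ (Fin (m + 1))) :
    fstPart (x • t) = x • fstPart t := by
  rw [fstPart_eq, fstPart_eq, inner_smul_right, smul_smul]

theorem sndPart_smul (x : ℝ) (t : EuclideanSpace ℝ (Fin (m + 1))) :
    sndPart (x • t) = x • sndPart t := by
  rw [sndPart_eq, sndPart_eq, inner_smul_right, smul_sub, smul_smul]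

theorem measurable_signal (C : EuclideanSpace ℝ (Fin (m + 1))) (R : ℝ) :
    Measurable fun u : Fin m → ℝ => C + R • sphereMap u :=
  ((continuous_sphereMap.const_smul R).const_add C).measurable

theorem isProbabilityMeasure_signalLaw (C : EuclideanSpace ℝ (Fin (m + 1))) (R : ℝ)
    {f : (Fin m → ℝ) → ℝ} (hf : Integrable f (cubeMeasure m))
    (h0 : ∀ᵐ u ∂cubeMeasure m, 0 ≤ f u) (h1 : ∫ u, f u ∂cubeMeasure m = 1) :
    IsProbabilityMeasure (signalLaw C R f) := by
  have : IsProbabilityMeasure ((cubeMeasure m).withDensity fun u => ENNReal.ofReal (f u)) := by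
    refine ⟨?_⟩
    rw [withDensity_apply _ MeasurableSet.univ, Measure.restrict_univ,
      ← ofReal_integral_eq_lintegral_ofReal hf h0, h1, ENNReal.ofReal_one]
  exact Measure.isProbabilityMeasure_map (measurable_signal C R).aemeasurable

theorem isProbabilityMeasure_noiseLaw (Q : Fin (m + 1) → Measure ℝ)
    [∀ j, IsProbabilityMeasure (Q j)] : IsProbabilityMeasure (noiseLaw Q) :=
  Measure.isProbabilityMeasure_map (WithLp.measurable_toLp 2 _).aemeasurable

theorem integral_signalLaw {E : Type*} [NormedAddCommGroup E] [NormedSpace ℝ E]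
    (C : EuclideanSpace ℝ (Fin (m + 1))) (R : ℝ)
    {f : (Fin m → ℝ) → ℝ} (hf : Integrable f (cubeMeasure m))
    (h0 : ∀ᵐ u ∂cubeMeasure m, 0 ≤ f u) {g : EuclideanSpace ℝ (Fin (m + 1)) → E}
    (hg : StronglyMeasurable g) :
    ∫ x, g x ∂signalLaw C R f = ∫ u, f u • g (C + R • sphereMap u) ∂cubeMeasure m := by
  rw [signalLaw, integral_map (measurable_signal C R).aemeasurable hg.aestronglyMeasurable,
    integral_withDensity_eq_integral_toReal_smul₀ hf.aemeasurable.ennreal_ofReal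
      (Eventually.of_forall fun _ => ENNReal.ofReal_lt_top)]
  refine integral_congr_ae ?_
  filter_upwards [h0] with u hu
  rw [ENNReal.toReal_ofReal hu]

theorem charFun_signalLaw (C : EuclideanSpace ℝ (Fin (m + 1))) (R : ℝ)
    {f : (Fin m → ℝ) → ℝ} (hf : Integrable f (cubeMeasure m))
    (h0 : ∀ᵐ u ∂cubeMeasure m, 0 ≤ f u) (t : EuclideanSpace ℝ (Fin (m + 1))) :
    charFun (signalLaw C R f) t = Complex.exp (Complex.I * ((inner ℝ t C : ℝ) : ℂ)) * Psi f R t := by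
  rw [charFun_apply, integral_signalLaw C R hf h0
    (Continuous.stronglyMeasurable (by fun_prop)), Psi, ← integral_const_mul]
  refine integral_congr_ae (Eventually.of_forall fun u => ?_)
  simp only [Complex.real_smul]
  rw [← mul_assoc, ← Complex.exp_add, mul_comm, real_inner_comm, inner_add_right,
    inner_smul_right]
  congr 2
  push_cast
  ring

/-- The characteristic function of the noise, shifted by the center. -/
noncomputable def noiseFactor (C : EuclideanSpace ℝ (Fin (m + 1))) (Q : Fin (m + 1) → Measure ℝ)
    (t : EuclideanSpace ℝ (Fin (m + 1))) : ℂ :=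
  Complex.exp (Complex.I * ((inner ℝ t C : ℝ) : ℂ)) * charFun (noiseLaw Q) t

theorem charFun_observationLaw (C : EuclideanSpace ℝ (Fin (m + 1))) (R : ℝ)
    {f : (Fin m → ℝ) → ℝ} (hf : Integrable f (cubeMeasure m))
    (h0 : ∀ᵐ u ∂cubeMeasure m, 0 ≤ f u) (h1 : ∫ u, f u ∂cubeMeasure m = 1)
    (Q : Fin (m + 1) → Measure ℝ) [∀ j, IsProbabilityMeasure (Q j)]
    (t : EuclideanSpace ℝ (Fin (m + 1))) :
    charFun (observationLaw C R f Q) t = noiseFactor C Q t * Psi f R t := by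
  have := isProbabilityMeasure_signalLaw C R hf h0 h1
  have := isProbabilityMeasure_noiseLaw Q
  rw [observationLaw, charFun_conv, charFun_signalLaw C R hf h0, noiseFactor]
  ring

variable (C : EuclideanSpace ℝ (Fin (m + 1))) (Q : Fin (m + 1) → Measure ℝ)
  [∀ j, IsProbabilityMeasure (Q j)]

theorem noiseFactor_zero : noiseFactor C Q 0 = 1 := by
  have := isProbabilityMeasure_noiseLaw Q
  simp [noiseFactor]

theorem continuous_noiseFactor : Continuous (noiseFactor C Q) := by
  have := isProbabilityMeasure_noiseLaw Q
  have h := continuous_charFun (μ := noiseLaw Q)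
  unfold noiseFactor
  fun_prop

/-- This is what independence of the noise coordinates gives: the characteristic function is a
product over coordinates, each of which belongs to one of the two parts. -/
theorem noiseFactor_eq_mul (t : EuclideanSpace ℝ (Fin (m + 1))) :
    noiseFactor C Q t = noiseFactor C Q (fstPart t) * noiseFactor C Q (sndPart t) := by
  have h : charFun (noiseLaw Q) t =
      charFun (noiseLaw Q) (fstPart t) * charFun (noiseLaw Q) (sndPart t) := by
    rw [noiseLaw, charFun_pi, charFun_pi, charFun_pi, ← Finset.prod_mul_distrib]
    refine Finset.prod_congr rfl fun i _ => ?_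
    by_cases hi : i = 0
    · simp [fstPart, sndPart, hi]
    · simp [fstPart, sndPart, hi]
  rw [noiseFactor, noiseFactor, noiseFactor, h]
  conv_lhs => rw [← fstPart_add_sndPart t, inner_add_left, Complex.ofReal_add, mul_add,
    Complex.exp_add, fstPart_add_sndPart]
  ring

/-- Both terms of the discrepancy carry the noise once at `(t₁, 0)` and once at `(0, t₂)`, so the
unknown noise is a common factor. -/
theorem discrepancy_observationLaw (R : ℝ)
    {f : (Fin m → ℝ) → ℝ} (hf : Integrable f (cubeMeasure m))
    (h0 : ∀ᵐ u ∂cubeMeasure m, 0 ≤ f u) (h1 : ∫ u, f u ∂cubeMeasure m = 1)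
    (g : (Fin m → ℝ) → ℝ) (r : ℝ) (t : EuclideanSpace ℝ (Fin (m + 1))) :
    discrepancy (charFun (observationLaw C R f Q)) g r t =
      noiseFactor C Q t * discrepancy (Psi f R) g r t := by
  unfold discrepancy
  simp only [charFun_observationLaw C R hf h0 h1 Q]
  rw [noiseFactor_eq_mul C Q t]
  ring

end CharFun

/-! ### From Fourier to Laplace transforms -/

section Laplace

variable {m : ℕ}

theorem Psi_smul_eq_laplaceC (f : (Fin m → ℝ) → ℝ) (R x : ℝ)
    (t : EuclideanSpace ℝ (Fin (m + 1))) :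
    Psi f R (x • t) = laplaceC (cubeMeasure m) (fun u => (f u : ℂ))
      (fun u => ((inner ℝ t (R • sphereMap u) : ℝ) : ℂ)) (x * Complex.I) := by
  refine integral_congr_ae (Eventually.of_forall fun u => ?_)
  simp only [real_inner_smul_left, inner_smul_right]
  rw [mul_comm]
  congr 2
  push_cast
  ring

theorem laplace_eq_laplaceC (f : (Fin m → ℝ) → ℝ) (R : ℝ)
    (t : EuclideanSpace ℝ (Fin (m + 1))) :
    ((laplace (cubeMeasure m) f (fun u => R • sphereMap u) t : ℝ) : ℂ) =
      laplaceC (cubeMeasure m) (fun u => (f u : ℂ))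
        (fun u => ((inner ℝ t (R • sphereMap u) : ℝ) : ℂ)) 1 := by
  rw [laplace, ← integral_complex_ofReal]
  refine integral_congr_ae (Eventually.of_forall fun u => ?_)
  simp

theorem differentiable_laplaceC_sphere {f : (Fin m → ℝ) → ℝ} (hf : Integrable f (cubeMeasure m))
    (R : ℝ) (t : EuclideanSpace ℝ (Fin (m + 1))) :
    Differentiable ℂ (laplaceC (cubeMeasure m) (fun u => (f u : ℂ))
      (fun u => ((inner ℝ t (R • sphereMap u) : ℝ) : ℂ))) := by
  have hc := continuous_sphereMap (m := m)
  refine differentiable_laplaceC (B := ‖t‖ * |R|) hf.ofReal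
    (Continuous.aestronglyMeasurable (by fun_prop)) fun u => ?_
  rw [Complex.norm_real]
  refine (norm_inner_le_norm _ _).trans (le_of_eq ?_)
  rw [norm_smul, norm_sphereMap, mul_one, Real.norm_eq_abs]

/-- If the discrepancy of two Fourier transforms vanishes near `0`, then the corresponding
relation holds for the Laplace transforms. -/
theorem laplace_factorisation_of_discrepancy {f g : (Fin m → ℝ) → ℝ} {R r : ℝ}
    (hf : Integrable f (cubeMeasure m)) (hg : Integrable g (cubeMeasure m))
    (h : ∀ᶠ t in 𝓝 0, discrepancy (Psi g r) f R t = 0) (t : EuclideanSpace ℝ (Fin (m + 1))) :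
    laplace (cubeMeasure m) f (fun u => R • sphereMap u) t
        * laplace (cubeMeasure m) g (fun u => r • sphereMap u) (fstPart t)
        * laplace (cubeMeasure m) g (fun u => r • sphereMap u) (sndPart t)
      = laplace (cubeMeasure m) g (fun u => r • sphereMap u) t
        * laplace (cubeMeasure m) f (fun u => R • sphereMap u) (fstPart t)
        * laplace (cubeMeasure m) f (fun u => R • sphereMap u) (sndPart t) := by
  let L (f : (Fin m → ℝ) → ℝ) (R : ℝ) (t : EuclideanSpace ℝ (Fin (m + 1))) : ℂ → ℂ :=
    laplaceC (cubeMeasure m) (fun u => (f u : ℂ))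
      (fun u => ((inner ℝ t (R • sphereMap u) : ℝ) : ℂ))
  have hF : ∀ s, Differentiable ℂ (L f R s) := differentiable_laplaceC_sphere hf R
  have hG : ∀ s, Differentiable ℂ (L g r s) := differentiable_laplaceC_sphere hg r
  -- The relation at `z t` is entire in `z` and holds for small real `z`; at `z = -I` it is the one
  -- for Laplace transforms.
  have hD : Differentiable ℂ fun z => L f R t (z * Complex.I) * L g r (fstPart t) (z * Complex.I)
      * L g r (sndPart t) (z * Complex.I) - L g r t (z * Complex.I)
      * L f R (fstPart t) (z * Complex.I) * L f R (sndPart t) (z * Complex.I) := by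
    have hi : Differentiable ℂ fun z : ℂ => z * Complex.I := by fun_prop
    exact ((((hF t).comp hi).mul ((hG _).comp hi)).mul ((hG _).comp hi)).sub
      ((((hG t).comp hi).mul ((hF _).comp hi)).mul ((hF _).comp hi))
  have hx : Tendsto (fun x : ℝ => x • t) (𝓝 0) (𝓝 0) := by
    have : Continuous fun x : ℝ => x • t := by fun_prop
    simpa using this.tendsto 0
  have h0 := eq_zero_of_entire_of_eventually_real hD ((hx.eventually h).mono fun x hx => by
    rw [discrepancy, fstPart_smul, sndPart_smul] at hx
    simp only [Psi_smul_eq_laplaceC] at hx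
    exact hx) (-Complex.I)
  have e : -Complex.I * Complex.I = 1 := by simp
  simp only [e] at h0
  have := sub_eq_zero.1 h0
  simp only [L, ← laplace_eq_laplaceC] at this
  exact_mod_cast this

end Laplace

/-! ### The zero set of the population contrast -/

section Identifiability

variable {m : ℕ}

theorem continuous_discrepancy_right {φ : EuclideanSpace ℝ (Fin (m + 1)) → ℂ} (hφ : Continuous φ)
    (f : Lp ℝ 2 (cubeMeasure m)) (R : ℝ) : Continuous (discrepancy φ f R) := by
  have hp : Continuous fun t : EuclideanSpace ℝ (Fin (m + 1)) => ((f, R), t) := by fun_prop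
  have := (continuous_discrepancy hφ).comp hp
  simpa only [Function.comp_def] using this

theorem isOpen_openBox (ν : ℝ) :
    IsOpen {t : EuclideanSpace ℝ (Fin (m + 1)) | ∀ i, t i ∈ Ioo (-ν) ν} := by
  have : {t : EuclideanSpace ℝ (Fin (m + 1)) | ∀ i, t i ∈ Ioo (-ν) ν} =
      ⋂ i, (fun t : EuclideanSpace ℝ (Fin (m + 1)) => t i) ⁻¹' Ioo (-ν) ν := by
    ext t; simp
  rw [this]
  exact isOpen_iInter_of_finite fun i => isOpen_Ioo.preimage (by fun_prop)

theorem eqOn_zero_of_integral_box_sq_eq_zero {ν : ℝ} {D : EuclideanSpace ℝ (Fin (m + 1)) → ℂ}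
    (hD : Continuous D) (h : ∫ t in box m ν, ‖D t‖ ^ 2 = 0)
    {t : EuclideanSpace ℝ (Fin (m + 1))} (ht : ∀ i, t i ∈ Ioo (-ν) ν) : D t = 0 := by
  have hOb : {t : EuclideanSpace ℝ (Fin (m + 1)) | ∀ i, t i ∈ Ioo (-ν) ν} ⊆ box m ν :=
    fun t ht i => Ioo_subset_Icc_self (ht i)
  have hi : IntegrableOn (fun t => ‖D t‖ ^ 2) (box m ν) :=
    (hD.norm.pow 2).continuousOn.integrableOn_compact (isCompact_box ν)
  have h := (integral_eq_zero_iff_of_nonneg (fun t => by positivity) hi).1 h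
  have hzero : EqOn (fun t => ‖D t‖ ^ 2) (fun _ => 0) _ :=
    Measure.eqOn_open_of_ae_eq (ae_restrict_of_ae_restrict_of_subset hOb h) (isOpen_openBox ν)
      (hD.norm.pow 2).continuousOn continuousOn_const
  simpa using hzero ht

/-- The population contrast vanishes only at the true parameters. -/
theorem eq_of_contrastOf_eq_zero (hm : 1 ≤ m) {ν : ℝ} (hν : 0 < ν)
    {f g : Lp ℝ 2 (cubeMeasure m)} {R r : ℝ} (hR : 0 < R) (hr : 0 < r)
    (hf1 : ∫ u, f u ∂cubeMeasure m = 1) (hg1 : ∫ u, g u ∂cubeMeasure m = 1)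
    (hg0 : ∀ᵐ u ∂cubeMeasure m, 0 ≤ g u)
    (hgpos : 2 ≤ m → ∃ γ : ℝ, 0 < γ ∧ ∀ᵐ u ∂(cubeMeasure m), (∀ j, u j ∈ Ioo 0 γ) → 0 < g u)
    (C : EuclideanSpace ℝ (Fin (m + 1))) (Q : Fin (m + 1) → Measure ℝ)
    [∀ j, IsProbabilityMeasure (Q j)]
    (h : contrastOf ν (charFun (observationLaw C r g Q)) f R = 0) : R = r ∧ f = g := by
  have hgi := integrable_Lp g
  have hlaw := charFun_observationLaw C r hgi hg0 hg1 Q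
  have hsig := isProbabilityMeasure_signalLaw C r hgi hg0 hg1
  have hnoi := isProbabilityMeasure_noiseLaw Q
  have hobs : IsProbabilityMeasure (observationLaw C r g Q) := by
    unfold observationLaw; infer_instance
  have hDc := continuous_discrepancy_right (φ := charFun (observationLaw C r g Q))
    continuous_charFun f R
  have h0O : (0 : EuclideanSpace ℝ (Fin (m + 1))) ∈
      {t : EuclideanSpace ℝ (Fin (m + 1)) | ∀ i, t i ∈ Ioo (-ν) ν} := fun i => by simp [hν]
  -- The characteristic function of the noise may have zeros, but not near `0`, and a neighbourhood
  -- of `0` is enough.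
  have hN : ∀ᶠ t in 𝓝 0, noiseFactor C Q t ≠ 0 :=
    (continuous_noiseFactor C Q).continuousAt.eventually_ne (by simp [noiseFactor_zero])
  have hev : ∀ᶠ t in 𝓝 0, discrepancy (Psi g r) f R t = 0 := by
    filter_upwards [hN, (isOpen_openBox ν).mem_nhds h0O] with t ht htO
    have := eqOn_zero_of_integral_box_sq_eq_zero hDc h htO
    rw [discrepancy_observationLaw C Q r hgi hg0 hg1] at this
    exact (mul_eq_zero.1 this).resolve_left ht
  have hfin := eq_of_laplace_factorisation hm hR hr (integrable_Lp f) hgi hf1 hg1 hg0 hgpos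
    (laplace_factorisation_of_discrepancy (integrable_Lp f) hgi hev)
  exact ⟨hfin.1, Lp.ext hfin.2⟩

theorem contrastOf_self (ν : ℝ) {g : (Fin m → ℝ) → ℝ} {r : ℝ}
    (hg : Integrable g (cubeMeasure m)) (hg1 : ∫ u, g u ∂cubeMeasure m = 1)
    (hg0 : ∀ᵐ u ∂cubeMeasure m, 0 ≤ g u)
    (C : EuclideanSpace ℝ (Fin (m + 1))) (Q : Fin (m + 1) → Measure ℝ)
    [∀ j, IsProbabilityMeasure (Q j)] :
    contrastOf ν (charFun (observationLaw C r g Q)) g r = 0 := by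
  simp only [contrastOf, discrepancy_observationLaw C Q r hg hg0 hg1]
  simp [discrepancy]

end Identifiability

/-! ### Near minimisers and the mean of the observations -/

section Consistency

variable {m : ℕ}

theorem continuous_empCF (n : ℕ) (y : ℕ → EuclideanSpace ℝ (Fin (m + 1))) :
    Continuous (empCF n y) := by
  unfold empCF
  fun_prop

theorem norm_empCF_le_one (n : ℕ) (y : ℕ → EuclideanSpace ℝ (Fin (m + 1)))
    (t : EuclideanSpace ℝ (Fin (m + 1))) : ‖empCF n y t‖ ≤ 1 := by
  rw [empCF, norm_mul]
  have h : ‖∑ l ∈ Finset.range n, Complex.exp (Complex.I * ((inner ℝ t (y l) : ℝ) : ℂ))‖ ≤ n := by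
    refine (norm_sum_le _ _).trans (le_of_eq ?_)
    simp [mul_comm Complex.I, Complex.norm_exp_ofReal_mul_I]
  rw [norm_div, norm_one, Complex.norm_natCast, one_div_mul_eq_div]
  exact div_le_one_of_le₀ h (Nat.cast_nonneg n)

theorem contrastOf_nonneg (ν : ℝ) (φ : EuclideanSpace ℝ (Fin (m + 1)) → ℂ)
    (f : (Fin m → ℝ) → ℝ) (R : ℝ) : 0 ≤ contrastOf ν φ f R :=
  integral_nonneg fun _ => by positivity

/-- If the empirical characteristic functions converge uniformly on the box, then the
population contrast of near minimizers of the empirical contrasts tends to `0`. -/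
theorem tendsto_contrastOf_near_min {ν : ℝ} (hν : 0 < ν) {F : Set (Lp ℝ 2 (cubeMeasure m))}
    (hF : IsCompact F) {Rmin Rmax : ℝ} {φ : EuclideanSpace ℝ (Fin (m + 1)) → ℂ}
    (hφ : Continuous φ) (hφ1 : ∀ t, ‖φ t‖ ≤ 1) {y : ℕ → EuclideanSpace ℝ (Fin (m + 1))}
    (hy : TendstoUniformlyOn (fun n => empCF n y) φ atTop (box m ν))
    {f₀ : Lp ℝ 2 (cubeMeasure m)} {R₀ : ℝ} (hf₀ : f₀ ∈ F) (hR₀ : R₀ ∈ Icc Rmin Rmax)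
    (h₀ : contrastOf ν φ f₀ R₀ = 0) {f : ℕ → Lp ℝ 2 (cubeMeasure m)} {R : ℕ → ℝ}
    (hf : ∀ n, 1 ≤ n → f n ∈ F)
    (hmin : ∀ n, 1 ≤ n → contrast ν n y (f n) (R n) ≤
      sInf ((fun θ : Lp ℝ 2 (cubeMeasure m) × ℝ => contrast ν n y θ.1 θ.2) ''
        (F ×ˢ Icc Rmin Rmax)) + 1 / (n : ℝ)) :
    Tendsto (fun n => contrastOf ν φ (f n) (R n)) atTop (𝓝 0) := by
  obtain ⟨B, hB⟩ := hF.isBounded.exists_norm_le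
  set L := 2 * (B + B ^ 2) * (2 * B + B ^ 2) * volume.real (box m ν) with hL
  have hB0 : 0 ≤ B := (norm_nonneg _).trans (hB f₀ hf₀)
  have hL0 : 0 ≤ L := by positivity
  refine tendsto_order.2 ⟨fun a ha => Eventually.of_forall fun n =>
    ha.trans_le (contrastOf_nonneg _ _ _ _), fun ε hε => ?_⟩
  -- Replacing one contrast by the other costs at most `ε / 4`, at `f n` and again at `f₀`, and the
  -- tolerance `1 / n` is below `ε / 2`.
  have hδ : 0 < ε / (4 * (L + 1)) := by positivity
  have hn : ∀ᶠ n : ℕ in atTop, 1 / (n : ℝ) < ε / 2 :=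
    tendsto_one_div_atTop_nhds_zero_nat.eventually_lt_const (by positivity)
  filter_upwards [Metric.tendstoUniformlyOn_iff.1 hy _ hδ, hn, eventually_ge_atTop 1]
    with n h1 h2 h3
  have hd : ∀ t ∈ box m ν, ‖φ t - empCF n y t‖ ≤ ε / (4 * (L + 1)) := fun t ht => by
    rw [← dist_eq_norm]
    exact (h1 t ht).le
  have e1 := abs_contrastOf_sub_le hφ (continuous_empCF n y) hφ1 (norm_empCF_le_one n y) hν hd
    (R := R n) (hB (f n) (hf n h3))
  have e2 := abs_contrastOf_sub_le hφ (continuous_empCF n y) hφ1 (norm_empCF_le_one n y) hν hd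
    (R := R₀) (hB f₀ hf₀)
  have e3 : sInf ((fun θ : Lp ℝ 2 (cubeMeasure m) × ℝ => contrast ν n y θ.1 θ.2) ''
      (F ×ˢ Icc Rmin Rmax)) ≤ contrastOf ν (empCF n y) f₀ R₀ := by
    refine csInf_le ⟨0, ?_⟩ ⟨(f₀, R₀), ⟨hf₀, hR₀⟩, rfl⟩
    rintro _ ⟨θ, -, rfl⟩
    exact contrastOf_nonneg _ _ _ _
  have e4 := hmin n h3
  rw [contrast_eq] at e4
  rw [← hL] at e1 e2
  have e5 : L * (ε / (4 * (L + 1))) ≤ ε / 4 := by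
    rw [← mul_div_assoc, div_le_div_iff₀ (by positivity) (by norm_num)]
    nlinarith
  rw [h₀] at e2
  have e6 := (abs_le.1 e1).2
  have e7 := (abs_le.1 e2).1
  linarith

/-- Nothing is known at the index `n = 0`; shifting the sequence by one removes it. -/
theorem tendstoInMeasure_of_tendsto_ae_of_one_le {Ω E : Type*} [MeasurableSpace Ω]
    {P : Measure Ω} [IsFiniteMeasure P] [PseudoEMetricSpace E] {f : ℕ → Ω → E} {g : Ω → E}
    (hf : ∀ n, 1 ≤ n → AEStronglyMeasurable (f n) P)
    (hfg : ∀ᵐ ω ∂P, Tendsto (fun n => f n ω) atTop (𝓝 (g ω))) :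
    TendstoInMeasure P f atTop g := by
  have h : TendstoInMeasure P (fun n => f (n + 1)) atTop g :=
    tendstoInMeasure_of_tendsto_ae (fun n => hf _ (by omega))
      (hfg.mono fun ω hω => (tendsto_add_atTop_iff_nat 1).2 hω)
  exact fun ε hε => (tendsto_add_atTop_iff_nat 1).1 (h ε hε)

theorem integral_sq_sub_eq (f g : Lp ℝ 2 (cubeMeasure m)) :
    ∫ u, (f u - g u) ^ 2 ∂cubeMeasure m = ‖f - g‖ ^ 2 := by
  rw [← real_inner_self_eq_norm_sq, L2.inner_def]
  refine integral_congr_ae ?_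
  filter_upwards [Lp.coeFn_sub f g] with u hu
  rw [hu, Pi.sub_apply, real_inner_self_eq_norm_sq, Real.norm_eq_abs, sq_abs]

theorem integrable_smul_sphereMap {f : (Fin m → ℝ) → ℝ} (hf : Integrable f (cubeMeasure m)) :
    Integrable (fun u => f u • sphereMap u) (cubeMeasure m) := by
  refine hf.norm.mono' (hf.aestronglyMeasurable.smul
    continuous_sphereMap.aestronglyMeasurable) (Eventually.of_forall fun u => ?_)
  rw [norm_smul, norm_sphereMap, mul_one]

/-- 1-Lipschitz, because `sphereMap` has norm one and the `L¹` norm is at most the `L²` norm for a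
probability measure. -/
theorem continuous_integral_smul_sphereMap :
    Continuous fun f : Lp ℝ 2 (cubeMeasure m) => ∫ u, f u • sphereMap u ∂cubeMeasure m := by
  refine LipschitzWith.continuous (K := 1) (LipschitzWith.of_dist_le_mul fun f g => ?_)
  rw [NNReal.coe_one, one_mul, dist_eq_norm, dist_eq_norm,
    ← integral_sub (integrable_smul_sphereMap (integrable_Lp f))
      (integrable_smul_sphereMap (integrable_Lp g))]
  refine le_trans ?_ (integral_norm_Lp_le (f - g))
  refine norm_integral_le_of_norm_le (integrable_Lp (f - g)).norm ?_
  filter_upwards [Lp.coeFn_sub f g] with u hu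
  rw [hu, ← sub_smul, norm_smul, norm_sphereMap, mul_one, Pi.sub_apply]

section Mean

variable (C : EuclideanSpace ℝ (Fin (m + 1))) (R : ℝ) {f : (Fin m → ℝ) → ℝ}
  (hf : Integrable f (cubeMeasure m)) (h0 : ∀ᵐ u ∂cubeMeasure m, 0 ≤ f u)
  (h1 : ∫ u, f u ∂cubeMeasure m = 1)
include hf h0 h1

theorem integrable_id_signalLaw : Integrable (fun x => x) (signalLaw C R f) := by
  have := isProbabilityMeasure_signalLaw C R hf h0 h1
  refine Integrable.of_bound continuous_id'.aestronglyMeasurable (‖C‖ + |R|) ?_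
  refine (ae_map_iff (measurable_signal C R).aemeasurable
    (measurableSet_le measurable_norm measurable_const)).2 (Eventually.of_forall fun u => ?_)
  refine (norm_add_le _ _).trans ?_
  rw [norm_smul, norm_sphereMap, mul_one, Real.norm_eq_abs]

theorem integral_id_signalLaw : ∫ x, x ∂signalLaw C R f =
    C + R • ∫ u, f u • sphereMap u ∂cubeMeasure m := by
  rw [integral_signalLaw (g := fun x => x) C R hf h0 stronglyMeasurable_id]
  have e : ∀ u, f u • (C + R • sphereMap u) = f u • C + R • f u • sphereMap u := fun u => by
    rw [smul_add, smul_comm]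
  have i1 : Integrable (fun u => f u • C) (cubeMeasure m) := hf.smul_const C
  have i2 : Integrable (fun u => R • f u • sphereMap u) (cubeMeasure m) :=
    (integrable_smul_sphereMap hf).smul R
  simp only [e]
  rw [integral_add i1 i2, integral_smul_const, h1, one_smul, integral_smul]

variable (Q : Fin (m + 1) → Measure ℝ) [∀ j, IsProbabilityMeasure (Q j)]
  (hQ : Integrable (fun x => x) (noiseLaw Q))
include hQ

theorem integrable_id_observationLaw :
    Integrable (fun x => x) (observationLaw C R f Q) := by
  have := isProbabilityMeasure_signalLaw C R hf h0 h1
  have := isProbabilityMeasure_noiseLaw Q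
  rw [observationLaw, Measure.conv,
    integrable_map_measure continuous_id'.aestronglyMeasurable (by fun_prop)]
  exact ((integrable_id_signalLaw C R hf h0 h1).comp_fst _).add (hQ.comp_snd _)

theorem integral_id_observationLaw (hQ0 : ∫ x, x ∂noiseLaw Q = 0) :
    ∫ x, x ∂observationLaw C R f Q = C + R • ∫ u, f u • sphereMap u ∂cubeMeasure m := by
  have := isProbabilityMeasure_signalLaw C R hf h0 h1
  have := isProbabilityMeasure_noiseLaw Q
  have i1 : Integrable (fun p : EuclideanSpace ℝ (Fin (m + 1)) × EuclideanSpace ℝ (Fin (m + 1)) =>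
    p.1) ((signalLaw C R f).prod (noiseLaw Q)) :=
      (integrable_id_signalLaw C R hf h0 h1).comp_fst _
  have i2 : Integrable (fun p : EuclideanSpace ℝ (Fin (m + 1)) × EuclideanSpace ℝ (Fin (m + 1)) =>
    p.2) ((signalLaw C R f).prod (noiseLaw Q)) := hQ.comp_snd _
  rw [observationLaw, Measure.conv,
    integral_map (by fun_prop) continuous_id'.aestronglyMeasurable, integral_add i1 i2,
    integral_fun_fst (fun x => x), integral_fun_snd (fun x => x), hQ0,
    integral_id_signalLaw C R hf h0 h1]
  simp

end Mean

end Consistency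

end SphereDeconv

/-! ### Consistency of the estimators -/

theorem proposition2 {m : ℕ} (hm : 1 ≤ m)
    -- the tuning parameters of the estimation method
    (ν : ℝ) (hν : 0 < ν)
    (F : Set (Lp ℝ 2 (SphereDeconv.cubeMeasure m))) (hF : IsCompact F)
    (hF_int : ∀ f ∈ F, ∫ u, f u ∂(SphereDeconv.cubeMeasure m) = 1)
    (Rmin Rmax : ℝ) (hRmin : 0 < Rmin) (hRmax : Rmin < Rmax)
    -- the true parameters; the noise has independent coordinates and is otherwise arbitrary
    (Cstar : EuclideanSpace ℝ (Fin (m + 1)))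
    (Rstar : ℝ) (hRstar : Rstar ∈ Ioo Rmin Rmax)
    (fstar : Lp ℝ 2 (SphereDeconv.cubeMeasure m)) (hfstar : fstar ∈ F)
    (hfstar_nonneg : ∀ᵐ u ∂(SphereDeconv.cubeMeasure m), 0 ≤ fstar u)
    (hfstar_pos : 2 ≤ m → ∃ γ : ℝ, 0 < γ ∧
      ∀ᵐ u ∂(SphereDeconv.cubeMeasure m), (∀ j, u j ∈ Ioo 0 γ) → 0 < fstar u)
    (Q : Fin (m + 1) → Measure ℝ) (hQ : ∀ j, IsProbabilityMeasure (Q j))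
    -- the i.i.d. observations
    {Ω : Type*} [MeasurableSpace Ω] (P : Measure Ω) [IsProbabilityMeasure P]
    (Y : ℕ → Ω → EuclideanSpace ℝ (Fin (m + 1)))
    (hY_meas : ∀ i, Measurable (Y i)) (hY_indep : iIndepFun Y P)
    (hY_law : ∀ i, P.map (Y i) = SphereDeconv.observationLaw Cstar Rstar fstar Q)
    -- the estimators
    (fhat : ℕ → Ω → Lp ℝ 2 (SphereDeconv.cubeMeasure m)) (Rhat : ℕ → Ω → ℝ)
    (hest : SphereDeconv.IsMinContrast P ν F Rmin Rmax Y fhat Rhat) :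
    TendstoInMeasure P Rhat atTop (fun _ => Rstar) ∧
    TendstoInMeasure P
      (fun n ω => ∫ u, (fhat n ω u - fstar u) ^ 2 ∂(SphereDeconv.cubeMeasure m))
      atTop (fun _ => (0 : ℝ)) ∧
    (Integrable (fun x => x) (SphereDeconv.noiseLaw Q) →
      ∫ x, x ∂(SphereDeconv.noiseLaw Q) = 0 →
      TendstoInMeasure P (SphereDeconv.centerEst Y fhat Rhat) atTop (fun _ => Cstar)) := by
  have hfs1 := hF_int fstar hfstar
  have hfi := SphereDeconv.integrable_Lp fstar
  have hsig := SphereDeconv.isProbabilityMeasure_signalLaw Cstar Rstar hfi hfstar_nonneg hfs1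
  have hnoi := SphereDeconv.isProbabilityMeasure_noiseLaw Q
  have hobs : IsProbabilityMeasure (SphereDeconv.observationLaw Cstar Rstar fstar Q) := by
    unfold SphereDeconv.observationLaw
    infer_instance
  have hR0 : 0 < Rstar := hRmin.trans hRstar.1
  have hRI : Rstar ∈ Icc Rmin Rmax := Ioo_subset_Icc_self hRstar
  have hK : IsCompact (F ×ˢ Icc Rmin Rmax) := hF.prod isCompact_Icc
  -- The argument is deterministic for almost every `ω`: the convergence of the pair is almost sure
  -- in `L² × ℝ`, which is stronger than in probability.
  have hmain : ∀ᵐ ω ∂P, Tendsto (fun n => (fhat n ω, Rhat n ω)) atTop (𝓝 (fstar, Rstar)) := by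
    filter_upwards [SphereDeconv.tendstoUniformlyOn_empirical_charFun hY_meas hY_indep hY_law
        (SphereDeconv.isCompact_box (m := m) ν),
      ae_all_iff.2 fun n => ae_all_iff.2 (hest.fhat_mem n),
      ae_all_iff.2 fun n => ae_all_iff.2 (hest.Rhat_mem n),
      ae_all_iff.2 fun n => ae_all_iff.2 (hest.near_min n)] with ω h1 h2 h3 h4
    refine SphereDeconv.tendsto_of_tendsto_zero_of_unique_zero hK
      (SphereDeconv.continuousOn_contrastOf ν continuous_charFun hK) ?_
      ((eventually_ge_atTop 1).mono fun n hn => ⟨h2 n hn, h3 n hn⟩)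
      (SphereDeconv.tendsto_contrastOf_near_min hν hF continuous_charFun norm_charFun_le_one h1
        hfstar hRI (SphereDeconv.contrastOf_self ν hfi hfs1 hfstar_nonneg Cstar Q) h2 h4)
    rintro ⟨f, R⟩ hθ hz
    have := SphereDeconv.eq_of_contrastOf_eq_zero hm hν (hRmin.trans_le hθ.2.1) hR0
      (hF_int f hθ.1) hfs1 hfstar_nonneg hfstar_pos Cstar Q hz
    exact Prod.ext this.2 this.1
  have hfhat : ∀ᵐ ω ∂P, Tendsto (fun n => fhat n ω) atTop (𝓝 fstar) :=
    hmain.mono fun ω h => (continuous_fst.tendsto _).comp h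
  have hRhat : ∀ᵐ ω ∂P, Tendsto (fun n => Rhat n ω) atTop (𝓝 Rstar) :=
    hmain.mono fun ω h => (continuous_snd.tendsto _).comp h
  refine ⟨SphereDeconv.tendstoInMeasure_of_tendsto_ae_of_one_le
    (fun n hn => (hest.measurable_Rhat n hn).aestronglyMeasurable) hRhat, ?_, ?_⟩
  · simp only [SphereDeconv.integral_sq_sub_eq]
    have hc : Continuous fun f : Lp ℝ 2 (SphereDeconv.cubeMeasure m) => ‖f - fstar‖ ^ 2 := by
      fun_prop
    refine SphereDeconv.tendstoInMeasure_of_tendsto_ae_of_one_le (fun n hn =>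
      (hc.comp_stronglyMeasurable (hest.measurable_fhat n hn)).aestronglyMeasurable)
      (hfhat.mono fun ω h => ?_)
    have := (hc.tendsto fstar).comp h
    simpa [Function.comp_def] using this
  · intro hint hzero
    have hJ := SphereDeconv.continuous_integral_smul_sphereMap (m := m)
    refine SphereDeconv.tendstoInMeasure_of_tendsto_ae_of_one_le (fun n hn => ?_) ?_
    · have hsum : Measurable fun ω => (1 / (n : ℝ)) • ∑ l ∈ Finset.range n, Y l ω :=
        by fun_prop
      exact hsum.aestronglyMeasurable.sub ((hest.measurable_Rhat n hn).aestronglyMeasurable.smul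
        (hJ.comp_stronglyMeasurable (hest.measurable_fhat n hn)).aestronglyMeasurable)
    · have hid := SphereDeconv.integrable_id_observationLaw Cstar Rstar hfi hfstar_nonneg hfs1 Q
        hint
      have hmean := SphereDeconv.integral_id_observationLaw Cstar Rstar hfi hfstar_nonneg hfs1 Q
        hint hzero
      rw [← hY_law 0] at hid hmean
      have hY0 : Integrable (Y 0) P := hid.comp_aemeasurable (hY_meas 0).aemeasurable
      rw [integral_map (hY_meas 0).aemeasurable continuous_id'.aestronglyMeasurable] at hmean
      filter_upwards [hfhat, hRhat, strong_law_ae Y hY0 (fun i j hij => hY_indep.indepFun hij)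
        fun i => ⟨(hY_meas i).aemeasurable, (hY_meas 0).aemeasurable, by rw [hY_law, hY_law]⟩]
        with ω h1 h2 h3
      -- The limit is `E[Y] - R⋆ ∫ S f⋆`, which is `C⋆` as the noise is centred.
      have h4 := h3.sub (h2.smul ((hJ.tendsto fstar).comp h1))
      rw [hmean, add_sub_cancel_right] at h4
      refine h4.congr fun n => ?_
      simp only [SphereDeconv.centerEst, one_div, Function.comp_apply]
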